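/- **Setting.** Let $m\ge 1$, let $M$ be a compact smooth manifold without boundary, and let $f\in C^\infty(M)$ have a transverse zero along the hypersurface $Z=f^{-1}(0)$ (that is, $df\neq 0$ along $Z$). The $b^m$-tangent bundle ${}^{b^m}TM$ is the vector bundle whose sections are the vector fields $v$ tangent to $Z$ to order $m$, i.e. with $v(f)=f^m h$ for a smooth function $h$. A $b^m$-symplectic form is a smooth section $\omega$ of $\Lambda^2({}^{b^m}T^*M)$ that is closed and everywhere nondegenerate. A $b^m$-function is a function on $M\setminus Z$ of the form $a\log|f|+g+\sum_{j=1}^{m-1}f^{-j}g_j$ with $a,g,g_j\in C^\infty(M)$ and $a$ locally constant near $Z$. Let a torus $T$ (a compact connected abelian Lie group) with Lie algebra $\mathfrak t$ act smoothly on $M$, preserving $f$ and $\omega$; then it acts on $Z$. For $X\in\mathfrak t$ let $X^M$ and $X^Z$ be the fundamental vector fields on $M$ and $Z$. Suppose that the action is Hamiltonian with moment map $\mu$: for every $X\in\mathfrak t$, $\langle\mu,X\rangle$ is a $b^m$-function and $d\langle\mu,X\rangle=\iota_{X^M}\omega$, where $\iota_{X^M}\omega=\omega(X^M,\cdot)$.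 **Lemma.** There are $\varepsilon>0$ and a $T$-equivariant diffeomorphism $\Phi$ from $Z\times(-\varepsilon,\varepsilon)$ (with $T$ acting on the first factor) onto an open neighborhood $U$ of $Z$, with $\Phi(z,0)=z$ and $f(\Phi(z,t))=t+t^{m+1}h(z,t)$ for a smooth function $h$; there are closed $T$-invariant smooth $1$-forms $\alpha_1,\dots,\alpha_m$ and a closed $T$-invariant smooth $2$-form $\beta$ on $Z$ with, for $t\ne 0$, $$\Phi^*\omega=\sum_{j=1}^m\frac{dt}{t^j}\wedge\alpha_j+\beta,$$ where $\alpha_m$ vanishes nowhere and $\beta$ is nondegenerate on $\ker\alpha_m$ (so the leaves of the foliation $\ker\alpha_m$ of $Z$, with the restrictions of $\beta$, are symplectic manifolds: the symplectic leaves of $Z$); and there are maps $a_1,\dots,a_m:Z\to\mathfrak t^*$, constant on each connected component of $Z$ (the modular weights), and a smooth map $\mu_0:Z\to\mathfrak t^*$ such that: 1. $\langle a_i(z),X\rangle=\alpha_i(X^Z)(z)$ for all $z\in Z$, $X\in\mathfrak t$ and $1\le i\le m$. Moreover $a_i\in\mathfrak t_L^0$: if $L$ is the symplectic leaf through $z$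 and $X\in\mathfrak t$ is such that $X^Z$ is tangent to $L$ at $z$, i.e. $\alpha_m(X^Z)(z)=0$, then $\langle a_i(z),X\rangle=0$. 2. $\mu_0$ is a moment map for the action of $T$ on $Z$, namely $d\langle\mu_0,X\rangle=\iota_{X^Z}\beta$ on $Z$ for all $X\in\mathfrak t$. In particular, for those $X$ for which $X^Z$ is tangent to a leaf $L$, it restricts on $L$ to a moment map with respect to $\beta|_L$. 3. For all $z\in Z$ and $0<|t|<\varepsilon$, $$\mu(\Phi(z,t))=-a_1(z)\log|t|+\sum_{i=2}^m a_i(z)\,\frac{t^{-(i-1)}}{i-1}+\mu_0(z).$$ 4. In terms of the given function $f$, on $U\setminus Z$, $$\mu=-a_1\log|f|+\sum_{i=2}^m a_i\,\frac{f^{-(i-1)}}{i-1}+\nu,$$ where the $a_i$ are extended to $U$ by $a_i(\Phi(z,t))=a_i(z)$, and $\nu:U\to\mathfrak t^*$ is smooth with $\nu|_Z=\mu_0$. -/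

import Mathlib

open Set Filter Topology
open scoped Manifold ContDiff

/-! ### Differential forms on manifolds -/

section Forms

variable {E : Type*} [NormedAddCommGroup E] [NormedSpace ℝ E]
  {H : Type*} [TopologicalSpace H] (I : ModelWithCorners ℝ E H)
  {M : Type*} [TopologicalSpace M] [ChartedSpace H M]

/-- The differential `df` of a real function at `x`, as a linear form on `T_x M`. -/
noncomputable def diffAt (f : M → ℝ) (x : M) : TangentSpace I x →L[ℝ] ℝ :=
  mfderiv I 𝓘(ℝ, ℝ) f x

/-- A (not necessarily smooth) `k`-form on `M`: an alternating `k`-form on each tangent space. -/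
abbrev RawForm (M : Type*) [TopologicalSpace M] [ChartedSpace H M] (k : ℕ) : Type _ :=
  ∀ x : M, TangentSpace I x [⋀^Fin k]→L[ℝ] ℝ

/-- The expression of a `k`-form in the preferred chart around `x₀`, i.e. its pullback under the
inverse of that chart. It is meaningful on the target of the chart. -/
noncomputable def RawForm.inChart {k : ℕ} (η : RawForm I M k) (x₀ : M) :
    E → E [⋀^Fin k]→L[ℝ] ℝ := fun y =>
  (η ((extChartAt I x₀).symm y)).compContinuousLinearMap
    (mfderiv 𝓘(ℝ, E) I (extChartAt I x₀).symm y)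

/-- `η` is a smooth form on `M`: it is smooth in all charts. (Manifolds without boundary.) -/
def RawForm.IsSmooth {k : ℕ} (η : RawForm I M k) : Prop :=
  ∀ x₀ : M, ContDiffOn ℝ ∞ (RawForm.inChart I η x₀) (extChartAt I x₀).target

/-- `dη = 0` at every point of the open set `S`. (Manifolds without boundary.) -/
def RawForm.IsClosedOn {k : ℕ} (η : RawForm I M k) (S : Set M) : Prop :=
  ∀ x₀ : M, ∀ y ∈ (extChartAt I x₀).target, (extChartAt I x₀).symm y ∈ S →
    extDeriv (RawForm.inChart I η x₀) y = 0

/-- `g^* η = η` at every point of `S` for every `g : G`. -/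
def RawForm.IsInvariantOn (G : Type*) [SMul G M] {k : ℕ} (η : RawForm I M k) (S : Set M) : Prop :=
  ∀ g : G, ∀ x ∈ S,
    (η (g • x)).compContinuousLinearMap (mfderiv I I (fun y : M => g • y) x) = η x

end Forms

/-! ### The `b^m`-tangent bundle and `b^m`-symplectic forms

`f` is a smooth function with transverse zeros and `Z = f⁻¹(0)`. -/

section Bm

variable {E : Type*} [NormedAddCommGroup E] [NormedSpace ℝ E]
  {H : Type*} [TopologicalSpace H] (I : ModelWithCorners ℝ E H)
  {M : Type*} [TopologicalSpace M] [ChartedSpace H M]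

/-- The fibre at `x` of the `b^m`-tangent bundle, realised as the subbundle
`{(h, v) : df(v) = f^m h}` of `ℝ ⊕ TM`. As `df ≠ 0` on `Z`, this is a vector bundle of rank `dim M`;
its smooth sections are the pairs `(h, v)` of a smooth vector field `v` and a smooth function `h`
with `v f = f^m h`, and `h` is determined by `v`, so that they are exactly the vector fields `v`
which are tangent to `Z` to order `m`. -/
noncomputable def BmTangent (f : M → ℝ) (m : ℕ) (x : M) : Submodule ℝ (ℝ × TangentSpace I x) where
  carrier := {p | diffAt I f x p.2 = f x ^ m * p.1}
  add_mem' := by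
    intro p q hp hq
    simp only [mem_ofPred_eq, Prod.snd_add, Prod.fst_add, map_add] at *
    rw [hp, hq]; ring
  zero_mem' := by simp
  smul_mem' := by
    intro c p hp
    simp only [mem_ofPred_eq, Prod.smul_snd, Prod.smul_fst, map_smul, smul_eq_mul] at *
    rw [hp]; ring

/-- `p` is a smooth section of the `b^m`-tangent bundle, i.e. a `b^m`-vector field. -/
def IsSmoothBmField (f : M → ℝ) (m : ℕ) [IsManifold I ∞ M] (p : ∀ x : M, BmTangent I f m x) : Prop :=
  ContMDiff I 𝓘(ℝ, ℝ) ∞ (fun x => (p x).1.1) ∧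
    ContMDiff I I.tangent ∞ (fun x => (⟨x, (p x).1.2⟩ : TangentBundle I M))

/-- A (not necessarily smooth) `b^m`-form of degree two: an element of `Λ²(ᵇᵐT*_x M)` for each
`x`, including the points of `Z`. -/
abbrev BmForm (f : M → ℝ) (m : ℕ) : Type _ :=
  ∀ x : M, (BmTangent I f m x) [⋀^Fin 2]→L[ℝ] ℝ

/-- `σ` is a smooth section of `Λ²(ᵇᵐT*M)`: it takes smooth `b^m`-vector fields to smooth functions
on all of `M`. -/
def BmForm.IsSmooth {f : M → ℝ} {m : ℕ} [IsManifold I ∞ M] (σ : BmForm I f m) : Prop :=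
  ∀ p q : ∀ x : M, BmTangent I f m x, IsSmoothBmField I f m p → IsSmoothBmField I f m q →
    ContMDiff I 𝓘(ℝ, ℝ) ∞ (fun x => σ x ![p x, q x])

/-- Off `Z`, the identification `T_x M ≃ ᵇᵐT_x M`, `v ↦ (f⁻ᵐ df(v), v)`; zero on `Z`. -/
noncomputable def bmLift (f : M → ℝ) (m : ℕ) (x : M) : TangentSpace I x →L[ℝ] BmTangent I f m x :=
  open Classical in
  if h : f x ≠ 0 then
    ContinuousLinearMap.codRestrict
      ((((f x ^ m)⁻¹ • diffAt I f x : TangentSpace I x →L[ℝ] ℝ)).prod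
        (ContinuousLinearMap.id ℝ (TangentSpace I x)))
      (BmTangent I f m x)
      (by
        intro v
        change diffAt I f x v = f x ^ m * ((f x ^ m)⁻¹ * diffAt I f x v)
        rw [← mul_assoc, mul_inv_cancel₀ (pow_ne_zero m h), one_mul])
  else 0

/-- The ordinary two-form on `M \ Z` given by a `b^m`-form (zero on `Z`). -/
noncomputable def BmForm.toForm {f : M → ℝ} {m : ℕ} (σ : BmForm I f m) : RawForm I M 2 := fun x =>
  (σ x).compContinuousLinearMap (bmLift I f m x)

/-- `σ` is a `b^m`-symplectic form: smooth, closed, and nondegenerate at every point, those of `Z`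
included, as an element of `Λ²(ᵇᵐT*M)`. (Since `M \ Z` is dense, `dσ = 0` holds as soon as it
holds on `M \ Z`.) -/
structure IsBmSymplectic {f : M → ℝ} {m : ℕ} [IsManifold I ∞ M] (σ : BmForm I f m) : Prop where
  smooth : BmForm.IsSmooth I σ
  closed : RawForm.IsClosedOn I (BmForm.toForm I σ) {x | f x ≠ 0}
  nondegenerate : ∀ (x : M) (p : BmTangent I f m x),
    (∀ q : BmTangent I f m x, σ x ![p, q] = 0) → p = 0

/-- `u` is a `b^m`-function, i.e. a member of
`C^∞(M) ⊕ ⨁_{j=1}^{m-1} f^{-j} C^∞(M) ⊕ {a log |f| + g}`. The coefficient `a` of the logarithm is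
constant near each component of `Z`. Only the values of `u` on `M \ Z` matter. -/
def IsBmFunction (f : M → ℝ) (m : ℕ) (u : M → ℝ) : Prop :=
  ∃ (a g : M → ℝ) (c : ℕ → M → ℝ),
    ContMDiff I 𝓘(ℝ, ℝ) ∞ a ∧ ContMDiff I 𝓘(ℝ, ℝ) ∞ g ∧ (∀ j, ContMDiff I 𝓘(ℝ, ℝ) ∞ (c j)) ∧
    (∀ z, f z = 0 → ∀ᶠ x in 𝓝 z, a x = a z) ∧
    ∀ x, f x ≠ 0 →
      u x = a x * Real.log |f x| + g x + ∑ j ∈ Finset.Icc 1 (m - 1), (f x ^ j)⁻¹ * c j x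

end Bm

/-! ### Actions and moment maps -/

section Action

variable {E : Type*} [NormedAddCommGroup E] [NormedSpace ℝ E]
  {H : Type*} [TopologicalSpace H] (I : ModelWithCorners ℝ E H)
  {M : Type*} [TopologicalSpace M] [ChartedSpace H M]
  {F : Type*} [NormedAddCommGroup F] [NormedSpace ℝ F]
  {K : Type*} [TopologicalSpace K] (J : ModelWithCorners ℝ F K)
  {T : Type*} [TopologicalSpace T] [ChartedSpace K T] [CommGroup T] [MulAction T M]

/-- The fundamental vector field `X^M` generated by `X ∈ 𝔱 = T_1 T`: its value at `x` is the image
of `X` under the derivative at `1` of the orbit map `g ↦ g • x`. -/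
noncomputable def fundamentalField (X : GroupLieAlgebra J T) (x : M) : TangentSpace I x :=
  mfderiv J I (fun g : T => g • x) 1 X

/-- `μ : M → 𝔱*` is a moment map of the action: each `⟨μ, X⟩` is a `b^m`-function and
`d⟨μ, X⟩ = σ(X^M, ·)`. (Only the values of `μ` on `M \ Z` matter.) -/
structure IsBmMomentMap {f : M → ℝ} {m : ℕ} (σ : BmForm I f m)
    (μ : M → Module.Dual ℝ (GroupLieAlgebra J T)) : Prop where
  bmFunction : ∀ X : GroupLieAlgebra J T, IsBmFunction I f m (fun x => μ x X)
  hamiltonian : ∀ (X : GroupLieAlgebra J T) (x : M), f x ≠ 0 → ∀ v : TangentSpace I x,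
    diffAt I (fun y => μ y X) x v = BmForm.toForm I σ x ![fundamentalField I J X x, v]

end Action

/-! Collar. Near `Z` there is a vector field w with df(w) = 1. Averaging w over `T` makes it
invariant and keeps this property, because f is invariant. Its flow out of `Z` is an equivariant
collar Φ₀ on which f is the coordinate t (`exists_equivariant_collar`). Over the collar the
b^m-tangent bundle is framed by TZ and t^m ∂_t, so the form pulls back to t^{-m} dt ∧ A_t + B_t,
with families A_t, B_t of forms on `Z` that are smooth through t = 0 and dt ∧ A_0 + B_0
nondegenerate.

Laurent expansion. Closedness means dB_t = 0 and dA_t = t^m ∂_t B_t. Hence the Taylor coefficients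
of A_t of order less than m are closed; they are α_m, ..., α_1. What remains is κ = dt ∧ R_t + B_t,
closed and smooth through t = 0 (`exists_laurent_expansion`).

Moser. The scalings δ_s(z, t) = (z, st) connect κ to β = B_0. For ω_s = Σ t^{-j} dt ∧ α_j + δ_s^* κ
the derivative in s is d(t R_{st}), and ι_v ω_s = -t R_{st} is solved by v = (t ξ', t^{m+1} ξ''),
where (ξ', ξ'') solves a linear equation that stays nondegenerate at t = 0. So v vanishes on `Z` and
its t-component vanishes to order m + 1: the time-one map fixes `Z` and changes t by O(t^{m+1}). All
data are invariant, so the map is equivariant (`exists_isotopy`, `familyForm_pullback_isotopy`,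
`exists_normalForm`).

Moment map. Put c_j = α_j(X^Z). In the normal form d⟨μ, X⟩ = -Σ c_j t^{-j} dt + β(X^Z, ·). The last
term does not depend on t, which forces the c_j to be locally constant. Integration in t gives a
Laurent primitive plus one constant for t > 0 and one for t < 0. They agree because ⟨μ, X⟩ is a
b^m-function while t^{m-1} sgn t is not smooth (`exists_eq_laurentPrimitive_add`). The common
constant C is a smooth function on `Z` with dC = β(X^Z, ·); it is ⟨μ₀, X⟩. If c_m vanishes at a
point, then at a maximum of C on the clopen set where the c_j keep their values, X^Z lies in the
kernel of dt ∧ α_m + β, so X^Z = 0 there and all c_j vanish (`exists_moment_expansion`). Finally f =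
t (1 + t^m h) with positive second factor, so passing from t to f changes the primitive by smooth
terms vanishing on `Z`.

The analytic tools are smooth dependence of flows on initial data, by the implicit function theorem
in C([0, 1], E), differentiation under the integral sign, and Hadamard's quotient (g t - g 0) / t.
-/

/-! ### Smoothness of superposition operators -/

section Superposition

universe u

variable {K : Type*} [TopologicalSpace K] [CompactSpace K]

/-- Pointwise application of a continuous family of operators, as a bounded bilinear map. -/
noncomputable def ContinuousMap.clmApply (K : Type*) [TopologicalSpace K] [CompactSpace K]
    (E F : Type*) [NormedAddCommGroup E]
    [NormedSpace ℝ E] [NormedAddCommGroup F] [NormedSpace ℝ F] :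
    C(K, E →L[ℝ] F) →L[ℝ] C(K, E) →L[ℝ] C(K, F) :=
  LinearMap.mkContinuous₂
    (LinearMap.mk₂ ℝ (fun (A : C(K, E →L[ℝ] F)) (h : C(K, E)) =>
        (⟨fun k => A k (h k), by fun_prop⟩ : C(K, F)))
      (by intros; ext; simp) (by intros; ext; simp) (by intros; ext; simp) (by intros; ext; simp))
    1 (by
      intro A h
      rw [one_mul, ContinuousMap.norm_le _ (by positivity)]
      intro k
      exact ((A k).le_opNorm _).trans
        (mul_le_mul (A.norm_coe_le_norm k) (h.norm_coe_le_norm k) (norm_nonneg _) (by positivity)))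

@[simp] theorem ContinuousMap.clmApply_apply {E F : Type*} [NormedAddCommGroup E]
    [NormedSpace ℝ E] [NormedAddCommGroup F] [NormedSpace ℝ F] (A : C(K, E →L[ℝ] F)) (h : C(K, E))
    (k : K) : ContinuousMap.clmApply K E F A h k = A k (h k) := rfl

/-- Since β ↦ f' ∘ β is continuous for the sup norm, f' varies by at most c on the δ-balls around
all the values α k simultaneously. The mean value inequality on each ball then gives an estimate
uniform in k. -/
theorem hasFDerivAt_postcomp {E F : Type*} [NormedAddCommGroup E]
    [NormedSpace ℝ E] [NormedAddCommGroup F] [NormedSpace ℝ F] (f : C(E, F))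
    (f' : C(E, E →L[ℝ] F)) (hf : ∀ x, HasFDerivAt f (f' x) x) (α : C(K, E)) :
    HasFDerivAt (fun β : C(K, E) => f.comp β)
      (ContinuousMap.clmApply K E F (f'.comp α)) α := by
  rw [hasFDerivAt_iff_isLittleO, Asymptotics.isLittleO_iff]
  intro c hc
  have hcont : Continuous fun β : C(K, E) => f'.comp β := ContinuousMap.continuous_postcomp f'
  obtain ⟨δ, hδ, H⟩ := (Metric.continuousAt_iff (f := fun β : C(K, E) => f'.comp β)).1
    (hcont.continuousAt (x := α)) c hc
  filter_upwards [Metric.ball_mem_nhds α hδ] with β hβ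
  rw [ContinuousMap.norm_le _ (by positivity)]
  intro k
  have hb : ∀ y ∈ Metric.ball (α k) δ, ‖f' y - f' (α k)‖ ≤ c := by
    intro y hy
    -- Shifting α by a constant gives a map close to α whose value at k is y.
    have h1 : dist (α + ContinuousMap.const K (y - α k)) α < δ := by
      rw [dist_eq_norm, add_sub_cancel_left]
      refine lt_of_le_of_lt ?_ (by simpa [dist_eq_norm] using hy)
      rw [ContinuousMap.norm_le _ (norm_nonneg _)]
      intro _
      rfl
    have h2 := (H h1).le
    have h3 := (ContinuousMap.dist_apply_le_dist k).trans h2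
    simpa [dist_eq_norm] using h3
  have hβk : β k ∈ Metric.ball (α k) δ := by
    rw [Metric.mem_ball, dist_eq_norm]
    rw [Metric.mem_ball, dist_eq_norm] at hβ
    exact lt_of_le_of_lt ((β - α).norm_coe_le_norm k) hβ
  have h := (convex_ball (α k) δ).norm_image_sub_le_of_norm_hasFDerivWithin_le'
    (f := f) (f' := fun x => f' x) (φ := f' (α k)) (fun x _ => (hf x).hasFDerivWithinAt) hb
    (Metric.mem_ball_self hδ) hβk
  refine h.trans ?_
  exact mul_le_mul_of_nonneg_left ((β - α).norm_coe_le_norm k) hc.le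

/-- The derivative is post-composition with f' followed by a bounded linear map, so the order climbs
by induction with F replaced by `E →L[ℝ] F`. This is why E and F share a universe. -/
theorem contDiff_nat_postcomp (n : ℕ) {E F : Type u} [NormedAddCommGroup E]
    [NormedSpace ℝ E] [NormedAddCommGroup F] [NormedSpace ℝ F] (f : C(E, F))
    (hf : ContDiff ℝ n f) : ContDiff ℝ n (fun β : C(K, E) => f.comp β) := by
  induction n generalizing F with
  | zero => exact contDiff_zero.2 (ContinuousMap.continuous_postcomp f)
  | succ n ih =>
    have h1 : ContDiff ℝ n (fderiv ℝ f) := hf.fderiv_right (by norm_cast)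
    let f' : C(E, E →L[ℝ] F) := ⟨fderiv ℝ f, h1.continuous⟩
    have hd : ∀ x, HasFDerivAt f (f' x) x := fun x =>
      ((hf.differentiable (by norm_cast)) x).hasFDerivAt
    push_cast
    rw [contDiff_succ_iff_hasFDerivAt]
    refine ⟨fun α => ContinuousMap.clmApply K E F (f'.comp α), ?_,
      fun α => hasFDerivAt_postcomp f f' hd α⟩
    exact (ContinuousMap.clmApply K E F).contDiff.comp (ih f' h1)

theorem contDiff_postcomp {E F : Type u} [NormedAddCommGroup E]
    [NormedSpace ℝ E] [NormedAddCommGroup F] [NormedSpace ℝ F] (f : C(E, F))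
    (hf : ContDiff ℝ ∞ f) : ContDiff ℝ ∞ (fun β : C(K, E) => f.comp β) :=
  contDiff_infty.2 fun n => contDiff_nat_postcomp n f (contDiff_infty.1 hf n)

end Superposition

/-! ### Smooth dependence of local flows -/

section LocalFlow

variable {E : Type*} [NormedAddCommGroup E] [NormedSpace ℝ E]

/-- The primitive vanishing at `0`, as an operator on `C([0,1], E)`. -/
noncomputable def primitiveCLM (E : Type*) [NormedAddCommGroup E] [NormedSpace ℝ E] :
    C(unitInterval, E) →L[ℝ] C(unitInterval, E) :=
  LinearMap.mkContinuous
    { toFun := fun β => ⟨fun τ => ∫ r in (0 : ℝ)..τ, β (projIcc 0 1 zero_le_one r), by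
        have : Continuous fun τ : ℝ => ∫ r in (0 : ℝ)..τ, β (projIcc 0 1 zero_le_one r) :=
          intervalIntegral.continuous_primitive
            (fun a b => (β.continuous.comp continuous_projIcc).intervalIntegrable a b) 0
        exact this.comp continuous_subtype_val⟩
      map_add' := by
        intro β γ
        ext τ
        exact intervalIntegral.integral_add
          ((β.continuous.comp continuous_projIcc).intervalIntegrable _ _)
          ((γ.continuous.comp continuous_projIcc).intervalIntegrable _ _)
      map_smul' := by
        intro c β
        ext τ
        exact intervalIntegral.integral_smul _ _ }
    1 (by
      intro β
      rw [one_mul, ContinuousMap.norm_le _ (norm_nonneg _)]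
      intro τ
      have h := intervalIntegral.norm_integral_le_of_norm_le_const (a := 0) (b := (τ : ℝ))
        (f := fun r => β (projIcc 0 1 zero_le_one r)) (C := ‖β‖)
        (fun r _ => β.norm_coe_le_norm _)
      refine h.trans ?_
      rw [sub_zero, abs_of_nonneg τ.2.1]
      exact mul_le_of_le_one_right (norm_nonneg _) τ.2.2)

theorem primitiveCLM_apply (β : C(unitInterval, E)) (τ : unitInterval) :
    primitiveCLM E β τ = ∫ r in (0 : ℝ)..τ, β (projIcc 0 1 zero_le_one r) := rfl


/-- The equation `α = x + s ∫₀ f ∘ α` in `C([0, 1], E)`, whose solution is a rescaled integral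
curve of `f`. -/
noncomputable def flowEquation (f : C(E, E)) (u : (E × ℝ) × C(unitInterval, E)) :
    C(unitInterval, E) :=
  u.2 - ContinuousMap.const _ u.1.1 - u.1.2 • primitiveCLM E (f.comp u.2)

theorem contDiff_flowEquation {f : C(E, E)} (hf : ContDiff ℝ ∞ f) :
    ContDiff ℝ ∞ (flowEquation f) := by
  unfold flowEquation
  have hc : ContDiff ℝ ∞ (fun x : E => ContinuousMap.const unitInterval x) :=
    (LinearMap.mkContinuous (𝕜 := ℝ) (𝕜₂ := ℝ) (σ := RingHom.id ℝ)
      { toFun := fun x : E => ContinuousMap.const unitInterval x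
        map_add' := fun _ _ => rfl
        map_smul' := fun _ _ => rfl } 1 (by
          intro x
          rw [one_mul, ContinuousMap.norm_le _ (norm_nonneg _)]
          intro _
          rfl)).contDiff
  have h1 := hc.comp (contDiff_fst.comp
    (contDiff_fst (𝕜 := ℝ) (n := ∞) (E := E × ℝ) (F := C(unitInterval, E))))
  have h2 := (primitiveCLM E).contDiff.comp ((contDiff_postcomp (K := unitInterval) f hf).comp
    (contDiff_snd (𝕜 := ℝ) (n := ∞) (E := E × ℝ) (F := C(unitInterval, E))))
  have h3 := contDiff_snd.comp
    (contDiff_fst (𝕜 := ℝ) (n := ∞) (E := E × ℝ) (F := C(unitInterval, E)))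
  exact (contDiff_snd.sub h1).sub (h3.smul h2)

/-- At s = 0 the integral term drops out and the equation becomes affine in α, with linear part the
identity. -/
theorem isInvertible_fderiv_flowEquation {f : C(E, E)} (hf : ContDiff ℝ ∞ f) (x : E)
    (α : C(unitInterval, E)) :
    (fderiv ℝ (flowEquation f) ((x, 0), α) ∘L
      .inr ℝ (E × ℝ) C(unitInterval, E)).IsInvertible := by
  have h : fderiv ℝ (flowEquation f) ((x, 0), α) ∘L
      .inr ℝ (E × ℝ) C(unitInterval, E) = ContinuousLinearMap.id ℝ _ := by
    have h1 : HasFDerivAt (fun β : C(unitInterval, E) => (((x, 0), β) : (E × ℝ) × _))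
        (.inr ℝ (E × ℝ) C(unitInterval, E)) α := hasFDerivAt_prodMk_right _ _
    have h2 := (((contDiff_flowEquation hf).differentiable (by simp)
      ((x, 0), α)).hasFDerivAt).comp α h1
    have h3 : HasFDerivAt (flowEquation f ∘
        fun β : C(unitInterval, E) => (((x, 0), β) : (E × ℝ) × _))
        (ContinuousLinearMap.id ℝ _) α := by
      have : (flowEquation f ∘ fun β : C(unitInterval, E) => (((x, 0), β) : (E × ℝ) × _)) =
          fun β => β - ContinuousMap.const _ x := by
        funext β
        simp [flowEquation]
      rw [this]
      exact (hasFDerivAt_id α).sub_const _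
    exact h2.unique h3
  rw [h]
  exact ⟨ContinuousLinearEquiv.refl ℝ _, rfl⟩

/-- A continuous family of integral curves of a smooth vector field is smooth at time `0`, and
nearby. -/
theorem contDiffAt_of_flowEquation [CompleteSpace E] {f : C(E, E)} (hf : ContDiff ℝ ∞ f)
    {θ : E × ℝ → C(unitInterval, E)} {p : E × ℝ}
    (hinv : (fderiv ℝ (flowEquation f) (p, θ p) ∘L
      .inr ℝ (E × ℝ) C(unitInterval, E)).IsInvertible)
    (hθ : ContinuousAt θ p) (h0 : ∀ᶠ q in 𝓝 p, flowEquation f (q, θ q) = 0) :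
    ContDiffAt ℝ ∞ θ p := by
  have hG : ContDiffAt ℝ ∞ (flowEquation f) (p, θ p) := (contDiff_flowEquation hf).contDiffAt
  have h1 := hG.eventually_apply_eq_iff_implicitFunction (by simp) hinv
  have h2 : Tendsto (fun q => (q, θ q)) (𝓝 p) (𝓝 (p, θ p)) := continuousAt_id.prodMk hθ
  refine (hG.contDiffAt_implicitFunction (by simp) hinv).congr_of_eventuallyEq ?_
  filter_upwards [h2.eventually h1, h0] with q hq hq0
  exact (hq.1 (by rw [hq0, h0.self_of_nhds])).symm

/-- The local flow of a smooth vector field is smooth. -/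
theorem exists_contDiffOn_localFlow [CompleteSpace E] {f : E → E} (hf : ContDiff ℝ ∞ f) (x₀ : E) :
    ∃ δ > (0 : ℝ), ∃ U : Set E, IsOpen U ∧ x₀ ∈ U ∧ ∃ θ : E × ℝ → E,
      ContDiffOn ℝ ∞ θ (U ×ˢ Ioo (-δ) δ) ∧
      ∀ x ∈ U, θ (x, 0) = x ∧
        ∀ t ∈ Ioo (-δ) δ, HasDerivAt (fun s => θ (x, s)) (f (θ (x, t))) t := by
  -- Picard–Lindelöf gives a jointly continuous flow φ; only its smoothness remains to be shown.
  obtain ⟨ε, hε, a, r, B, L, hr, hpl⟩ :=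
    IsPicardLindelof.of_contDiffAt_one ((hf.of_le (by simp)).contDiffAt (x := x₀))
  obtain ⟨φ, hφ, hφc⟩ := (hpl 0).exists_forall_mem_closedBall_eq_hasDerivWithinAt_continuousOn
  simp only [zero_sub, zero_add] at hφ hφc
  set fc : C(E, E) := ⟨f, hf.continuous⟩ with hfc
  set D : Set (E × ℝ) := Metric.ball x₀ r ×ˢ Ioo (-ε) ε with hD
  have hDo : IsOpen D := Metric.isOpen_ball.prod isOpen_Ioo
  have hmem : ∀ q ∈ D, ∀ τ : unitInterval, (q.1, q.2 * τ) ∈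
      Metric.closedBall x₀ r ×ˢ Icc (-ε) ε := by
    rintro ⟨x, s⟩ ⟨hx, hs⟩ τ
    refine ⟨Metric.ball_subset_closedBall hx, ?_⟩
    have h1 : |s * (τ : ℝ)| ≤ ε := by
      rw [abs_mul, abs_of_nonneg τ.2.1]
      exact (mul_le_of_le_one_right (abs_nonneg _) τ.2.2).trans (abs_lt.2 hs).le
    exact abs_le.1 h1
  have hcD : Continuous fun q : D × unitInterval => φ (q.1.1.1, q.1.1.2 * q.2) := by
    refine hφc.comp_continuous (by fun_prop) ?_
    rintro ⟨⟨q, hq⟩, τ⟩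
    exact hmem q hq τ
  -- Currying turns joint continuity of φ into continuity of (x, s) ↦ (τ ↦ φ (x, s τ)) for the sup
  -- norm, which is what the implicit function theorem needs. Off D the curve gets the default value
  -- 0.
  let Θ : C(D, C(unitInterval, E)) := ContinuousMap.curry ⟨_, hcD⟩
  classical
  let θ : E × ℝ → C(unitInterval, E) := fun q => if h : q ∈ D then Θ ⟨q, h⟩ else 0
  have hθ : ∀ q ∈ D, ∀ τ : unitInterval, θ q τ = φ (q.1, q.2 * τ) := by
    intro q hq τ
    simp only [θ, dif_pos hq]
    rfl
  have hθc : ContinuousOn θ D := by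
    rw [continuousOn_iff_continuous_domRestrict]
    have : D.domRestrict θ = Θ := by
      funext q
      simp [θ, Set.domRestrict]
    rw [this]
    exact Θ.continuous
  have hder : ∀ q ∈ D, HasDerivAt (fun s => φ (q.1, s)) (f (φ q)) q.2 := by
    intro q hq
    exact ((hφ q.1 (Metric.ball_subset_closedBall hq.1)).2 q.2
      (Ioo_subset_Icc_self hq.2)).hasDerivAt (Icc_mem_nhds hq.2.1 hq.2.2)
  have hG : ∀ q ∈ D, flowEquation fc (q, θ q) = 0 := by
    intro q hq
    ext τ
    have hmul : ∀ ρ : ℝ, ρ ∈ Icc (0:ℝ) 1 → (q.1, q.2 * ρ) ∈ D := by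
      intro ρ hρ
      refine ⟨hq.1, abs_lt.1 ?_⟩
      rw [abs_mul, abs_of_nonneg hρ.1]
      exact (mul_le_of_le_one_right (abs_nonneg _) hρ.2).trans_lt (abs_lt.2 hq.2)
    have hd : ∀ ρ ∈ uIcc (0 : ℝ) τ, HasDerivAt (fun ρ => φ (q.1, q.2 * ρ))
        (q.2 • f (φ (q.1, q.2 * ρ))) ρ := by
      intro ρ hρ
      rw [uIcc_of_le τ.2.1] at hρ
      have h1 := hder _ (hmul ρ ⟨hρ.1, hρ.2.trans τ.2.2⟩)
      have h2 : HasDerivAt (fun ρ : ℝ => q.2 * ρ) q.2 ρ := by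
        simpa using (hasDerivAt_id ρ).const_mul q.2
      exact h1.scomp ρ h2
    have hI : ∫ ρ in (0 : ℝ)..τ, q.2 • f (φ (q.1, q.2 * ρ)) = φ (q.1, q.2 * τ) - φ (q.1, 0) := by
      rw [intervalIntegral.integral_eq_sub_of_hasDerivAt hd]
      · simp
      · refine ContinuousOn.intervalIntegrable ?_
        refine continuousOn_const.smul (hf.continuous.comp_continuousOn ?_)
        intro ρ hρ
        exact (hd ρ hρ).continuousAt.continuousWithinAt
    have h0 : φ (q.1, 0) = q.1 := (hφ q.1 (Metric.ball_subset_closedBall hq.1)).1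
    have hJ : primitiveCLM E (fc.comp (θ q)) τ = ∫ ρ in (0 : ℝ)..τ, f (φ (q.1, q.2 * ρ)) := by
      rw [primitiveCLM_apply]
      refine intervalIntegral.integral_congr fun ρ hρ => ?_
      rw [uIcc_of_le τ.2.1] at hρ
      have hρ1 : ρ ∈ Icc (0 : ℝ) 1 := ⟨hρ.1, hρ.2.trans τ.2.2⟩
      change f (θ q (projIcc 0 1 zero_le_one ρ)) = _
      rw [hθ q hq, projIcc_of_mem _ hρ1]
    simp only [flowEquation, ContinuousMap.sub_apply, ContinuousMap.const_apply,
      ContinuousMap.smul_apply, ContinuousMap.zero_apply]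
    rw [hJ, hθ q hq, ← intervalIntegral.integral_smul, hI, h0]
    abel
  have hp : (x₀, (0 : ℝ)) ∈ D := ⟨Metric.mem_ball_self hr, by simpa using hε⟩
  have hcG : ContinuousOn (fun q => fderiv ℝ (flowEquation fc) (q, θ q) ∘L
      .inr ℝ (E × ℝ) C(unitInterval, E)) D := by
    have h1 : Continuous (fderiv ℝ (flowEquation fc)) :=
      (contDiff_flowEquation (f := fc) hf).continuous_fderiv (by simp)
    exact (h1.comp_continuousOn (continuousOn_id.prodMk hθc)).clm_comp continuousOn_const
  -- Invertibility at (x₀, 0) persists nearby because invertible operators form an open set.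
  have hinvo : IsOpen {A : C(unitInterval, E) →L[ℝ] C(unitInterval, E) | A.IsInvertible} := by
    have : {A : C(unitInterval, E) →L[ℝ] C(unitInterval, E) | A.IsInvertible} =
        range ((↑) : (C(unitInterval, E) ≃L[ℝ] C(unitInterval, E)) → _) := by
      ext A
      rfl
    rw [this]
    exact ContinuousLinearEquiv.isOpen
  have hev : ∀ᶠ q in 𝓝 (x₀, (0 : ℝ)), (fderiv ℝ (flowEquation fc) (q, θ q) ∘L
      .inr ℝ (E × ℝ) C(unitInterval, E)).IsInvertible := by
    refine (hcG.continuousAt (hDo.mem_nhds hp)).eventually_mem (hinvo.mem_nhds ?_)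
    exact isInvertible_fderiv_flowEquation (f := fc) hf x₀ _
  have hev2 := hev.and (hDo.mem_nhds hp)
  obtain ⟨U, hU, V, hV, hUV⟩ := mem_nhds_prod_iff.1 hev2
  obtain ⟨δ, hδ, hVδ⟩ := Metric.mem_nhds_iff.1 hV
  obtain ⟨U', hU'U, hU'o, hxU'⟩ := mem_nhds_iff.1 hU
  have hsub : ∀ q ∈ U' ×ˢ Ioo (-δ) δ, q ∈ D ∧ (fderiv ℝ (flowEquation fc) (q, θ q) ∘L
      .inr ℝ (E × ℝ) C(unitInterval, E)).IsInvertible := by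
    rintro ⟨x, s⟩ ⟨hx, hs⟩
    have := hUV (show (x, s) ∈ U ×ˢ V from ⟨hU'U hx, hVδ (by
      rw [Metric.mem_ball, dist_zero_right, Real.norm_eq_abs]
      exact abs_lt.2 hs)⟩)
    exact ⟨this.2, this.1⟩
  refine ⟨δ, hδ, U', hU'o, hxU', φ, ?_, ?_⟩
  · intro q hq
    obtain ⟨hqD, hqi⟩ := hsub q hq
    have h1 : ContDiffAt ℝ ∞ θ q := contDiffAt_of_flowEquation (f := fc) hf hqi
      (hθc.continuousAt (hDo.mem_nhds hqD)) (by
        filter_upwards [hDo.mem_nhds hqD] with q' hq' using hG q' hq')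
    -- Evaluating the rescaled curve at τ = 1 recovers φ.
    have h2 : ContDiffAt ℝ ∞ (fun q => θ q 1) q :=
      (ContinuousMap.evalCLM ℝ (1 : unitInterval) :
        C(unitInterval, E) →L[ℝ] E).contDiff.contDiffAt.comp q h1
    refine (h2.congr_of_eventuallyEq ?_).contDiffWithinAt
    filter_upwards [hDo.mem_nhds hqD] with q' hq'
    rw [hθ q' hq']
    simp
  · intro x hx
    refine ⟨(hφ x ?_).1, fun t ht => hder (x, t) (hsub (x, t) ⟨hx, ht⟩).1⟩
    exact Metric.ball_subset_closedBall (hsub (x, 0) ⟨hx, by simpa using hδ⟩).1.1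

end LocalFlow

/-! ### Charts of manifolds without boundary -/

section Charts

variable {E : Type*} [NormedAddCommGroup E] [NormedSpace ℝ E]
  {H : Type*} [TopologicalSpace H] {I : ModelWithCorners ℝ E H}
  {N : Type*} [TopologicalSpace N] [ChartedSpace H N]

theorem mem_chartAt_source_of_mem_target {x₀ : N} {y : E} (hy : y ∈ (extChartAt I x₀).target) :
    (extChartAt I x₀).symm y ∈ (chartAt H x₀).source := by
  rw [← extChartAt_source (I := I)]
  exact (extChartAt I x₀).map_target hy

variable [IsManifold I ∞ N]

/-- The pushforward of a smooth vector field on a vector space under a smooth map. -/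
theorem contMDiffOn_mfderiv_apply {E' : Type*} [NormedAddCommGroup E'] [NormedSpace ℝ E']
    {G : E' → N} {X : E' → E'} {O : Set E'} (hO : IsOpen O) (hG : ContMDiffOn 𝓘(ℝ, E') I ∞ G O)
    (hX : ContDiffOn ℝ ∞ X O) :
    ContMDiffOn 𝓘(ℝ, E') I.tangent ∞
      (fun y => (⟨G y, mfderiv 𝓘(ℝ, E') I G y (X y)⟩ : TangentBundle I N)) O := by
  have h1 := hG.contMDiffOn_tangentMapWithin (m := ∞) (by simp) hO.uniqueMDiffOn
  have h2 : ContMDiffOn 𝓘(ℝ, E') 𝓘(ℝ, E').tangent ∞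
      (fun y => (⟨y, X y⟩ : TangentBundle 𝓘(ℝ, E') E')) O :=
    contMDiffOn_vectorSpace_iff_contDiffOn.2 hX
  refine (h1.comp h2 fun y hy => hy).congr fun y hy => ?_
  simp only [Function.comp_apply, tangentMapWithin]
  rw [mfderivWithin_of_isOpen hO hy]

variable [I.Boundaryless]

theorem contMDiffAt_extChartAt_symm_of_mem {x₀ : N} {y : E} (hy : y ∈ (extChartAt I x₀).target) :
    ContMDiffAt 𝓘(ℝ, E) I ∞ (extChartAt I x₀).symm y :=
  (contMDiffOn_extChartAt_symm x₀).contMDiffAt ((isOpen_extChartAt_target x₀).mem_nhds hy)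

theorem mfderiv_extChartAt_mfderiv_symm {x₀ : N} {y : E} (hy : y ∈ (extChartAt I x₀).target)
    (v : E) : mfderiv I 𝓘(ℝ, E) (extChartAt I x₀) ((extChartAt I x₀).symm y)
      (mfderiv 𝓘(ℝ, E) I (extChartAt I x₀).symm y v) = v := by
  have : IsManifold I 1 N := IsManifold.of_le (n := ∞) (by simp)
  have h := mfderiv_extChartAt_comp_mfderivWithin_extChartAt_symm (I := I) hy
  rw [I.range_eq_univ, mfderivWithin_univ] at h
  exact congrArg (fun L => L v) h

theorem mfderiv_symm_mfderiv_extChartAt {x₀ : N} {y : E} (hy : y ∈ (extChartAt I x₀).target)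
    (v : TangentSpace I ((extChartAt I x₀).symm y)) :
    mfderiv 𝓘(ℝ, E) I (extChartAt I x₀).symm y
      (mfderiv I 𝓘(ℝ, E) (extChartAt I x₀) ((extChartAt I x₀).symm y) v) = v := by
  have : IsManifold I 1 N := IsManifold.of_le (n := ∞) (by simp)
  have h := mfderivWithin_extChartAt_symm_comp_mfderiv_extChartAt (I := I) hy
  rw [I.range_eq_univ, mfderivWithin_univ] at h
  exact congrArg (fun L => L v) h

/-- A smooth vector field is smooth in charts. -/
theorem contDiffOn_chart_vectorField {V : ∀ x : N, TangentSpace I x} {x₀ : N} {s : Set N}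
    (hs : IsOpen s)
    (hV : ContMDiffOn I I.tangent ∞ (fun x => (⟨x, V x⟩ : TangentBundle I N)) s) :
    ContDiffOn ℝ ∞ (fun y : E => (mfderiv I 𝓘(ℝ, E) (extChartAt I x₀) ((extChartAt I x₀).symm y)
      (V ((extChartAt I x₀).symm y)) : E))
      ((extChartAt I x₀).target ∩ (extChartAt I x₀).symm ⁻¹' s) := by
  have : IsManifold I 1 N := IsManifold.of_le (n := ∞) (by simp)
  have h1 := ((trivializationAt E (TangentSpace I) x₀).contMDiffOn_section_iff (IB := I) (n := ∞)
    (s := V) (a := s ∩ (chartAt H x₀).source) (hs.inter (chartAt H x₀).open_source)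
    (by rw [TangentBundle.trivializationAt_baseSet]; exact inter_subset_right)).1
    (hV.mono inter_subset_left)
  have hmaps : MapsTo (extChartAt I x₀).symm
      ((extChartAt I x₀).target ∩ (extChartAt I x₀).symm ⁻¹' s) (s ∩ (chartAt H x₀).source) :=
    fun y hy => ⟨hy.2, mem_chartAt_source_of_mem_target hy.1⟩
  have h2 : ContMDiffOn 𝓘(ℝ, E) I ∞ (extChartAt I x₀).symm
      ((extChartAt I x₀).target ∩ (extChartAt I x₀).symm ⁻¹' s) :=
    (contMDiffOn_extChartAt_symm (I := I) x₀).mono inter_subset_left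
  have h2 := h1.comp h2 hmaps
  refine (contMDiffOn_iff_contDiffOn.1 h2).congr fun y hy => ?_
  have hy' := mem_chartAt_source_of_mem_target (I := I) hy.1
  have h4 : (trivializationAt E (TangentSpace I) x₀).continuousLinearMapAt ℝ
      ((extChartAt I x₀).symm y) (V ((extChartAt I x₀).symm y)) =
        ((trivializationAt E (TangentSpace I) x₀)
          ⟨(extChartAt I x₀).symm y, V ((extChartAt I x₀).symm y)⟩).2 := by
    rw [Bundle.Trivialization.continuousLinearMapAt_apply,
      Bundle.Trivialization.coe_linearMapAt_of_mem _
        (by rw [TangentBundle.trivializationAt_baseSet]; exact hy')]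
  exact (congrArg (fun L : TangentSpace I ((extChartAt I x₀).symm y) →L[ℝ] E =>
    L (V ((extChartAt I x₀).symm y)))
      (TangentBundle.continuousLinearMapAt_trivializationAt hy')).symm.trans h4

end Charts

/-! ### Global flows of compactly supported vector fields -/

section GlobalFlow

variable {E : Type*} [NormedAddCommGroup E] [NormedSpace ℝ E] [FiniteDimensional ℝ E]

/-- The flow theorem on a vector space asks for a globally smooth field; cutting off by a bump
function provides one with the same germ. -/
theorem exists_contDiff_eqOn_nhds {f : E → E} {s : Set E} (hs : IsOpen s)
    (hf : ContDiffOn ℝ ∞ f s) {x₀ : E} (hx : x₀ ∈ s) :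
    ∃ g : E → E, ContDiff ℝ ∞ g ∧ g =ᶠ[𝓝 x₀] f := by
  obtain ⟨r, hr, hrs⟩ := Metric.nhds_basis_closedBall.mem_iff.1 (hs.mem_nhds hx)
  let χ : ContDiffBump x₀ := ⟨r / 2, r, by positivity, by linarith⟩
  refine ⟨fun x => χ x • f x, ?_, ?_⟩
  · rw [contDiff_iff_contDiffAt]
    intro x
    by_cases hxs : x ∈ s
    · exact χ.contDiff.contDiffAt.smul (hf.contDiffAt (hs.mem_nhds hxs))
    · have : (fun x => χ x • f x) =ᶠ[𝓝 x] fun _ => 0 := by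
        have hx' : x ∈ (Metric.closedBall x₀ r)ᶜ := fun h => hxs (hrs h)
        filter_upwards [Metric.isClosed_closedBall.isOpen_compl.mem_nhds hx'] with y hy
        have : χ y = 0 := by
          by_contra h
          have hy' : y ∈ Function.support χ := h
          rw [χ.support_eq] at hy'
          exact hy (Metric.ball_subset_closedBall hy')
        rw [this, zero_smul]
      exact contDiffAt_const.congr_of_eventuallyEq this
  · filter_upwards [χ.eventuallyEq_one] with x hx
    simp only [Pi.one_apply] at hx
    rw [hx, one_smul]

variable {H : Type*} [TopologicalSpace H] {I : ModelWithCorners ℝ E H} [I.Boundaryless]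
  {N : Type*} [TopologicalSpace N] [ChartedSpace H N] [IsManifold I ∞ N]

/-- The field is read in the chart at x₀ and replaced by a global field with the same germ, whose
flow is carried back. The domain is shrunk until the flow stays where the two fields agree. -/
theorem exists_contMDiffOn_localFlow {V : ∀ x : N, TangentSpace I x}
    (hV : ContMDiff I I.tangent ∞ (fun x => (⟨x, V x⟩ : TangentBundle I N))) (x₀ : N) :
    ∃ δ > (0 : ℝ), ∃ U : Set N, IsOpen U ∧ x₀ ∈ U ∧ ∃ θ : N × ℝ → N,
      ContMDiffOn (I.prod 𝓘(ℝ, ℝ)) I ∞ θ (U ×ˢ Ioo (-δ) δ) ∧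
      ∀ x ∈ U, θ (x, 0) = x ∧ IsMIntegralCurveOn (fun t => θ (x, t)) V (Ioo (-δ) δ) := by
  set e := extChartAt I x₀ with he
  have hcont := contDiffOn_chart_vectorField (x₀ := x₀) isOpen_univ hV.contMDiffOn
  rw [preimage_univ, inter_univ] at hcont
  have hx₀ : e x₀ ∈ e.target := mem_extChartAt_target x₀
  have hto : IsOpen e.target := isOpen_extChartAt_target x₀
  obtain ⟨g, hg, hgf⟩ := exists_contDiff_eqOn_nhds hto hcont hx₀
  obtain ⟨δ, hδ, U, hU, hxU, φ, hφ, hφd⟩ := exists_contDiffOn_localFlow hg (e x₀)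
  have hgood : ∀ᶠ y in 𝓝 (e x₀), y ∈ e.target ∧
      g y = mfderiv I 𝓘(ℝ, E) e (e.symm y) (V (e.symm y)) :=
    Filter.Eventually.and (hto.mem_nhds hx₀) hgf
  have hφ0 : φ (e x₀, 0) = e x₀ := (hφd _ hxU).1
  have hD : IsOpen (U ×ˢ Ioo (-δ) δ) := hU.prod isOpen_Ioo
  have hmem : ((e x₀, (0 : ℝ)) : E × ℝ) ∈ U ×ˢ Ioo (-δ) δ := ⟨hxU, by simpa using hδ⟩
  have hφc : ContinuousAt φ (e x₀, 0) := hφ.continuousOn.continuousAt (hD.mem_nhds hmem)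
  have hev : ∀ᶠ q in 𝓝 ((e x₀, (0 : ℝ)) : E × ℝ), φ q ∈ e.target ∧
      g (φ q) = mfderiv I 𝓘(ℝ, E) e (e.symm (φ q)) (V (e.symm (φ q))) := by
    rw [← hφ0] at hgood
    exact hφc.eventually hgood
  obtain ⟨A, hA, B, hB, hAB⟩ := mem_nhds_prod_iff.1 (hev.and (hD.mem_nhds hmem))
  obtain ⟨η, hη, hBη⟩ := Metric.mem_nhds_iff.1 hB
  obtain ⟨A', hA'A, hA'o, hxA'⟩ := mem_nhds_iff.1 hA
  have hBη' : Ioo (-η) η ⊆ B := fun t ht => hBη (by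
    rw [Metric.mem_ball, dist_zero_right, Real.norm_eq_abs]
    exact abs_lt.2 ht)
  have hWo : IsOpen (e.source ∩ e ⁻¹' A') :=
    (continuousOn_extChartAt (I := I) x₀).isOpen_inter_preimage (isOpen_extChartAt_source x₀) hA'o
  refine ⟨η, hη, e.source ∩ e ⁻¹' A', hWo, ⟨mem_extChartAt_source x₀, hxA'⟩,
    fun q => e.symm (φ (e q.1, q.2)), ?_, ?_⟩
  · have h1 : ContMDiffOn (I.prod 𝓘(ℝ, ℝ)) 𝓘(ℝ, E) ∞ (fun q : N × ℝ => e q.1)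
        ((e.source ∩ e ⁻¹' A') ×ˢ Ioo (-η) η) :=
      (contMDiffOn_extChartAt (I := I) (n := ∞) (x := x₀)).comp contMDiff_fst.contMDiffOn
        (fun q hq => by rw [← extChartAt_source (I := I)]; exact hq.1.1)
    have h2 : ContMDiffOn (I.prod 𝓘(ℝ, ℝ)) 𝓘(ℝ, E × ℝ) ∞ (fun q : N × ℝ => (e q.1, q.2))
        ((e.source ∩ e ⁻¹' A') ×ˢ Ioo (-η) η) :=
      h1.prodMk_space contMDiff_snd.contMDiffOn
    have h3 := (contMDiffOn_iff_contDiffOn.2 hφ).comp h2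
      (fun q hq => (hAB (show (e q.1, q.2) ∈ A ×ˢ B from ⟨hA'A hq.1.2, hBη' hq.2⟩)).2)
    exact (contMDiffOn_extChartAt_symm (I := I) (n := ∞) x₀).comp h3
      (fun q hq => (hAB (show (e q.1, q.2) ∈ A ×ˢ B from ⟨hA'A hq.1.2, hBη' hq.2⟩)).1.1)
  · rintro x ⟨hxs, hxA⟩
    have hxU' : ∀ t ∈ Ioo (-η) η, (e x, t) ∈ U ×ˢ Ioo (-δ) δ := fun t ht =>
      (hAB (show (e x, t) ∈ A ×ˢ B from ⟨hA'A hxA, hBη' ht⟩)).2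
    have hxx := hφd (e x) (hxU' 0 (by simpa using hη)).1
    refine ⟨?_, ?_⟩
    · simp only [hxx.1]
      exact e.left_inv hxs
    · intro t ht
      obtain ⟨ht1, ht2⟩ := (hAB (show (e x, t) ∈ A ×ˢ B from ⟨hA'A hxA, hBη' ht⟩)).1
      have h1 : HasDerivAt (fun s => φ (e x, s)) (g (φ (e x, t))) t := hxx.2 t (hxU' t ht).2
      have h2 : HasMFDerivAt 𝓘(ℝ, ℝ) 𝓘(ℝ, E) (fun s => φ (e x, s)) t
          ((1 : ℝ →L[ℝ] ℝ).smulRight (g (φ (e x, t)))) := h1.hasFDerivAt.hasMFDerivAt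
      have h3 : HasMFDerivAt 𝓘(ℝ, E) I e.symm (φ (e x, t))
          (mfderiv 𝓘(ℝ, E) I e.symm (φ (e x, t))) :=
        ((contMDiffAt_extChartAt_symm_of_mem ht1).mdifferentiableAt (by simp)).hasMFDerivAt
      refine ((h3.comp t h2).congr_mfderiv ?_).hasMFDerivWithinAt
      refine ContinuousLinearMap.ext fun r : ℝ => ?_
      change mfderiv 𝓘(ℝ, E) I e.symm (φ (e x, t)) (r • g (φ (e x, t))) =
        r • V (e.symm (φ (e x, t)))
      rw [ht2]
      exact (map_smul _ r _).trans (congrArg (r • ·) (mfderiv_symm_mfderiv_extChartAt ht1 _))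

variable [T2Space N]

/-- A smooth vector field which vanishes off a compact set has a global smooth flow. -/
theorem exists_contMDiff_flow {V : ∀ x : N, TangentSpace I x}
    (hV : ContMDiff I I.tangent ∞ (fun x => (⟨x, V x⟩ : TangentBundle I N)))
    {K : Set N} (hK : IsCompact K) (hVK : ∀ x ∉ K, V x = 0) :
    ∃ θ : N × ℝ → N, ContMDiff (I.prod 𝓘(ℝ, ℝ)) I ∞ θ ∧ (∀ x, θ (x, 0) = x) ∧
      ∀ x, IsMIntegralCurve (fun t => θ (x, t)) V := by
  have : IsManifold I 1 N := IsManifold.of_le (n := ∞) (by simp)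
  have hV1 : ContMDiff I I.tangent 1 (fun x => (⟨x, V x⟩ : TangentBundle I N)) :=
    hV.of_le (by simp)
  choose δ hδ U hU hxU φ hφ hφV using exists_contMDiffOn_localFlow hV
  obtain ⟨s, -, hs⟩ := hK.elim_nhds_subcover U fun x _ => (hU x).mem_nhds (hxU x)
  -- Finitely many local flows cover K, so they have a common time of existence; off K the integral
  -- curves are constant.
  obtain ⟨η, hη, hηδ⟩ : ∃ η > (0 : ℝ), ∀ x ∈ s, η ≤ δ x := by
    rcases s.eq_empty_or_nonempty with h | h
    · exact ⟨1, one_pos, by simp [h]⟩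
    · obtain ⟨x, hx, hmin⟩ := s.exists_min_image δ h
      exact ⟨δ x, hδ x, hmin⟩
  have hconst : ∀ x ∉ K, IsMIntegralCurve (fun _ : ℝ => x) V := fun x hx =>
    isMIntegralCurve_const (hVK x hx)
  have hloc : ∀ x : N, ∃ γ : ℝ → N, γ 0 = x ∧ IsMIntegralCurveOn γ V (Ioo (-η) η) := by
    intro x
    by_cases hx : x ∈ K
    · obtain ⟨i, hi, hxi⟩ := mem_iUnion₂.1 (hs hx)
      refine ⟨fun t => φ i (x, t), (hφV i x hxi).1, (hφV i x hxi).2.mono ?_⟩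
      exact Ioo_subset_Ioo (neg_le_neg (hηδ i hi)) (hηδ i hi)
    · exact ⟨fun _ => x, rfl, (hconst x hx).isMIntegralCurveOn _⟩
  choose γ hγ0 hγ using exists_isMIntegralCurve_of_isMIntegralCurveOn hV1 hη hloc
  have hgroup : ∀ x a t, γ (γ x a) t = γ x (t + a) := by
    intro x a t
    have h := isMIntegralCurve_Ioo_eq_of_contMDiff_boundaryless (t₀ := 0) hV1 (hγ (γ x a))
      ((hγ x).comp_add a) (by simp [hγ0])
    exact congrFun h t
  let θ : N × ℝ → N := fun q => γ q.1 q.2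
  have hsmall : ContMDiffOn (I.prod 𝓘(ℝ, ℝ)) I ∞ θ (univ ×ˢ Ioo (-η) η) := by
    rintro ⟨x, t⟩ ⟨-, ht⟩
    by_cases hx : x ∈ K
    · obtain ⟨i, hi, hxi⟩ := mem_iUnion₂.1 (hs hx)
      have hsub : Ioo (-η) η ⊆ Ioo (-(δ i)) (δ i) :=
        Ioo_subset_Ioo (neg_le_neg (hηδ i hi)) (hηδ i hi)
      have hopen : U i ×ˢ Ioo (-η) η ∈ 𝓝 (x, t) :=
        ((hU i).prod isOpen_Ioo).mem_nhds ⟨hxi, ht⟩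
      have h1 : ContMDiffAt (I.prod 𝓘(ℝ, ℝ)) I ∞ (φ i) (x, t) :=
        ((hφ i).mono (prod_mono subset_rfl hsub)).contMDiffAt hopen
      refine (h1.congr_of_eventuallyEq ?_).contMDiffWithinAt
      filter_upwards [hopen] with q hq
      have h0 : (0 : ℝ) ∈ Ioo (-η) η := by simpa using hη
      exact isMIntegralCurveOn_Ioo_eqOn_of_contMDiff_boundaryless h0 hV1
        ((hγ q.1).isMIntegralCurveOn _) ((hφV i q.1 hq.1).2.mono hsub)
        (by rw [hγ0, (hφV i q.1 hq.1).1]) hq.2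
    · refine (contMDiffAt_fst.congr_of_eventuallyEq ?_).contMDiffWithinAt
      have hopen : Kᶜ ×ˢ (univ : Set ℝ) ∈ 𝓝 (x, t) :=
        (hK.isClosed.isOpen_compl.prod isOpen_univ).mem_nhds ⟨hx, mem_univ _⟩
      filter_upwards [hopen] with q hq
      exact congrFun (isMIntegralCurve_Ioo_eq_of_contMDiff_boundaryless (t₀ := 0) hV1 (hγ q.1)
        (hconst q.1 hq.1) (hγ0 _)) q.2
  have hn : ∀ n : ℕ, ContMDiffOn (I.prod 𝓘(ℝ, ℝ)) I ∞ θ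
      (univ ×ˢ Ioo (-((n + 1) * η)) ((n + 1) * η)) := by
    intro n
    induction n with
    | zero => simpa using hsmall
    | succ n ih =>
      push_cast
      have hpos : (0 : ℝ) < n + 1 + 1 := by positivity
      -- Splitting t as (n+1)/(n+2) t + 1/(n+2) t, the group law extends smoothness from |t| <
      -- (n+1)η to |t| < (n+2)η.
      have heq : θ = fun q => θ (θ (q.1, (n + 1) / (n + 1 + 1) * q.2), 1 / (n + 1 + 1) * q.2) := by
        funext q
        simp only [θ]
        rw [hgroup]
        congr 1
        field_simp
        ring
      rw [heq]
      have hlin : ∀ c : ℝ, ContMDiff (I.prod 𝓘(ℝ, ℝ)) 𝓘(ℝ, ℝ) ∞ (fun q : N × ℝ => c * q.2) :=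
        fun c => (contDiff_const.mul contDiff_id : ContDiff ℝ ∞ fun t : ℝ => c * t).contMDiff.comp
          contMDiff_snd
      have h1 := ih.comp (s := univ ×ˢ Ioo (-((n + 1 + 1) * η)) ((n + 1 + 1) * η))
        (contMDiff_fst.prodMk (hlin ((n + 1) / (n + 1 + 1)))).contMDiffOn (by
          rintro q ⟨-, hq⟩
          refine ⟨mem_univ _, abs_lt.1 ?_⟩
          rw [abs_mul, abs_of_pos (by positivity), div_mul_eq_mul_div, div_lt_iff₀ hpos]
          have := abs_lt.2 hq
          nlinarith [mul_lt_mul_of_pos_left this (show (0 : ℝ) < n + 1 by positivity)])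
      exact hsmall.comp (h1.prodMk (hlin (1 / (n + 1 + 1))).contMDiffOn) (by
          rintro q ⟨-, hq⟩
          refine ⟨mem_univ _, abs_lt.1 ?_⟩
          rw [abs_mul, abs_of_pos (by positivity), div_mul_eq_mul_div, one_mul, div_lt_iff₀ hpos]
          have := abs_lt.2 hq
          linarith)
  refine ⟨θ, ?_, hγ0, hγ⟩
  rintro ⟨x, t⟩
  obtain ⟨n, hnt⟩ := exists_nat_gt (|t| / η)
  refine (hn n).contMDiffAt ((isOpen_univ.prod isOpen_Ioo).mem_nhds ⟨mem_univ _, abs_lt.1 ?_⟩)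
  rw [div_lt_iff₀ hη] at hnt
  linarith

end GlobalFlow

/-! ### Smoothness of parametric integrals -/

section ParametricIntegral

universe u

open MeasureTheory

variable {F : Type*} [NormedAddCommGroup F] [NormedSpace ℝ F]
  {H : Type*} [TopologicalSpace H] {J : ModelWithCorners ℝ F H}
  {N : Type*} [TopologicalSpace N] [ChartedSpace H N]

/-- Smooth dependence on parameters holds for `mfderiv`, which between vector spaces is `fderiv`.
The result is the integrand that appears on differentiating a parametric integral. -/
theorem contMDiffOn_fderiv_snd {E G : Type*} [NormedAddCommGroup E] [NormedSpace ℝ E]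
    [NormedAddCommGroup G] [NormedSpace ℝ G] [IsManifold J ∞ N]
    {f : N × E → G} {O : Set (N × E)} (hO : IsOpen O)
    (hf : ContMDiffOn (J.prod 𝓘(ℝ, E)) 𝓘(ℝ, G) ∞ f O) :
    ContMDiffOn (J.prod 𝓘(ℝ, E)) 𝓘(ℝ, E →L[ℝ] G) ∞
      (fun p => fderiv ℝ (fun y => f (p.1, y)) p.2) O := by
  intro p hp
  have h1 : ContMDiffAt ((J.prod 𝓘(ℝ, E)).prod 𝓘(ℝ, E)) 𝓘(ℝ, G) ∞
      (Function.uncurry fun (q : N × E) (y : E) => f (q.1, y)) (p, p.2) := by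
    have h2 : ContMDiffAt (J.prod 𝓘(ℝ, E)) 𝓘(ℝ, G) ∞ f (p.1, p.2) :=
      hf.contMDiffAt (hO.mem_nhds hp)
    have h3 : ContMDiffAt ((J.prod 𝓘(ℝ, E)).prod 𝓘(ℝ, E)) (J.prod 𝓘(ℝ, E)) ∞
        (fun q : (N × E) × E => (q.1.1, q.2)) (p, p.2) :=
      ((contMDiff_fst.comp contMDiff_fst).prodMk contMDiff_snd).contMDiffAt
    exact h2.comp (p, p.2) h3
  have h4 := ContMDiffAt.mfderiv (m := ∞) (fun (q : N × E) (y : E) => f (q.1, y)) Prod.snd h1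
    contMDiffAt_snd (by simp)
  refine (h4.congr_of_eventuallyEq (Eventually.of_forall fun q => ?_)).contMDiffWithinAt
  exact (mfderiv_eq_fderiv).symm.trans (congrFun (inTangentCoordinates_model_space Prod.snd
    (fun x : N × E => f (x.1, x.2))
    (fun x : N × E => mfderiv 𝓘(ℝ, E) 𝓘(ℝ, G) (fun y => f (x.1, y)) x.2) p) q).symm

variable [MeasurableSpace N] [BorelSpace N] [T2Space N] [SecondCountableTopology N]
  (μ : Measure N) [IsFiniteMeasureOnCompacts μ]

/-- The partial derivative is continuous, hence bounded, on the compact set K × closedBall y r, and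
a constant is integrable over K; so differentiation is dominated. -/
theorem hasFDerivAt_setIntegral_of_contMDiffOn {E G : Type*} [NormedAddCommGroup E]
    [NormedSpace ℝ E] [FiniteDimensional ℝ E]
    [NormedAddCommGroup G] [NormedSpace ℝ G] [IsManifold J ∞ N]
    {f : N × E → G} {O : Set (N × E)} (hO : IsOpen O)
    (hf : ContMDiffOn (J.prod 𝓘(ℝ, E)) 𝓘(ℝ, G) ∞ f O) {K : Set N} (hK : IsCompact K) {U : Set E}
    (hU : IsOpen U) (hKU : K ×ˢ U ⊆ O) {y : E} (hy : y ∈ U) :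
    HasFDerivAt (fun y => ∫ x in K, f (x, y) ∂μ)
      (∫ x in K, fderiv ℝ (fun y => f (x, y)) y ∂μ) y := by
  obtain ⟨r, hr, hrU⟩ := Metric.nhds_basis_closedBall.mem_iff.1 (hU.mem_nhds hy)
  have hD := (contMDiffOn_fderiv_snd hO hf).continuousOn
  have hKB : IsCompact (K ×ˢ Metric.closedBall y r) := hK.prod (isCompact_closedBall y r)
  obtain ⟨C, hC⟩ := hKB.exists_bound_of_continuousOn
    (hD.mono ((prod_mono subset_rfl hrU).trans hKU))
  have hsl : ∀ y ∈ U, ContinuousOn (fun x => f (x, y)) K := fun y hy =>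
    hf.continuousOn.comp (by fun_prop) fun x hx => hKU ⟨hx, hy⟩
  have hsl' : ContinuousOn (fun x => fderiv ℝ (fun y => f (x, y)) y) K :=
    hD.comp (f := fun x => (x, y)) (by fun_prop) fun x hx => hKU ⟨hx, hy⟩
  refine hasFDerivAt_integral_of_dominated_of_fderiv_le (s := Metric.ball y r)
    (bound := fun _ => C) (F' := fun z x => fderiv ℝ (fun y => f (x, y)) z)
    (Metric.ball_mem_nhds y hr) ?_ ?_ ?_ ?_ ?_ ?_
  · filter_upwards [hU.mem_nhds hy] with z hz
    exact (hsl z hz).aestronglyMeasurable hK.measurableSet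
  · exact (hsl y hy).integrableOn_compact hK
  · exact hsl'.aestronglyMeasurable hK.measurableSet
  · refine ae_restrict_of_forall_mem hK.measurableSet fun x hx z hz => ?_
    exact hC (x, z) ⟨hx, Metric.ball_subset_closedBall hz⟩
  · exact integrableOn_const hK.measure_lt_top.ne
  · refine ae_restrict_of_forall_mem hK.measurableSet fun x hx z hz => ?_
    have h1 : ContMDiffAt (J.prod 𝓘(ℝ, E)) 𝓘(ℝ, G) ∞ f (x, z) :=
      hf.contMDiffAt (hO.mem_nhds (hKU ⟨hx, hrU (Metric.ball_subset_closedBall hz)⟩))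
    have h2 : ContMDiffAt 𝓘(ℝ, E) 𝓘(ℝ, G) ∞ (fun y => f (x, y)) z :=
      h1.comp (f := fun y => (x, y)) z (contMDiffAt_const.prodMk contMDiffAt_id)
    exact (h2.contDiffAt.differentiableAt (by simp)).hasFDerivAt

/-- Induction with G replaced by `E →L[ℝ] G`, where the differentiated integrand takes its values;
hence the common universe of E and G. -/
theorem contDiffOn_nat_setIntegral (n : ℕ) {E G : Type u} [NormedAddCommGroup E]
    [NormedSpace ℝ E] [FiniteDimensional ℝ E]
    [NormedAddCommGroup G] [NormedSpace ℝ G] [IsManifold J ∞ N]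
    {f : N × E → G} {O : Set (N × E)} (hO : IsOpen O)
    (hf : ContMDiffOn (J.prod 𝓘(ℝ, E)) 𝓘(ℝ, G) ∞ f O) {K : Set N} (hK : IsCompact K) {U : Set E}
    (hU : IsOpen U) (hKU : K ×ˢ U ⊆ O) :
    ContDiffOn ℝ n (fun y => ∫ x in K, f (x, y) ∂μ) U := by
  induction n generalizing G with
  | zero =>
    exact contDiffOn_zero.2 fun y hy =>
      (hasFDerivAt_setIntegral_of_contMDiffOn μ hO hf hK hU hKU hy).continuousAt.continuousWithinAt
  | succ n ih =>
    push_cast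
    rw [contDiffOn_succ_iff_fderiv_of_isOpen hU]
    refine ⟨fun y hy => (hasFDerivAt_setIntegral_of_contMDiffOn μ hO hf hK hU hKU
      hy).differentiableAt.differentiableWithinAt, by simp, ?_⟩
    refine (ih (contMDiffOn_fderiv_snd hO hf)).congr fun y hy => ?_
    exact (hasFDerivAt_setIntegral_of_contMDiffOn μ hO hf hK hU hKU hy).fderiv

/-- Differentiation under the integral sign. -/
theorem contDiffOn_setIntegral {E G : Type u} [NormedAddCommGroup E]
    [NormedSpace ℝ E] [FiniteDimensional ℝ E]
    [NormedAddCommGroup G] [NormedSpace ℝ G] [IsManifold J ∞ N]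
    {f : N × E → G} {O : Set (N × E)} (hO : IsOpen O)
    (hf : ContMDiffOn (J.prod 𝓘(ℝ, E)) 𝓘(ℝ, G) ∞ f O) {K : Set N} (hK : IsCompact K) {U : Set E}
    (hU : IsOpen U) (hKU : K ×ˢ U ⊆ O) :
    ContDiffOn ℝ ∞ (fun y => ∫ x in K, f (x, y) ∂μ) U :=
  contDiffOn_infty.2 fun n => contDiffOn_nat_setIntegral μ n hO hf hK hU hKU

end ParametricIntegral

/-! ### Division by `t` -/

section Hadamard

variable {W : Type*} [NormedAddCommGroup W] [NormedSpace ℝ W]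

/-- The difference quotient `(g t - g 0) / t`, extended smoothly across `t = 0`. -/
noncomputable def divX (g : ℝ → W) (t : ℝ) : W := ∫ u in Icc (0 : ℝ) 1, deriv g (u * t)

theorem mul_mem_Ioo_of_mem_Icc {ε t u : ℝ} (ht : t ∈ Ioo (-ε) ε) (hu : u ∈ Icc (0 : ℝ) 1) :
    u * t ∈ Ioo (-ε) ε := by
  refine abs_lt.1 ?_
  rw [abs_mul, abs_of_nonneg hu.1]
  exact (mul_le_of_le_one_left (abs_nonneg _) hu.2).trans_lt (abs_lt.2 ht)

/-- The fundamental theorem of calculus for u ↦ g (u t) on [0, 1]. -/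
theorem eq_add_smul_divX [CompleteSpace W] {g : ℝ → W} {ε : ℝ} (hg : ContDiffOn ℝ ∞ g (Ioo (-ε) ε))
    {t : ℝ} (ht : t ∈ Ioo (-ε) ε) : g t = g 0 + t • divX g t := by
  have hd : ∀ u ∈ uIcc (0 : ℝ) 1, HasDerivAt (fun u => g (u * t)) (t • deriv g (u * t)) u := by
    intro u hu
    rw [uIcc_of_le zero_le_one] at hu
    have h1 : HasDerivAt g (deriv g (u * t)) (u * t) :=
      ((hg.contDiffAt (isOpen_Ioo.mem_nhds (mul_mem_Ioo_of_mem_Icc ht hu))).differentiableAt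
        (by simp)).hasDerivAt
    have h2 : HasDerivAt (fun u : ℝ => u * t) t u := by
      simpa using (hasDerivAt_id u).mul_const t
    exact h1.scomp u h2
  have hc : ContinuousOn (fun u => deriv g (u * t)) (uIcc 0 1) := by
    rw [uIcc_of_le zero_le_one]
    exact (hg.continuousOn_deriv_of_isOpen isOpen_Ioo (by simp)).comp (by fun_prop)
      fun u hu => mul_mem_Ioo_of_mem_Icc ht hu
  have h := intervalIntegral.integral_eq_sub_of_hasDerivAt hd
    ((hc.const_smul t).intervalIntegrable)
  simp only [one_mul, zero_mul] at h
  rw [intervalIntegral.integral_smul, intervalIntegral.integral_of_le zero_le_one,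
    ← MeasureTheory.integral_Icc_eq_integral_Ioc] at h
  rw [divX, h]
  abel

/-- Applied to the pullback of forms by a fixed linear map, this lets the quotient pass to chart
expressions and preserves invariance under a group. -/
theorem map_divX [CompleteSpace W] {W' : Type*} [NormedAddCommGroup W'] [NormedSpace ℝ W']
    [CompleteSpace W']
    (L : W →L[ℝ] W') {g : ℝ → W} {ε : ℝ}
    (hg : ContDiffOn ℝ ∞ g (Ioo (-ε) ε)) {t : ℝ} (ht : t ∈ Ioo (-ε) ε) :
    L (divX g t) = divX (fun s => L (g s)) t := by
  have hc : ContinuousOn (fun u => deriv g (u * t)) (Icc 0 1) :=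
    (hg.continuousOn_deriv_of_isOpen isOpen_Ioo (by simp)).comp (by fun_prop)
      fun u hu => mul_mem_Ioo_of_mem_Icc ht hu
  rw [divX, divX, ← L.integral_comp_comm (hc.integrableOn_compact isCompact_Icc)]
  refine MeasureTheory.setIntegral_congr_fun measurableSet_Icc fun u hu => ?_
  have h1 : HasDerivAt g (deriv g (u * t)) (u * t) :=
    ((hg.contDiffAt (isOpen_Ioo.mem_nhds (mul_mem_Ioo_of_mem_Icc ht hu))).differentiableAt
      (by simp)).hasDerivAt
  exact (L.hasFDerivAt.comp_hasDerivAt _ h1).deriv.symm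

theorem divX_congr {g g' : ℝ → W} {ε : ℝ} (h : EqOn g g' (Ioo (-ε) ε)) {t : ℝ}
    (ht : t ∈ Ioo (-ε) ε) : divX g t = divX g' t := by
  refine MeasureTheory.setIntegral_congr_fun measurableSet_Icc fun u hu => ?_
  refine Filter.EventuallyEq.deriv_eq ?_
  filter_upwards [isOpen_Ioo.mem_nhds (mul_mem_Ioo_of_mem_Icc ht hu)] with s hs using h hs

universe u in
/-- `divX` depends smoothly on parameters. -/
theorem contDiffOn_divX {E W : Type u} [NormedAddCommGroup E] [NormedSpace ℝ E]
    [FiniteDimensional ℝ E] [NormedAddCommGroup W] [NormedSpace ℝ W] {g : E × ℝ → W} {U : Set E}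
    (hU : IsOpen U) {ε : ℝ} (hg : ContDiffOn ℝ ∞ g (U ×ˢ Ioo (-ε) ε)) :
    ContDiffOn ℝ ∞ (fun p : E × ℝ => divX (fun t => g (p.1, t)) p.2) (U ×ˢ Ioo (-ε) ε) := by
  have hDo : IsOpen (U ×ˢ Ioo (-ε) ε) := hU.prod isOpen_Ioo
  let O : Set (ℝ × (E × ℝ)) := {q | (q.2.1, q.1 * q.2.2) ∈ U ×ˢ Ioo (-ε) ε}
  have hO : IsOpen O := hDo.preimage (by fun_prop)
  have h1 : ContDiffOn ℝ ∞ (fun q : ℝ × (E × ℝ) => fderiv ℝ g (q.2.1, q.1 * q.2.2) (0, 1)) O := by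
    have h2 : ContDiffOn ℝ ∞ (fderiv ℝ g) (U ×ˢ Ioo (-ε) ε) :=
      hg.fderiv_of_isOpen hDo (by simp)
    have h3 : ContDiff ℝ ∞ (fun q : ℝ × (E × ℝ) => (q.2.1, q.1 * q.2.2)) := by fun_prop
    exact (h2.comp h3.contDiffOn fun q hq => hq).clm_apply contDiffOn_const
  have h1' := h1.contMDiffOn
  rw [modelWithCornersSelf_prod, ← chartedSpaceSelf_prod] at h1'
  have h4 := contDiffOn_setIntegral (J := 𝓘(ℝ, ℝ)) (MeasureTheory.volume : MeasureTheory.Measure ℝ)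
    (f := fun q : ℝ × (E × ℝ) => fderiv ℝ g (q.2.1, q.1 * q.2.2) (0, 1)) hO
    h1'
    (isCompact_Icc (a := (0 : ℝ)) (b := 1)) hDo
    (fun q hq => ⟨hq.2.1, mul_mem_Ioo_of_mem_Icc hq.2.2 hq.1⟩)
  refine h4.congr fun p hp => ?_
  refine MeasureTheory.setIntegral_congr_fun measurableSet_Icc fun u hu => ?_
  have hm : (p.1, u * p.2) ∈ U ×ˢ Ioo (-ε) ε := ⟨hp.1, mul_mem_Ioo_of_mem_Icc hp.2 hu⟩
  have h5 : HasFDerivAt g (fderiv ℝ g (p.1, u * p.2)) (p.1, u * p.2) :=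
    ((hg.contDiffAt (hDo.mem_nhds hm)).differentiableAt (by simp)).hasFDerivAt
  have h6 : HasDerivAt (fun t : ℝ => (p.1, t)) ((0, 1) : E × ℝ) (u * p.2) :=
    (hasDerivAt_const _ _).prodMk (hasDerivAt_id _)
  exact (h5.comp_hasDerivAt (u * p.2) h6).deriv

end Hadamard

/-! ### Alternating maps depending smoothly on parameters -/

section AlternatingSmooth

variable {X : Type*} [NormedAddCommGroup X] [NormedSpace ℝ X]
  {E : Type*} [NormedAddCommGroup E] [NormedSpace ℝ E]

/-- Induction on the degree: currying the first argument is a bounded linear operation. -/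
theorem ContDiffWithinAt.alternating_apply {k : ℕ} {η : X → E [⋀^Fin k]→L[ℝ] ℝ}
    {v : Fin k → X → E} {s : Set X} {x : X} (hη : ContDiffWithinAt ℝ ∞ η s x)
    (hv : ∀ i, ContDiffWithinAt ℝ ∞ (v i) s x) :
    ContDiffWithinAt ℝ ∞ (fun y => η y (fun i => v i y)) s x := by
  induction k with
  | zero =>
    have h : (fun y => η y (fun i => v i y)) =
        fun y => ContinuousAlternatingMap.apply ℝ E ℝ (0 : Fin 0 → E) (η y) := by
      funext y
      exact congrArg (η y) (Subsingleton.elim _ _)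
    rw [h]
    exact (ContinuousAlternatingMap.apply ℝ E ℝ (0 : Fin 0 → E)).contDiff.contDiffAt
      |>.comp_contDiffWithinAt x hη
  | succ k ih =>
    have hb : IsBoundedLinearMap ℝ
        (fun φ : E [⋀^Fin (k + 1)]→L[ℝ] ℝ => φ.curryLeft) :=
      { map_add := fun _ _ => rfl
        map_smul := fun _ _ => rfl
        bound := ⟨1, one_pos, fun φ => by
          rw [one_mul]
          exact (ContinuousAlternatingMap.norm_curryLeft φ).le⟩ }
    have hc : ContDiff ℝ ∞ (fun φ : E [⋀^Fin (k + 1)]→L[ℝ] ℝ => φ.curryLeft) := hb.contDiff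
    have h1 : ContDiffWithinAt ℝ ∞ (fun y => (η y).curryLeft) s x :=
      hc.contDiffAt.comp_contDiffWithinAt x hη
    have h2 := ih (η := fun y => (η y).curryLeft (v 0 y)) (v := fun i => v i.succ)
      (h1.clm_apply (hv 0)) (fun i => hv i.succ)
    refine h2.congr_of_eventuallyEq (Eventually.of_forall fun y => ?_) ?_ <;>
    · simp only [ContinuousAlternatingMap.curryLeft_apply_apply]
      congr 1
      funext i
      refine Fin.cases ?_ (fun i => ?_) i <;> simp

variable [FiniteDimensional ℝ E]

/-- Evaluation on tuples of basis vectors is linear and injective. A left inverse turns smoothness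
of these finitely many values into smoothness of the form. -/
theorem contDiffWithinAt_alternating {k : ℕ} {η : X → E [⋀^Fin k]→L[ℝ] ℝ}
    {s : Set X} {x : X} (h : ∀ v : Fin k → E, ContDiffWithinAt ℝ ∞ (fun y => η y v) s x) :
    ContDiffWithinAt ℝ ∞ η s x := by
  let b := Module.finBasis ℝ E
  let ev : (E [⋀^Fin k]→L[ℝ] ℝ) →ₗ[ℝ] ((Fin k → Fin (Module.finrank ℝ E)) → ℝ) :=
    { toFun := fun φ i => φ (fun j => b (i j))
      map_add' := fun _ _ => rfl
      map_smul' := fun _ _ => rfl }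
  have hev : Function.Injective ev := by
    intro φ φ' hφ
    apply ContinuousAlternatingMap.toContinuousMultilinearMap_injective
    apply ContinuousMultilinearMap.toMultilinearMap_injective
    exact Module.Basis.ext_multilinear (fun _ => b) fun i => congrFun hφ i
  obtain ⟨L, hL⟩ := ev.exists_leftInverse_of_injective (LinearMap.ker_eq_bot.2 hev)
  have h1 : η = fun y => LinearMap.toContinuousLinearMap L (ev (η y)) := by
    funext y
    exact (LinearMap.congr_fun hL (η y)).symm
  rw [h1]
  refine (LinearMap.toContinuousLinearMap L).contDiff.contDiffAt.comp_contDiffWithinAt x ?_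
  exact contDiffWithinAt_pi.2 fun i => h _

theorem ContDiffWithinAt.compAlternating {E' : Type*} [NormedAddCommGroup E'] [NormedSpace ℝ E']
    {k : ℕ} {η : X → E' [⋀^Fin k]→L[ℝ] ℝ} {L : X → E →L[ℝ] E'} {s : Set X} {x : X}
    (hη : ContDiffWithinAt ℝ ∞ η s x) (hL : ContDiffWithinAt ℝ ∞ L s x) :
    ContDiffWithinAt ℝ ∞ (fun y => (η y).compContinuousLinearMap (L y)) s x :=
  contDiffWithinAt_alternating fun _ =>
    hη.alternating_apply fun _ => hL.clm_apply contDiffWithinAt_const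

end AlternatingSmooth

/-! ### Exterior derivatives of forms of degree one and two -/

section ExtDeriv

variable {E : Type*} [NormedAddCommGroup E] [NormedSpace ℝ E]

theorem extDeriv_one_apply {η : E → E [⋀^Fin 1]→L[ℝ] ℝ} {y : E} (h : DifferentiableAt ℝ η y)
    (u v : E) : extDeriv η y ![u, v] =
      fderiv ℝ (fun z => η z ![v]) y u - fderiv ℝ (fun z => η z ![u]) y v := by
  rw [extDeriv_apply h, Fin.sum_univ_two]
  have h0 : Fin.removeNth 0 ![u, v] = ![v] := by
    funext i; fin_cases i; rfl
  have h1 : Fin.removeNth 1 ![u, v] = ![u] := by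
    funext i; fin_cases i; rfl
  rw [h0, h1]
  simp
  ring

theorem extDeriv_two_apply {η : E → E [⋀^Fin 2]→L[ℝ] ℝ} {y : E} (h : DifferentiableAt ℝ η y)
    (u v w : E) : extDeriv η y ![u, v, w] =
      fderiv ℝ (fun z => η z ![v, w]) y u - fderiv ℝ (fun z => η z ![u, w]) y v +
        fderiv ℝ (fun z => η z ![u, v]) y w := by
  rw [extDeriv_apply h, Fin.sum_univ_three]
  have h0 : Fin.removeNth 0 ![u, v, w] = ![v, w] := by
    funext i; fin_cases i <;> rfl
  have h1 : Fin.removeNth 1 ![u, v, w] = ![u, w] := by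
    funext i; fin_cases i <;> rfl
  have h2 : Fin.removeNth 2 ![u, v, w] = ![u, v] := by
    funext i; fin_cases i <;> rfl
  rw [h0, h1, h2]
  simp
  ring

theorem alternating_two_ext {V : Type*} [AddCommGroup V] [Module ℝ V] [TopologicalSpace V]
    {η η' : V [⋀^Fin 2]→L[ℝ] ℝ}
    (h : ∀ u v, η ![u, v] = η' ![u, v]) : η = η' := by
  ext v
  have : v = ![v 0, v 1] := by funext i; fin_cases i <;> rfl
  rw [this]
  exact h _ _

theorem alternating_three_ext {V : Type*} [AddCommGroup V] [Module ℝ V] [TopologicalSpace V]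
    {η η' : V [⋀^Fin 3]→L[ℝ] ℝ}
    (h : ∀ u v w, η ![u, v, w] = η' ![u, v, w]) : η = η' := by
  ext v
  have : v = ![v 0, v 1, v 2] := by funext i; fin_cases i <;> rfl
  rw [this]
  exact h _ _ _

theorem alternating_one_ext {V : Type*} [AddCommGroup V] [Module ℝ V] [TopologicalSpace V]
    {η η' : V [⋀^Fin 1]→L[ℝ] ℝ}
    (h : ∀ u, η ![u] = η' ![u]) : η = η' := by
  ext v
  have : v = ![v 0] := by funext i; fin_cases i; rfl
  rw [this]
  exact h _

end ExtDeriv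

/-! ### Pullback of forms -/

section Pullback

variable {E₁ : Type*} [NormedAddCommGroup E₁] [NormedSpace ℝ E₁]
  {H₁ : Type*} [TopologicalSpace H₁] (I₁ : ModelWithCorners ℝ E₁ H₁)
  {N₁ : Type*} [TopologicalSpace N₁] [ChartedSpace H₁ N₁]
  {E₂ : Type*} [NormedAddCommGroup E₂] [NormedSpace ℝ E₂]
  {H₂ : Type*} [TopologicalSpace H₂] (I₂ : ModelWithCorners ℝ E₂ H₂)
  {N₂ : Type*} [TopologicalSpace N₂] [ChartedSpace H₂ N₂]

/-- `η` is smooth on the open set `S`. -/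
def RawForm.IsSmoothOn {k : ℕ} (η : RawForm I₁ N₁ k) (S : Set N₁) : Prop :=
  ∀ x₀ : N₁, ContDiffOn ℝ ∞ (RawForm.inChart I₁ η x₀)
    ((extChartAt I₁ x₀).target ∩ (extChartAt I₁ x₀).symm ⁻¹' S)

/-- The pullback `G^* η`. -/
noncomputable def RawForm.pullback {k : ℕ} (G : N₁ → N₂) (η : RawForm I₂ N₂ k) :
    RawForm I₁ N₁ k := fun x =>
  (η (G x)).compContinuousLinearMap (mfderiv I₁ I₂ G x)

variable {I₁ I₂}

theorem RawForm.isSmoothOn_univ {k : ℕ} {η : RawForm I₁ N₁ k} :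
    RawForm.IsSmoothOn I₁ η univ ↔ RawForm.IsSmooth I₁ η := by
  simp [RawForm.IsSmoothOn, RawForm.IsSmooth]

theorem RawForm.inChart_apply {k : ℕ} (η : RawForm I₁ N₁ k) (x₀ : N₁) (y : E₁) (v : Fin k → E₁) :
    RawForm.inChart I₁ η x₀ y v =
      η ((extChartAt I₁ x₀).symm y)
        (fun i => mfderiv 𝓘(ℝ, E₁) I₁ (extChartAt I₁ x₀).symm y (v i)) := rfl

variable [I₁.Boundaryless]

theorem RawForm.isOpen_chart_preimage {S : Set N₁} (hS : IsOpen S) (x₁ : N₁) :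
    IsOpen ((extChartAt I₁ x₁).target ∩ (extChartAt I₁ x₁).symm ⁻¹' S) :=
  (continuousOn_extChartAt_symm x₁).isOpen_inter_preimage (isOpen_extChartAt_target x₁) hS

variable [I₂.Boundaryless]
variable [IsManifold I₁ ∞ N₁] [IsManifold I₂ ∞ N₂]

/-- The pullback in charts. -/
theorem RawForm.inChart_pullback {k : ℕ} {G : N₁ → N₂} (η : RawForm I₂ N₂ k) {x₁ : N₁} {x₂ : N₂}
    {y : E₁} (hy : y ∈ (extChartAt I₁ x₁).target)
    (hG : ContMDiffAt I₁ I₂ ∞ G ((extChartAt I₁ x₁).symm y))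
    (hG2 : G ((extChartAt I₁ x₁).symm y) ∈ (extChartAt I₂ x₂).source) :
    RawForm.inChart I₁ (RawForm.pullback I₁ I₂ G η) x₁ y =
      (RawForm.inChart I₂ η x₂ (extChartAt I₂ x₂ (G ((extChartAt I₁ x₁).symm y)))
        ).compContinuousLinearMap
        (fderiv ℝ (fun y => extChartAt I₂ x₂ (G ((extChartAt I₁ x₁).symm y))) y) := by
  have hs := (contMDiffAt_extChartAt_symm_of_mem (I := I₁) hy).mdifferentiableAt (by simp)
  have hGd := hG.mdifferentiableAt (by simp : (∞ : ℕ∞ω) ≠ 0)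
  have hc : MDifferentiableAt I₂ 𝓘(ℝ, E₂) (extChartAt I₂ x₂) (G ((extChartAt I₁ x₁).symm y)) :=
    (contMDiffAt_extChartAt' (n := ∞) (by rwa [← extChartAt_source I₂])).mdifferentiableAt
      (by simp)
  have hF : HasMFDerivAt 𝓘(ℝ, E₁) 𝓘(ℝ, E₂)
      (fun y => extChartAt I₂ x₂ (G ((extChartAt I₁ x₁).symm y))) y
      ((mfderiv I₂ 𝓘(ℝ, E₂) (extChartAt I₂ x₂) (G ((extChartAt I₁ x₁).symm y))).comp
        ((mfderiv I₁ I₂ G ((extChartAt I₁ x₁).symm y)).comp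
          (mfderiv 𝓘(ℝ, E₁) I₁ (extChartAt I₁ x₁).symm y))) :=
    hc.hasMFDerivAt.comp y (hGd.hasMFDerivAt.comp y hs.hasMFDerivAt)
  have hF' := mfderiv_eq_fderiv.symm.trans hF.mfderiv
  have hinv : ∀ v, mfderiv 𝓘(ℝ, E₂) I₂ (extChartAt I₂ x₂).symm
      (extChartAt I₂ x₂ (G ((extChartAt I₁ x₁).symm y)))
      (mfderiv I₂ 𝓘(ℝ, E₂) (extChartAt I₂ x₂) (G ((extChartAt I₁ x₁).symm y)) v) = v := by
    intro v
    have : IsManifold I₂ 1 N₂ := IsManifold.of_le (n := ∞) (by simp)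
    have h := mfderivWithin_extChartAt_symm_comp_mfderiv_extChartAt' (I := I₂) (x := x₂)
      (y := G ((extChartAt I₁ x₁).symm y)) hG2
    rw [I₂.range_eq_univ, mfderivWithin_univ] at h
    exact congrArg (fun L => L v) h
  have hη : ∀ (z z' : N₂), z = z' → ∀ v v' : Fin k → E₂, v = v' → η z v = η z' v' := by
    rintro z _ rfl v _ rfl
    rfl
  ext v
  rw [ContinuousAlternatingMap.compContinuousLinearMap_apply, RawForm.inChart_apply,
    RawForm.inChart_apply]
  refine hη _ _ ((extChartAt I₂ x₂).left_inv hG2).symm _ _ ?_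
  funext i
  refine (hinv _).symm.trans ?_
  exact congrArg (mfderiv 𝓘(ℝ, E₂) I₂ (extChartAt I₂ x₂).symm
    (extChartAt I₂ x₂ (G ((extChartAt I₁ x₁).symm y)))) (congrArg (fun L : E₁ →L[ℝ] E₂ => L (v i)) hF'.symm)

theorem contDiffAt_chart_comp {G : N₁ → N₂} {x₁ : N₁} {x₂ : N₂}
    {y : E₁} (hy : y ∈ (extChartAt I₁ x₁).target)
    (hG : ContMDiffAt I₁ I₂ ∞ G ((extChartAt I₁ x₁).symm y))
    (hG2 : G ((extChartAt I₁ x₁).symm y) ∈ (extChartAt I₂ x₂).source) :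
    ContDiffAt ℝ ∞ (fun y => extChartAt I₂ x₂ (G ((extChartAt I₁ x₁).symm y))) y := by
  have h1 := contMDiffAt_extChartAt_symm_of_mem (I := I₁) hy
  have h2 : ContMDiffAt I₂ 𝓘(ℝ, E₂) ∞ (extChartAt I₂ x₂) (G ((extChartAt I₁ x₁).symm y)) :=
    contMDiffAt_extChartAt' (by rwa [← extChartAt_source I₂])
  exact (h2.comp y (hG.comp y h1)).contDiffAt

/-- `extDeriv` depends on the germ of the form, so the chart formula is needed on a neighbourhood
and not only at the point. -/
theorem RawForm.inChart_pullback_eventuallyEq {k : ℕ} {G : N₁ → N₂} (η : RawForm I₂ N₂ k)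
    {S : Set N₁} (hS : IsOpen S) (hG : ContMDiffOn I₁ I₂ ∞ G S) {x₁ : N₁} {x₂ : N₂}
    {y : E₁} (hy : y ∈ (extChartAt I₁ x₁).target) (hyS : (extChartAt I₁ x₁).symm y ∈ S)
    (hG2 : G ((extChartAt I₁ x₁).symm y) ∈ (extChartAt I₂ x₂).source) :
    RawForm.inChart I₁ (RawForm.pullback I₁ I₂ G η) x₁ =ᶠ[𝓝 y] fun y =>
      (RawForm.inChart I₂ η x₂ (extChartAt I₂ x₂ (G ((extChartAt I₁ x₁).symm y)))
        ).compContinuousLinearMap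
        (fderiv ℝ (fun y => extChartAt I₂ x₂ (G ((extChartAt I₁ x₁).symm y))) y) := by
  have hsc : ContinuousAt (extChartAt I₁ x₁).symm y :=
    (contMDiffAt_extChartAt_symm_of_mem (I := I₁) hy).continuousAt
  have hGc : ContinuousAt (fun y => G ((extChartAt I₁ x₁).symm y)) y :=
    ContinuousAt.comp (hG.contMDiffAt (hS.mem_nhds hyS)).continuousAt hsc
  filter_upwards [(isOpen_extChartAt_target x₁).mem_nhds hy,
    hsc.preimage_mem_nhds (hS.mem_nhds hyS),
    hGc.preimage_mem_nhds ((isOpen_extChartAt_source x₂).mem_nhds hG2)] with z hz hzS hzG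
  exact RawForm.inChart_pullback η hz (hG.contMDiffAt (hS.mem_nhds hzS)) hzG

theorem RawForm.IsSmoothOn.pullback [FiniteDimensional ℝ E₁] {k : ℕ} {G : N₁ → N₂}
    {η : RawForm I₂ N₂ k}
    {S₁ : Set N₁} {S₂ : Set N₂} (hη : RawForm.IsSmoothOn I₂ η S₂) (hS₁ : IsOpen S₁)
    (hS₂ : IsOpen S₂) (hG : ContMDiffOn I₁ I₂ ∞ G S₁) (hm : MapsTo G S₁ S₂) :
    RawForm.IsSmoothOn I₁ (RawForm.pullback I₁ I₂ G η) S₁ := by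
  rintro x₁ y ⟨hy, hyS⟩
  set x₂ := G ((extChartAt I₁ x₁).symm y) with hx₂
  have hG2 : G ((extChartAt I₁ x₁).symm y) ∈ (extChartAt I₂ x₂).source := mem_extChartAt_source _
  have h1 := RawForm.inChart_pullback_eventuallyEq η hS₁ hG hy hyS hG2
  have hc := contDiffAt_chart_comp hy (hG.contMDiffAt (hS₁.mem_nhds hyS)) hG2
  have h2 : ContDiffAt ℝ ∞ (RawForm.inChart I₂ η x₂)
      (extChartAt I₂ x₂ (G ((extChartAt I₁ x₁).symm y))) := by
    refine (hη x₂).contDiffAt ((RawForm.isOpen_chart_preimage hS₂ x₂).mem_nhds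
      ⟨(extChartAt I₂ x₂).map_source hG2, ?_⟩)
    rw [mem_preimage, (extChartAt I₂ x₂).left_inv hG2]
    exact hm hyS
  have h3 := (h2.comp y hc).contDiffWithinAt.compAlternating
    (hc.fderiv_right (m := ∞) (by simp)).contDiffWithinAt (s := univ)
  exact ((contDiffWithinAt_univ.1 h3).congr_of_eventuallyEq h1).contDiffWithinAt

theorem RawForm.IsClosedOn.pullback {k : ℕ} {G : N₁ → N₂} {η : RawForm I₂ N₂ k}
    {S₁ : Set N₁} {S₂ : Set N₂} (hη : RawForm.IsSmoothOn I₂ η S₂)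
    (hcl : RawForm.IsClosedOn I₂ η S₂) (hS₁ : IsOpen S₁)
    (hS₂ : IsOpen S₂) (hG : ContMDiffOn I₁ I₂ ∞ G S₁) (hm : MapsTo G S₁ S₂) :
    RawForm.IsClosedOn I₁ (RawForm.pullback I₁ I₂ G η) S₁ := by
  intro x₁ y hy hyS
  set x₂ := G ((extChartAt I₁ x₁).symm y) with hx₂
  have hG2 : G ((extChartAt I₁ x₁).symm y) ∈ (extChartAt I₂ x₂).source := mem_extChartAt_source _
  have h1 := RawForm.inChart_pullback_eventuallyEq η hS₁ hG hy hyS hG2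
  have hc := contDiffAt_chart_comp hy (hG.contMDiffAt (hS₁.mem_nhds hyS)) hG2
  have hmem : (extChartAt I₂ x₂).symm (extChartAt I₂ x₂ (G ((extChartAt I₁ x₁).symm y))) ∈ S₂ := by
    rw [(extChartAt I₂ x₂).left_inv hG2]
    exact hm hyS
  have h2 : ContDiffAt ℝ ∞ (RawForm.inChart I₂ η x₂)
      ((fun y => extChartAt I₂ x₂ (G ((extChartAt I₁ x₁).symm y))) y) :=
    (hη x₂).contDiffAt ((RawForm.isOpen_chart_preimage hS₂ x₂).mem_nhds
      ⟨(extChartAt I₂ x₂).map_source hG2, hmem⟩)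
  rw [h1.extDeriv_eq]
  refine (extDeriv_pullback (f := fun y => extChartAt I₂ x₂ (G ((extChartAt I₁ x₁).symm y)))
    (x := y) (r := ∞) (h2.differentiableAt (by simp)) hc
    (by rw [minSmoothness_of_isRCLikeNormedField]; exact WithTop.coe_le_coe.2 le_top)).trans ?_
  rw [hcl x₂ _ ((extChartAt I₂ x₂).map_source hG2) hmem]
  ext v
  simp

end Pullback

/-! ### Two-forms `dt ∧ a + b` on a product with a line -/

section WedgeLine

variable {E : Type*} [NormedAddCommGroup E] [NormedSpace ℝ E]

/-- The two-form `dt ∧ a + b` on `E × ℝ`. -/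
noncomputable def wedgeLine (a : E [⋀^Fin 1]→L[ℝ] ℝ) (b : E [⋀^Fin 2]→L[ℝ] ℝ) :
    (E × ℝ) [⋀^Fin 2]→L[ℝ] ℝ :=
  ContinuousAlternatingMap.alternatizeUncurryFin ((ContinuousLinearMap.snd ℝ E ℝ).smulRight
    (a.compContinuousLinearMap (ContinuousLinearMap.fst ℝ E ℝ))) +
  b.compContinuousLinearMap (ContinuousLinearMap.fst ℝ E ℝ)

theorem wedgeLine_apply (a : E [⋀^Fin 1]→L[ℝ] ℝ) (b : E [⋀^Fin 2]→L[ℝ] ℝ) (v w : E × ℝ) :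
    wedgeLine a b ![v, w] = v.2 * a ![w.1] - w.2 * a ![v.1] + b ![v.1, w.1] := by
  have h0 : Fin.removeNth 0 ![v, w] = ![w] := by
    funext i; fin_cases i; rfl
  have h1 : Fin.removeNth 1 ![v, w] = ![v] := by
    funext i; fin_cases i; rfl
  have h2 : ∀ v : E × ℝ, (ContinuousLinearMap.fst ℝ E ℝ) ∘ ![v] = ![v.1] := by
    intro v; funext i; fin_cases i; rfl
  have h3 : (ContinuousLinearMap.fst ℝ E ℝ) ∘ ![v, w] = ![v.1, w.1] := by
    funext i; fin_cases i <;> rfl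
  rw [wedgeLine, ContinuousAlternatingMap.add_apply,
    ContinuousAlternatingMap.alternatizeUncurryFin_apply, Fin.sum_univ_two, h0, h1,
    ContinuousAlternatingMap.compContinuousLinearMap_apply, h3]
  change (-1 : ℤ) ^ 0 • (v.2 * a ((ContinuousLinearMap.fst ℝ E ℝ) ∘ ![w])) +
    (-1 : ℤ) ^ 1 • (w.2 * a ((ContinuousLinearMap.fst ℝ E ℝ) ∘ ![v])) + _ = _
  rw [h2, h2]
  simp
  ring

/-- Coordinate changes of N leave dt alone; this reduces charts of N × ℝ to charts of N. -/
theorem wedgeLine_compContinuousLinearMap {E' : Type*} [NormedAddCommGroup E'] [NormedSpace ℝ E']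
    (a : E [⋀^Fin 1]→L[ℝ] ℝ) (b : E [⋀^Fin 2]→L[ℝ] ℝ) (L : E' →L[ℝ] E) :
    (wedgeLine a b).compContinuousLinearMap (L.prodMap (ContinuousLinearMap.id ℝ ℝ)) =
      wedgeLine (a.compContinuousLinearMap L) (b.compContinuousLinearMap L) := by
  refine alternating_two_ext fun v w => ?_
  have h1 : ((L.prodMap (ContinuousLinearMap.id ℝ ℝ)) ∘ ![v, w]) =
      ![(L v.1, v.2), (L w.1, w.2)] := by
    funext i; fin_cases i <;> rfl
  have h2 : ∀ v : E', L ∘ ![v] = ![L v] := by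
    intro v; funext i; fin_cases i; rfl
  have h3 : ∀ v w : E', L ∘ ![v, w] = ![L v, L w] := by
    intro v w; funext i; fin_cases i <;> rfl
  rw [ContinuousAlternatingMap.compContinuousLinearMap_apply, h1, wedgeLine_apply, wedgeLine_apply]
  simp [h2, h3]

variable {X : Type*} [NormedAddCommGroup X] [NormedSpace ℝ X]

theorem ContDiffOn.apply_one {a : X → E [⋀^Fin 1]→L[ℝ] ℝ} {S : Set X} (ha : ContDiffOn ℝ ∞ a S)
    (v : E) : ContDiffOn ℝ ∞ (fun p => a p ![v]) S := fun p hp =>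
  (ha p hp).alternating_apply (v := fun i _ => ![v] i) fun _ => contDiffWithinAt_const

theorem ContDiffOn.apply_two {a : X → E [⋀^Fin 2]→L[ℝ] ℝ} {S : Set X} (ha : ContDiffOn ℝ ∞ a S)
    (v w : E) : ContDiffOn ℝ ∞ (fun p => a p ![v, w]) S := fun p hp =>
  (ha p hp).alternating_apply (v := fun i _ => ![v, w] i) fun _ => contDiffWithinAt_const

theorem ContDiffOn.wedgeLine [FiniteDimensional ℝ E] {a : X → E [⋀^Fin 1]→L[ℝ] ℝ}
    {b : X → E [⋀^Fin 2]→L[ℝ] ℝ} {S : Set X}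
    (ha : ContDiffOn ℝ ∞ a S) (hb : ContDiffOn ℝ ∞ b S) :
    ContDiffOn ℝ ∞ (fun p => wedgeLine (a p) (b p)) S := by
  intro p hp
  refine contDiffWithinAt_alternating fun v => ?_
  have hv : v = ![v 0, v 1] := by funext i; fin_cases i <;> rfl
  rw [hv]
  simp only [wedgeLine_apply]
  exact (((contDiffOn_const.mul (ha.apply_one _)).sub
    (contDiffOn_const.mul (ha.apply_one _))).add (hb.apply_two _ _)) p hp

/-- The exterior derivative of `dt ∧ a + b`. -/
theorem extDeriv_wedgeLine_apply [FiniteDimensional ℝ E] {a : E × ℝ → E [⋀^Fin 1]→L[ℝ] ℝ}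
    {b : E × ℝ → E [⋀^Fin 2]→L[ℝ] ℝ} {S : Set (E × ℝ)} (hS : IsOpen S)
    (ha : ContDiffOn ℝ ∞ a S) (hb : ContDiffOn ℝ ∞ b S) {y : E} {t : ℝ} (hyt : (y, t) ∈ S)
    (u v w : E × ℝ) :
    extDeriv (fun p => wedgeLine (a p) (b p)) (y, t) ![u, v, w] =
      extDeriv (fun y => b (y, t)) y ![u.1, v.1, w.1] +
      u.2 * (deriv (fun t => b (y, t) ![v.1, w.1]) t -
        extDeriv (fun y => a (y, t)) y ![v.1, w.1]) -
      v.2 * (deriv (fun t => b (y, t) ![u.1, w.1]) t -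
        extDeriv (fun y => a (y, t)) y ![u.1, w.1]) +
      w.2 * (deriv (fun t => b (y, t) ![u.1, v.1]) t -
        extDeriv (fun y => a (y, t)) y ![u.1, v.1]) := by
  have hslice : ContDiff ℝ ∞ (fun y : E => (y, t)) := by fun_prop
  have hSy : IsOpen {y : E | (y, t) ∈ S} := hS.preimage (by fun_prop)
  have hdiff : ∀ {g : E × ℝ → ℝ},
      ContDiffOn ℝ ∞ g S → DifferentiableAt ℝ g (y, t) := fun hg =>
    (hg.contDiffAt (hS.mem_nhds hyt)).differentiableAt (by simp)
  have hdy : ∀ {k : ℕ} {g : E × ℝ → E [⋀^Fin k]→L[ℝ] ℝ},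
      ContDiffOn ℝ ∞ g S → DifferentiableAt ℝ (fun y => g (y, t)) y := fun {k g} hg =>
    DifferentiableAt.comp (g := g) y
      ((hg.contDiffAt (hS.mem_nhds hyt)).differentiableAt (by simp))
      ((hslice.differentiable (by simp)) y)
  have hf : ∀ {g : E × ℝ → ℝ}, ContDiffOn ℝ ∞ g S → ∀ z : E × ℝ, fderiv ℝ g (y, t) z =
      fderiv ℝ (fun y => g (y, t)) y z.1 + z.2 * deriv (fun t => g (y, t)) t := by
    intro g hg z
    have h1 := (hdiff hg).hasFDerivAt
    have h2 : HasFDerivAt (fun y : E => (y, t)) (ContinuousLinearMap.inl ℝ E ℝ) y :=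
      (hasFDerivAt_id y).prodMk (hasFDerivAt_const t y)
    have h3 : HasDerivAt (fun t : ℝ => (y, t)) ((0, 1) : E × ℝ) t :=
      (hasDerivAt_const _ _).prodMk (hasDerivAt_id _)
    have h4 := (h1.comp y h2).fderiv
    have h5 := (h1.comp_hasDerivAt t h3).deriv
    change fderiv ℝ (fun y => g (y, t)) y = _ at h4
    change deriv (fun t => g (y, t)) t = _ at h5
    rw [h4, h5]
    have hz : z = (z.1, 0) + z.2 • ((0, 1) : E × ℝ) := by ext <;> simp
    conv_lhs => rw [hz]
    rw [map_add, map_smul]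
    rfl
  rw [extDeriv_two_apply
    (((ha.wedgeLine hb).contDiffAt (hS.mem_nhds hyt)).differentiableAt (by simp)),
    extDeriv_two_apply (hdy hb), extDeriv_one_apply (hdy ha), extDeriv_one_apply (hdy ha),
    extDeriv_one_apply (hdy ha)]
  have hw : ∀ v w : E × ℝ, ContDiffOn ℝ ∞
      (fun p => v.2 * a p ![w.1] - w.2 * a p ![v.1] + b p ![v.1, w.1]) S := fun v w =>
    ((contDiffOn_const.mul (ha.apply_one _)).sub
      (contDiffOn_const.mul (ha.apply_one _))).add (hb.apply_two _ _)
  have key : ∀ v w z : E × ℝ, fderiv ℝ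
      (fun p => v.2 * a p ![w.1] - w.2 * a p ![v.1] + b p ![v.1, w.1]) (y, t) z =
      v.2 * (fderiv ℝ (fun y => a (y, t) ![w.1]) y z.1 + z.2 * deriv (fun t => a (y, t) ![w.1]) t) -
      w.2 * (fderiv ℝ (fun y => a (y, t) ![v.1]) y z.1 + z.2 * deriv (fun t => a (y, t) ![v.1]) t) +
      (fderiv ℝ (fun y => b (y, t) ![v.1, w.1]) y z.1 +
        z.2 * deriv (fun t => b (y, t) ![v.1, w.1]) t) := by
    intro v w z
    rw [← hf (ha.apply_one _), ← hf (ha.apply_one _), ← hf (hb.apply_two _ _)]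
    have h1 := (((hdiff (ha.apply_one w.1)).hasFDerivAt.const_mul v.2).sub
      ((hdiff (ha.apply_one v.1)).hasFDerivAt.const_mul w.2)).add
        (hdiff (hb.apply_two v.1 w.1)).hasFDerivAt
    exact congrArg (fun L : E × ℝ →L[ℝ] ℝ => L z) h1.fderiv
  simp only [wedgeLine_apply, key]
  ring

end WedgeLine

/-! ### Families of forms -/

section Families

variable {E : Type*} [NormedAddCommGroup E] [NormedSpace ℝ E]
  {H : Type*} [TopologicalSpace H] (I : ModelWithCorners ℝ E H)
  {N : Type*} [TopologicalSpace N] [ChartedSpace H N]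

/-- The derivative of the inverse of the chart at `x₀`. -/
noncomputable def chartDeriv (x₀ : N) (y : E) : E →L[ℝ] E :=
  mfderiv 𝓘(ℝ, E) I (extChartAt I x₀).symm y

variable {I} in
/-- The value of a form, as a form on the model space. -/
def RawForm.val {k : ℕ} (η : RawForm I N k) (x : N) : E [⋀^Fin k]→L[ℝ] ℝ := η x

theorem RawForm.inChart_eq {k : ℕ} (η : RawForm I N k) (x₀ : N) (y : E) :
    RawForm.inChart I η x₀ y =
      (η.val ((extChartAt I x₀).symm y)).compContinuousLinearMap (chartDeriv I x₀ y) := rfl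

theorem RawForm.inChart_one_apply (η : RawForm I N 1) (x₀ : N) (y v : E) :
    RawForm.inChart I η x₀ y ![v] =
      η.val ((extChartAt I x₀).symm y) ![chartDeriv I x₀ y v] := by
  rw [RawForm.inChart_eq, ContinuousAlternatingMap.compContinuousLinearMap_apply]
  congr 1
  funext i; fin_cases i; rfl

theorem RawForm.inChart_two_apply (η : RawForm I N 2) (x₀ : N) (y v w : E) :
    RawForm.inChart I η x₀ y ![v, w] =
      η.val ((extChartAt I x₀).symm y) ![chartDeriv I x₀ y v, chartDeriv I x₀ y w] := by
  rw [RawForm.inChart_eq, ContinuousAlternatingMap.compContinuousLinearMap_apply]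
  congr 1
  funext i; fin_cases i <;> rfl

/-- A family of forms on `N`, smooth for parameters in `J`. -/
def IsSmoothFamily {X : Type*} [NormedAddCommGroup X] [NormedSpace ℝ X] {k : ℕ} (J : Set X)
    (A : X → RawForm I N k) : Prop :=
  ∀ x₀ : N, ContDiffOn ℝ ∞ (fun p : E × X => RawForm.inChart I (A p.2) x₀ p.1)
    ((extChartAt I x₀).target ×ˢ J)

/-- The form `dt ∧ A_t + B_t` on `N × ℝ`. -/
noncomputable def familyForm (A : ℝ → RawForm I N 1) (B : ℝ → RawForm I N 2) :
    RawForm (I.prod 𝓘(ℝ, ℝ)) (N × ℝ) 2 := fun p =>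
  wedgeLine ((A p.2).val p.1) ((B p.2).val p.1)

variable {I}

theorem familyForm_apply (A : ℝ → RawForm I N 1) (B : ℝ → RawForm I N 2) (p : N × ℝ)
    (v w : E × ℝ) :
    (familyForm I A B).val p ![v, w] =
      v.2 * (A p.2).val p.1 ![w.1] - w.2 * (A p.2).val p.1 ![v.1] +
        (B p.2).val p.1 ![v.1, w.1] :=
  wedgeLine_apply _ _ _ _

theorem extChartAt_prod_line (x₀ : N × ℝ) : extChartAt (I.prod 𝓘(ℝ, ℝ)) x₀ =
    (extChartAt I x₀.1).prod (PartialEquiv.refl ℝ) := by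
  rw [extChartAt_prod, extChartAt_model_space_eq_id]

variable [I.Boundaryless] [IsManifold I ∞ N]

theorem chartDeriv_prod_line (x₀ : N × ℝ) {p : E × ℝ}
    (hp : p.1 ∈ (extChartAt I x₀.1).target) :
    chartDeriv (I.prod 𝓘(ℝ, ℝ)) x₀ p =
      (chartDeriv I x₀.1 p.1).prodMap (ContinuousLinearMap.id ℝ ℝ) := by
  rw [chartDeriv, extChartAt_prod_line]
  have h1 := (contMDiffAt_extChartAt_symm_of_mem (I := I) hp).mdifferentiableAt (by simp)
  have h2 := HasMFDerivAt.prodMap (p := p) h1.hasMFDerivAt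
    ((hasMFDerivAt_id (I := 𝓘(ℝ, ℝ)) p.2).mdifferentiableAt.hasMFDerivAt)
  rw [modelWithCornersSelf_prod, ← chartedSpaceSelf_prod]
  refine h2.mfderiv.trans ?_
  exact congrArg (fun L : ℝ →L[ℝ] ℝ => (chartDeriv I x₀.1 p.1).prodMap L) (mfderiv_id)

theorem inChart_familyForm (A : ℝ → RawForm I N 1) (B : ℝ → RawForm I N 2) (x₀ : N × ℝ) {p : E × ℝ}
    (hp : p.1 ∈ (extChartAt I x₀.1).target) :
    RawForm.inChart (I.prod 𝓘(ℝ, ℝ)) (familyForm I A B) x₀ p =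
      wedgeLine (RawForm.inChart I (A p.2) x₀.1 p.1) (RawForm.inChart I (B p.2) x₀.1 p.1) := by
  rw [RawForm.inChart_eq, chartDeriv_prod_line x₀ hp, extChartAt_prod_line]
  exact wedgeLine_compContinuousLinearMap _ _ _

theorem isOpen_target_prod (x₀ : N) {J : Set ℝ} (hJ : IsOpen J) :
    IsOpen ((extChartAt I x₀).target ×ˢ J) :=
  (isOpen_extChartAt_target x₀).prod hJ

theorem IsSmoothFamily.familyForm [FiniteDimensional ℝ E] {J : Set ℝ} {A : ℝ → RawForm I N 1}
    {B : ℝ → RawForm I N 2} (hA : IsSmoothFamily I J A) (hB : IsSmoothFamily I J B) :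
    RawForm.IsSmoothOn (I.prod 𝓘(ℝ, ℝ)) (familyForm I A B) (univ ×ˢ J) := by
  intro x₀
  refine (((hA x₀.1).wedgeLine (hB x₀.1)).mono ?_).congr ?_
  · rw [extChartAt_prod_line]
    rintro p ⟨hp, hp'⟩
    exact ⟨hp.1, hp'.2⟩
  · rintro p ⟨hp, -⟩
    rw [extChartAt_prod_line] at hp
    exact inChart_familyForm A B x₀ hp.1

/-- `dt ∧ A_t + B_t` is closed if and only if `d B_t = 0` and `∂_t B_t = d A_t`. -/
theorem isClosedOn_familyForm_iff [FiniteDimensional ℝ E] {J : Set ℝ} (hJ : IsOpen J)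
    {A : ℝ → RawForm I N 1}
    {B : ℝ → RawForm I N 2} (hA : IsSmoothFamily I J A) (hB : IsSmoothFamily I J B) :
    RawForm.IsClosedOn (I.prod 𝓘(ℝ, ℝ)) (familyForm I A B) (univ ×ˢ J) ↔
      ∀ x₀ : N, ∀ y ∈ (extChartAt I x₀).target, ∀ t ∈ J,
        extDeriv (RawForm.inChart I (B t) x₀) y = 0 ∧
        ∀ u v : E, deriv (fun t => RawForm.inChart I (B t) x₀ y ![u, v]) t =
          extDeriv (RawForm.inChart I (A t) x₀) y ![u, v] := by
  have key : ∀ (x₀ : N × ℝ) (y : E) (_ : y ∈ (extChartAt I x₀.1).target) (t : ℝ) (_ : t ∈ J)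
      (u v w : E × ℝ),
      extDeriv (RawForm.inChart (I.prod 𝓘(ℝ, ℝ)) (familyForm I A B) x₀) (y, t) ![u, v, w] = _ :=
    fun x₀ y hy t ht u v w => by
      have h1 : RawForm.inChart (I.prod 𝓘(ℝ, ℝ)) (familyForm I A B) x₀ =ᶠ[𝓝 (y, t)] fun p =>
        wedgeLine (RawForm.inChart I (A p.2) x₀.1 p.1) (RawForm.inChart I (B p.2) x₀.1 p.1) := by
        filter_upwards [(isOpen_target_prod x₀.1 hJ).mem_nhds ⟨hy, ht⟩] with p hp using
          inChart_familyForm A B x₀ hp.1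
      exact (congrArg (fun L : (E × ℝ) [⋀^Fin 3]→L[ℝ] ℝ => L ![u, v, w])
        h1.extDeriv_eq).trans (extDeriv_wedgeLine_apply (isOpen_target_prod x₀.1 hJ)
        (hA x₀.1) (hB x₀.1) ⟨hy, ht⟩ u v w)
  constructor
  · intro h x₀ y hy t ht
    have h0 : extDeriv (RawForm.inChart (I.prod 𝓘(ℝ, ℝ)) (familyForm I A B) (x₀, t)) (y, t) = 0 := by
      refine h (x₀, t) (y, t) ?_ ?_ <;> rw [extChartAt_prod_line]
      · exact ⟨hy, mem_univ _⟩
      · exact ⟨mem_univ _, ht⟩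
    refine ⟨alternating_three_ext fun u v w => ?_, fun u v => ?_⟩
    -- Three vectors tangent to N isolate dB_t; two of them together with ∂_t isolate ∂_t B_t -
    -- dA_t.
    · have := key (x₀, t) y hy t ht (u, 0) (v, 0) (w, 0)
      rw [h0] at this
      simpa using this.symm
    · have := key (x₀, t) y hy t ht (u, 0) (v, 0) (0, 1)
      rw [h0] at this
      have h1 : ∀ u : E, extDeriv (fun y => RawForm.inChart I (B t) x₀ y) y ![u, v, 0] = 0 := fun u =>
        ContinuousAlternatingMap.map_coord_zero _ 2 rfl
      simp only [zero_mul, sub_zero, add_zero, one_mul, h1, zero_add] at this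
      exact sub_eq_zero.1 this.symm
  · intro h x₀ p hp hpJ
    rw [extChartAt_prod_line] at hp hpJ
    obtain ⟨y, t⟩ := p
    obtain ⟨h1, h2⟩ := h x₀.1 y hp.1 t hpJ.2
    refine alternating_three_ext fun u v w => ?_
    refine (key x₀ y hp.1 t hpJ.2 u v w).trans ?_
    simp only [h2, sub_self, mul_zero, sub_zero, add_zero]
    exact congrArg (fun L : E [⋀^Fin 3]→L[ℝ] ℝ => L ![u.1, v.1, w.1]) h1

/-- A closed form on `N × ℝ` which is annihilated by `∂_r` does not depend on `r`. -/
theorem RawForm.IsClosedOn.eq_of_contract_eq_zero {η : RawForm (I.prod 𝓘(ℝ, ℝ)) (N × ℝ) 2}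
    {S : Set (N × ℝ)} (hS : IsOpen S) (hη : RawForm.IsSmoothOn (I.prod 𝓘(ℝ, ℝ)) η S)
    (hcl : RawForm.IsClosedOn (I.prod 𝓘(ℝ, ℝ)) η S)
    (h0 : ∀ p ∈ S, ∀ v : E × ℝ, η.val p ![v, ((0 : E), (1 : ℝ))] = 0)
    {x : N} {c : ℝ} (hx : ∀ r ∈ Icc 0 c, (x, r) ∈ S) (hc : 0 ≤ c) (u w : E) :
    η.val (x, c) ![((u, 0) : E × ℝ), ((w, 0) : E × ℝ)] =
      η.val (x, 0) ![((u, 0) : E × ℝ), ((w, 0) : E × ℝ)] := by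
  obtain ⟨y, hy⟩ : ∃ y, y = extChartAt I x x := ⟨_, rfl⟩
  have hyt : y ∈ (extChartAt I x).target := by rw [hy]; exact mem_extChartAt_target x
  have hsy : (extChartAt I x).symm y = x := by rw [hy]; exact extChartAt_to_inv x
  have hDu : ∀ u : E, ∃ u' : E, chartDeriv I x y u' = u := by
    intro u
    have h := mfderiv_symm_mfderiv_extChartAt (I := I) hyt
    rw [hsy] at h
    exact ⟨_, h u⟩
  obtain ⟨u, rfl⟩ := hDu u
  obtain ⟨w, rfl⟩ := hDu w
  set F := RawForm.inChart (I.prod 𝓘(ℝ, ℝ)) η (x, (0 : ℝ)) with hF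
  have hFa : ∀ p : E × ℝ, p.1 ∈ (extChartAt I x).target → ∀ v w : E × ℝ,
      F p ![v, w] = η.val ((extChartAt I x).symm p.1, p.2)
        ![(chartDeriv I x p.1 v.1, v.2), (chartDeriv I x p.1 w.1, w.2)] := by
    intro p hp v w
    rw [hF, RawForm.inChart_two_apply, chartDeriv_prod_line _ hp, extChartAt_prod_line]
    rfl
  have hO := RawForm.isOpen_chart_preimage (I₁ := I.prod 𝓘(ℝ, ℝ)) hS (x, (0 : ℝ))
  have hFs : ∀ r ∈ Icc 0 c, DifferentiableAt ℝ F (y, r) ∧ HasDerivAt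
      (fun r => F (y, r) ![((u, 0) : E × ℝ), ((w, 0) : E × ℝ)]) 0 r := by
    intro r hr
    have hm : ((y, r) : E × ℝ) ∈ (extChartAt (I.prod 𝓘(ℝ, ℝ)) (x, (0 : ℝ))).target ∩
        (extChartAt (I.prod 𝓘(ℝ, ℝ)) (x, (0 : ℝ))).symm ⁻¹' S := by
      rw [extChartAt_prod_line]
      refine ⟨⟨hyt, mem_univ _⟩, ?_⟩
      change ((extChartAt I x).symm y, r) ∈ S
      rw [hsy]
      exact hx r hr
    have hca := (hη (x, (0 : ℝ))).contDiffAt (hO.mem_nhds hm)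
    have hd : DifferentiableAt ℝ F (y, r) := hca.differentiableAt (by simp)
    refine ⟨hd, ?_⟩
    -- In dη(u, w, ∂_r) = 0 the two terms that differentiate η(·, ∂_r) vanish, so only the
    -- derivative of η(u, w) in r is left.
    have hz : ∀ v : E × ℝ, fderiv ℝ (fun p => F p ![v, ((0 : E), (1 : ℝ))]) (y, r) = 0 := by
      intro v
      have : (fun p => F p ![v, ((0 : E), (1 : ℝ))]) =ᶠ[𝓝 (y, r)] fun _ => 0 := by
        filter_upwards [hO.mem_nhds hm] with p hp
        rw [extChartAt_prod_line] at hp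
        rw [hFa p hp.1.1, map_zero]
        exact h0 _ hp.2 _
      rw [this.fderiv_eq]
      simp
    have he := extDeriv_two_apply hd ((u, 0) : E × ℝ) ((w, 0) : E × ℝ) ((0 : E), (1 : ℝ))
    rw [hcl (x, (0 : ℝ)) (y, r) hm.1 hm.2, hz, hz] at he
    have he' : fderiv ℝ (fun p => F p ![((u, 0) : E × ℝ), ((w, 0) : E × ℝ)]) (y, r)
        ((0 : E), (1 : ℝ)) = 0 := by simpa using he.symm
    have hd2 : DifferentiableAt ℝ (fun p => F p ![((u, 0) : E × ℝ), ((w, 0) : E × ℝ)]) (y, r) :=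
      (ContDiffWithinAt.alternating_apply (s := univ) (v := fun i _ => ![((u, 0) : E × ℝ), ((w, 0) : E × ℝ)] i) hca.contDiffWithinAt
        fun _ => contDiffWithinAt_const).contDiffAt univ_mem |>.differentiableAt (by simp)
    have h3 : HasDerivAt (fun t : ℝ => (y, t)) ((0, 1) : E × ℝ) r :=
      (hasDerivAt_const _ _).prodMk (hasDerivAt_id _)
    have h4 := hd2.hasFDerivAt.comp_hasDerivAt r h3
    rwa [he'] at h4
  have heq : F (y, c) ![((u, 0) : E × ℝ), ((w, 0) : E × ℝ)] =
      F (y, 0) ![((u, 0) : E × ℝ), ((w, 0) : E × ℝ)] := by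
    refine (constant_of_has_deriv_right_zero
      (f := fun r => F (y, r) ![((u, 0) : E × ℝ), ((w, 0) : E × ℝ)])
      (fun r hr => (hFs r hr).2.continuousAt.continuousWithinAt)
      (fun r hr => (hFs r ⟨hr.1, hr.2.le⟩).2.hasDerivWithinAt)) c ⟨hc, le_rfl⟩
  rw [hFa _ hyt, hFa _ hyt] at heq
  simpa only [hsy] using heq

end Families

/-! ### Iterated division by `t` -/

section Taylor

theorem contDiffOn_divX_line {W : Type} [NormedAddCommGroup W] [NormedSpace ℝ W] {g : ℝ → W} {ε : ℝ}
    (hg : ContDiffOn ℝ ∞ g (Ioo (-ε) ε)) : ContDiffOn ℝ ∞ (divX g) (Ioo (-ε) ε) := by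
  have h1 : ContDiffOn ℝ ∞ (fun p : ℝ × ℝ => g p.2) (univ ×ˢ Ioo (-ε) ε) :=
    hg.comp contDiff_snd.contDiffOn fun p hp => hp.2
  have h2 := contDiffOn_divX isOpen_univ h1
  exact h2.comp (f := fun t : ℝ => ((0 : ℝ), t)) (contDiff_prodMk_right _).contDiffOn
    fun t ht => ⟨mem_univ _, ht⟩

theorem contDiffOn_iterate_divX {g : ℝ → ℝ} {ε : ℝ}
    (hg : ContDiffOn ℝ ∞ g (Ioo (-ε) ε)) (n : ℕ) :
    ContDiffOn ℝ ∞ (divX^[n] g) (Ioo (-ε) ε) := by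
  induction n with
  | zero => exact hg
  | succ n ih =>
    rw [Function.iterate_succ_apply']
    exact contDiffOn_divX_line ih

/-- Identities proved for t ≠ 0, where the singular form lives, are carried to the hypersurface t =
0 by continuity. -/
theorem eq_zero_of_tendsto_of_forall_ne {f g : ℝ → ℝ} {ε : ℝ} (hε : 0 < ε)
    (hf : ContinuousOn f (Ioo (-ε) ε)) (hg : ContinuousOn g (Ioo (-ε) ε))
    (h : ∀ t ∈ Ioo (-ε) ε, t ≠ 0 → f t = g t) : f 0 = g 0 := by
  have h0 : (0 : ℝ) ∈ Ioo (-ε) ε := ⟨by linarith, hε⟩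
  have h1 := ((hf.continuousAt (isOpen_Ioo.mem_nhds h0)).tendsto).mono_left
    (nhdsWithin_le_nhds (s := {0}ᶜ))
  have h2 := ((hg.continuousAt (isOpen_Ioo.mem_nhds h0)).tendsto).mono_left
    (nhdsWithin_le_nhds (s := {0}ᶜ))
  refine tendsto_nhds_unique h1 (h2.congr' ?_)
  filter_upwards [self_mem_nhdsWithin, mem_nhdsWithin_of_mem_nhds (isOpen_Ioo.mem_nhds h0)]
    with t ht ht' using (h t ht' ht).symm

/-- A smooth function which is `O(t^n)` is divisible by `t^n`. -/
theorem eq_pow_mul_iterate_divX {n : ℕ} {g : ℝ → ℝ} {ε C : ℝ} (hε : 0 < ε)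
    (hg : ContDiffOn ℝ ∞ g (Ioo (-ε) ε))
    (hb : ∀ t ∈ Ioo (-ε) ε, t ≠ 0 → |g t| ≤ C * |t| ^ n) {t : ℝ} (ht : t ∈ Ioo (-ε) ε) :
    g t = t ^ n * divX^[n] g t := by
  induction n generalizing g with
  | zero => simp
  | succ n ih =>
    have h00 : (0 : ℝ) ∈ Ioo (-ε) ε := ⟨by linarith, hε⟩
    -- The bound forces g 0 = 0, and dividing g by t lowers the order in the bound by one.
    have h0 : g 0 = 0 := by
      have h1 := ((hg.continuousOn.continuousAt (isOpen_Ioo.mem_nhds h00)).tendsto).mono_left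
        (nhdsWithin_le_nhds (s := {0}ᶜ))
      have h2 : Tendsto (fun t : ℝ => C * |t| ^ (n + 1)) (𝓝[≠] 0) (𝓝 0) := by
        have : Continuous (fun t : ℝ => C * |t| ^ (n + 1)) := by fun_prop
        have := (this.tendsto 0).mono_left (nhdsWithin_le_nhds (s := {0}ᶜ))
        simpa using this
      refine tendsto_nhds_unique h1 (squeeze_zero_norm' ?_ h2)
      filter_upwards [self_mem_nhdsWithin, mem_nhdsWithin_of_mem_nhds (isOpen_Ioo.mem_nhds h00)]
        with t ht ht' using hb t ht' ht
    have hd : ∀ t ∈ Ioo (-ε) ε, g t = t * divX g t := fun t ht => by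
      have := eq_add_smul_divX hg ht
      rwa [h0, zero_add] at this
    rw [hd t ht, ih (contDiffOn_divX_line hg) ?_, Function.iterate_succ_apply]
    · ring
    · intro t ht ht0
      have h3 := hb t ht ht0
      rw [hd t ht, abs_mul, pow_succ] at h3
      refine le_of_mul_le_mul_left (a := |t|) ?_ (abs_pos.2 ht0)
      linarith

/-- `t^n sgn t` is not smooth at `0`. -/
theorem eq_zero_of_contDiffOn_sign_pow {n : ℕ} {g : ℝ → ℝ} {ε D : ℝ} (hε : 0 < ε)
    (hg : ContDiffOn ℝ ∞ g (Ioo (-ε) ε)) (hp : ∀ t ∈ Ioo 0 ε, g t = D * t ^ n)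
    (hn : ∀ t ∈ Ioo (-ε) 0, g t = -D * t ^ n) : D = 0 := by
  have h00 : (0 : ℝ) ∈ Ioo (-ε) ε := ⟨by linarith, hε⟩
  have hb : ∀ t ∈ Ioo (-ε) ε, t ≠ 0 → |g t| ≤ |D| * |t| ^ n := by
    intro t ht ht0
    rcases lt_or_gt_of_ne ht0 with h | h
    · rw [hn t ⟨ht.1, h⟩, abs_mul, abs_neg, abs_pow]
    · rw [hp t ⟨h, ht.2⟩, abs_mul, abs_pow]
  have key : ∀ t ∈ Ioo (-ε) ε, g t = t ^ n * divX^[n] g t := fun t ht =>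
    eq_pow_mul_iterate_divX hε hg hb ht
  have hc := (contDiffOn_iterate_divX hg n).continuousOn.continuousAt (isOpen_Ioo.mem_nhds h00)
  -- The n-th quotient of g is continuous at 0 and tends to D from the right and to -D from the
  -- left.
  have h1 : divX^[n] g 0 = D := by
    refine tendsto_nhds_unique (hc.tendsto.mono_left (nhdsWithin_le_nhds (s := Ioi 0)))
      (tendsto_const_nhds.congr' ?_)
    filter_upwards [self_mem_nhdsWithin, mem_nhdsWithin_of_mem_nhds (isOpen_Ioo.mem_nhds h00)]
      with t ht ht'
    have h := key t ht'
    rw [hp t ⟨ht, ht'.2⟩, mul_comm] at h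
    exact mul_left_cancel₀ (pow_ne_zero n (ne_of_gt ht)) h
  have h2 : divX^[n] g 0 = -D := by
    refine tendsto_nhds_unique (hc.tendsto.mono_left (nhdsWithin_le_nhds (s := Iio 0)))
      (tendsto_const_nhds.congr' ?_)
    filter_upwards [self_mem_nhdsWithin, mem_nhdsWithin_of_mem_nhds (isOpen_Ioo.mem_nhds h00)]
      with t ht ht'
    have h := key t ht'
    rw [hn t ⟨ht'.1, ht⟩, mul_comm] at h
    exact mul_left_cancel₀ (pow_ne_zero n (ne_of_lt ht)) h
  linarith

end Taylor

/-! ### Laurent expansion of a family of closed forms -/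

section Laurent

universe u

variable {E : Type u} [NormedAddCommGroup E] [NormedSpace ℝ E]
  {H : Type*} [TopologicalSpace H] {I : ModelWithCorners ℝ E H}
  {N : Type*} [TopologicalSpace N] [ChartedSpace H N]

/-- The family `(A_t - A_0) / t`. -/
noncomputable def familyDivX {k : ℕ} (A : ℝ → RawForm I N k) : ℝ → RawForm I N k := fun t x =>
  divX (W := E [⋀^Fin k]→L[ℝ] ℝ) (fun s => (A s).val x) t

theorem inChart_add {k : ℕ} (η η' : RawForm I N k) (x₀ : N) (y : E) :
    RawForm.inChart I (η + η') x₀ y = RawForm.inChart I η x₀ y + RawForm.inChart I η' x₀ y := rfl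

theorem val_add {k : ℕ} (η η' : RawForm I N k) (x : N) : (η + η').val x = η.val x + η'.val x := rfl

variable [FiniteDimensional ℝ E] [I.Boundaryless] [IsManifold I ∞ N]

/-- The chart centred at x expresses the value at x up to an invertible linear map that does not
depend on t. -/
theorem IsSmoothFamily.contDiffOn_val {k : ℕ} {J : Set ℝ} {A : ℝ → RawForm I N k}
    (hA : IsSmoothFamily I J A) (x : N) : ContDiffOn ℝ ∞ (fun t => (A t).val x) J := by
  obtain ⟨y, hy⟩ : ∃ y, y = extChartAt I x x := ⟨_, rfl⟩
  have hyt : y ∈ (extChartAt I x).target := by rw [hy]; exact mem_extChartAt_target x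
  have hsy : (extChartAt I x).symm y = x := by rw [hy]; exact extChartAt_to_inv x
  have h1 : ContDiffOn ℝ ∞ (fun t => RawForm.inChart I (A t) x y) J :=
    (hA x).comp (f := fun t : ℝ => (y, t)) (contDiff_prodMk_right y).contDiffOn
      fun t ht => ⟨hyt, ht⟩
  have h2 : ∃ D : E →L[ℝ] E, ∀ v, chartDeriv I x y (D v) = v :=
    ⟨_, fun v => mfderiv_symm_mfderiv_extChartAt (I := I) hyt v⟩
  obtain ⟨D, hD⟩ := h2
  intro t ht
  refine contDiffWithinAt_alternating fun v => ?_
  have h3 := (h1 t ht).alternating_apply (v := fun i _ => D (v i)) fun _ => contDiffWithinAt_const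
  refine h3.congr_of_mem (fun t _ => ?_) ht
  rw [RawForm.inChart_eq, hsy, ContinuousAlternatingMap.compContinuousLinearMap_apply]
  congr 1
  funext i
  exact (hD (v i)).symm

theorem IsSmoothFamily.contDiffOn_inChart {k : ℕ} {J : Set ℝ} {A : ℝ → RawForm I N k}
    (hA : IsSmoothFamily I J A) {x₀ : N} {y : E} (hy : y ∈ (extChartAt I x₀).target) :
    ContDiffOn ℝ ∞ (fun t => RawForm.inChart I (A t) x₀ y) J :=
  (hA x₀).comp (f := fun t : ℝ => (y, t)) (contDiff_prodMk_right y).contDiffOn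
    fun t ht => ⟨hy, ht⟩

theorem inChart_familyDivX {k : ℕ} {ε : ℝ} {A : ℝ → RawForm I N k}
    (hA : IsSmoothFamily I (Ioo (-ε) ε) A) (x₀ : N) (y : E) {t : ℝ} (ht : t ∈ Ioo (-ε) ε) :
    RawForm.inChart I (familyDivX A t) x₀ y = divX (fun s => RawForm.inChart I (A s) x₀ y) t :=
  map_divX (ContinuousAlternatingMap.compContinuousLinearMapCLM (chartDeriv I x₀ y))
    (hA.contDiffOn_val _) ht

theorem IsSmoothFamily.familyDivX {k : ℕ} {ε : ℝ} {A : ℝ → RawForm I N k}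
    (hA : IsSmoothFamily I (Ioo (-ε) ε) A) : IsSmoothFamily I (Ioo (-ε) ε) (familyDivX A) :=
  fun x₀ => (contDiffOn_divX (isOpen_extChartAt_target x₀) (hA x₀)).congr fun p hp =>
    inChart_familyDivX hA x₀ p.1 hp.2

theorem eq_add_smul_familyDivX {k : ℕ} {ε : ℝ} {A : ℝ → RawForm I N k}
    (hA : IsSmoothFamily I (Ioo (-ε) ε) A) {t : ℝ} (ht : t ∈ Ioo (-ε) ε) :
    A t = A 0 + t • familyDivX A t := by
  funext x
  exact eq_add_smul_divX (hA.contDiffOn_val x) ht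

theorem isInvariantOn_familyDivX {G : Type*} [SMul G N] {k : ℕ} {ε : ℝ} {A : ℝ → RawForm I N k}
    (hA : IsSmoothFamily I (Ioo (-ε) ε) A)
    (hinv : ∀ t ∈ Ioo (-ε) ε, RawForm.IsInvariantOn I G (A t) univ) :
    ∀ t ∈ Ioo (-ε) ε, RawForm.IsInvariantOn I G (familyDivX A t) univ := by
  intro t ht g x _
  let D : E →L[ℝ] E := mfderiv I I (fun y : N => g • y) x
  refine (map_divX (ContinuousAlternatingMap.compContinuousLinearMapCLM D)
    (hA.contDiffOn_val (g • x)) ht).trans ?_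
  exact divX_congr (W := E [⋀^Fin k]→L[ℝ] ℝ) (fun s hs => hinv s hs g x (mem_univ _)) ht

theorem IsSmoothFamily.iterate_familyDivX {k : ℕ} {ε : ℝ} {A : ℝ → RawForm I N k}
    (hA : IsSmoothFamily I (Ioo (-ε) ε) A) (n : ℕ) :
    IsSmoothFamily I (Ioo (-ε) ε) (_root_.familyDivX^[n] A) := by
  induction n with
  | zero => exact hA
  | succ n ih =>
    rw [Function.iterate_succ_apply']
    exact ih.familyDivX

theorem isInvariantOn_iterate_familyDivX {G : Type*} [SMul G N] {k : ℕ} {ε : ℝ}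
    {A : ℝ → RawForm I N k} (hA : IsSmoothFamily I (Ioo (-ε) ε) A)
    (hinv : ∀ t ∈ Ioo (-ε) ε, RawForm.IsInvariantOn I G (A t) univ) (n : ℕ) :
    ∀ t ∈ Ioo (-ε) ε, RawForm.IsInvariantOn I G (familyDivX^[n] A t) univ := by
  induction n with
  | zero => exact hinv
  | succ n ih =>
    rw [Function.iterate_succ_apply']
    exact isInvariantOn_familyDivX (hA.iterate_familyDivX n) ih

/-- Taylor's formula with smooth remainder, by iterating Hadamard's quotient. -/
theorem eq_sum_iterate_familyDivX {k : ℕ} {ε : ℝ} {A : ℝ → RawForm I N k}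
    (hA : IsSmoothFamily I (Ioo (-ε) ε) A) (n : ℕ) {t : ℝ} (ht : t ∈ Ioo (-ε) ε) :
    A t = ∑ i ∈ Finset.range n, t ^ i • familyDivX^[i] A 0 + t ^ n • familyDivX^[n] A t := by
  induction n with
  | zero => simp
  | succ n ih =>
    rw [ih, Finset.sum_range_succ, add_assoc]
    congr 1
    rw [eq_add_smul_familyDivX (hA.iterate_familyDivX n) ht, smul_add, smul_smul, ← pow_succ,
      ← Function.iterate_succ_apply' familyDivX]

theorem IsSmoothFamily.isSmooth {k : ℕ} {J : Set ℝ} {A : ℝ → RawForm I N k}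
    (hA : IsSmoothFamily I J A) {t : ℝ} (ht : t ∈ J) : RawForm.IsSmooth I (A t) := fun x₀ =>
  (hA x₀).comp (f := fun y : E => (y, t)) (contDiff_prodMk_left t).contDiffOn
    fun y hy => ⟨hy, ht⟩

theorem IsSmoothFamily.continuousOn_deriv {J : Set ℝ} (hJ : IsOpen J) {B : ℝ → RawForm I N 2}
    (hB : IsSmoothFamily I J B) {x₀ : N} {y : E} (hy : y ∈ (extChartAt I x₀).target) (u v : E) :
    ContinuousOn (deriv (fun t => RawForm.inChart I (B t) x₀ y ![u, v])) J :=
  ((hB.contDiffOn_inChart hy).apply_two u v).continuousOn_deriv_of_isOpen hJ (by simp)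

theorem IsSmoothFamily.continuousOn_extDeriv {J : Set ℝ} (hJ : IsOpen J) {A : ℝ → RawForm I N 1}
    (hA : IsSmoothFamily I J A) {x₀ : N} {y : E} (hy : y ∈ (extChartAt I x₀).target) (u v : E) :
    ContinuousOn (fun t => extDeriv (RawForm.inChart I (A t) x₀) y ![u, v]) J := by
  have h1 : ∀ u v : E, ContinuousOn
      (fun t => fderiv ℝ (fun y => RawForm.inChart I (A t) x₀ y ![v]) y u) J := by
    intro u v
    have h2 := (hA x₀).apply_one v
    have hO := isOpen_target_prod (I := I) x₀ hJ
    have h3 : ContinuousOn (fun t => fderiv ℝ (fun p : E × ℝ =>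
        RawForm.inChart I (A p.2) x₀ p.1 ![v]) (y, t) (u, 0)) J :=
      (((h2.fderiv_of_isOpen hO (m := ∞) (by simp)).clm_apply contDiffOn_const).continuousOn).comp
        (f := fun t : ℝ => (y, t)) (by fun_prop) fun t ht => ⟨hy, ht⟩
    refine h3.congr fun t ht => ?_
    have h4 : HasFDerivAt (fun y : E => (y, t)) (ContinuousLinearMap.inl ℝ E ℝ) y :=
      (hasFDerivAt_id y).prodMk (hasFDerivAt_const t y)
    have h5 := ((h2.contDiffAt (hO.mem_nhds (x := (y, t)) ⟨hy, ht⟩)).differentiableAt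
      (by simp)).hasFDerivAt.comp y h4
    exact congrArg (fun L : E →L[ℝ] ℝ => L u) h5.fderiv
  refine ((h1 u v).sub (h1 v u)).congr fun t ht => ?_
  exact extDeriv_one_apply (((hA.isSmooth ht x₀).contDiffAt
    ((isOpen_extChartAt_target x₀).mem_nhds hy)).differentiableAt (by simp)) u v

theorem extDeriv_inChart_add_smul {A₀ A₁ : RawForm I N 1} (h₀ : RawForm.IsSmooth I A₀)
    (h₁ : RawForm.IsSmooth I A₁) (c : ℝ) {x₀ : N} {y : E} (hy : y ∈ (extChartAt I x₀).target) :
    extDeriv (RawForm.inChart I (A₀ + c • A₁) x₀) y =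
      extDeriv (RawForm.inChart I A₀ x₀) y + c • extDeriv (RawForm.inChart I A₁ x₀) y := by
  have hd : ∀ {A : RawForm I N 1}, RawForm.IsSmooth I A →
      DifferentiableAt ℝ (RawForm.inChart I A x₀) y := fun h =>
    ((h x₀).contDiffAt ((isOpen_extChartAt_target x₀).mem_nhds hy)).differentiableAt (by simp)
  rw [← extDeriv_smul, ← extDeriv_add (hd h₀) ((hd h₁).const_smul c)]
  rfl

/-- The hypothesis dA_t = t^m ∂_t B_t is what closedness of t^{-m} dt ∧ A_t + B_t provides. As long
as the power on the right is positive, setting t = 0 shows that the constant term is closed;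
removing it and dividing by t lowers the power by one. -/
theorem extDeriv_iterate_familyDivX {ε : ℝ} (hε : 0 < ε) {m : ℕ} {A : ℝ → RawForm I N 1}
    {B : ℝ → RawForm I N 2} (hA : IsSmoothFamily I (Ioo (-ε) ε) A)
    (hB : IsSmoothFamily I (Ioo (-ε) ε) B) {x₀ : N} {y : E} (hy : y ∈ (extChartAt I x₀).target)
    (u v : E)
    (h : ∀ t ∈ Ioo (-ε) ε, t ≠ 0 → extDeriv (RawForm.inChart I (A t) x₀) y ![u, v] =
      t ^ m * deriv (fun t => RawForm.inChart I (B t) x₀ y ![u, v]) t) {n : ℕ} (hn : n ≤ m) :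
    ∀ t ∈ Ioo (-ε) ε, extDeriv (RawForm.inChart I (familyDivX^[n] A t) x₀) y ![u, v] =
      t ^ (m - n) * deriv (fun t => RawForm.inChart I (B t) x₀ y ![u, v]) t := by
  -- Both sides are continuous in t, so the identity extends to t = 0.
  have hcl : ∀ n, (∀ t ∈ Ioo (-ε) ε, t ≠ 0 →
      extDeriv (RawForm.inChart I (familyDivX^[n] A t) x₀) y ![u, v] =
      t ^ (m - n) * deriv (fun t => RawForm.inChart I (B t) x₀ y ![u, v]) t) →
      ∀ t ∈ Ioo (-ε) ε, extDeriv (RawForm.inChart I (familyDivX^[n] A t) x₀) y ![u, v] =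
      t ^ (m - n) * deriv (fun t => RawForm.inChart I (B t) x₀ y ![u, v]) t := by
    intro n hn t ht
    by_cases h0 : t = 0
    · subst h0
      exact eq_zero_of_tendsto_of_forall_ne hε
        ((hA.iterate_familyDivX n).continuousOn_extDeriv isOpen_Ioo hy u v)
        ((by fun_prop : ContinuousOn (fun t : ℝ => t ^ (m - n)) _).mul
          (hB.continuousOn_deriv isOpen_Ioo hy u v)) hn
    · exact hn t ht h0
  induction n with
  | zero => exact hcl 0 (by simpa using h)
  | succ n ih =>
    have h00 : (0 : ℝ) ∈ Ioo (-ε) ε := ⟨by linarith, hε⟩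
    have ih := ih (by omega)
    refine hcl (n + 1) fun t ht ht0 => ?_
    have h1 := ih t ht
    have h2 := ih 0 h00
    rw [zero_pow (by omega), zero_mul] at h2
    rw [eq_add_smul_familyDivX (hA.iterate_familyDivX n) ht,
      ← Function.iterate_succ_apply' familyDivX, extDeriv_inChart_add_smul
        ((hA.iterate_familyDivX n).isSmooth h00) ((hA.iterate_familyDivX (n + 1)).isSmooth ht) t hy,
      ContinuousAlternatingMap.add_apply, h2, zero_add, ContinuousAlternatingMap.smul_apply,
      show m - n = (m - (n + 1)) + 1 by omega, pow_succ, smul_eq_mul] at h1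
    refine mul_left_cancel₀ ht0 (h1.trans ?_)
    ring

/-- If `t^{-m} dt ∧ A_t + B_t` is closed, then the coefficients of its Laurent expansion are. -/
theorem exists_laurent_expansion {ε : ℝ} (hε : 0 < ε) {m : ℕ} {A : ℝ → RawForm I N 1}
    {B : ℝ → RawForm I N 2} (hA : IsSmoothFamily I (Ioo (-ε) ε) A)
    (hB : IsSmoothFamily I (Ioo (-ε) ε) B)
    (hcl : RawForm.IsClosedOn (I.prod 𝓘(ℝ, ℝ)) (familyForm I (fun t => (t ^ m)⁻¹ • A t) B)
      (univ ×ˢ {t ∈ Ioo (-ε) ε | t ≠ 0}))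
    {G : Type*} [SMul G N] (hinv : ∀ t ∈ Ioo (-ε) ε, RawForm.IsInvariantOn I G (A t) univ) :
    ∃ (α : ℕ → RawForm I N 1) (R : ℝ → RawForm I N 1),
      (∀ j ∈ Finset.Icc 1 m, RawForm.IsSmooth I (α j) ∧ RawForm.IsClosedOn I (α j) univ) ∧
      IsSmoothFamily I (Ioo (-ε) ε) R ∧
      (∀ t ∈ Ioo (-ε) ε, A t = ∑ j ∈ Finset.Icc 1 m, t ^ (m - j) • α j + t ^ m • R t) ∧
      α m = A 0 ∧
      RawForm.IsClosedOn (I.prod 𝓘(ℝ, ℝ)) (familyForm I R B) (univ ×ˢ Ioo (-ε) ε) ∧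
      (∀ j ∈ Finset.Icc 1 m, RawForm.IsInvariantOn I G (α j) univ) ∧
      ∀ t ∈ Ioo (-ε) ε, RawForm.IsInvariantOn I G (R t) univ := by
  have h00 : (0 : ℝ) ∈ Ioo (-ε) ε := ⟨by linarith, hε⟩
  have hJ : IsOpen {t ∈ Ioo (-ε) ε | t ≠ 0} := isOpen_Ioo.inter isOpen_ne
  have hA' : IsSmoothFamily I {t ∈ Ioo (-ε) ε | t ≠ 0} (fun t => (t ^ m)⁻¹ • A t) := fun x₀ =>
    ((contDiff_snd.pow m).contDiffOn.inv fun p hp => pow_ne_zero m hp.2.2).smul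
      ((hA x₀).mono fun p hp => ⟨hp.1, hp.2.1⟩)
  have hB' : IsSmoothFamily I {t ∈ Ioo (-ε) ε | t ≠ 0} B := fun x₀ =>
    (hB x₀).mono fun p hp => ⟨hp.1, hp.2.1⟩
  have h1 := (isClosedOn_familyForm_iff hJ hA' hB').1 hcl
  have h2 : ∀ x₀ : N, ∀ y ∈ (extChartAt I x₀).target, ∀ u v : E, ∀ n ≤ m, ∀ t ∈ Ioo (-ε) ε,
      extDeriv (RawForm.inChart I (familyDivX^[n] A t) x₀) y ![u, v] =
      t ^ (m - n) * deriv (fun t => RawForm.inChart I (B t) x₀ y ![u, v]) t := by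
    intro x₀ y hy u v n hn
    refine extDeriv_iterate_familyDivX hε hA hB hy u v (fun t ht ht0 => ?_) hn
    rw [(h1 x₀ y hy t ⟨ht, ht0⟩).2 u v]
    have h3 : RawForm.inChart I ((t ^ m)⁻¹ • A t) x₀ = (t ^ m)⁻¹ • RawForm.inChart I (A t) x₀ := rfl
    rw [h3, extDeriv_smul, ContinuousAlternatingMap.smul_apply, smul_eq_mul,
      mul_inv_cancel_left₀ (pow_ne_zero m ht0)]
  -- α_j is the Taylor coefficient of A_t of order m - j and R_t is the remainder of order m. The
  -- case n = m of the recursion reads dR_t = ∂_t B_t, which with dB_t = 0 is closedness of dt ∧ R_t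
  -- + B_t.
  refine ⟨fun j => familyDivX^[m - j] A 0, familyDivX^[m] A, fun j hj => ?_,
    hA.iterate_familyDivX m, fun t ht => ?_, ?_, ?_, fun j _ => ?_, ?_⟩
  · refine ⟨(hA.iterate_familyDivX (m - j)).isSmooth h00, fun x₀ y hy _ => ?_⟩
    rw [Finset.mem_Icc] at hj
    refine alternating_two_ext fun u v => ?_
    rw [h2 x₀ y hy u v (m - j) (by omega) 0 h00, zero_pow (by omega), zero_mul]
    rfl
  · refine (eq_sum_iterate_familyDivX hA m ht).trans ?_
    congr 1
    refine Finset.sum_nbij' (fun i => m - i) (fun j => m - j) ?_ ?_ ?_ ?_ ?_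
    · intro i hi; rw [Finset.mem_range] at hi; rw [Finset.mem_Icc]; omega
    · intro i hi; rw [Finset.mem_Icc] at hi; rw [Finset.mem_range]; omega
    · intro i hi; rw [Finset.mem_range] at hi; omega
    · intro i hi; rw [Finset.mem_Icc] at hi; omega
    · intro i hi
      rw [Finset.mem_range] at hi
      beta_reduce
      rw [show m - (m - i) = i by omega]
  · simp
  · refine (isClosedOn_familyForm_iff isOpen_Ioo (hA.iterate_familyDivX m) hB).2
      fun x₀ y hy t ht => ⟨?_, fun u v => ?_⟩
    · have hB2 : ContinuousOn (fun t => extDeriv (RawForm.inChart I (B t) x₀) y) (Ioo (-ε) ε) := by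
        have h2 := hB x₀
        have hO := isOpen_target_prod (I := I) x₀ (isOpen_Ioo (a := -ε) (b := ε))
        have h3 : ContinuousOn (fun t => (fderiv ℝ (fun p : E × ℝ =>
            RawForm.inChart I (B p.2) x₀ p.1) (y, t)).comp (ContinuousLinearMap.inl ℝ E ℝ))
            (Ioo (-ε) ε) :=
          (((h2.fderiv_of_isOpen hO (m := ∞) (by simp)).clm_comp contDiffOn_const).continuousOn).comp
            (f := fun t : ℝ => (y, t)) (by fun_prop) fun t ht => ⟨hy, ht⟩
        refine ((ContinuousAlternatingMap.alternatizeUncurryFinCLM ℝ E ℝ).continuous.comp_continuousOn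
          h3).congr fun t ht => ?_
        have h4 : HasFDerivAt (fun y : E => (y, t)) (ContinuousLinearMap.inl ℝ E ℝ) y :=
          (hasFDerivAt_id y).prodMk (hasFDerivAt_const t y)
        have h5 := ((h2.contDiffAt (hO.mem_nhds (x := (y, t)) ⟨hy, ht⟩)).differentiableAt
          (by simp)).hasFDerivAt.comp y h4
        exact congrArg _ h5.fderiv
      by_cases ht0 : t = 0
      · subst ht0
        refine alternating_three_ext fun u v w => ?_
        refine eq_zero_of_tendsto_of_forall_ne
          (f := fun t => extDeriv (RawForm.inChart I (B t) x₀) y ![u, v, w]) (g := fun _ => 0) hε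
          ((ContinuousAlternatingMap.apply ℝ E ℝ ![u, v, w]).continuous.comp_continuousOn hB2)
          continuousOn_const fun t ht ht0 => ?_
        change extDeriv (RawForm.inChart I (B t) x₀) y ![u, v, w] = 0
        rw [(h1 x₀ y hy t ⟨ht, ht0⟩).1]
        rfl
      · exact (h1 x₀ y hy t ⟨ht, ht0⟩).1
    · rw [h2 x₀ y hy u v m le_rfl t ht]
      simp
  · exact isInvariantOn_iterate_familyDivX hA hinv (m - j) 0 h00
  · exact isInvariantOn_iterate_familyDivX hA hinv m

end Laurent

/-! ### Derivatives as maps between the model spaces -/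

section ModelDeriv

variable {E₁ : Type*} [NormedAddCommGroup E₁] [NormedSpace ℝ E₁]
  {H₁ : Type*} [TopologicalSpace H₁] (I₁ : ModelWithCorners ℝ E₁ H₁)
  {N₁ : Type*} [TopologicalSpace N₁] [ChartedSpace H₁ N₁]
  {E₂ : Type*} [NormedAddCommGroup E₂] [NormedSpace ℝ E₂]
  {H₂ : Type*} [TopologicalSpace H₂] (I₂ : ModelWithCorners ℝ E₂ H₂)
  {N₂ : Type*} [TopologicalSpace N₂] [ChartedSpace H₂ N₂]

/-- The derivative of a map between manifolds, as a map between the model spaces. -/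
noncomputable def modelDeriv (F : N₁ → N₂) (x : N₁) : E₁ →L[ℝ] E₂ := mfderiv I₁ I₂ F x

variable {I₁ I₂}

theorem RawForm.val_pullback_two (G : N₁ → N₂) (η : RawForm I₂ N₂ 2) (x : N₁) (v w : E₁) :
    (RawForm.pullback I₁ I₂ G η).val x ![v, w] =
      η.val (G x) ![modelDeriv I₁ I₂ G x v, modelDeriv I₁ I₂ G x w] := by
  have h : (RawForm.pullback I₁ I₂ G η).val x =
    (η.val (G x)).compContinuousLinearMap (modelDeriv I₁ I₂ G x) := rfl
  rw [h, ContinuousAlternatingMap.compContinuousLinearMap_apply]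
  congr 1
  funext i; fin_cases i <;> rfl

theorem modelDeriv_comp {E₃ : Type*} [NormedAddCommGroup E₃] [NormedSpace ℝ E₃]
    {H₃ : Type*} [TopologicalSpace H₃] {I₃ : ModelWithCorners ℝ E₃ H₃}
    {N₃ : Type*} [TopologicalSpace N₃] [ChartedSpace H₃ N₃] {G : N₂ → N₃} {F : N₁ → N₂} {x : N₁}
    (hG : MDifferentiableAt I₂ I₃ G (F x)) (hF : MDifferentiableAt I₁ I₂ F x) (v : E₁) :
    modelDeriv I₁ I₃ (fun y => G (F y)) x v = modelDeriv I₂ I₃ G (F x) (modelDeriv I₁ I₂ F x v) :=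
  congrArg (fun L : E₁ →L[ℝ] E₃ => L v) (mfderiv_comp x hG hF)

theorem Filter.EventuallyEq.modelDeriv_eq {F G : N₁ → N₂} {x : N₁} (h : F =ᶠ[𝓝 x] G) :
    modelDeriv I₁ I₂ F x = modelDeriv I₁ I₂ G x := h.mfderiv_eq

end ModelDeriv

/-! ### Sums of closed forms -/

section Sums

universe u

variable {E : Type u} [NormedAddCommGroup E] [NormedSpace ℝ E]
  {H : Type*} [TopologicalSpace H] {I : ModelWithCorners ℝ E H}
  {N : Type*} [TopologicalSpace N] [ChartedSpace H N] [I.Boundaryless]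

theorem RawForm.IsSmoothOn.add {k : ℕ} {η η' : RawForm I N k} {S : Set N}
    (h : RawForm.IsSmoothOn I η S) (h' : RawForm.IsSmoothOn I η' S) :
    RawForm.IsSmoothOn I (η + η') S := fun x₀ => (h x₀).add (h' x₀)

theorem RawForm.IsClosedOn.add {k : ℕ} {η η' : RawForm I N k} {S : Set N} (hS : IsOpen S)
    (hs : RawForm.IsSmoothOn I η S) (hs' : RawForm.IsSmoothOn I η' S)
    (h : RawForm.IsClosedOn I η S) (h' : RawForm.IsClosedOn I η' S) :
    RawForm.IsClosedOn I (η + η') S := by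
  intro x₀ y hy hyS
  have hd : ∀ {η : RawForm I N k}, RawForm.IsSmoothOn I η S →
      DifferentiableAt ℝ (RawForm.inChart I η x₀) y := fun h =>
    ((h x₀).contDiffAt ((RawForm.isOpen_chart_preimage hS x₀).mem_nhds ⟨hy, hyS⟩)).differentiableAt
      (by simp)
  have h1 : RawForm.inChart I (η + η') x₀ = RawForm.inChart I η x₀ + RawForm.inChart I η' x₀ := rfl
  rw [h1, extDeriv_add (hd hs) (hd hs'), h x₀ y hy hyS, h' x₀ y hy hyS, add_zero]

theorem RawForm.isSmooth_isClosedOn_sum {k : ℕ} {α : ℕ → RawForm I N k} {s : Finset ℕ} {c : ℕ → ℝ}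
    (h : ∀ j ∈ s, RawForm.IsSmooth I (α j) ∧ RawForm.IsClosedOn I (α j) univ) :
    RawForm.IsSmooth I (∑ j ∈ s, c j • α j) ∧
      RawForm.IsClosedOn I (∑ j ∈ s, c j • α j) univ := by
  induction s using Finset.induction_on with
  | empty =>
    have h0 : ∀ x₀, RawForm.inChart I (0 : RawForm I N k) x₀ = 0 := fun x₀ => rfl
    refine ⟨fun x₀ => ?_, fun x₀ y hy _ => ?_⟩
    · rw [Finset.sum_empty, h0]
      exact contDiffOn_const
    · rw [Finset.sum_empty, h0]
      have := extDeriv_smul (𝕜 := ℝ) (x := y) (0 : ℝ) (0 : E → E [⋀^Fin k]→L[ℝ] ℝ)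
      simpa using this
  | insert i s hi ih =>
    rw [Finset.sum_insert hi]
    have h1 := ih fun j hj => h j (Finset.mem_insert_of_mem hj)
    have h2 := h i (Finset.mem_insert_self i s)
    have h3 : RawForm.IsSmooth I (c i • α i) := fun x₀ => (h2.1 x₀).const_smul (c i)
    have h4 : RawForm.IsClosedOn I (c i • α i) univ := fun x₀ y hy hyS => by
      have : RawForm.inChart I (c i • α i) x₀ = c i • RawForm.inChart I (α i) x₀ := rfl
      rw [this, extDeriv_smul, h2.2 x₀ y hy hyS, smul_zero]
    exact ⟨fun x₀ => (h3 x₀).add (h1.1 x₀), RawForm.IsClosedOn.add isOpen_univ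
      (RawForm.isSmoothOn_univ.2 h3) (RawForm.isSmoothOn_univ.2 h1.1) h4 h1.2⟩

theorem RawForm.val_sum {k : ℕ} (s : Finset ℕ) (α : ℕ → RawForm I N k) (x : N) :
    (∑ j ∈ s, α j).val x = ∑ j ∈ s, (α j).val x := by
  induction s using Finset.induction_on with
  | empty => rfl
  | insert i s hi ih => rw [Finset.sum_insert hi, Finset.sum_insert hi, val_add, ih]

theorem RawForm.inChart_sum {k : ℕ} (s : Finset ℕ) (α : ℕ → RawForm I N k) (x₀ : N) (y : E) :
    RawForm.inChart I (∑ j ∈ s, α j) x₀ y = ∑ j ∈ s, RawForm.inChart I (α j) x₀ y := by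
  induction s using Finset.induction_on with
  | empty => rfl
  | insert i s hi ih => rw [Finset.sum_insert hi, Finset.sum_insert hi, inChart_add, ih]

theorem IsSmoothFamily.sum_smul {X : Type*} [NormedAddCommGroup X] [NormedSpace ℝ X] {k : ℕ}
    {J : Set X} {s : Finset ℕ} {α : ℕ → RawForm I N k} {c : ℕ → X → ℝ}
    (h : ∀ j ∈ s, RawForm.IsSmooth I (α j)) (hc : ∀ j ∈ s, ContDiffOn ℝ ∞ (c j) J) :
    IsSmoothFamily I J (fun t => ∑ j ∈ s, c j t • α j) := by
  intro x₀
  simp only [RawForm.inChart_sum]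
  refine ContDiffOn.sum fun j hj => ?_
  exact ((hc j hj).comp contDiff_snd.contDiffOn fun p hp => hp.2).smul
    ((h j hj x₀).comp contDiff_fst.contDiffOn fun p hp => hp.1)

/-- The principal part `∑ t^{-j} dt ∧ α_j` is smooth and closed off `t = 0`. -/
theorem isSmoothOn_isClosedOn_principal [FiniteDimensional ℝ E] [IsManifold I ∞ N]
    {s : Finset ℕ} {α : ℕ → RawForm I N 1}
    (h : ∀ j ∈ s, RawForm.IsSmooth I (α j) ∧ RawForm.IsClosedOn I (α j) univ) :
    RawForm.IsSmoothOn (I.prod 𝓘(ℝ, ℝ)) (familyForm I (fun t => ∑ j ∈ s, (t ^ j)⁻¹ • α j) 0)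
        (univ ×ˢ {t | t ≠ 0}) ∧
      RawForm.IsClosedOn (I.prod 𝓘(ℝ, ℝ)) (familyForm I (fun t => ∑ j ∈ s, (t ^ j)⁻¹ • α j) 0)
        (univ ×ˢ {t | t ≠ 0}) := by
  have h1 : IsSmoothFamily I {t : ℝ | t ≠ 0} (fun t => ∑ j ∈ s, (t ^ j)⁻¹ • α j) :=
    IsSmoothFamily.sum_smul (c := fun j t => (t ^ j)⁻¹) (fun j hj => (h j hj).1)
      fun j _ => (contDiff_id.pow j).contDiffOn.inv fun t ht => pow_ne_zero j ht
  have h2 : IsSmoothFamily I {t : ℝ | t ≠ 0} (0 : ℝ → RawForm I N 2) := fun x₀ =>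
    contDiffOn_const (c := (0 : E [⋀^Fin 2]→L[ℝ] ℝ))
  refine ⟨h1.familyForm h2, (isClosedOn_familyForm_iff isOpen_ne h1 h2).2
    fun x₀ y hy t ht => ⟨?_, fun u v => ?_⟩⟩
  · have h0 : RawForm.inChart I ((0 : ℝ → RawForm I N 2) t) x₀ = 0 := rfl
    have := extDeriv_smul (𝕜 := ℝ) (x := y) (0 : ℝ) (0 : E → E [⋀^Fin 2]→L[ℝ] ℝ)
    rw [h0]
    simpa using this
  · rw [(RawForm.isSmooth_isClosedOn_sum (c := fun j => (t ^ j)⁻¹) h).2 x₀ y hy (mem_univ _)]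
    exact deriv_const t (0 : ℝ)

end Sums

/-! ### The homotopy of forms along an isotopy -/

section Isotopy

universe u

variable {E : Type u} [NormedAddCommGroup E] [NormedSpace ℝ E]
  {H : Type*} [TopologicalSpace H] {I : ModelWithCorners ℝ E H}
  {N : Type*} [TopologicalSpace N] [ChartedSpace H N]

theorem RawForm.val_smul_one_apply (c : ℝ) (η : RawForm I N 1) (x : N) (v : E) :
    (c • η).val x ![v] = c * η.val x ![v] := rfl

theorem alternating_one_smul (φ : E [⋀^Fin 1]→L[ℝ] ℝ) (c : ℝ) (v : E) :
    φ ![c • v] = c * φ ![v] := by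
  have := φ.map_update_smul ![v] 0 c v
  have h1 : Function.update ![v] 0 (c • v) = ![c • v] := by funext i; fin_cases i; rfl
  have h2 : Function.update ![v] 0 v = ![v] := by funext i; fin_cases i; rfl
  rwa [h1, h2] at this

theorem alternating_two_smul_right (φ : E [⋀^Fin 2]→L[ℝ] ℝ) (c : ℝ) (u v : E) :
    φ ![u, c • v] = c * φ ![u, v] := by
  have := φ.map_update_smul ![u, v] 1 c v
  have h1 : Function.update ![u, v] 1 (c • v) = ![u, c • v] := by funext i; fin_cases i <;> rfl
  have h2 : Function.update ![u, v] 1 v = ![u, v] := by funext i; fin_cases i <;> rfl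
  rwa [h1, h2] at this

theorem alternating_two_swap (φ : E [⋀^Fin 2]→L[ℝ] ℝ) (u v : E) :
    φ ![u, v] = -φ ![v, u] := by
  have := φ.toAlternatingMap.map_swap ![v, u] (i := 0) (j := 1) (by decide)
  have h1 : (![v, u] ∘ Equiv.swap (0 : Fin 2) 1) = ![u, v] := by
    funext i; fin_cases i <;> rfl
  rw [h1] at this
  exact this

theorem alternating_two_self (φ : E [⋀^Fin 2]→L[ℝ] ℝ) (u : E) : φ ![u, u] = 0 := by
  have := alternating_two_swap φ u u
  linarith

/-- The map `((x, t), s) ↦ (x, s t)`. -/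
theorem modelDeriv_scaled {G : (N × ℝ) × ℝ → N × ℝ} {q : (N × ℝ) × ℝ}
    (hG : MDifferentiableAt ((I.prod 𝓘(ℝ, ℝ)).prod 𝓘(ℝ, ℝ)) (I.prod 𝓘(ℝ, ℝ)) G q)
    (v : (E × ℝ) × ℝ) :
    modelDeriv ((I.prod 𝓘(ℝ, ℝ)).prod 𝓘(ℝ, ℝ)) (I.prod 𝓘(ℝ, ℝ))
      (fun q => ((G q).1, q.2 * (G q).2)) q v =
    ((modelDeriv ((I.prod 𝓘(ℝ, ℝ)).prod 𝓘(ℝ, ℝ)) (I.prod 𝓘(ℝ, ℝ)) G q v).1,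
      v.2 * (G q).2 +
        q.2 * (modelDeriv ((I.prod 𝓘(ℝ, ℝ)).prod 𝓘(ℝ, ℝ)) (I.prod 𝓘(ℝ, ℝ)) G q v).2) := by
  have h1 := (hasMFDerivAt_fst (I := I) (I' := 𝓘(ℝ, ℝ)) (G q)).comp q hG.hasMFDerivAt
  have h2 := (hasMFDerivAt_snd (I := I) (I' := 𝓘(ℝ, ℝ)) (G q)).comp q hG.hasMFDerivAt
  have h3 := hasMFDerivAt_snd (I := I.prod 𝓘(ℝ, ℝ)) (I' := 𝓘(ℝ, ℝ)) q
  have h4 := h1.prodMk (h3.mul h2)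
  refine (congrArg (fun L : (E × ℝ) × ℝ →L[ℝ] E × ℝ => L v) h4.mfderiv).trans ?_
  refine Prod.ext rfl ?_
  change q.2 * (modelDeriv ((I.prod 𝓘(ℝ, ℝ)).prod 𝓘(ℝ, ℝ)) (I.prod 𝓘(ℝ, ℝ)) G q v).2 +
    (G q).2 * v.2 = _
  ring

variable [FiniteDimensional ℝ E] [I.Boundaryless] [IsManifold I ∞ N]

/-- Moser's argument. -/
theorem familyForm_pullback_isotopy {m : ℕ} {ε : ℝ} {α : ℕ → RawForm I N 1}
    {R : ℝ → RawForm I N 1} {B : ℝ → RawForm I N 2}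
    (hα : ∀ j ∈ Finset.Icc 1 m, RawForm.IsSmooth I (α j) ∧ RawForm.IsClosedOn I (α j) univ)
    (hR : IsSmoothFamily I (Ioo (-ε) ε) R) (hB : IsSmoothFamily I (Ioo (-ε) ε) B)
    (hcl : RawForm.IsClosedOn (I.prod 𝓘(ℝ, ℝ)) (familyForm I R B) (univ ×ˢ Ioo (-ε) ε))
    {G : (N × ℝ) × ℝ → N × ℝ} {S₀ : Set (N × ℝ)} (hS₀ : IsOpen S₀) {J : Set ℝ} (hJo : IsOpen J)
    (hJ : Icc 0 1 ⊆ J)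
    (hG : ContMDiffOn ((I.prod 𝓘(ℝ, ℝ)).prod 𝓘(ℝ, ℝ)) (I.prod 𝓘(ℝ, ℝ)) ∞ G (S₀ ×ˢ J))
    (hG0 : ∀ p ∈ S₀, G (p, 0) = p)
    (hne : ∀ q ∈ S₀ ×ˢ J, (G q).2 ≠ 0) (hlt : ∀ q ∈ S₀ ×ˢ J, q.2 * (G q).2 ∈ Ioo (-ε) ε)
    (hV : ∀ q ∈ S₀ ×ˢ J, ∃ ξ : E × ℝ,
      modelDeriv ((I.prod 𝓘(ℝ, ℝ)).prod 𝓘(ℝ, ℝ)) (I.prod 𝓘(ℝ, ℝ)) G q (0, 1) =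
        ((G q).2 • ξ.1, (G q).2 ^ (m + 1) * ξ.2) ∧
      ∀ (w : E) (k : ℝ), wedgeLine
        ((∑ j ∈ Finset.Icc 1 m, (G q).2 ^ (m - j) • α j +
          (q.2 * (G q).2 ^ m) • R (q.2 * (G q).2)).val (G q).1)
        ((B (q.2 * (G q).2)).val (G q).1) ![ξ, (w, k)] = -(R (q.2 * (G q).2)).val (G q).1 ![w])
    {p : N × ℝ} (hp : p ∈ S₀) (v w : E × ℝ) :
    (familyForm I (fun t => ∑ j ∈ Finset.Icc 1 m, (t ^ j)⁻¹ • α j + R t) B).val (G (p, 1))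
      ![modelDeriv (I.prod 𝓘(ℝ, ℝ)) (I.prod 𝓘(ℝ, ℝ)) (fun p => G (p, 1)) p v,
        modelDeriv (I.prod 𝓘(ℝ, ℝ)) (I.prod 𝓘(ℝ, ℝ)) (fun p => G (p, 1)) p w] =
    (familyForm I (fun t => ∑ j ∈ Finset.Icc 1 m, (t ^ j)⁻¹ • α j) (fun _ => B 0)).val p
      ![v, w] := by
  set P : ℝ → RawForm I N 1 := fun t => ∑ j ∈ Finset.Icc 1 m, (t ^ j)⁻¹ • α j with hP
  set I' := I.prod 𝓘(ℝ, ℝ) with hI'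
  set δG : (N × ℝ) × ℝ → N × ℝ := fun q => ((G q).1, q.2 * (G q).2) with hδ
  set S := S₀ ×ˢ J with hS
  have hSo : IsOpen S := hS₀.prod hJo
  have hδG : ContMDiffOn (I'.prod 𝓘(ℝ, ℝ)) I' ∞ δG S := by
    refine (contMDiff_fst.comp_contMDiffOn hG).prodMk ?_
    exact contMDiff_snd.contMDiffOn.mul (contMDiff_snd.comp_contMDiffOn hG)
  obtain ⟨hPs, hPc⟩ := isSmoothOn_isClosedOn_principal hα
  have hop : IsOpen ((univ : Set N) ×ˢ {t : ℝ | t ≠ 0}) := isOpen_univ.prod isOpen_ne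
  have hoε : IsOpen ((univ : Set N) ×ˢ Ioo (-ε) ε) := isOpen_univ.prod isOpen_Ioo
  have hm1 : MapsTo G S (univ ×ˢ {t : ℝ | t ≠ 0}) := fun q hq => ⟨mem_univ _, hne q hq⟩
  have hm2 : MapsTo δG S (univ ×ˢ Ioo (-ε) ε) := fun q hq => ⟨mem_univ _, hlt q hq⟩
  -- Instead of a Lie derivative in s, one closed form on (N × ℝ) × ℝ is used. The principal part is
  -- pulled back by the isotopy G, the smooth part by G followed by the scaling t ↦ s t.
  set η : RawForm (I'.prod 𝓘(ℝ, ℝ)) ((N × ℝ) × ℝ) 2 :=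
    RawForm.pullback (I'.prod 𝓘(ℝ, ℝ)) I' G (familyForm I P 0) +
      RawForm.pullback (I'.prod 𝓘(ℝ, ℝ)) I' δG (familyForm I R B) with hη
  have hRB := hR.familyForm hB
  have hs1 : RawForm.IsSmoothOn (I'.prod 𝓘(ℝ, ℝ))
      (RawForm.pullback (I'.prod 𝓘(ℝ, ℝ)) I' G (familyForm I P 0)) S := hPs.pullback hSo hop hG hm1
  have hs2 : RawForm.IsSmoothOn (I'.prod 𝓘(ℝ, ℝ))
      (RawForm.pullback (I'.prod 𝓘(ℝ, ℝ)) I' δG (familyForm I R B)) S :=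
    hRB.pullback hSo hoε hδG hm2
  have hηs : RawForm.IsSmoothOn (I'.prod 𝓘(ℝ, ℝ)) η S := hs1.add hs2
  have hηc : RawForm.IsClosedOn (I'.prod 𝓘(ℝ, ℝ)) η S :=
    RawForm.IsClosedOn.add hSo hs1 hs2 (hPc.pullback hPs hSo hop hG hm1)
      (hcl.pullback hRB hSo hoε hδG hm2)
  have hGd : ∀ q ∈ S, MDifferentiableAt (I'.prod 𝓘(ℝ, ℝ)) I' G q := fun q hq =>
    (hG.contMDiffAt (hSo.mem_nhds hq)).mdifferentiableAt (by simp)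
  have hηv : ∀ q ∈ S, ∀ a b : (E × ℝ) × ℝ, η.val q ![a, b] =
      (familyForm I P 0).val (G q)
        ![modelDeriv (I'.prod 𝓘(ℝ, ℝ)) I' G q a, modelDeriv (I'.prod 𝓘(ℝ, ℝ)) I' G q b] +
      (familyForm I R B).val (δG q)
        ![((modelDeriv (I'.prod 𝓘(ℝ, ℝ)) I' G q a).1,
          a.2 * (G q).2 + q.2 * (modelDeriv (I'.prod 𝓘(ℝ, ℝ)) I' G q a).2),
          ((modelDeriv (I'.prod 𝓘(ℝ, ℝ)) I' G q b).1,
          b.2 * (G q).2 + q.2 * (modelDeriv (I'.prod 𝓘(ℝ, ℝ)) I' G q b).2)] := by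
    intro q hq a b
    rw [hη, val_add, ContinuousAlternatingMap.add_apply, RawForm.val_pullback_two,
      RawForm.val_pullback_two, modelDeriv_scaled (hGd q hq), modelDeriv_scaled (hGd q hq)]
  have hPA : ∀ (t : ℝ) (x : N) (u : E), t ≠ 0 → (P t).val x ![u] =
      (t ^ m)⁻¹ * (∑ j ∈ Finset.Icc 1 m, t ^ (m - j) • α j).val x ![u] := by
    intro t x u ht
    have hsum : ∀ c : ℕ → ℝ, (∑ j ∈ Finset.Icc 1 m, c j • α j).val x ![u] =
        ∑ j ∈ Finset.Icc 1 m, c j * (α j).val x ![u] := by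
      intro c
      rw [RawForm.val_sum, ContinuousAlternatingMap.sum_apply]
      rfl
    rw [hP]
    simp only [hsum, Finset.mul_sum]
    refine Finset.sum_congr rfl fun j hj => ?_
    rw [Finset.mem_Icc] at hj
    rw [← mul_assoc]
    congr 1
    have h2 : t ^ m = t ^ (m - j) * t ^ j := by rw [← pow_add]; congr 1; omega
    rw [h2]
    field_simp
  -- Moser's equation makes ∂_s annihilate η; since η is closed, its restriction to the slices then
  -- does not depend on s.
  have h0 : ∀ q ∈ S, ∀ a : (E × ℝ) × ℝ, η.val q ![a, ((0 : E × ℝ), (1 : ℝ))] = 0 := by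
    intro q hq a
    obtain ⟨ξ, hξ, hE⟩ := hV q hq
    rw [hηv q hq, hξ, familyForm_apply, familyForm_apply]
    obtain ⟨x', hx'⟩ : ∃ x', x' = (modelDeriv (I'.prod 𝓘(ℝ, ℝ)) I' G q a) := ⟨_, rfl⟩
    rw [← hx']
    have ht := hne q hq
    obtain ⟨t, ht'⟩ : ∃ t, t = (G q).2 := ⟨_, rfl⟩
    obtain ⟨z, hz⟩ : ∃ z, z = (G q).1 := ⟨_, rfl⟩
    simp only [hδ]
    rw [← ht'] at ht hE ⊢
    rw [← hz] at hE ⊢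
    -- Write the linear equation as (dt ∧ a + b)(ξ, ·) = -R. Testing on ∂_t gives a(ξ') = 0; testing
    -- on ξ' gives R(ξ') = 0, as b(ξ', ξ') = 0; testing on the N-component of the given vector gives
    -- the last relation.
    have e1 := hE 0 1
    have e2 := hE x'.1 0
    have e3 := hE ξ.1 0
    simp only [wedgeLine_apply, val_add, ContinuousAlternatingMap.add_apply,
      RawForm.val_smul_one_apply] at e1 e2 e3
    have z1 : ∀ φ : E [⋀^Fin 1]→L[ℝ] ℝ, φ ![(0 : E)] = 0 := fun φ => φ.map_coord_zero 0 rfl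
    have z2 : ∀ φ : E [⋀^Fin 2]→L[ℝ] ℝ, φ ![ξ.1, (0 : E)] = 0 := fun φ => φ.map_coord_zero 1 rfl
    rw [z1, z1, z2] at e1
    rw [alternating_two_self] at e3
    rw [alternating_two_swap] at e2
    rw [hPA t z _ ht, hPA t z _ ht, alternating_one_smul, alternating_one_smul,
      alternating_two_smul_right, alternating_two_smul_right]
    have z3 : ((0 : ℝ → RawForm I N 2) t).val z ![x'.1, ξ.1] = 0 := rfl
    rw [z3]
    have htm : t ^ m ≠ 0 := pow_ne_zero m ht
    set X1 := (∑ j ∈ Finset.Icc 1 m, t ^ (m - j) • α j).val z ![ξ.1]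
    set X2 := (∑ j ∈ Finset.Icc 1 m, t ^ (m - j) • α j).val z ![x'.1]
    set R1 := (R (q.2 * t)).val z ![ξ.1]
    set R2 := (R (q.2 * t)).val z ![x'.1]
    set B1 := (B (q.2 * t)).val z ![x'.1, ξ.1]
    have e4 : R1 = 0 := by
      have : X1 + q.2 * t ^ m * R1 = 0 := by linarith
      rw [this] at e3
      linarith
    rw [e4] at e1 ⊢
    have e5 : X1 = 0 := by linarith
    rw [e5]
    have e6 : B1 = ξ.2 * (X2 + q.2 * t ^ m * R2) + R2 := by linarith
    rw [e6]
    field_simp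
    ring
  have h1J : ∀ r ∈ Icc (0 : ℝ) 1, (p, r) ∈ S := fun r hr => ⟨hp, hJ hr⟩
  have hfin := hηc.eq_of_contract_eq_zero hSo hηs h0 h1J zero_le_one v w
  have hsl : ∀ r ∈ Icc (0 : ℝ) 1, ∀ v : E × ℝ, modelDeriv (I'.prod 𝓘(ℝ, ℝ)) I' G (p, r) (v, 0) =
      modelDeriv I' I' (fun p => G (p, r)) p v := by
    intro r hr v
    have h1 : HasMFDerivAt I' (I'.prod 𝓘(ℝ, ℝ)) (fun p : N × ℝ => (p, r)) p _ :=
      (hasMFDerivAt_id p).prodMk (hasMFDerivAt_const r p)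
    have h2 := (hGd _ (h1J r hr)).hasMFDerivAt.comp p h1
    exact (congrArg (fun L : E × ℝ →L[ℝ] E × ℝ => L v) h2.mfderiv).symm
  have hz : (0 : ℝ) ∈ Icc (0 : ℝ) 1 := ⟨le_rfl, zero_le_one⟩
  have ho : (1 : ℝ) ∈ Icc (0 : ℝ) 1 := ⟨zero_le_one, le_rfl⟩
  have hid : ∀ v : E × ℝ, modelDeriv I' I' (fun p => G (p, 0)) p v = v := by
    intro v
    have h1 : (fun p => G (p, 0)) =ᶠ[𝓝 p] id := by
      filter_upwards [hS₀.mem_nhds hp] with p' hp' using hG0 p' hp'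
    rw [h1.modelDeriv_eq]
    exact congrArg (fun L : E × ℝ →L[ℝ] E × ℝ => L v) (mfderiv_id (I := I'))
  -- At s = 1 the slice of η is the pullback of the full form; at s = 0 the isotopy is the identity
  -- and the scaling collapses the smooth part to B 0.
  rw [hηv _ (h1J 1 ho), hηv _ (h1J 0 hz), hsl 1 ho, hsl 1 ho, hsl 0 hz, hsl 0 hz, hid, hid] at hfin
  simp only [hδ, familyForm_apply, one_mul, zero_mul, zero_add, hG0 p hp, sub_zero] at hfin ⊢
  have z3 : ∀ (t : ℝ) (x : N) (a b : E), ((0 : ℝ → RawForm I N 2) t).val x ![a, b] = 0 :=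
    fun _ _ _ _ => rfl
  rw [z3, z3] at hfin
  simp only [val_add, ContinuousAlternatingMap.add_apply]
  linarith

end Isotopy

/-! ### Nondegenerate two-forms -/

section Nondegenerate

variable {V : Type*} [NormedAddCommGroup V] [NormedSpace ℝ V]

/-- `φ` is nondegenerate. -/
def NondegTwo (φ : V [⋀^Fin 2]→L[ℝ] ℝ) : Prop := ∀ u, (∀ v, φ ![u, v] = 0) → u = 0

theorem alternating_two_add_left (φ : V [⋀^Fin 2]→L[ℝ] ℝ) (u u' v : V) :
    φ ![u + u', v] = φ ![u, v] + φ ![u', v] :=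
  φ.toAlternatingMap.map_vecCons_add ![v] u u'

theorem alternating_two_smul_left (φ : V [⋀^Fin 2]→L[ℝ] ℝ) (c : ℝ) (u v : V) :
    φ ![c • u, v] = c * φ ![u, v] :=
  φ.toAlternatingMap.map_vecCons_smul ![v] c u

theorem alternating_two_add_right (φ : V [⋀^Fin 2]→L[ℝ] ℝ) (u v v' : V) :
    φ ![u, v + v'] = φ ![u, v] + φ ![u, v'] := by
  rw [alternating_two_swap, alternating_two_add_left, alternating_two_swap φ v,
    alternating_two_swap φ v']
  ring

/-- The linear functional of a form of degree one. -/
noncomputable def oneFormCLM (ρ : V [⋀^Fin 1]→L[ℝ] ℝ) : V →L[ℝ] ℝ :=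
  (ContinuousAlternatingMap.ofSubsingleton ℝ V ℝ (0 : Fin 1)).symm ρ

theorem oneFormCLM_apply (ρ : V [⋀^Fin 1]→L[ℝ] ℝ) (v : V) : oneFormCLM ρ v = ρ ![v] := by
  have h := (ContinuousAlternatingMap.ofSubsingleton ℝ V ℝ (0 : Fin 1)).apply_symm_apply ρ
  exact congrArg (fun L : V [⋀^Fin 1]→L[ℝ] ℝ => L ![v]) h

variable [FiniteDimensional ℝ V]

/-- The map `u ↦ φ(u, ·)`. -/
noncomputable def flatTwo (φ : V [⋀^Fin 2]→L[ℝ] ℝ) : V →L[ℝ] V →L[ℝ] ℝ :=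
  LinearMap.toContinuousLinearMap
    ((LinearMap.toContinuousLinearMap (𝕜 := ℝ) (E := V) (F' := ℝ)).toLinearMap ∘ₗ
      LinearMap.mk₂ ℝ (fun u v => φ ![u, v]) (alternating_two_add_left φ)
        (alternating_two_smul_left φ) (alternating_two_add_right φ)
        (fun c u v => alternating_two_smul_right φ c u v))

theorem flatTwo_apply (φ : V [⋀^Fin 2]→L[ℝ] ℝ) (u v : V) : flatTwo φ u v = φ ![u, v] := rfl

/-- The solution `u` of `φ(u, ·) = r`. -/
noncomputable def solveTwo (φ : V [⋀^Fin 2]→L[ℝ] ℝ) (r : V →L[ℝ] ℝ) : V :=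
  (flatTwo φ).inverse r

theorem NondegTwo.exists_equiv {φ : V [⋀^Fin 2]→L[ℝ] ℝ} (h : NondegTwo φ) :
    ∃ e : V ≃L[ℝ] (V →L[ℝ] ℝ), (e : V →L[ℝ] V →L[ℝ] ℝ) = flatTwo φ := by
  have hinj : Function.Injective (flatTwo φ : V →ₗ[ℝ] (V →L[ℝ] ℝ)) := by
    refine (injective_iff_map_eq_zero _).2 fun u hu => h u fun v => ?_
    exact congrArg (fun L : V →L[ℝ] ℝ => L v) hu
  have hr : Module.finrank ℝ V = Module.finrank ℝ (V →L[ℝ] ℝ) := by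
    rw [← (LinearMap.toContinuousLinearMap (𝕜 := ℝ) (E := V) (F' := ℝ)).finrank_eq]
    exact (Subspace.dual_finrank_eq (K := ℝ) (V := V)).symm
  refine ⟨(LinearEquiv.ofInjectiveOfFinrankEq _ hinj hr).toContinuousLinearEquiv, ?_⟩
  ext u v
  rfl

theorem nondegTwo_of_equiv {φ : V [⋀^Fin 2]→L[ℝ] ℝ} (e : V ≃L[ℝ] (V →L[ℝ] ℝ))
    (he : (e : V →L[ℝ] V →L[ℝ] ℝ) = flatTwo φ) : NondegTwo φ := by
  intro u hu
  apply e.injective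
  rw [map_zero]
  ext v
  refine (congrArg (fun L : V →L[ℝ] V →L[ℝ] ℝ => L u v) he).trans ?_
  exact hu v

theorem NondegTwo.solveTwo_apply {φ : V [⋀^Fin 2]→L[ℝ] ℝ} (h : NondegTwo φ) (r : V →L[ℝ] ℝ) (v : V) :
    φ ![solveTwo φ r, v] = r v := by
  obtain ⟨e, he⟩ := h.exists_equiv
  rw [← flatTwo_apply, solveTwo, ← he, ContinuousLinearMap.inverse_equiv]
  simp

theorem NondegTwo.eq_solveTwo {φ : V [⋀^Fin 2]→L[ℝ] ℝ} (h : NondegTwo φ) {r : V →L[ℝ] ℝ} {u : V}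
    (hu : ∀ v, φ ![u, v] = r v) : u = solveTwo φ r := by
  obtain ⟨e, he⟩ := h.exists_equiv
  have h1 : e u = r := by
    ext v
    exact (congrArg (fun L : V →L[ℝ] V →L[ℝ] ℝ => L u v) he).trans (hu v)
  rw [solveTwo, ← he, ContinuousLinearMap.inverse_equiv, ← h1]
  simp

variable {X : Type*} [NormedAddCommGroup X] [NormedSpace ℝ X]

theorem ContDiffOn.flatTwo {φ : X → V [⋀^Fin 2]→L[ℝ] ℝ} {S : Set X} (hφ : ContDiffOn ℝ ∞ φ S) :
    ContDiffOn ℝ ∞ (fun x => flatTwo (φ x)) S :=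
  contDiffOn_clm_apply.2 fun u => contDiffOn_clm_apply.2 fun v => hφ.apply_two u v

/-- Nondegeneracy is invertibility of u ↦ φ(u, ·), and invertible operators form an open set. -/
theorem NondegTwo.eventually {φ : X → V [⋀^Fin 2]→L[ℝ] ℝ} {S : Set X} (hS : IsOpen S)
    (hφ : ContDiffOn ℝ ∞ φ S) {x : X} (hx : x ∈ S) (h : NondegTwo (φ x)) :
    ∀ᶠ y in 𝓝 x, NondegTwo (φ y) := by
  obtain ⟨e, he⟩ := h.exists_equiv
  have h1 := (hφ.flatTwo.continuousOn.continuousAt (hS.mem_nhds hx)).eventually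
    (p := fun L => ∃ e : V ≃L[ℝ] (V →L[ℝ] ℝ), (e : V →L[ℝ] V →L[ℝ] ℝ) = L)
    (by beta_reduce; rw [← he]; exact ContinuousLinearEquiv.nhds e)
  filter_upwards [h1] with y ⟨e', he'⟩ using nondegTwo_of_equiv e' he'

/-- Inversion of operators is smooth near an invertible one. -/
theorem ContDiffAt.solveTwo {φ : X → V [⋀^Fin 2]→L[ℝ] ℝ} {r : X → V →L[ℝ] ℝ} {S : Set X}
    (hS : IsOpen S) (hφ : ContDiffOn ℝ ∞ φ S) (hr : ContDiffOn ℝ ∞ r S) {x : X} (hx : x ∈ S)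
    (h : NondegTwo (φ x)) : ContDiffAt ℝ ∞ (fun y => solveTwo (φ y) (r y)) x := by
  obtain ⟨e, he⟩ := h.exists_equiv
  have h1 : ContDiffAt ℝ ∞ (ContinuousLinearMap.inverse (R := ℝ) (M := V) (M₂ := V →L[ℝ] ℝ))
      (_root_.flatTwo (φ x)) := by
    rw [← he]; exact contDiffAt_map_inverse e
  exact (h1.comp x (hφ.flatTwo.contDiffAt (hS.mem_nhds hx))).clm_apply
    (hr.contDiffAt (hS.mem_nhds hx))

end Nondegenerate

/-! ### Vector fields in charts -/

section ChartFields

variable {E : Type*} [NormedAddCommGroup E] [NormedSpace ℝ E]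
  {H : Type*} [TopologicalSpace H] {I : ModelWithCorners ℝ E H}
  {N : Type*} [TopologicalSpace N] [ChartedSpace H N] [I.Boundaryless] [IsManifold I ∞ N]

theorem exists_chartDeriv_inverse {x₀ : N} {y : E} (hy : y ∈ (extChartAt I x₀).target) :
    ∃ D : E →L[ℝ] E, (∀ v, chartDeriv I x₀ y (D v) = v) ∧ ∀ v, D (chartDeriv I x₀ y v) = v :=
  ⟨mfderiv I 𝓘(ℝ, E) (extChartAt I x₀) ((extChartAt I x₀).symm y),
    fun v => mfderiv_symm_mfderiv_extChartAt (I := I) hy v,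
    fun v => mfderiv_extChartAt_mfderiv_symm (I := I) hy v⟩

/-- A vector field which is smooth in a chart is smooth. -/
theorem contMDiffAt_section_of_chartDeriv {V : N → E} {x₀ : N} {X : E → E} {S : Set E}
    (hS : IsOpen S) (hxS : extChartAt I x₀ x₀ ∈ S) (hX : ContDiffOn ℝ ∞ X S)
    (hV : ∀ y ∈ S, y ∈ (extChartAt I x₀).target →
      V ((extChartAt I x₀).symm y) = chartDeriv I x₀ y (X y)) :
    ContMDiffAt I I.tangent ∞ (fun x => (⟨x, V x⟩ : TangentBundle I N)) x₀ := by
  have hO : IsOpen (S ∩ (extChartAt I x₀).target) := hS.inter (isOpen_extChartAt_target x₀)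
  have h1 := contMDiffOn_mfderiv_apply (I := I) hO
    ((contMDiffOn_extChartAt_symm (n := ∞) x₀).mono inter_subset_right)
    (hX.mono inter_subset_left)
  have hm : extChartAt I x₀ x₀ ∈ S ∩ (extChartAt I x₀).target := ⟨hxS, mem_extChartAt_target x₀⟩
  have h2 := (h1.contMDiffAt (hO.mem_nhds hm)).comp x₀ (contMDiffAt_extChartAt (n := ∞))
  refine h2.congr_of_eventuallyEq ?_
  filter_upwards [(isOpen_extChartAt_source (I := I) x₀).mem_nhds (mem_extChartAt_source x₀),
    (continuousAt_extChartAt x₀).preimage_mem_nhds (hO.mem_nhds hm)] with x hx hx'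
  have h3 := hV _ hx'.1 hx'.2
  rw [(extChartAt I x₀).left_inv hx] at h3
  have h4 : ∀ (x' : N) (v : E), x = x' → V x = v →
      (⟨x, V x⟩ : TangentBundle I N) = ⟨x', v⟩ := by
    rintro _ _ rfl rfl; rfl
  exact h4 _ _ ((extChartAt I x₀).left_inv hx).symm h3

end ChartFields

/-! ### The vector field in Moser's argument -/

section MoserField

universe u

variable {E : Type u} [NormedAddCommGroup E] [NormedSpace ℝ E] [FiniteDimensional ℝ E]
  {H : Type*} [TopologicalSpace H] {I : ModelWithCorners ℝ E H}
  {N : Type*} [TopologicalSpace N] [ChartedSpace H N]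

/-- The functional `-ρ` on `E × ℝ`. -/
noncomputable def negFst (ρ : E [⋀^Fin 1]→L[ℝ] ℝ) : E × ℝ →L[ℝ] ℝ :=
  -(oneFormCLM ρ).comp (ContinuousLinearMap.fst ℝ E ℝ)

theorem negFst_apply (ρ : E [⋀^Fin 1]→L[ℝ] ℝ) (v : E × ℝ) : negFst ρ v = -ρ ![v.1] := by
  rw [← oneFormCLM_apply]
  rfl

/-- The solution `ξ` of `(dt ∧ a + b)(ξ, ·) = -ρ`. -/
noncomputable def lineSolution (a : E [⋀^Fin 1]→L[ℝ] ℝ) (b : E [⋀^Fin 2]→L[ℝ] ℝ)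
    (ρ : E [⋀^Fin 1]→L[ℝ] ℝ) : E × ℝ := solveTwo (wedgeLine a b) (negFst ρ)

/-- The linear equation has a unique solution, so the solution is natural under isomorphisms of E.
With L the derivative of a chart this yields smoothness on the manifold; with L the derivative of a
group element it yields equivariance. -/
theorem lineSolution_comp {E' : Type*} [NormedAddCommGroup E'] [NormedSpace ℝ E']
    [FiniteDimensional ℝ E']
    {a ρ : E [⋀^Fin 1]→L[ℝ] ℝ} {b : E [⋀^Fin 2]→L[ℝ] ℝ} {L : E' →L[ℝ] E} {L' : E →L[ℝ] E'}
    (h1 : ∀ v, L (L' v) = v) (h2 : ∀ v, L' (L v) = v) (h : NondegTwo (wedgeLine a b)) :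
    NondegTwo (wedgeLine (a.compContinuousLinearMap L) (b.compContinuousLinearMap L)) ∧
      lineSolution a b ρ =
        (L (lineSolution (a.compContinuousLinearMap L) (b.compContinuousLinearMap L)
          (ρ.compContinuousLinearMap L)).1,
        (lineSolution (a.compContinuousLinearMap L) (b.compContinuousLinearMap L)
          (ρ.compContinuousLinearMap L)).2) := by
  have key : ∀ u v : E' × ℝ, wedgeLine (a.compContinuousLinearMap L) (b.compContinuousLinearMap L)
      ![u, v] = wedgeLine a b ![(L u.1, u.2), (L v.1, v.2)] := by
    intro u v
    rw [← wedgeLine_compContinuousLinearMap, ContinuousAlternatingMap.compContinuousLinearMap_apply]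
    congr 1
    funext i; fin_cases i <;> rfl
  have hnd : NondegTwo (wedgeLine (a.compContinuousLinearMap L) (b.compContinuousLinearMap L)) := by
    intro u hu
    have := h (L u.1, u.2) fun v => by
      have h3 := hu (L' v.1, v.2)
      rw [key] at h3
      simpa only [h1] using h3
    have h4 := congrArg Prod.fst this
    have h5 := congrArg Prod.snd this
    refine Prod.ext ?_ h5
    rw [← h2 u.1]
    exact (congrArg L' h4).trans (map_zero L')
  refine ⟨hnd, (h.eq_solveTwo fun v => ?_).symm⟩
  have h3 := hnd.solveTwo_apply (negFst (ρ.compContinuousLinearMap L)) (L' v.1, v.2)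
  rw [key, negFst_apply] at h3
  simp only [h1] at h3
  rw [negFst_apply]
  refine h3.trans ?_
  rw [ContinuousAlternatingMap.compContinuousLinearMap_apply]
  congr 2
  funext i; fin_cases i; exact h1 _

theorem ContDiffOn.negFst {X : Type*} [NormedAddCommGroup X] [NormedSpace ℝ X]
    {ρ : X → E [⋀^Fin 1]→L[ℝ] ℝ} {S : Set X} (h : ContDiffOn ℝ ∞ ρ S) :
    ContDiffOn ℝ ∞ (fun x => negFst (ρ x)) S :=
  contDiffOn_clm_apply.2 fun v => by
    simp only [negFst_apply]
    exact (h.apply_one v.1).neg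

variable [I.Boundaryless] [IsManifold I ∞ N]

theorem nondegTwo_inChart_iff {a : RawForm I N 1} {b : RawForm I N 2} {x₀ : N} {y : E}
    (hy : y ∈ (extChartAt I x₀).target) :
    NondegTwo (wedgeLine (RawForm.inChart I a x₀ y) (RawForm.inChart I b x₀ y)) ↔
    NondegTwo (wedgeLine (a.val ((extChartAt I x₀).symm y)) (b.val ((extChartAt I x₀).symm y))) := by
  obtain ⟨D, h1, h2⟩ := exists_chartDeriv_inverse hy
  refine ⟨fun h => ?_, fun h => (lineSolution_comp (ρ := 0) h1 h2 h).1⟩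
  have h3 := (lineSolution_comp (ρ := 0) h2 h1 h).1
  have h4 : ∀ {k : ℕ} (η : RawForm I N k), (RawForm.inChart I η x₀ y).compContinuousLinearMap D =
      η.val ((extChartAt I x₀).symm y) := by
    intro k η
    rw [RawForm.inChart_eq]
    ext v
    rw [ContinuousAlternatingMap.compContinuousLinearMap_apply,
      ContinuousAlternatingMap.compContinuousLinearMap_apply]
    congr 1
    funext i
    exact h1 (v i)
  rwa [h4, h4] at h3

/-- Nondegeneracy is an open condition. -/
theorem NondegTwo.eventually_family {X : Type*} [NormedAddCommGroup X] [NormedSpace ℝ X]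
    {J : Set X} (hJ : IsOpen J) {a : X → RawForm I N 1} {b : X → RawForm I N 2}
    (ha : IsSmoothFamily I J a) (hb : IsSmoothFamily I J b) {x : N} {q : X} (hq : q ∈ J)
    (h : NondegTwo (wedgeLine ((a q).val x) ((b q).val x))) :
    ∀ᶠ p : N × X in 𝓝 (x, q), NondegTwo (wedgeLine ((a p.2).val p.1) ((b p.2).val p.1)) := by
  have hO : IsOpen ((extChartAt I x).target ×ˢ J) := (isOpen_extChartAt_target x).prod hJ
  have hm : (extChartAt I x x, q) ∈ (extChartAt I x).target ×ˢ J := ⟨mem_extChartAt_target x, hq⟩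
  have h1 := NondegTwo.eventually hO ((ha x).wedgeLine (hb x)) hm
    ((nondegTwo_inChart_iff hm.1).2 (by rwa [extChartAt_to_inv x]))
  have h2 : ContinuousAt (fun p : N × X => (extChartAt I x p.1, p.2)) (x, q) :=
    ContinuousAt.prodMk
      (ContinuousAt.comp (f := Prod.fst) (continuousAt_extChartAt x) continuousAt_fst)
      continuousAt_snd
  filter_upwards [h2.eventually h1, continuousAt_fst.preimage_mem_nhds
    ((isOpen_extChartAt_source (I := I) x).mem_nhds (mem_extChartAt_source x))] with p hp hp'
  have h3 := (nondegTwo_inChart_iff ((extChartAt I x).map_source hp')).1 hp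
  rwa [(extChartAt I x).left_inv hp'] at h3

theorem chartDeriv_prod_line_two (x₀ : (N × ℝ) × ℝ) {p : (E × ℝ) × ℝ}
    (hp : p.1.1 ∈ (extChartAt I x₀.1.1).target) (v : (E × ℝ) × ℝ) :
    chartDeriv ((I.prod 𝓘(ℝ, ℝ)).prod 𝓘(ℝ, ℝ)) x₀ p v =
      ((chartDeriv I x₀.1.1 p.1.1 v.1.1, v.1.2), v.2) := by
  rw [chartDeriv_prod_line (I := I.prod 𝓘(ℝ, ℝ)) x₀
    (by rw [extChartAt_prod_line]; exact ⟨hp, mem_univ _⟩), chartDeriv_prod_line (I := I) x₀.1 hp]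
  rfl

/-- Smoothness of the field `χ (t ξ', t^{m+1} ξ'', 1)`, where `(ξ', ξ'')` solves the linear
equation of Moser's argument. -/
theorem contMDiffAt_moserField {m : ℕ} {J : Set (ℝ × ℝ)} (hJ : IsOpen J)
    {a r : ℝ × ℝ → RawForm I N 1} {b : ℝ × ℝ → RawForm I N 2}
    (ha : IsSmoothFamily I J a) (hr : IsSmoothFamily I J r) (hb : IsSmoothFamily I J b)
    {χ : ℝ × ℝ → ℝ} (hχ : ContDiff ℝ ∞ χ) {p : (N × ℝ) × ℝ} (hp : (p.1.2, p.2) ∈ J)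
    (h : NondegTwo (wedgeLine ((a (p.1.2, p.2)).val p.1.1) ((b (p.1.2, p.2)).val p.1.1))) :
    ContMDiffAt ((I.prod 𝓘(ℝ, ℝ)).prod 𝓘(ℝ, ℝ)) ((I.prod 𝓘(ℝ, ℝ)).prod 𝓘(ℝ, ℝ)).tangent ∞
      (fun p : (N × ℝ) × ℝ => (⟨p, (χ (p.1.2, p.2) •
        ((p.1.2 • (lineSolution ((a (p.1.2, p.2)).val p.1.1) ((b (p.1.2, p.2)).val p.1.1)
          ((r (p.1.2, p.2)).val p.1.1)).1,
        p.1.2 ^ (m + 1) * (lineSolution ((a (p.1.2, p.2)).val p.1.1) ((b (p.1.2, p.2)).val p.1.1)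
          ((r (p.1.2, p.2)).val p.1.1)).2), (1 : ℝ)) : (E × ℝ) × ℝ)⟩ :
        TangentBundle ((I.prod 𝓘(ℝ, ℝ)).prod 𝓘(ℝ, ℝ)) ((N × ℝ) × ℝ))) p := by
  have hO : IsOpen ((extChartAt I p.1.1).target ×ˢ J) := (isOpen_extChartAt_target _).prod hJ
  set Y : E × (ℝ × ℝ) → E × ℝ := fun q => lineSolution (RawForm.inChart I (a q.2) p.1.1 q.1)
    (RawForm.inChart I (b q.2) p.1.1 q.1) (RawForm.inChart I (r q.2) p.1.1 q.1) with hY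
  set W : Set (E × (ℝ × ℝ)) := {q | q ∈ (extChartAt I p.1.1).target ×ˢ J ∧
    NondegTwo (wedgeLine (RawForm.inChart I (a q.2) p.1.1 q.1)
      (RawForm.inChart I (b q.2) p.1.1 q.1))} with hW
  have hφ := (ha p.1.1).wedgeLine (hb p.1.1)
  have hWo : IsOpen W := isOpen_iff_mem_nhds.2 fun q hq =>
    Filter.inter_mem (hO.mem_nhds hq.1) (NondegTwo.eventually hO hφ hq.1 hq.2)
  have hYs : ContDiffOn ℝ ∞ Y W := fun q hq =>
    (ContDiffAt.solveTwo hO hφ (hr p.1.1).negFst hq.1 hq.2).contDiffWithinAt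
  set c : (E × ℝ) × ℝ → E × (ℝ × ℝ) := fun q => (q.1.1, (q.1.2, q.2)) with hc
  have hcs : ContDiff ℝ ∞ c := by fun_prop
  refine contMDiffAt_section_of_chartDeriv (I := (I.prod 𝓘(ℝ, ℝ)).prod 𝓘(ℝ, ℝ))
    (X := fun q => χ (q.1.2, q.2) • ((q.1.2 • (Y (c q)).1, q.1.2 ^ (m + 1) * (Y (c q)).2), (1 : ℝ)))
    (S := c ⁻¹' W) (hWo.preimage hcs.continuous) ?_ ?_ ?_
  · rw [extChartAt_prod_line, extChartAt_prod_line]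
    have h1 : p.1.1 ∈ (extChartAt I p.1.1).source := mem_extChartAt_source _
    refine ⟨⟨(extChartAt I p.1.1).map_source h1, hp⟩, (nondegTwo_inChart_iff
      ((extChartAt I p.1.1).map_source h1)).2 ?_⟩
    rw [(extChartAt I p.1.1).left_inv h1]
    exact h
  · have h1 : ContDiffOn ℝ ∞ (fun q => Y (c q)) (c ⁻¹' W) :=
      hYs.comp hcs.contDiffOn fun q hq => hq
    have h2 : ContDiff ℝ ∞ (fun q : (E × ℝ) × ℝ => q.1.2) := by fun_prop
    have h3 : ContDiff ℝ ∞ (fun q : (E × ℝ) × ℝ => χ (q.1.2, q.2)) := hχ.comp (by fun_prop)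
    exact h3.contDiffOn.smul (((h2.contDiffOn.smul (contDiff_fst.comp_contDiffOn h1)).prodMk
      ((h2.contDiffOn.pow _).mul (contDiff_snd.comp_contDiffOn h1))).prodMk contDiffOn_const)
  · intro q hq hqt
    have hq1 : q.1.1 ∈ (extChartAt I p.1.1).target := hq.1.1
    rw [chartDeriv_prod_line_two p hq1]
    obtain ⟨D, d1, d2⟩ := exists_chartDeriv_inverse hq1
    have h4 := (lineSolution_comp (ρ := (r (q.1.2, q.2)).val ((extChartAt I p.1.1).symm q.1.1))
      d1 d2 ((nondegTwo_inChart_iff hq1).1 hq.2)).2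
    rw [extChartAt_prod_line, extChartAt_prod_line]
    change χ (q.1.2, q.2) • ((q.1.2 • (lineSolution
      ((a (q.1.2, q.2)).val ((extChartAt I p.1.1).symm q.1.1))
      ((b (q.1.2, q.2)).val ((extChartAt I p.1.1).symm q.1.1))
      ((r (q.1.2, q.2)).val ((extChartAt I p.1.1).symm q.1.1))).1, q.1.2 ^ (m + 1) * (lineSolution
      ((a (q.1.2, q.2)).val ((extChartAt I p.1.1).symm q.1.1))
      ((b (q.1.2, q.2)).val ((extChartAt I p.1.1).symm q.1.1))
      ((r (q.1.2, q.2)).val ((extChartAt I p.1.1).symm q.1.1))).2), (1 : ℝ)) = _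
    rw [h4]
    refine Prod.ext (Prod.ext ?_ rfl) rfl
    change _ • (_ • chartDeriv I p.1.1 q.1.1 _) = chartDeriv I p.1.1 q.1.1 _
    rw [← map_smul, ← map_smul]
    rfl

end MoserField

/-! ### Properties of flows -/

section FlowProperties

variable {E : Type*} [NormedAddCommGroup E] [NormedSpace ℝ E] [CompleteSpace E]
  {H : Type*} [TopologicalSpace H] {I : ModelWithCorners ℝ E H}
  {N : Type*} [TopologicalSpace N] [ChartedSpace H N] [I.Boundaryless] [IsManifold I ∞ N]
  [T2Space N]

theorem flow_add {V : ∀ x : N, TangentSpace I x}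
    (hV : ContMDiff I I.tangent ∞ (fun x => (⟨x, V x⟩ : TangentBundle I N))) {θ : N × ℝ → N}
    (h0 : ∀ x, θ (x, 0) = x) (hθ : ∀ x, IsMIntegralCurve (fun t => θ (x, t)) V) (x : N) (a t : ℝ) :
    θ (θ (x, a), t) = θ (x, t + a) := by
  have : IsManifold I 1 N := IsManifold.of_le (n := ∞) (by simp)
  exact congrFun (isMIntegralCurve_Ioo_eq_of_contMDiff_boundaryless (t₀ := 0) (hV.of_le (by simp))
    (hθ (θ (x, a))) ((hθ x).comp_add a) (by simp [h0])) t

/-- A map preserving V carries integral curves to integral curves, and these are determined by their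
initial points. -/
theorem flow_equivariant {V : ∀ x : N, TangentSpace I x}
    (hV : ContMDiff I I.tangent ∞ (fun x => (⟨x, V x⟩ : TangentBundle I N))) {θ : N × ℝ → N}
    (h0 : ∀ x, θ (x, 0) = x) (hθ : ∀ x, IsMIntegralCurve (fun t => θ (x, t)) V) {g : N → N}
    (hg : ContMDiff I I ∞ g) (hgV : ∀ x, mfderiv I I g x (V x) = V (g x)) (x : N) (t : ℝ) :
    θ (g x, t) = g (θ (x, t)) := by
  have : IsManifold I 1 N := IsManifold.of_le (n := ∞) (by simp)
  have h1 : IsMIntegralCurve (fun t => g (θ (x, t))) V := by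
    intro t
    have h2 := ((hg (θ (x, t))).mdifferentiableAt (by simp)).hasMFDerivAt.comp t (hθ x t)
    have h3 : ((mfderiv I I g (θ (x, t)) : E →L[ℝ] E).comp
        ((1 : ℝ →L[ℝ] ℝ).smulRight (V (θ (x, t)) : E)) : ℝ →L[ℝ] E) =
        (1 : ℝ →L[ℝ] ℝ).smulRight (V (g (θ (x, t))) : E) := by
      ext
      refine (congrArg (mfderiv I I g (θ (x, t)) : E →L[ℝ] E) (one_smul ℝ _)).trans ?_
      exact (hgV _).trans (one_smul ℝ (V (g (θ (x, t))) : E)).symm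
    exact h3 ▸ h2
  exact congrFun (isMIntegralCurve_Ioo_eq_of_contMDiff_boundaryless (t₀ := 0) (hV.of_le (by simp))
    (hθ (g x)) h1 (by simp [h0])) t

end FlowProperties

/-! ### Curves in a product with a line -/

section Components

variable {E : Type*} [NormedAddCommGroup E] [NormedSpace ℝ E]
  {H : Type*} [TopologicalSpace H] {I : ModelWithCorners ℝ E H}
  {N : Type*} [TopologicalSpace N] [ChartedSpace H N]

theorem HasMFDerivAt.hasDerivAt_snd {γ : ℝ → N × ℝ} {r : ℝ} {v : E × ℝ}
    (h : HasMFDerivAt 𝓘(ℝ, ℝ) (I.prod 𝓘(ℝ, ℝ)) γ r ((1 : ℝ →L[ℝ] ℝ).smulRight v)) :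
    HasDerivAt (fun r => (γ r).2) v.2 r := by
  have h1 := (hasMFDerivAt_snd (I := I) (I' := 𝓘(ℝ, ℝ)) (γ r)).comp r h
  have h2 : HasFDerivAt (fun r => (γ r).2) ((1 : ℝ →L[ℝ] ℝ).smulRight v.2) r := h1.hasFDerivAt
  simpa using h2.hasDerivAt

theorem HasMFDerivAt.fst_curve {γ : ℝ → N × ℝ} {r : ℝ} {v : E × ℝ}
    (h : HasMFDerivAt 𝓘(ℝ, ℝ) (I.prod 𝓘(ℝ, ℝ)) γ r ((1 : ℝ →L[ℝ] ℝ).smulRight v)) :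
    HasMFDerivAt 𝓘(ℝ, ℝ) I (fun r => (γ r).1) r ((1 : ℝ →L[ℝ] ℝ).smulRight v.1) :=
  (hasMFDerivAt_fst (I := I) (I' := 𝓘(ℝ, ℝ)) (γ r)).comp r h

theorem modelDeriv_apply_zero_one {E' : Type*} [NormedAddCommGroup E'] [NormedSpace ℝ E']
    {H' : Type*} [TopologicalSpace H'] {I' : ModelWithCorners ℝ E' H'}
    {N' : Type*} [TopologicalSpace N'] [ChartedSpace H' N'] {G : N × ℝ → N'} {p : N} {r : ℝ}
    {v : E'} (hG : MDifferentiableAt (I.prod 𝓘(ℝ, ℝ)) I' G (p, r))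
    (h : HasMFDerivAt 𝓘(ℝ, ℝ) I' (fun r => G (p, r)) r ((1 : ℝ →L[ℝ] ℝ).smulRight v)) :
    modelDeriv (I.prod 𝓘(ℝ, ℝ)) I' G (p, r) (0, 1) = v := by
  have h1 : HasMFDerivAt 𝓘(ℝ, ℝ) (I.prod 𝓘(ℝ, ℝ)) (fun r : ℝ => (p, r)) r _ :=
    (hasMFDerivAt_const p r).prodMk (hasMFDerivAt_id r)
  have h2 := hG.hasMFDerivAt.comp r h1
  have h3 := congrArg (fun L : ℝ →L[ℝ] E' => L 1) (hasMFDerivAt_unique h2 h)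
  exact h3.trans (one_smul ℝ v)

end Components

/-! ### The isotopy -/

section IsotopyFlow

universe u

variable {E : Type u} [NormedAddCommGroup E] [NormedSpace ℝ E] [FiniteDimensional ℝ E]
  {H : Type*} [TopologicalSpace H] {I : ModelWithCorners ℝ E H}
  {N : Type*} [TopologicalSpace N] [ChartedSpace H N] [I.Boundaryless] [IsManifold I ∞ N]
  [T2Space N] [CompactSpace N]

/-- The vector field `χ (t ξ', t^{m+1} ξ'', 1)`. -/
def isotopyField (m : ℕ) (χ : ℝ × ℝ → ℝ) (ξ : (N × ℝ) × ℝ → E × ℝ) (p : (N × ℝ) × ℝ) :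
    (E × ℝ) × ℝ :=
  χ (p.1.2, p.2) • ((p.1.2 • (ξ p).1, p.1.2 ^ (m + 1) * (ξ p).2), (1 : ℝ))

/-- From |τ'| ≤ ρ^m C |τ| Grönwall bounds |τ r| by a multiple of |τ 0|. Inserting this bound back
into τ' = τ^(m+1) ζ gives an increment of order m + 1, the source of t ∘ Ψ = t + O(t^(m+1)). -/
theorem abs_sub_le_of_hasDerivAt_pow {m : ℕ} {τ ζ : ℝ → ℝ} {ρ C : ℝ}
    (hτ : ∀ r ∈ Icc (0 : ℝ) 1, HasDerivAt τ (τ r ^ (m + 1) * ζ r) r)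
    (hρ : ∀ r ∈ Icc (0 : ℝ) 1, |τ r| ≤ ρ) (hC : ∀ r ∈ Icc (0 : ℝ) 1, |ζ r| ≤ C) :
    |τ 1 - τ 0| ≤ C * Real.exp (ρ ^ m * C) ^ (m + 1) * |τ 0| ^ (m + 1) := by
  have h00 : (0 : ℝ) ∈ Icc (0 : ℝ) 1 := ⟨le_rfl, zero_le_one⟩
  have hC0 : 0 ≤ C := (abs_nonneg _).trans (hC 0 h00)
  have hρ0 : 0 ≤ ρ := (abs_nonneg _).trans (hρ 0 h00)
  have hg : ∀ r ∈ Icc (0 : ℝ) 1, |τ r| ≤ |τ 0| * Real.exp (ρ ^ m * C) := by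
    intro r hr
    have h1 := norm_le_gronwallBound_of_norm_deriv_right_le (f := τ)
      (f' := fun r => τ r ^ (m + 1) * ζ r) (δ := |τ 0|) (K := ρ ^ m * C) (ε := 0) (a := 0) (b := 1)
      (fun r hr => (hτ r hr).continuousAt.continuousWithinAt)
      (fun r hr => (hτ r ⟨hr.1, hr.2.le⟩).hasDerivWithinAt) le_rfl (fun r hr => by
        have hr' : r ∈ Icc (0 : ℝ) 1 := ⟨hr.1, hr.2.le⟩
        rw [Real.norm_eq_abs, Real.norm_eq_abs, abs_mul, abs_pow, pow_succ, add_zero]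
        have h2 : |τ r| ^ m ≤ ρ ^ m := pow_le_pow_left₀ (abs_nonneg _) (hρ r hr') m
        have h3 := mul_le_mul h2 (hC r hr') (abs_nonneg _) (by positivity)
        nlinarith [mul_le_mul_of_nonneg_right h3 (abs_nonneg (τ r))]) r hr
    rw [gronwallBound_ε0, Real.norm_eq_abs] at h1
    refine h1.trans (mul_le_mul_of_nonneg_left (Real.exp_le_exp.2 ?_) (abs_nonneg _))
    have : 0 ≤ ρ ^ m * C := by positivity
    nlinarith [hr.2]
  have h4 := norm_image_sub_le_of_norm_deriv_le_segment_01' (f := τ)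
    (f' := fun r => τ r ^ (m + 1) * ζ r) (C := C * Real.exp (ρ ^ m * C) ^ (m + 1) * |τ 0| ^ (m + 1))
    (fun r hr => (hτ r hr).hasDerivWithinAt) (fun r hr => by
      have hr' : r ∈ Icc (0 : ℝ) 1 := ⟨hr.1, hr.2.le⟩
      rw [Real.norm_eq_abs, abs_mul, abs_pow]
      have h2 := pow_le_pow_left₀ (abs_nonneg _) (hg r hr') (m + 1)
      have h3 := mul_le_mul h2 (hC r hr') (abs_nonneg _) (by positivity)
      rw [mul_pow] at h3
      linarith)
  exact h4

/-- The time s is made a coordinate, so that the isotopy and the inverse of its time-one map both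
come from the global flow of one autonomous, compactly supported field. Where the cutoff is 1 the
s-component is 1, so a curve starting at s = 0 has s as its parameter. On t = 0 the field is ∂_s,
hence the hypersurface is fixed and nearby curves stay in the good region. -/
theorem exists_isotopy {m : ℕ} {ξ : (N × ℝ) × ℝ → E × ℝ} {χ : ℝ × ℝ → ℝ} {ρ C : ℝ} (hρ : 0 < ρ)
    (hχ1 : ∀ t s, |t| < ρ → |s| < 2 → χ (t, s) = 1) {K : Set (ℝ × ℝ)} (hK : IsCompact K)
    (hχK : ∀ q ∉ K, χ q = 0)
    (hC : ∀ p : (N × ℝ) × ℝ, |p.1.2| < ρ → |p.2| < 2 → |(ξ p).2| ≤ C)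
    (hV : ContMDiff ((I.prod 𝓘(ℝ, ℝ)).prod 𝓘(ℝ, ℝ)) ((I.prod 𝓘(ℝ, ℝ)).prod 𝓘(ℝ, ℝ)).tangent ∞
      (fun p : (N × ℝ) × ℝ => (⟨p, isotopyField m χ ξ p⟩ :
        TangentBundle ((I.prod 𝓘(ℝ, ℝ)).prod 𝓘(ℝ, ℝ)) ((N × ℝ) × ℝ)))) :
    ∃ (ε C' : ℝ) (G : (N × ℝ) × ℝ → N × ℝ) (Ψ' : N × ℝ → N × ℝ) (O : Set (N × ℝ)),
      0 < ε ∧ ContMDiff ((I.prod 𝓘(ℝ, ℝ)).prod 𝓘(ℝ, ℝ)) (I.prod 𝓘(ℝ, ℝ)) ∞ G ∧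
      ContMDiff (I.prod 𝓘(ℝ, ℝ)) (I.prod 𝓘(ℝ, ℝ)) ∞ Ψ' ∧ IsOpen O ∧ (∀ q ∈ O, |q.2| < ρ) ∧
      (∀ p, G (p, 0) = p) ∧ (∀ x, G ((x, 0), 1) = (x, 0)) ∧
      MapsTo (fun p => G (p, 1)) (univ ×ˢ Ioo (-ε) ε) O ∧
      MapsTo Ψ' O (univ ×ˢ Ioo (-ε) ε) ∧
      (∀ p ∈ (univ : Set N) ×ˢ Ioo (-ε) ε, Ψ' (G (p, 1)) = p) ∧
      (∀ q ∈ O, G (Ψ' q, 1) = q) ∧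
      (∀ p ∈ (univ : Set N) ×ˢ Ioo (-ε) ε, ∀ r ∈ Ioo (-1 / 2 : ℝ) (3 / 2),
        |(G (p, r)).2| < ρ ∧
        modelDeriv ((I.prod 𝓘(ℝ, ℝ)).prod 𝓘(ℝ, ℝ)) (I.prod 𝓘(ℝ, ℝ)) G (p, r) (0, 1) =
          ((G (p, r)).2 • (ξ (G (p, r), r)).1, (G (p, r)).2 ^ (m + 1) * (ξ (G (p, r), r)).2) ∧
        (p.2 ≠ 0 → (G (p, r)).2 ≠ 0)) ∧
      (∀ p ∈ (univ : Set N) ×ˢ Ioo (-ε) ε, |(G (p, 1)).2 - p.2| ≤ C' * |p.2| ^ (m + 1)) ∧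
      ∀ g : N → N, ContMDiff I I ∞ g → (∀ x t s, χ (t, s) ≠ 0 → ξ ((g x, t), s) =
        (modelDeriv I I g x (ξ ((x, t), s)).1, (ξ ((x, t), s)).2)) →
        ∀ x t r, G ((g x, t), r) = (g (G ((x, t), r)).1, (G ((x, t), r)).2) := by
  set I' := I.prod 𝓘(ℝ, ℝ) with hI'
  set I'' := I'.prod 𝓘(ℝ, ℝ) with hI''
  have hVK : ∀ p ∉ {p : (N × ℝ) × ℝ | (p.1.2, p.2) ∈ K}, isotopyField m χ ξ p = 0 := by
    intro p hp
    rw [isotopyField, hχK _ hp, zero_smul]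
  have hKc : IsCompact {p : (N × ℝ) × ℝ | (p.1.2, p.2) ∈ K} := by
    have h1 : {p : (N × ℝ) × ℝ | (p.1.2, p.2) ∈ K} =
        (fun q : N × (ℝ × ℝ) => ((q.1, q.2.1), q.2.2)) '' (univ ×ˢ K) := by
      ext ⟨⟨x, t⟩, s⟩
      constructor
      · intro h
        exact ⟨(x, (t, s)), ⟨mem_univ _, h⟩, rfl⟩
      · rintro ⟨⟨x', q⟩, ⟨-, hq⟩, hq'⟩
        simp only [Prod.mk.injEq] at hq'
        obtain ⟨⟨rfl, rfl⟩, rfl⟩ := hq'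
        exact hq
    rw [h1]
    exact (isCompact_univ.prod hK).image (by fun_prop)
  obtain ⟨θ, hθs, hθ0, hθ⟩ := exists_contMDiff_flow (I := I'') hV hKc hVK
  have hadd := flow_add (I := I'') hV hθ0 hθ
  have hθc : Continuous θ := hθs.continuous
  set Q : Set ((N × ℝ) × ℝ) := {p | |p.1.2| < ρ ∧ |p.2| < 2} with hQ
  have hQo : IsOpen Q := by
    have h1 : IsOpen {p : (N × ℝ) × ℝ | |p.1.2| < ρ} := isOpen_lt (by fun_prop) continuous_const
    have h2 : IsOpen {p : (N × ℝ) × ℝ | |p.2| < 2} := isOpen_lt (by fun_prop) continuous_const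
    exact h1.inter h2
  have hVQ : ∀ p ∈ Q, isotopyField m χ ξ p =
      ((p.1.2 • (ξ p).1, p.1.2 ^ (m + 1) * (ξ p).2), (1 : ℝ)) := by
    intro p hp
    rw [isotopyField, hχ1 _ _ hp.1 hp.2, one_smul]
  have hd : ∀ p r, HasMFDerivAt 𝓘(ℝ, ℝ) I'' (fun r => θ (p, r)) r
      ((1 : ℝ →L[ℝ] ℝ).smulRight (isotopyField m χ ξ (θ (p, r)))) := fun p r => hθ p r
  -- While a curve stays in Q its s-component moves with unit speed.
  have hs : ∀ (p : (N × ℝ) × ℝ) (a b : ℝ), (∀ r ∈ Icc a b, θ (p, r) ∈ Q) → ∀ r ∈ Icc a b,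
      ∀ r' ∈ Icc a b, (θ (p, r)).2 - r = (θ (p, r')).2 - r' := by
    intro p a b hab
    have h1 : ∀ r ∈ Icc a b, HasDerivAt (fun r => (θ (p, r)).2 - r) 0 r := by
      intro r hr
      have h2 := (hd p r).hasDerivAt_snd.sub (hasDerivAt_id r)
      rw [hVQ _ (hab r hr), sub_self] at h2
      exact h2
    have h3 := constant_of_has_deriv_right_zero (f := fun r => (θ (p, r)).2 - r)
      (fun r hr => (h1 r hr).continuousAt.continuousWithinAt)
      (fun r hr => (h1 r ⟨hr.1, hr.2.le⟩).hasDerivWithinAt)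
    intro r hr r' hr'
    exact (h3 r hr).trans (h3 r' hr').symm
  have hzero : ∀ (x : N), ∀ r ∈ Ioo (-2 : ℝ) 2, θ (((x, 0), 0), r) = ((x, 0), r) := by
    intro x
    have : IsManifold I'' 1 ((N × ℝ) × ℝ) := IsManifold.of_le (n := ∞) (by simp)
    refine isMIntegralCurveOn_Ioo_eqOn_of_contMDiff_boundaryless (I := I'') (t₀ := 0) (by norm_num)
      (hV.of_le (by simp)) ((hθ _).isMIntegralCurveOn _) (fun r hr => ?_) (hθ0 _)
    have h1 : HasMFDerivAt 𝓘(ℝ, ℝ) I'' (fun r : ℝ => ((x, (0 : ℝ)), r)) r _ :=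
      (hasMFDerivAt_const (x, (0 : ℝ)) r).prodMk (hasMFDerivAt_id r)
    refine HasMFDerivAt.hasMFDerivWithinAt ?_
    have h2 : isotopyField m χ ξ ((x, (0 : ℝ)), r) = (((0 : E), (0 : ℝ)), (1 : ℝ)) := by
      have hq : ((x, (0 : ℝ)), r) ∈ Q := ⟨by simpa using hρ, abs_lt.2 hr⟩
      rw [hVQ _ hq]
      simp
    have h3 : ((0 : ℝ →L[ℝ] E × ℝ).prod (ContinuousLinearMap.id ℝ ℝ) : ℝ →L[ℝ] (E × ℝ) × ℝ) =
        (1 : ℝ →L[ℝ] ℝ).smulRight (isotopyField m χ ξ ((x, (0 : ℝ)), r)) := by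
      rw [h2]
      ext <;> simp
    exact h3 ▸ h1
  have hI1 : Icc (-1 / 2 : ℝ) (3 / 2) ⊆ Ioo (-2) 2 := fun r hr =>
    ⟨by linarith [hr.1], by linarith [hr.2]⟩
  -- Curves starting on t = 0 stay in Q, so by compactness nearby ones do. The time interval
  -- contains [0, 1] in its interior because Moser's argument needs an open set of times.
  obtain ⟨ε, hε, hεQ⟩ : ∃ ε > 0, ∀ p ∈ (univ : Set N) ×ˢ Ioo (-ε) ε,
      ∀ r ∈ Icc (-1 / 2 : ℝ) (3 / 2), θ ((p, 0), r) ∈ Q := by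
    have h1 := (isCompact_univ.prod isCompact_Icc :
      IsCompact ((univ : Set N) ×ˢ Icc (-1 / 2 : ℝ) (3 / 2))).eventually_forall_of_forall_eventually
      (x₀ := (0 : ℝ)) (P := fun t y => θ (((y.1, t), 0), y.2) ∈ Q) (by
        rintro ⟨x, r⟩ ⟨-, hr⟩
        have h2 : Continuous (fun z : ℝ × (N × ℝ) => θ (((z.2.1, z.1), 0), z.2.2)) := by fun_prop
        refine h2.continuousAt.preimage_mem_nhds (hQo.mem_nhds ?_)
        change θ (((x, 0), 0), r) ∈ Q
        rw [hzero x r (hI1 hr)]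
        exact ⟨by simpa using hρ, abs_lt.2 (hI1 hr)⟩)
    obtain ⟨ε, hε, h3⟩ := Metric.eventually_nhds_iff.1 h1
    refine ⟨ε, hε, fun p hp r hr => h3 ?_ (p.1, r) ⟨mem_univ _, hr⟩⟩
    rw [Real.dist_eq, sub_zero]
    exact abs_lt.2 hp.2
  have hz' : (0 : ℝ) ∈ Icc (-1 / 2 : ℝ) (3 / 2) := by constructor <;> norm_num
  have ho' : (1 : ℝ) ∈ Icc (-1 / 2 : ℝ) (3 / 2) := by constructor <;> norm_num
  have hsr : ∀ p ∈ (univ : Set N) ×ˢ Ioo (-ε) ε, ∀ r ∈ Icc (-1 / 2 : ℝ) (3 / 2),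
      (θ ((p, 0), r)).2 = r := by
    intro p hp r hr
    have := hs (p, 0) _ _ (hεQ p hp) r hr 0 hz'
    rw [hθ0] at this
    simpa [sub_eq_zero] using this
  set G : (N × ℝ) × ℝ → N × ℝ := fun q => (θ ((q.1, 0), q.2)).1 with hG
  set Ψ' : N × ℝ → N × ℝ := fun q => (θ ((q, 1), -1)).1 with hΨ'
  have hGs : ContMDiff I'' I' ∞ G := by
    refine contMDiff_fst.comp (hθs.comp ?_)
    exact (contMDiff_fst.prodMk contMDiff_const).prodMk contMDiff_snd
  have hΨs : ContMDiff I' I' ∞ Ψ' := by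
    refine contMDiff_fst.comp (hθs.comp ?_)
    exact (contMDiff_id.prodMk contMDiff_const).prodMk contMDiff_const
  have hGθ : ∀ p ∈ (univ : Set N) ×ˢ Ioo (-ε) ε, ∀ r ∈ Icc (-1 / 2 : ℝ) (3 / 2),
      θ ((p, 0), r) = (G (p, r), r) := fun p hp r hr => Prod.ext rfl (hsr p hp r hr)
  -- The image of the tube under the time-one map, described by open conditions: the backward curve
  -- stays in Q and ends in the tube.
  set O : Set (N × ℝ) := {q | (∀ r ∈ Icc (-1 : ℝ) 0, θ ((q, 1), r) ∈ Q) ∧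
    |(Ψ' q).2| < ε} with hO
  have hOo : IsOpen O := by
    refine IsOpen.inter (isOpen_iff_mem_nhds.2 fun q hq => ?_)
      (isOpen_lt ((continuous_snd.comp hΨs.continuous).abs) continuous_const)
    refine isCompact_Icc.eventually_forall_of_forall_eventually
      (P := fun (q : N × ℝ) r => θ ((q, 1), r) ∈ Q) fun r hr => ?_
    have h2 : Continuous (fun z : (N × ℝ) × ℝ => θ ((z.1, 1), z.2)) := by fun_prop
    exact h2.continuousAt.preimage_mem_nhds (hQo.mem_nhds (hq r hr))
  have hback : ∀ p ∈ (univ : Set N) ×ˢ Ioo (-ε) ε, ∀ r, θ ((G (p, 1), 1), r) =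
      θ ((p, 0), r + 1) := by
    intro p hp r
    rw [← hGθ p hp 1 ho', hadd]
  have hΨG : ∀ p ∈ (univ : Set N) ×ˢ Ioo (-ε) ε, Ψ' (G (p, 1)) = p := by
    intro p hp
    change (θ ((G (p, 1), 1), -1)).1 = p
    rw [hback p hp, neg_add_cancel, hθ0]
  have hder : ∀ p ∈ (univ : Set N) ×ˢ Ioo (-ε) ε, ∀ r ∈ Icc (-1 / 2 : ℝ) (3 / 2),
      HasMFDerivAt 𝓘(ℝ, ℝ) I' (fun r => G (p, r)) r ((1 : ℝ →L[ℝ] ℝ).smulRight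
        (((G (p, r)).2 • (ξ (G (p, r), r)).1, (G (p, r)).2 ^ (m + 1) * (ξ (G (p, r), r)).2) :
          E × ℝ)) := by
    intro p hp r hr
    have h1 := (hd (p, 0) r).fst_curve
    rw [hVQ _ (hεQ p hp r hr), hGθ p hp r hr] at h1
    exact h1
  refine ⟨ε, C * Real.exp (ρ ^ m * C) ^ (m + 1), G, Ψ', O, hε, hGs, hΨs, hOo, fun q hq => ?_,
    fun p => ?_, fun x => ?_, fun p hp => ⟨fun r hr => ?_, ?_⟩, fun q hq => ⟨mem_univ _, abs_lt.1 hq.2⟩,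
    hΨG, fun q hq => ?_, fun p hp r hr => ?_, fun p hp => ?_, fun g hg hgξ x t r => ?_⟩
  · have := hq.1 0 ⟨by norm_num, le_rfl⟩
    rw [hθ0] at this
    exact this.1
  · change (θ ((p, 0), 0)).1 = p
    rw [hθ0]
  · change (θ (((x, 0), 0), 1)).1 = (x, 0)
    rw [hzero x 1 (by norm_num)]
  · change θ ((G (p, 1), 1), r) ∈ Q
    rw [hback p hp]
    exact hεQ p hp _ ⟨by linarith [hr.1], by linarith [hr.2]⟩
  · rw [hΨG p hp]
    exact abs_lt.2 hp.2
  · have h1 := hs (q, 1) (-1) 0 hq.1 (-1) ⟨le_rfl, by norm_num⟩ 0 ⟨by norm_num, le_rfl⟩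
    rw [hθ0] at h1
    have h2 : θ ((q, 1), -1) = (Ψ' q, 0) := Prod.ext rfl (by linarith)
    change (θ ((Ψ' q, 0), 1)).1 = q
    rw [← h2, hadd, add_neg_cancel, hθ0]
  · have hr' : r ∈ Icc (-1 / 2 : ℝ) (3 / 2) := ⟨hr.1.le, hr.2.le⟩
    refine ⟨(hεQ p hp r hr').1, modelDeriv_apply_zero_one ((hGs (p, r)).mdifferentiableAt (by simp))
      (hder p hp r hr'), fun hp0 h0 => hp0 ?_⟩
    -- A curve that meets t = 0 coincides with the curve inside t = 0 through that point, so it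
    -- started there.
    have h1 : θ ((p, 0), r) = ((((G (p, r)).1, 0), r) : (N × ℝ) × ℝ) := by
      rw [hGθ p hp r hr']
      exact Prod.ext (Prod.ext rfl h0) rfl
    have h2 := hadd ((p, 0)) r (-r)
    rw [neg_add_cancel, hθ0, h1, ← hzero _ r (hI1 hr'), hadd, neg_add_cancel, hθ0] at h2
    exact (congrArg (fun q : (N × ℝ) × ℝ => q.1.2) h2).symm
  · have h01 : ∀ r ∈ Icc (0 : ℝ) 1, r ∈ Icc (-1 / 2 : ℝ) (3 / 2) := fun r hr =>
      ⟨by linarith [hr.1], by linarith [hr.2]⟩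
    have h1 := abs_sub_le_of_hasDerivAt_pow (m := m) (τ := fun r => (G (p, r)).2)
      (ζ := fun r => (ξ (G (p, r), r)).2) (ρ := ρ) (C := C)
      (fun r hr => (hder p hp r (h01 r hr)).hasDerivAt_snd)
      (fun r hr => (hεQ p hp r (h01 r hr)).1.le) (fun r hr => by
        have h2 := hεQ p hp r (h01 r hr)
        rw [hGθ p hp r (h01 r hr)] at h2
        exact hC _ h2.1 h2.2)
    have h2 : G (p, 0) = p := by
      change (θ ((p, 0), 0)).1 = p
      rw [hθ0]
    simpa only [h2] using h1
  · have hg' : ContMDiff I'' I'' ∞ (fun p : (N × ℝ) × ℝ => ((g p.1.1, p.1.2), p.2)) :=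
      ((hg.comp (contMDiff_fst.comp contMDiff_fst)).prodMk
        (contMDiff_snd.comp contMDiff_fst)).prodMk contMDiff_snd
    have h1 := flow_equivariant (I := I'') hV hθ0 hθ hg' (fun p => ?_) ((x, t), 0) r
    · exact congrArg Prod.fst h1
    · have h2 := ((hg p.1.1).mdifferentiableAt (by simp)).hasMFDerivAt.comp p
        ((hasMFDerivAt_fst (I := I) (I' := 𝓘(ℝ, ℝ)) p.1).comp p
          (hasMFDerivAt_fst (I := I') (I' := 𝓘(ℝ, ℝ)) p))
      have h3 := (hasMFDerivAt_snd (I := I) (I' := 𝓘(ℝ, ℝ)) p.1).comp p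
        (hasMFDerivAt_fst (I := I') (I' := 𝓘(ℝ, ℝ)) p)
      have h4 := (h2.prodMk h3).prodMk (hasMFDerivAt_snd (I := I') (I' := 𝓘(ℝ, ℝ)) p)
      refine (congrArg (fun L : (E × ℝ) × ℝ →L[ℝ] (E × ℝ) × ℝ =>
        L (isotopyField m χ ξ p)) h4.mfderiv).trans ?_
      obtain ⟨⟨x, t⟩, s⟩ := p
      change (((modelDeriv I I g x (χ (t, s) • (t • (ξ ((x, t), s)).1)),
        χ (t, s) * (t ^ (m + 1) * (ξ ((x, t), s)).2)), χ (t, s) * 1) : (E × ℝ) × ℝ) =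
        isotopyField m χ ξ ((g x, t), s)
      by_cases h0 : χ (t, s) = 0
      · simp [isotopyField, h0]
      · rw [isotopyField, hgξ x t s h0]
        simp
end IsotopyFlow

/-! ### Operations on families of forms -/

section FamilyOperations

variable {E : Type*} [NormedAddCommGroup E] [NormedSpace ℝ E]
  {H : Type*} [TopologicalSpace H] {I : ModelWithCorners ℝ E H}
  {N : Type*} [TopologicalSpace N] [ChartedSpace H N]
  {X : Type*} [NormedAddCommGroup X] [NormedSpace ℝ X] {k : ℕ} {J : Set X}

theorem IsSmoothFamily.add {A A' : X → RawForm I N k} (h : IsSmoothFamily I J A)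
    (h' : IsSmoothFamily I J A') : IsSmoothFamily I J (fun q => A q + A' q) := fun x₀ =>
  (h x₀).add (h' x₀)

theorem IsSmoothFamily.smul {A : X → RawForm I N k} {c : X → ℝ} (h : IsSmoothFamily I J A)
    (hc : ContDiffOn ℝ ∞ c J) : IsSmoothFamily I J (fun q => c q • A q) := fun x₀ =>
  (hc.comp contDiff_snd.contDiffOn fun _ hp => hp.2).smul (h x₀)

theorem IsSmoothFamily.comp {Y : Type*} [NormedAddCommGroup Y] [NormedSpace ℝ Y] {J' : Set Y}
    {A : X → RawForm I N k} (h : IsSmoothFamily I J A) {f : Y → X} (hf : ContDiff ℝ ∞ f)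
    (hm : MapsTo f J' J) : IsSmoothFamily I J' (fun q => A (f q)) := fun x₀ =>
  (h x₀).comp (f := fun p : E × Y => (p.1, f p.2))
    (contDiff_fst.prodMk (hf.comp contDiff_snd)).contDiffOn fun _ hp => ⟨hp.1, hm hp.2⟩

variable [I.Boundaryless] [IsManifold I ∞ N] [FiniteDimensional ℝ E]

/-- By naturality the t-component of the solution is the same in every chart, so continuity may be
read in one. It is used to bound ξ'' on a compact tube. -/
theorem continuousAt_lineSolution_snd (hJ : IsOpen J) {a r : X → RawForm I N 1}
    {b : X → RawForm I N 2} (ha : IsSmoothFamily I J a) (hr : IsSmoothFamily I J r)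
    (hb : IsSmoothFamily I J b) {x : N} {q : X} (hq : q ∈ J)
    (h : NondegTwo (wedgeLine ((a q).val x) ((b q).val x))) :
    ContinuousAt (fun p : N × X => (lineSolution ((a p.2).val p.1) ((b p.2).val p.1)
      ((r p.2).val p.1)).2) (x, q) := by
  have hO : IsOpen ((extChartAt I x).target ×ˢ J) := (isOpen_extChartAt_target x).prod hJ
  have hm : (extChartAt I x x, q) ∈ (extChartAt I x).target ×ˢ J := ⟨mem_extChartAt_target x, hq⟩
  have h1 : ContinuousAt (fun p : E × X => lineSolution (RawForm.inChart I (a p.2) x p.1)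
      (RawForm.inChart I (b p.2) x p.1) (RawForm.inChart I (r p.2) x p.1)) (extChartAt I x x, q) :=
    (ContDiffAt.solveTwo hO ((ha x).wedgeLine (hb x)) (hr x).negFst hm
      ((nondegTwo_inChart_iff hm.1).2 (by rwa [extChartAt_to_inv x]))).continuousAt
  have h2 : ContinuousAt (fun p : N × X => (extChartAt I x p.1, p.2)) (x, q) :=
    ContinuousAt.prodMk
      (ContinuousAt.comp (f := Prod.fst) (continuousAt_extChartAt x) continuousAt_fst)
      continuousAt_snd
  have h3 := (ContinuousAt.comp (f := fun p : N × X => (extChartAt I x p.1, p.2)) h1 h2).snd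
  refine h3.congr ?_
  filter_upwards [NondegTwo.eventually_family hJ ha hb hq h, continuousAt_fst.preimage_mem_nhds
    ((isOpen_extChartAt_source (I := I) x).mem_nhds (mem_extChartAt_source x))] with p hp hp'
  obtain ⟨D, d1, d2⟩ := exists_chartDeriv_inverse ((extChartAt I x).map_source hp')
  have h4 := (lineSolution_comp (ρ := (r p.2).val p.1) d1 d2 hp).2
  have h5 : ∀ {k : ℕ} (η : RawForm I N k), (η.val p.1).compContinuousLinearMap
      (chartDeriv I x (extChartAt I x p.1)) = RawForm.inChart I η x (extChartAt I x p.1) := by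
    intro k η
    rw [RawForm.inChart_eq, (extChartAt I x).left_inv hp']
  rw [h5, h5, h5] at h4
  rw [h4]
  rfl

end FamilyOperations

/-! ### Normal form near `t = 0` -/

section NormalForm

/-- E lies in `Type`, the universe of ℝ, since `contDiffOn_divX` wants parameters and values in one
universe. -/
theorem contDiffOn_iterate_divX_param {E : Type} [NormedAddCommGroup E] [NormedSpace ℝ E]
    [FiniteDimensional ℝ E] {g : E × ℝ → ℝ} {U : Set E} (hU : IsOpen U) {ε : ℝ}
    (hg : ContDiffOn ℝ ∞ g (U ×ˢ Ioo (-ε) ε)) (n : ℕ) :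
    ContDiffOn ℝ ∞ (fun p : E × ℝ => divX^[n] (fun t => g (p.1, t)) p.2) (U ×ˢ Ioo (-ε) ε) := by
  induction n with
  | zero => exact hg
  | succ n ih =>
    simp only [Function.iterate_succ_apply']
    exact contDiffOn_divX hU ih

variable {E : Type} [NormedAddCommGroup E] [NormedSpace ℝ E] [FiniteDimensional ℝ E]
  {H : Type*} [TopologicalSpace H] {I : ModelWithCorners ℝ E H}
  {N : Type*} [TopologicalSpace N] [ChartedSpace H N] [I.Boundaryless] [IsManifold I ∞ N]

/-- A smooth function on `N × ℝ` which is `O(t^n)` uniformly is divisible by `t^n`. -/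
theorem exists_eq_pow_mul_of_contMDiff {g : N × ℝ → ℝ}
    (hg : ContMDiff (I.prod 𝓘(ℝ, ℝ)) 𝓘(ℝ, ℝ) ∞ g) {n : ℕ} {ε C : ℝ} (hε : 0 < ε)
    (hb : ∀ p ∈ (univ : Set N) ×ˢ Ioo (-ε) ε, |g p| ≤ C * |p.2| ^ n) :
    ∃ h : N × ℝ → ℝ, ContMDiffOn (I.prod 𝓘(ℝ, ℝ)) 𝓘(ℝ, ℝ) ∞ h (univ ×ˢ Ioo (-ε) ε) ∧
      ∀ p ∈ (univ : Set N) ×ˢ Ioo (-ε) ε, g p = p.2 ^ n * h p := by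
  refine ⟨fun p => divX^[n] (fun t => g (p.1, t)) p.2, ?_, fun p hp => ?_⟩
  · rintro ⟨x, t⟩ hp
    have h1 : ContDiffOn ℝ ∞ (fun q : E × ℝ => g ((extChartAt I x).symm q.1, q.2))
        ((extChartAt I x).target ×ˢ Ioo (-ε) ε) := by
      have h2 : ContMDiffOn (𝓘(ℝ, E).prod 𝓘(ℝ, ℝ)) (I.prod 𝓘(ℝ, ℝ)) ∞
          (fun q : E × ℝ => ((extChartAt I x).symm q.1, q.2))
          ((extChartAt I x).target ×ˢ Ioo (-ε) ε) :=
        ((contMDiffOn_extChartAt_symm x).comp contMDiffOn_fst fun q hq => hq.1).prodMk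
          contMDiffOn_snd
      have h3 := hg.comp_contMDiffOn h2
      rw [← modelWithCornersSelf_prod, chartedSpaceSelf_prod] at h3
      exact h3.contDiffOn
    have h4 := contDiffOn_iterate_divX_param (isOpen_extChartAt_target x) h1 n
    have h5 : ContMDiffOn (𝓘(ℝ, E).prod 𝓘(ℝ, ℝ)) 𝓘(ℝ, ℝ) ∞
        (fun p : E × ℝ => divX^[n] (fun t => g ((extChartAt I x).symm p.1, t)) p.2)
        ((extChartAt I x).target ×ˢ Ioo (-ε) ε) := by
      have h6 := h4.contMDiffOn
      rw [modelWithCornersSelf_prod, ← chartedSpaceSelf_prod] at h6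
      exact h6
    have hO : IsOpen ((extChartAt I x).target ×ˢ Ioo (-ε) ε) :=
      (isOpen_extChartAt_target x).prod isOpen_Ioo
    have h7a : ContMDiffAt (I.prod 𝓘(ℝ, ℝ)) 𝓘(ℝ, E) ∞ (fun p : N × ℝ => extChartAt I x p.1) (x, t) :=
      ContMDiffAt.comp (I' := I) (x, t) contMDiffAt_extChartAt contMDiffAt_fst
    have h7b : ContMDiffAt (I.prod 𝓘(ℝ, ℝ)) 𝓘(ℝ, ℝ) ∞ (fun p : N × ℝ => p.2) (x, t) :=
      contMDiffAt_snd
    have h7 : ContMDiffAt (I.prod 𝓘(ℝ, ℝ)) (𝓘(ℝ, E).prod 𝓘(ℝ, ℝ)) ∞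
        (fun p : N × ℝ => (extChartAt I x p.1, p.2)) (x, t) :=
      h7a.prodMk h7b
    have h8 := (h5.contMDiffAt (hO.mem_nhds (x := (extChartAt I x x, t))
      ⟨mem_extChartAt_target x, hp.2⟩)).comp (x, t) h7
    refine (h8.congr_of_eventuallyEq ?_).contMDiffWithinAt
    filter_upwards [continuousAt_fst.preimage_mem_nhds
      ((isOpen_extChartAt_source (I := I) x).mem_nhds (mem_extChartAt_source x))] with q hq
    simp only [Function.comp_apply, (extChartAt I x).left_inv hq]
  · have h1 : ContDiff ℝ ∞ (fun t => g (p.1, t)) :=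
      (hg.comp (contMDiff_const.prodMk contMDiff_id)).contDiff
    exact eq_pow_mul_iterate_divX hε h1.contDiffOn (fun t ht _ => hb (p.1, t) ⟨mem_univ _, ht⟩) hp.2

variable [T2Space N] [CompactSpace N]

/-- Nondegeneracy is an open condition and N × K is compact, so the width of the tube around t = 0
can be chosen uniformly. -/
theorem exists_nondegTwo_tube {J : Set (ℝ × ℝ)} (hJ : IsOpen J) {a : ℝ × ℝ → RawForm I N 1}
    {b : ℝ × ℝ → RawForm I N 2} (ha : IsSmoothFamily I J a) (hb : IsSmoothFamily I J b) {K : Set ℝ}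
    (hK : IsCompact K) (hJK : ∀ s ∈ K, ((0 : ℝ), s) ∈ J)
    (h : ∀ s ∈ K, ∀ x, NondegTwo (wedgeLine ((a (0, s)).val x) ((b (0, s)).val x))) :
    ∃ ρ > 0, ∀ t, |t| < ρ → ∀ s ∈ K, ∀ x,
      NondegTwo (wedgeLine ((a (t, s)).val x) ((b (t, s)).val x)) := by
  have h1 := (isCompact_univ.prod hK :
    IsCompact ((univ : Set N) ×ˢ K)).eventually_forall_of_forall_eventually
    (x₀ := (0 : ℝ)) (P := fun t y =>
      NondegTwo (wedgeLine ((a (t, y.2)).val y.1) ((b (t, y.2)).val y.1))) (by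
      rintro ⟨x, s⟩ ⟨-, hs⟩
      have h2 := NondegTwo.eventually_family hJ ha hb (x := x) (q := (0, s)) (hJK s hs) (h s hs x)
      have h3 : Continuous (fun z : ℝ × (N × ℝ) => (z.2.1, (z.1, z.2.2))) := by fun_prop
      exact (h3.tendsto (0, (x, s))).eventually h2)
  obtain ⟨ρ', hρ', h3⟩ := Metric.eventually_nhds_iff.1 h1
  refine ⟨ρ', hρ', fun t ht s hs x => h3 ?_ (x, s) ⟨mem_univ _, hs⟩⟩
  rwa [Real.dist_eq, sub_zero]

-- The interpolating form is t^{-m} dt ∧ a + b with a = Σ t^(m-j) α_j + s t^m R_{st} and b = B_{st}.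
-- At t = 0 these are α_m and B_0 for every s, so the equation for ξ is solvable in a tube uniform
-- in s, where ξ is smooth and ξ'' is bounded. This feeds the isotopy and Moser's argument.
set_option maxHeartbeats 2000000 in
theorem exists_normalForm {m : ℕ} (hm : 1 ≤ m) {ε₀ : ℝ} (hε₀ : 0 < ε₀) {α : ℕ → RawForm I N 1}
    {R : ℝ → RawForm I N 1} {B : ℝ → RawForm I N 2}
    (hα : ∀ j ∈ Finset.Icc 1 m, RawForm.IsSmooth I (α j) ∧ RawForm.IsClosedOn I (α j) univ)
    (hR : IsSmoothFamily I (Ioo (-ε₀) ε₀) R) (hB : IsSmoothFamily I (Ioo (-ε₀) ε₀) B)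
    (hcl : RawForm.IsClosedOn (I.prod 𝓘(ℝ, ℝ)) (familyForm I R B) (univ ×ˢ Ioo (-ε₀) ε₀))
    (hnd : ∀ x, NondegTwo (wedgeLine ((α m).val x) ((B 0).val x)))
    {T : Type*} [Group T] [MulAction T N] (hT : ∀ g : T, ContMDiff I I ∞ (fun x : N => g • x))
    (hαT : ∀ j ∈ Finset.Icc 1 m, RawForm.IsInvariantOn I T (α j) univ)
    (hRT : ∀ t ∈ Ioo (-ε₀) ε₀, RawForm.IsInvariantOn I T (R t) univ)
    (hBT : ∀ t ∈ Ioo (-ε₀) ε₀, RawForm.IsInvariantOn I T (B t) univ) :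
    ∃ (ε : ℝ) (Ψ Ψ' : N × ℝ → N × ℝ) (O : Set (N × ℝ)) (h : N × ℝ → ℝ),
      0 < ε ∧ ContMDiff (I.prod 𝓘(ℝ, ℝ)) (I.prod 𝓘(ℝ, ℝ)) ∞ Ψ ∧
      ContMDiff (I.prod 𝓘(ℝ, ℝ)) (I.prod 𝓘(ℝ, ℝ)) ∞ Ψ' ∧ IsOpen O ∧ (∀ q ∈ O, |q.2| < ε₀) ∧
      (∀ x, Ψ (x, 0) = (x, 0)) ∧
      MapsTo Ψ (univ ×ˢ Ioo (-ε) ε) O ∧ MapsTo Ψ' O (univ ×ˢ Ioo (-ε) ε) ∧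
      (∀ p ∈ (univ : Set N) ×ˢ Ioo (-ε) ε, Ψ' (Ψ p) = p) ∧ (∀ q ∈ O, Ψ (Ψ' q) = q) ∧
      ContMDiffOn (I.prod 𝓘(ℝ, ℝ)) 𝓘(ℝ, ℝ) ∞ h (univ ×ˢ Ioo (-ε) ε) ∧
      (∀ p ∈ (univ : Set N) ×ˢ Ioo (-ε) ε, (Ψ p).2 = p.2 + p.2 ^ (m + 1) * h p) ∧
      (∀ p ∈ (univ : Set N) ×ˢ Ioo (-ε) ε, p.2 ≠ 0 → (Ψ p).2 ≠ 0) ∧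
      (∀ p ∈ (univ : Set N) ×ˢ Ioo (-ε) ε, p.2 ≠ 0 → ∀ v w : E × ℝ,
        (familyForm I (fun t => ∑ j ∈ Finset.Icc 1 m, (t ^ j)⁻¹ • α j + R t) B).val (Ψ p)
          ![modelDeriv (I.prod 𝓘(ℝ, ℝ)) (I.prod 𝓘(ℝ, ℝ)) Ψ p v,
            modelDeriv (I.prod 𝓘(ℝ, ℝ)) (I.prod 𝓘(ℝ, ℝ)) Ψ p w] =
        (familyForm I (fun t => ∑ j ∈ Finset.Icc 1 m, (t ^ j)⁻¹ • α j) (fun _ => B 0)).val p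
          ![v, w]) ∧
      ∀ (g : T) (x : N) (t : ℝ), Ψ (g • x, t) = (g • (Ψ (x, t)).1, (Ψ (x, t)).2) := by
  set a : ℝ × ℝ → RawForm I N 1 := fun q => ∑ j ∈ Finset.Icc 1 m, q.1 ^ (m - j) • α j +
    (q.2 * q.1 ^ m) • R (q.2 * q.1) with ha
  set b : ℝ × ℝ → RawForm I N 2 := fun q => B (q.2 * q.1) with hb
  set r : ℝ × ℝ → RawForm I N 1 := fun q => R (q.2 * q.1) with hr
  set J : Set (ℝ × ℝ) := {q | q.2 * q.1 ∈ Ioo (-ε₀) ε₀} with hJ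
  have hmul : ContDiff ℝ ∞ (fun q : ℝ × ℝ => q.2 * q.1) := by fun_prop
  have hJo : IsOpen J := isOpen_Ioo.preimage hmul.continuous
  have hrs : IsSmoothFamily I J r := hR.comp hmul fun q hq => hq
  have hbs : IsSmoothFamily I J b := hB.comp hmul fun q hq => hq
  have has : IsSmoothFamily I J a := by
    refine IsSmoothFamily.add (IsSmoothFamily.sum_smul (c := fun j (q : ℝ × ℝ) => q.1 ^ (m - j))
      (fun j hj => (hα j hj).1) fun j _ => (contDiff_fst.pow _).contDiffOn) (hrs.smul ?_)
    exact (contDiff_snd.mul (contDiff_fst.pow m)).contDiffOn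
  have ha0 : ∀ s x, (a (0, s)).val x = (α m).val x := by
    intro s x
    have h1 : a (0, s) = α m := by
      simp only [ha]
      rw [zero_pow (by omega), mul_zero, zero_smul, add_zero, Finset.sum_eq_single m]
      · simp
      · intro j hj hjm
        rw [Finset.mem_Icc] at hj
        rw [zero_pow (by omega), zero_smul]
      · intro h
        exact absurd (Finset.mem_Icc.2 ⟨hm, le_rfl⟩) h
    rw [h1]
  have hb0 : ∀ s, b (0, s) = B 0 := fun s => by simp only [hb, mul_zero]
  obtain ⟨ρ', hρ', hρnd⟩ : ∃ ρ' > 0, ∀ t, |t| < ρ' → ∀ s ∈ Icc (-3 : ℝ) 3, ∀ x,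
      NondegTwo (wedgeLine ((a (t, s)).val x) ((b (t, s)).val x)) := by
    refine exists_nondegTwo_tube hJo has hbs isCompact_Icc (fun s _ => ?_) fun s _ x => ?_
    · rw [hJ, mem_ofPred_eq, mul_zero]
      exact ⟨by linarith, hε₀⟩
    · rw [ha0, hb0]
      exact hnd x
  -- The cutoff will be supported in |t| ≤ 2ρ, |s| ≤ 5/2. There 2ρ < ρ' gives nondegeneracy, and 2ρ
  -- < ε₀ / 3 together with |s| < 3 keeps s t inside (-ε₀, ε₀).
  obtain ⟨ρ, hρ, hρρ, hρε⟩ : ∃ ρ > 0, 2 * ρ < ρ' ∧ 6 * ρ < ε₀ := by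
    refine ⟨min (ρ' / 3) (ε₀ / 7), by positivity, ?_, ?_⟩
    · linarith [min_le_left (ρ' / 3) (ε₀ / 7)]
    · linarith [min_le_right (ρ' / 3) (ε₀ / 7)]
  have hJmem : ∀ t s : ℝ, |t| < ε₀ / 3 → |s| < 3 → (t, s) ∈ J := by
    intro t s ht hs
    refine abs_lt.1 ?_
    rw [abs_mul]
    nlinarith [abs_nonneg t, abs_nonneg s]
  set ξ : (N × ℝ) × ℝ → E × ℝ := fun p => lineSolution ((a (p.1.2, p.2)).val p.1.1)
    ((b (p.1.2, p.2)).val p.1.1) ((r (p.1.2, p.2)).val p.1.1) with hξ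
  let b1 : ContDiffBump (0 : ℝ) := ⟨ρ, 2 * ρ, hρ, by linarith⟩
  let b2 : ContDiffBump (0 : ℝ) := ⟨2, 5 / 2, by norm_num, by norm_num⟩
  set χ : ℝ × ℝ → ℝ := fun q => b1 q.1 * b2 q.2 with hχ
  have hχs : ContDiff ℝ ∞ χ := (b1.contDiff.comp contDiff_fst).mul (b2.contDiff.comp contDiff_snd)
  have hχ1 : ∀ t s, |t| < ρ → |s| < 2 → χ (t, s) = 1 := by
    intro t s ht hs
    have h1 : b1 t = 1 := b1.one_of_mem_closedBall (by
      rw [Metric.mem_closedBall, Real.dist_eq, sub_zero]; exact ht.le)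
    have h2 : b2 s = 1 := b2.one_of_mem_closedBall (by
      rw [Metric.mem_closedBall, Real.dist_eq, sub_zero]; exact hs.le)
    simp only [hχ, h1, h2, mul_one]
  have hχ0 : ∀ t s, χ (t, s) ≠ 0 → |t| < 2 * ρ ∧ |s| < 5 / 2 := by
    intro t s h
    by_contra hn
    rw [not_and_or, not_lt, not_lt] at hn
    apply h
    rcases hn with hn | hn
    · have : b1 t = 0 := b1.zero_of_le_dist (by rw [Real.dist_eq, sub_zero]; exact hn)
      simp only [hχ, this, zero_mul]
    · have : b2 s = 0 := b2.zero_of_le_dist (by rw [Real.dist_eq, sub_zero]; exact hn)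
      simp only [hχ, this, mul_zero]
  set K : Set (ℝ × ℝ) := Icc (-(2 * ρ)) (2 * ρ) ×ˢ Icc (-(5 / 2)) (5 / 2) with hK
  have hKc : IsCompact K := isCompact_Icc.prod isCompact_Icc
  have hχK : ∀ q ∉ K, χ q = 0 := by
    rintro ⟨t, s⟩ hq
    by_contra h
    obtain ⟨h1, h2⟩ := hχ0 t s h
    exact hq ⟨abs_le.1 h1.le, abs_le.1 h2.le⟩
  have hV : ContMDiff ((I.prod 𝓘(ℝ, ℝ)).prod 𝓘(ℝ, ℝ)) ((I.prod 𝓘(ℝ, ℝ)).prod 𝓘(ℝ, ℝ)).tangent ∞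
      (fun p : (N × ℝ) × ℝ => (⟨p, isotopyField m χ ξ p⟩ :
        TangentBundle ((I.prod 𝓘(ℝ, ℝ)).prod 𝓘(ℝ, ℝ)) ((N × ℝ) × ℝ))) := by
    intro p
    by_cases hp : (p.1.2, p.2) ∈ K
    · have h1 : |p.1.2| ≤ 2 * ρ := abs_le.2 hp.1
      have h2 : |p.2| ≤ 5 / 2 := abs_le.2 hp.2
      exact contMDiffAt_moserField hJo has hrs hbs hχs
        (hJmem _ _ (by linarith) (by linarith)) (hρnd _ (by linarith) _
          (abs_le.1 (by linarith)) _)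
    · have h1 : ContMDiffAt ((I.prod 𝓘(ℝ, ℝ)).prod 𝓘(ℝ, ℝ))
          ((I.prod 𝓘(ℝ, ℝ)).prod 𝓘(ℝ, ℝ)).tangent ∞
          (fun p : (N × ℝ) × ℝ => (⟨p, 0⟩ :
            TangentBundle ((I.prod 𝓘(ℝ, ℝ)).prod 𝓘(ℝ, ℝ)) ((N × ℝ) × ℝ))) p :=
        Bundle.contMDiff_zeroSection ℝ (TangentSpace ((I.prod 𝓘(ℝ, ℝ)).prod 𝓘(ℝ, ℝ))) p
      refine h1.congr_of_eventuallyEq ?_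
      have h2 : Continuous (fun p : (N × ℝ) × ℝ => (p.1.2, p.2)) := by fun_prop
      filter_upwards [h2.continuousAt.preimage_mem_nhds (hKc.isClosed.isOpen_compl.mem_nhds hp)]
        with q hq
      rw [isotopyField, hχK _ hq, zero_smul]
      rfl
  obtain ⟨C, hC⟩ : ∃ C, ∀ p : (N × ℝ) × ℝ, |p.1.2| < ρ → |p.2| < 2 → |(ξ p).2| ≤ C := by
    have hcomp : IsCompact ((univ : Set N) ×ˢ (Icc (-ρ) ρ ×ˢ Icc (-2 : ℝ) 2)) :=
      isCompact_univ.prod (isCompact_Icc.prod isCompact_Icc)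
    obtain ⟨C, hC⟩ := hcomp.exists_bound_of_continuousOn (f := fun p : N × (ℝ × ℝ) =>
      (lineSolution ((a p.2).val p.1) ((b p.2).val p.1) ((r p.2).val p.1)).2) (by
        rintro ⟨x, t, s⟩ ⟨-, ht, hs⟩
        have h1 : |t| ≤ ρ := abs_le.2 ht
        have h2 : |s| ≤ 2 := abs_le.2 hs
        exact (continuousAt_lineSolution_snd hJo has hrs hbs
          (hJmem _ _ (by linarith) (by linarith)) (hρnd _ (by linarith) _
            (abs_le.1 (by linarith)) _)).continuousWithinAt)
    exact ⟨C, fun p h1 h2 => hC (p.1.1, (p.1.2, p.2))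
      ⟨mem_univ _, abs_le.1 h1.le, abs_le.1 h2.le⟩⟩
  obtain ⟨ε, C', G, Ψ', O, hε, hGs, hΨs, hOo, hOρ, hG0, hGx, hm1, hm2, hi1, hi2, hder, hbd, heq⟩ :=
    exists_isotopy hρ hχ1 hKc hχK hC hV
  have hΨ : ContMDiff (I.prod 𝓘(ℝ, ℝ)) (I.prod 𝓘(ℝ, ℝ)) ∞ (fun p => G (p, 1)) :=
    hGs.comp (contMDiff_id.prodMk contMDiff_const)
  -- The bound by |t|^(m+1) becomes divisibility by t^(m+1) with a smooth quotient.
  obtain ⟨h, hh, hhe⟩ := exists_eq_pow_mul_of_contMDiff (g := fun p => (G (p, 1)).2 - p.2)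
    ((contMDiff_snd.comp hΨ).sub contMDiff_snd) hε hbd
  have h1I : (1 : ℝ) ∈ Ioo (-1 / 2 : ℝ) (3 / 2) := by constructor <;> norm_num
  refine ⟨ε, fun p => G (p, 1), Ψ', O, h, hε, hΨ, hΨs, hOo, fun q hq => ?_, hGx, hm1, hm2, hi1, hi2,
    hh, fun p hp => ?_, fun p hp hp0 => (hder p hp 1 h1I).2.2 hp0, fun p hp hp0 v w => ?_, ?_⟩
  · exact (hOρ q hq).trans (by linarith)
  · linarith [hhe p hp]
  · have hS₀ : IsOpen ((univ : Set N) ×ˢ {t ∈ Ioo (-ε) ε | t ≠ 0}) :=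
      isOpen_univ.prod (isOpen_Ioo.inter isOpen_ne)
    refine familyForm_pullback_isotopy hα hR hB hcl hS₀ (isOpen_Ioo (a := (-1 / 2 : ℝ)) (b := 3 / 2))
      (fun s hs => ⟨by linarith [hs.1], by linarith [hs.2]⟩) hGs.contMDiffOn (fun p _ => hG0 p)
      (fun q hq => (hder q.1 ⟨mem_univ _, hq.1.2.1⟩ q.2 hq.2).2.2 hq.1.2.2) (fun q hq => ?_)
      (fun q hq => ?_) (p := p) ⟨mem_univ _, hp.2, hp0⟩ v w
    · have h1 := (hder q.1 ⟨mem_univ _, hq.1.2.1⟩ q.2 hq.2).1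
      exact hJmem _ _ (h1.trans (by linarith)) (abs_lt.2 ⟨by linarith [hq.2.1], by linarith [hq.2.2]⟩)
    · obtain ⟨h1, h2, -⟩ := hder q.1 ⟨mem_univ _, hq.1.2.1⟩ q.2 hq.2
      refine ⟨ξ (G q, q.2), h2, fun w k => ?_⟩
      have h3 := (hρnd (G q).2 (h1.trans (by linarith)) q.2
        ⟨by linarith [hq.2.1], by linarith [hq.2.2]⟩ (G q).1).solveTwo_apply
        (negFst ((r ((G q).2, q.2)).val (G q).1)) (w, k)
      rw [negFst_apply] at h3
      exact h3
  · intro g x t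
    -- By invariance of the forms, the derivative of g carries the linear equation at x to the one
    -- at g • x, hence solution to solution.
    refine heq (fun x => g • x) (hT g) (fun x t s hts => ?_) x t 1
    obtain ⟨h1, h2⟩ := hχ0 t s hts
    have hnd' := hρnd t (by linarith) s (abs_le.1 (by linarith))
    have hst : s * t ∈ Ioo (-ε₀) ε₀ := hJmem t s (by linarith) (by linarith)
    set D : E →L[ℝ] E := modelDeriv I I (fun y : N => g • y) x with hD
    set D' : E →L[ℝ] E := modelDeriv I I (fun y : N => g⁻¹ • y) (g • x) with hD'
    have hmd : ∀ (g : T) (x : N), MDifferentiableAt I I (fun y : N => g • y) x := fun g x =>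
      (hT g x).mdifferentiableAt (by simp)
    have hDD : ∀ (g : T) (x : N) (v : E), modelDeriv I I (fun y : N => g⁻¹ • y) (g • x)
        (modelDeriv I I (fun y : N => g • y) x v) = v := by
      intro g x v
      rw [← modelDeriv_comp (hmd g⁻¹ _) (hmd g x)]
      simp only [inv_smul_smul]
      exact congrArg (fun L : E →L[ℝ] E => L v) mfderiv_id
    have d2 : ∀ v, D' (D v) = v := hDD g x
    have d1 : ∀ v, D (D' v) = v := by
      intro v
      have := hDD g⁻¹ (g • x) v
      simpa only [inv_inv, inv_smul_smul] using this
    have hinv : ∀ {k : ℕ} {η : RawForm I N k}, RawForm.IsInvariantOn I T η univ →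
        (η.val (g • x)).compContinuousLinearMap D = η.val x := fun h => h g x (mem_univ _)
    have hinva : ((a (t, s)).val (g • x)).compContinuousLinearMap D = (a (t, s)).val x := by
      refine alternating_one_ext fun u => ?_
      have h5 : ∀ {η : RawForm I N 1}, RawForm.IsInvariantOn I T η univ →
          η.val (g • x) ![D u] = η.val x ![u] := fun {η} h => by
        rw [← hinv h, ContinuousAlternatingMap.compContinuousLinearMap_apply]
        congr 1
        funext i; fin_cases i; rfl
      have h6 : (D ∘ ![u]) = ![D u] := by funext i; fin_cases i; rfl
      rw [ContinuousAlternatingMap.compContinuousLinearMap_apply, h6]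
      simp only [ha, val_add, RawForm.val_sum, ContinuousAlternatingMap.add_apply,
        ContinuousAlternatingMap.sum_apply, RawForm.val_smul_one_apply]
      rw [h5 (hRT _ hst)]
      congr 1
      exact Finset.sum_congr rfl fun j hj => by rw [h5 (hαT j hj)]
    have h6 := (lineSolution_comp (ρ := (r (t, s)).val (g • x)) d1 d2 (hnd' (g • x))).2
    rw [hinva, hinv (hBT _ hst), hinv (hRT _ hst)] at h6
    exact h6

end NormalForm

/-! ### Averaging vector fields -/

section PartialDerivative

variable {E : Type*} [NormedAddCommGroup E] [NormedSpace ℝ E]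
  {H : Type*} [TopologicalSpace H] {I : ModelWithCorners ℝ E H}
  {M : Type*} [TopologicalSpace M] [ChartedSpace H M] [IsManifold I ∞ M]
  {F : Type*} [NormedAddCommGroup F] [NormedSpace ℝ F]
  {K : Type*} [TopologicalSpace K] {J : ModelWithCorners ℝ F K}
  {P : Type*} [TopologicalSpace P] [ChartedSpace K P] [IsManifold J ∞ P]
  {E' : Type*} [NormedAddCommGroup E'] [NormedSpace ℝ E']
  {F' : Type*} [NormedAddCommGroup F'] [NormedSpace ℝ F']
  {K' : Type*} [TopologicalSpace K'] {J' : ModelWithCorners ℝ F' K'}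
  {X : Type*} [TopologicalSpace X] [ChartedSpace K' X]

/-- The derivative of `A (p, q)` in the second variable along a field of vectors is smooth. -/
theorem ContMDiffOn.modelDeriv_snd {A : P × M → E'} {O : Set (P × M)} (hO : IsOpen O)
    (hA : ContMDiffOn (J.prod I) 𝓘(ℝ, E') ∞ A O) {γ : X → P} {W : X → TangentBundle I M} {S : Set X}
    (hγ : ContMDiffOn J' J ∞ γ S) (hW : ContMDiffOn J' I.tangent ∞ W S)
    (hm : ∀ x ∈ S, (γ x, (W x).1) ∈ O) :
    ContMDiffOn J' 𝓘(ℝ, E') ∞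
      (fun x => modelDeriv I 𝓘(ℝ, E') (fun q => A (γ x, q)) (W x).1 (W x).2) S := by
  have : IsManifold I 1 M := IsManifold.of_le (n := ∞) (by simp)
  have : IsManifold J 1 P := IsManifold.of_le (n := ∞) (by simp)
  have h1 := hA.contMDiffOn_tangentMapWithin (m := ∞) (by simp) hO.uniqueMDiffOn
  have h0 : ContMDiffOn J' J.tangent ∞ (fun x => (⟨γ x, 0⟩ : TangentBundle J P)) S :=
    (Bundle.contMDiff_zeroSection ℝ (TangentSpace J : P → Type _)).comp_contMDiffOn hγ
  have h2 : ContMDiffOn J' (J.prod I).tangent ∞ (fun x =>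
      (equivTangentBundleProd J P I M).symm (⟨γ x, 0⟩, W x)) S :=
    (contMDiff_equivTangentBundleProd_symm (n := ∞)).comp_contMDiffOn (h0.prodMk hW)
  have h3 := h1.comp h2 fun x hx => hm x hx
  have h4 := (contMDiff_snd_tangentBundle_modelSpace E' 𝓘(ℝ, E') (n := ∞)).comp_contMDiffOn h3
  refine h4.congr fun x hx => ?_
  have h5 : MDifferentiableAt (J.prod I) 𝓘(ℝ, E') A (γ x, (W x).1) :=
    (hA.contMDiffAt (hO.mem_nhds (hm x hx))).mdifferentiableAt (by simp)
  have h6 : HasMFDerivAt I (J.prod I) (fun q : M => (γ x, q)) (W x).1 _ :=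
    (hasMFDerivAt_const (γ x) _).prodMk (hasMFDerivAt_id _)
  have h7 := (h5.hasMFDerivAt.comp _ h6).mfderiv
  change (mfderiv I 𝓘(ℝ, E') (A ∘ fun q : M => (γ x, q)) (W x).1 : E →L[ℝ] E') (W x).2 =
    (mfderivWithin (J.prod I) 𝓘(ℝ, E') A O (γ x, (W x).1) : F × E →L[ℝ] E') (0, (W x).2)
  rw [mfderivWithin_of_isOpen hO (hm x hx)]
  exact congrArg (fun L : E →L[ℝ] E' => L (W x).2) h7

end PartialDerivative

/-! ### Averaging over the group and the transverse field -/

section Average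

open MeasureTheory

universe u

variable {E : Type u} [NormedAddCommGroup E] [NormedSpace ℝ E] [FiniteDimensional ℝ E]
  {H : Type*} [TopologicalSpace H] {I : ModelWithCorners ℝ E H} [I.Boundaryless]
  {M : Type*} [TopologicalSpace M] [ChartedSpace H M] [IsManifold I ∞ M]
  {F : Type*} [NormedAddCommGroup F] [NormedSpace ℝ F] [FiniteDimensional ℝ F]
  {K : Type*} [TopologicalSpace K] {J : ModelWithCorners ℝ F K}
  {T : Type*} [TopologicalSpace T] [ChartedSpace K T] [CommGroup T] [LieGroup J ∞ T]
  [MulAction T M]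

variable (I) in
/-- The vector field `w` translated by `g⁻¹`. -/
noncomputable def translateField (w : M → E) (g : T) (x : M) : E :=
  modelDeriv I I (fun y : M => g⁻¹ • y) (g • x) (w (g • x))

variable (I J) in
theorem contMDiff_const_smul_of_action [ContMDiffSMul J I ∞ T M] (g : T) :
    ContMDiff I I ∞ (fun x : M => g • x) :=
  (contMDiff_smul (I := J) (I' := I) (n := ∞)).comp (contMDiff_const.prodMk contMDiff_id)

/-- In the chart the translate is a partial derivative of the smooth map (g, q) ↦ g⁻¹ • q. It is
therefore smooth in g and the point jointly, as integration over T requires. -/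
theorem contMDiffOn_translateField_chart [ContMDiffSMul J I ∞ T M] {w : M → E}
    (hw : ContMDiff I I.tangent ∞ (fun x => (⟨x, w x⟩ : TangentBundle I M))) (x₀ : M) :
    ContMDiffOn (J.prod 𝓘(ℝ, E)) 𝓘(ℝ, E) ∞ (fun p : T × E => modelDeriv I 𝓘(ℝ, E)
      (extChartAt I x₀) ((extChartAt I x₀).symm p.2)
        (translateField I w p.1 ((extChartAt I x₀).symm p.2)))
      (univ ×ˢ (extChartAt I x₀).target) := by
  have hs : ContMDiff (J.prod I) I ∞ (fun p : T × M => p.1⁻¹ • p.2) :=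
    (contMDiff_smul (I := J) (I' := I) (n := ∞)).comp
      (((contMDiff_inv J ∞).comp contMDiff_fst).prodMk contMDiff_snd)
  have hO : IsOpen ((fun p : T × M => p.1⁻¹ • p.2) ⁻¹' (extChartAt I x₀).source) :=
    (isOpen_extChartAt_source (I := I) x₀).preimage hs.continuous
  have hA : ContMDiffOn (J.prod I) 𝓘(ℝ, E) ∞ (fun p : T × M => extChartAt I x₀ (p.1⁻¹ • p.2))
      ((fun p : T × M => p.1⁻¹ • p.2) ⁻¹' (extChartAt I x₀).source) :=
    (contMDiffOn_extChartAt (I := I) (n := ∞)).comp hs.contMDiffOn fun p hp => by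
      rw [← extChartAt_source I]; exact hp
  have hsm : ContMDiffOn (J.prod 𝓘(ℝ, E)) I ∞
      (fun p : T × E => p.1 • (extChartAt I x₀).symm p.2) (univ ×ˢ (extChartAt I x₀).target) :=
    (contMDiff_smul (I := J) (I' := I) (n := ∞)).comp_contMDiffOn (contMDiffOn_fst.prodMk
      ((contMDiffOn_extChartAt_symm x₀).comp contMDiffOn_snd fun p hp => hp.2))
  have hmem : ∀ p ∈ (univ : Set T) ×ˢ (extChartAt I x₀).target,
      p.1⁻¹ • p.1 • (extChartAt I x₀).symm p.2 ∈ (extChartAt I x₀).source := by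
    intro p hp
    rw [inv_smul_smul]
    exact (extChartAt I x₀).map_target hp.2
  have h1 := ContMDiffOn.modelDeriv_snd (J' := J.prod 𝓘(ℝ, E)) hO hA (γ := fun p : T × E => p.1)
    (W := fun p : T × E => ⟨p.1 • (extChartAt I x₀).symm p.2,
      w (p.1 • (extChartAt I x₀).symm p.2)⟩) contMDiffOn_fst (hw.comp_contMDiffOn hsm) hmem
  refine h1.congr fun p hp => ?_
  have h2 : MDifferentiableAt I I (fun y : M => p.1⁻¹ • y) (p.1 • (extChartAt I x₀).symm p.2) :=
    (contMDiff_const_smul_of_action I J p.1⁻¹).mdifferentiableAt (by simp)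
  have h3 : MDifferentiableAt I 𝓘(ℝ, E) (extChartAt I x₀)
      (p.1⁻¹ • p.1 • (extChartAt I x₀).symm p.2) :=
    mdifferentiableAt_extChartAt (by rw [← extChartAt_source I]; exact hmem p hp)
  have h4 := modelDeriv_comp h3 h2 (w (p.1 • (extChartAt I x₀).symm p.2))
  rw [inv_smul_smul] at h4
  exact h4.symm

theorem continuous_translateField [ContMDiffSMul J I ∞ T M] {w : M → E}
    (hw : ContMDiff I I.tangent ∞ (fun x => (⟨x, w x⟩ : TangentBundle I M))) (x : M) :
    Continuous (fun g : T => translateField I w g x) := by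
  obtain ⟨D, hD⟩ : ∃ D : E →L[ℝ] E, ∀ v, D (modelDeriv I 𝓘(ℝ, E) (extChartAt I x) x v) = v := by
    refine ⟨chartDeriv I x (extChartAt I x x), fun v => ?_⟩
    have h := mfderiv_symm_mfderiv_extChartAt (I := I) (mem_extChartAt_target x) (v : E)
    rw [extChartAt_to_inv x] at h
    exact h
  have h1 := (contMDiffOn_translateField_chart (J := J) (T := T) hw x).continuousOn
  have h2 : Continuous (fun g : T => modelDeriv I 𝓘(ℝ, E) (extChartAt I x)
      ((extChartAt I x).symm (extChartAt I x x))
        (translateField I w g ((extChartAt I x).symm (extChartAt I x x)))) :=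
    h1.comp_continuous (f := fun g : T => (g, extChartAt I x x)) (by fun_prop)
      fun g => ⟨mem_univ _, mem_extChartAt_target x⟩
  rw [extChartAt_to_inv x] at h2
  refine (D.continuous.comp h2).congr fun g => hD _

/-- Averaging a vector field over a compact group. -/
theorem exists_invariant_vectorField [ContMDiffSMul J I ∞ T M] [CompactSpace T] [T2Space T]
    [SecondCountableTopology T] {w : M → E}
    (hw : ContMDiff I I.tangent ∞ (fun x => (⟨x, w x⟩ : TangentBundle I M))) {f c : M → ℝ}
    (hf : ContMDiff I 𝓘(ℝ, ℝ) ∞ f) (hfT : ∀ (g : T) (x : M), f (g • x) = f x)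
    (hcT : ∀ (g : T) (x : M), c (g • x) = c x)
    (hwf : ∀ x, modelDeriv I 𝓘(ℝ, ℝ) f x (w x) = c x) :
    ∃ w' : M → E, ContMDiff I I.tangent ∞ (fun x => (⟨x, w' x⟩ : TangentBundle I M)) ∧
      (∀ (g : T) (x : M), modelDeriv I I (fun y : M => g • y) x (w' x) = w' (g • x)) ∧
      ∀ x, modelDeriv I 𝓘(ℝ, ℝ) f x (w' x) = c x := by
  let _ : MeasurableSpace T := borel T
  have _ : BorelSpace T := ⟨rfl⟩
  have _ : IsTopologicalGroup T := topologicalGroup_of_lieGroup J ∞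
  let ν : Measure T := Measure.haarMeasure ⊤
  have hν : IsProbabilityMeasure ν := ⟨Measure.haarMeasure_self⟩
  have hint : ∀ x, Integrable (fun g : T => translateField I w g x) ν := fun x =>
    (continuous_translateField (J := J) hw x).integrable_of_hasCompactSupport
      (HasCompactSupport.of_compactSpace _)
  have hsm : ∀ (g : T) (x : M), MDifferentiableAt I I (fun y : M => g • y) x := fun g x =>
    (contMDiff_const_smul_of_action I J g).mdifferentiableAt (by simp)
  refine ⟨fun x => ∫ g, translateField I w g x ∂ν, fun x₀ => ?_, fun h x => ?_, fun x => ?_⟩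
  · have h1 := contDiffOn_setIntegral ν (isOpen_univ.prod (isOpen_extChartAt_target x₀))
      (contMDiffOn_translateField_chart (J := J) (T := T) hw x₀) isCompact_univ
      (isOpen_extChartAt_target x₀) subset_rfl
    refine contMDiffAt_section_of_chartDeriv (isOpen_extChartAt_target x₀)
      (mem_extChartAt_target x₀) h1 fun y hy _ => ?_
    rw [setIntegral_univ]
    exact (mfderiv_symm_mfderiv_extChartAt (I := I) hy _).symm.trans
      (congrArg (chartDeriv I x₀ y) (ContinuousLinearMap.integral_comp_comm (modelDeriv I 𝓘(ℝ, E)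
        (extChartAt I x₀) ((extChartAt I x₀).symm y)) (hint _)).symm)
  · rw [← ContinuousLinearMap.integral_comp_comm _ (hint _)]
    -- Pushing forward by h amounts to the substitution g ↦ g h in the integral, under which the
    -- Haar measure is invariant, T being commutative.
    have h1 : ∀ g : T, modelDeriv I I (fun y : M => h • y) x (translateField I w (g * h) x) =
        translateField I w g (h • x) := by
      intro g
      have h2 := modelDeriv_comp (hsm h ((g * h)⁻¹ • (g * h) • x)) (hsm (g * h)⁻¹ ((g * h) • x))
        (w ((g * h) • x))
      rw [inv_smul_smul] at h2
      refine h2.symm.trans ?_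
      simp only [smul_smul, mul_inv_rev, mul_inv_cancel_left]
      rw [translateField, smul_smul]
    exact (integral_mul_right_eq_self (fun g => modelDeriv I I (fun y : M => h • y) x
      (translateField I w g x)) h).symm.trans (integral_congr_ae (Eventually.of_forall h1))
  · rw [← ContinuousLinearMap.integral_comp_comm _ (hint _)]
    have h1 : ∀ g : T, modelDeriv I 𝓘(ℝ, ℝ) f x (translateField I w g x) = c x := by
      intro g
      have h2 := modelDeriv_comp ((hf (g⁻¹ • g • x)).mdifferentiableAt (by simp))
        (hsm g⁻¹ (g • x)) (w (g • x))
      rw [inv_smul_smul] at h2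
      refine h2.symm.trans ?_
      simp only [hfT]
      rw [hwf, hcT]
    simp only [h1, integral_const, probReal_univ, one_smul]

/-- Given a function with no critical points on its compact zero set, there is a field whose
derivative of the function is a cutoff of `1` near the zero set. -/
theorem exists_transverse_vectorField [CompactSpace M] [T2Space M] {f : M → ℝ}
    (hf : ContMDiff I 𝓘(ℝ, ℝ) ∞ f) (hdf : ∀ x, f x = 0 → modelDeriv I 𝓘(ℝ, ℝ) f x ≠ 0) :
    ∃ (w : M → E) (χ : ℝ → ℝ) (δ : ℝ), 0 < δ ∧ (∀ s, |s| < δ → χ s = 1) ∧ (∀ s, |χ s| ≤ 1) ∧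
      ContMDiff I I.tangent ∞ (fun x => (⟨x, w x⟩ : TangentBundle I M)) ∧
      ∀ x, modelDeriv I 𝓘(ℝ, ℝ) f x (w x) = χ (f x) := by
  have : IsManifold I 1 M := IsManifold.of_le (n := ∞) (by simp)
  have hder : ∀ {w : M → E} {S : Set M}, ContMDiffOn I I.tangent ∞
      (fun x => (⟨x, w x⟩ : TangentBundle I M)) S →
      ContMDiffOn I 𝓘(ℝ, ℝ) ∞ (fun x => modelDeriv I 𝓘(ℝ, ℝ) f x (w x)) S := by
    intro w S hw
    exact (contMDiff_snd_tangentBundle_modelSpace ℝ 𝓘(ℝ, ℝ) (n := ∞)).comp_contMDiffOn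
      ((hf.contMDiff_tangentMap (m := ∞) (by simp)).comp_contMDiffOn hw)
  -- The condition df(v) > 0 over zeros of f is convex in v, so local solutions glue by a partition
  -- of unity.
  obtain ⟨w₀, hw₀⟩ := exists_contMDiffSection_forall_mem_convex_of_local I (n := ⊤)
    (TangentSpace I : M → Type _)
    (fun x => {v : E | f x = 0 → 0 < modelDeriv I 𝓘(ℝ, ℝ) f x v})
    (fun x => by
      by_cases hx : f x = 0
      · simp only [hx, forall_const]
        exact convex_halfSpace_gt (modelDeriv I 𝓘(ℝ, ℝ) f x).isLinear 0
      · simp only [hx, false_imp_iff]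
        exact convex_univ)
    (by
      intro x₀
      by_cases hx : f x₀ = 0
      · obtain ⟨v, hv⟩ : ∃ v : E, 0 < modelDeriv I 𝓘(ℝ, ℝ) f x₀ v := by
          by_contra! hn
          refine hdf x₀ hx (ContinuousLinearMap.ext fun v => le_antisymm (hn v) ?_)
          have := hn (-v)
          rw [map_neg] at this
          exact neg_nonpos.1 this
        obtain ⟨s, hs, hsw⟩ := FiberBundle.exists_contMDiffOn_extend (k := ∞) I E
          (V := (TangentSpace I : M → Type _)) (x₀ := x₀) v
        have h1 := ((hder hsw).contMDiffAt hs).continuousAt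
        refine ⟨s ∩ {x | 0 < modelDeriv I 𝓘(ℝ, ℝ) f x (FiberBundle.extend E
          (E := (TangentSpace I : M → Type _)) (x := x₀) v x)}, inter_mem hs
          (h1.eventually_const_lt ?_), FiberBundle.extend E
          (E := (TangentSpace I : M → Type _)) (x := x₀) v, hsw.mono inter_subset_left,
          fun y hy _ => hy.2⟩
        exact hv.trans_eq (congrArg (modelDeriv I 𝓘(ℝ, ℝ) f x₀)
          (FiberBundle.extend_apply_self (F := E) (E := (TangentSpace I : M → Type _))
            (x := x₀) v).symm)
      · refine ⟨{x | f x ≠ 0}, (isOpen_ne.preimage hf.continuous).mem_nhds hx, fun _ => (0 : E),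
          ?_, fun y hy h => absurd h hy⟩
        exact (Bundle.contMDiff_zeroSection ℝ (TangentSpace I : M → Type _)).contMDiffOn)
  have hφ : ContMDiff I 𝓘(ℝ, ℝ) ∞ (fun x => modelDeriv I 𝓘(ℝ, ℝ) f x (w₀ x)) :=
    contMDiffOn_univ.1 (hder w₀.contMDiff.contMDiffOn)
  obtain ⟨φ, hφe⟩ : ∃ φ : M → ℝ, φ = fun x => modelDeriv I 𝓘(ℝ, ℝ) f x (w₀ x) := ⟨_, rfl⟩
  rw [← hφe] at hφ
  -- On the compact set where df(w₀) ≤ 0 the function f has no zero, so |f| ≥ δ there. A cutoff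
  -- supported in |f| ≤ δ / 2 then permits division by df(w₀).
  obtain ⟨δ, hδ, hδφ⟩ : ∃ δ > 0, ∀ x, φ x ≤ 0 → δ ≤ |f x| := by
    obtain ⟨δ, hδ, h⟩ := ((isClosed_le hφ.continuous continuous_const).isCompact :
      IsCompact {x | φ x ≤ 0}).exists_forall_le' (f := fun x => |f x|) (a := 0)
      hf.continuous.abs.continuousOn fun x hx => by
        refine abs_pos.2 fun h0 => ?_
        have h1 : φ x ≤ 0 := hx
        have h2 : 0 < φ x := by rw [hφe]; exact hw₀ x h0
        linarith
    exact ⟨δ, hδ, h⟩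
  let b : ContDiffBump (0 : ℝ) := ⟨δ / 3, δ / 2, by linarith, by linarith⟩
  refine ⟨fun x => (b (f x) / φ x) • (w₀ x : E), b, δ / 3, by linarith, fun s hs =>
    b.one_of_mem_closedBall (by rw [Metric.mem_closedBall, Real.dist_eq, sub_zero]; exact hs.le),
    fun s => abs_le.2 ⟨by linarith [b.nonneg (x := s)], b.le_one⟩, fun x => ?_, fun x => ?_⟩
  · have hbf : ContMDiff I 𝓘(ℝ, ℝ) ∞ (fun x => b (f x)) := b.contDiff.contMDiff.comp hf
    refine ContMDiffAt.smul_section (f := fun x => b (f x) / φ x) ?_ (w₀.contMDiff x)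
    rcases le_or_gt (φ x) 0 with h | h
    · refine (contMDiffAt_const (c := (0 : ℝ))).congr_of_eventuallyEq ?_
      have h1 : δ / 2 < |f x| := by linarith [hδφ x h]
      filter_upwards [hf.continuous.abs.continuousAt.eventually_const_lt h1] with y hy
      rw [b.zero_of_le_dist (by rw [Real.dist_eq, sub_zero]; exact hy.le), zero_div]
    · exact (hbf x).div₀ (hφ x) h.ne'
  · refine ((modelDeriv I 𝓘(ℝ, ℝ) f x).map_smul (b (f x) / φ x) (w₀ x : E)).trans ?_
    rw [smul_eq_mul]
    rcases le_or_gt (φ x) 0 with h | h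
    · have h1 : b (f x) = 0 := b.zero_of_le_dist (by
        rw [Real.dist_eq, sub_zero]
        change δ / 2 ≤ _
        linarith [hδφ x h])
      rw [h1, zero_div, zero_mul]
    · have h2 : φ x = modelDeriv I 𝓘(ℝ, ℝ) f x (w₀ x) := by rw [hφe]
      rw [← h2, div_mul_cancel₀ _ h.ne']

end Average

/-! ### The equivariant collar -/

section Collar

/-- A curve with `u' = χ(u)`, `|χ| ≤ 1` and `χ = 1` near `0` moves with unit speed near `0`. -/
theorem eq_add_of_hasDerivAt_cutoff {u χ : ℝ → ℝ} {δ : ℝ} (hχ : ∀ s, |s| < δ → χ s = 1)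
    (hχ1 : ∀ s, |χ s| ≤ 1) (hu : ∀ t, HasDerivAt u (χ (u t)) t) {t : ℝ} (ht : |u 0| + |t| < δ) :
    u t = u 0 + t := by
  have h1 : ∀ s, |u s - u 0| ≤ |s| := by
    intro s
    have := convex_univ.norm_image_sub_le_of_norm_hasDerivWithin_le (f := u) (C := 1) (x := 0)
      (y := s) (fun r _ => (hu r).hasDerivWithinAt) (fun r _ => hχ1 _) (mem_univ _) (mem_univ _)
    simpa using this
  have h2 : ∀ s ∈ Icc (-|t|) |t|, χ (u s) = 1 := by
    intro s hs
    refine hχ _ ?_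
    have h3 : |u s| ≤ |u 0| + |u s - u 0| := by
      have := abs_add_le (u 0) (u s - u 0)
      rwa [add_sub_cancel] at this
    linarith [h1 s, abs_le.2 hs]
  have h4 := (convex_Icc (-|t|) |t|).norm_image_sub_le_of_norm_hasDerivWithin_le
    (f := fun s => u s - s) (f' := fun s => χ (u s) - 1) (C := 0) (x := 0) (y := t)
    (fun r _ => ((hu r).sub (hasDerivAt_id r)).hasDerivWithinAt)
    (fun r hr => by rw [h2 r hr, sub_self, norm_zero]) ⟨by simp, by simp⟩
    ⟨neg_abs_le t, le_abs_self t⟩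
  rw [zero_mul] at h4
  have h5 := norm_le_zero_iff.1 h4
  linarith

universe u

variable {E : Type u} [NormedAddCommGroup E] [NormedSpace ℝ E] [FiniteDimensional ℝ E]
  {H : Type*} [TopologicalSpace H] {I : ModelWithCorners ℝ E H} [I.Boundaryless]
  {M : Type*} [TopologicalSpace M] [ChartedSpace H M] [IsManifold I ∞ M]
  {E₂ : Type*} [NormedAddCommGroup E₂] [NormedSpace ℝ E₂]
  {H₂ : Type*} [TopologicalSpace H₂] {I₂ : ModelWithCorners ℝ E₂ H₂}
  {Z : Type*} [TopologicalSpace Z] [ChartedSpace H₂ Z] [IsManifold I₂ ∞ Z]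
  {F : Type*} [NormedAddCommGroup F] [NormedSpace ℝ F] [FiniteDimensional ℝ F]
  {K : Type*} [TopologicalSpace K] {J : ModelWithCorners ℝ F K}
  {T : Type*} [TopologicalSpace T] [ChartedSpace K T] [CommGroup T] [LieGroup J ∞ T]
  [MulAction T M] [MulAction T Z]

/-- Flowing out of Z along an invariant field with df(w) = 1 near Z makes f the collar coordinate;
the projection Q flows x back for time f x. Q is smooth because it is continuous and its composite
with the embedding is smooth. -/
theorem exists_equivariant_collar [CompactSpace M] [T2Space M] [ContMDiffSMul J I ∞ T M]
    [CompactSpace T] [T2Space T] [SecondCountableTopology T] [Nonempty Z] {ι : Z → M}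
    (hι : Manifold.IsSmoothEmbedding I₂ I ∞ ι) {f : M → ℝ} (hf : ContMDiff I 𝓘(ℝ, ℝ) ∞ f)
    (hZ : range ι = {x | f x = 0}) (hdf : ∀ x, f x = 0 → modelDeriv I 𝓘(ℝ, ℝ) f x ≠ 0)
    (hιT : ∀ (g : T) (z : Z), ι (g • z) = g • ι z) (hfT : ∀ (g : T) (x : M), f (g • x) = f x) :
    ∃ (ε : ℝ) (Φ : Z × ℝ → M) (Q : M → Z), 0 < ε ∧ ContMDiff (I₂.prod 𝓘(ℝ, ℝ)) I ∞ Φ ∧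
      ContMDiffOn I I₂ ∞ Q {x | |f x| < ε} ∧ (∀ z, Φ (z, 0) = ι z) ∧
      (∀ z t, |t| < ε → f (Φ (z, t)) = t) ∧ (∀ z t, |t| < ε → Q (Φ (z, t)) = z) ∧
      (∀ x, |f x| < ε → Φ (Q x, f x) = x) ∧
      ∀ (g : T) (z : Z) (t : ℝ), Φ (g • z, t) = g • Φ (z, t) := by
  obtain ⟨w₁, χ, δ, hδ, hχ, hχ1, hw₁, hw₁f⟩ := exists_transverse_vectorField hf hdf
  obtain ⟨w, hw, hwT, hwf⟩ := exists_invariant_vectorField (J := J) (T := T) hw₁ hf hfT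
    (c := fun x => χ (f x)) (fun g x => by rw [hfT]) hw₁f
  obtain ⟨θ, hθ, hθ0, hθw⟩ := exists_contMDiff_flow hw isCompact_univ
    (fun x hx => absurd (mem_univ x) hx)
  have hft : ∀ x t, |f x| + |t| < δ → f (θ (x, t)) = f x + t := by
    intro x t ht
    have h1 : ∀ t, HasDerivAt (fun t => f (θ (x, t))) (χ (f (θ (x, t)))) t := by
      intro t
      have h2 := ((hf (θ (x, t))).mdifferentiableAt (by simp)).hasMFDerivAt.comp t (hθw x t)
      have h3 : HasFDerivAt (fun t => f (θ (x, t))) ((modelDeriv I 𝓘(ℝ, ℝ) f (θ (x, t))).comp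
        ((1 : ℝ →L[ℝ] ℝ).smulRight (w (θ (x, t))))) t := h2.hasFDerivAt
      have h4 := h3.hasDerivAt
      simpa only [ContinuousLinearMap.comp_apply, ContinuousLinearMap.smulRight_apply,
        ContinuousLinearMap.one_apply, one_smul, hwf] using h4
    have h5 := eq_add_of_hasDerivAt_cutoff hχ hχ1 h1 (t := t)
    rw [hθ0] at h5
    exact h5 ht
  have hZ' : ∀ x, |f x| < δ / 2 → ∃ z, ι z = θ (x, -f x) := by
    intro x hx
    have h1 : θ (x, -f x) ∈ range ι := by
      rw [hZ, mem_ofPred_eq, hft x _ (by rw [abs_neg]; linarith), add_neg_cancel]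
    exact h1
  have hι0 : ∀ z, f (ι z) = 0 := fun z => by
    have : ι z ∈ {x | f x = 0} := hZ ▸ mem_range_self z
    exact this
  -- Off |f| < δ / 2 the value of Q is arbitrary; `Nonempty Z` is used here.
  choose! Q hQ using hZ'
  have hΦf : ∀ z t, |t| < δ / 2 → f (θ (ι z, t)) = t := fun z t ht => by
    rw [hft _ _ (by rw [hι0, abs_zero]; linarith), hι0, zero_add]
  have hO : IsOpen {x | |f x| < δ / 2} := isOpen_lt hf.continuous.abs continuous_const
  have hadd := fun x a t => flow_add hw hθ0 hθw x a t
  refine ⟨δ / 2, fun p => θ (ι p.1, p.2), Q, by linarith,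
    hθ.comp ((hι.contMDiff.comp contMDiff_fst).prodMk contMDiff_snd), ?_,
    fun z => hθ0 _, hΦf, fun z t ht => ?_, fun x hx => ?_, fun g z t => ?_⟩
  · have h1 : ContMDiff I I ∞ (fun x => θ (x, -f x)) := hθ.comp (contMDiff_id.prodMk hf.neg)
    have h2 : ContinuousOn Q {x | |f x| < δ / 2} :=
      hι.isEmbedding.isInducing.continuousOn_iff.2
        (h1.continuous.continuousOn.congr fun x hx => hQ x hx)
    intro x hx
    have h3 := hO.mem_nhds hx
    refine ContMDiffAt.contMDiffWithinAt ((ContMDiffAt.iff_comp_isImmersionAt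
      (hι.isImmersion.isImmersionAt (Q x))).2 ⟨h2.continuousAt h3, ?_⟩)
    refine (h1 x).congr_of_eventuallyEq ?_
    filter_upwards [h3] with y hy using hQ y hy
  · refine hι.isEmbedding.injective ?_
    rw [hQ _ (by rw [hΦf z t ht]; exact ht), hΦf z t ht, hadd, neg_add_cancel, hθ0]
  · beta_reduce
    rw [hQ x hx, hadd, add_neg_cancel, hθ0]
  · beta_reduce
    rw [hιT]
    exact flow_equivariant hw hθ0 hθw (contMDiff_const_smul_of_action I J g) (hwT g) _ _

end Collar

/-! ### Frames of the `b^m`-tangent bundle over a collar -/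

section Frame

universe u

variable {E : Type*} [NormedAddCommGroup E] [NormedSpace ℝ E]
  {H : Type*} [TopologicalSpace H] {I : ModelWithCorners ℝ E H}
  {M : Type*} [TopologicalSpace M] [ChartedSpace H M]
  {E₂ : Type*} [NormedAddCommGroup E₂] [NormedSpace ℝ E₂]
  {H₂ : Type*} [TopologicalSpace H₂] {I₂ : ModelWithCorners ℝ E₂ H₂}
  {Z : Type*} [TopologicalSpace Z] [ChartedSpace H₂ Z]

variable (I I₂) in
/-- `Φ` is a diffeomorphism from `Z × (-ε, ε)` onto `{|f| < ε}` with `f ∘ Φ = t`, and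
`x ↦ (Q x, f x)` is its inverse. -/
structure IsCollar (f : M → ℝ) (ε : ℝ) (Φ : Z × ℝ → M) (Q : M → Z) : Prop where
  smooth : ContMDiff (I₂.prod 𝓘(ℝ, ℝ)) I ∞ Φ
  smooth_fun : ContMDiff I 𝓘(ℝ, ℝ) ∞ f
  smooth_inv : ContMDiffOn I I₂ ∞ Q {x | |f x| < ε}
  fun_apply : ∀ p : Z × ℝ, |p.2| < ε → f (Φ p) = p.2
  left_inv : ∀ p : Z × ℝ, |p.2| < ε → Q (Φ p) = p.1
  right_inv : ∀ x, |f x| < ε → Φ (Q x, f x) = x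

namespace IsCollar

variable {f : M → ℝ} {ε : ℝ} {Φ : Z × ℝ → M} {Q : M → Z}

theorem isOpen (hc : IsCollar I I₂ f ε Φ Q) : IsOpen {x | |f x| < ε} :=
  isOpen_lt hc.smooth_fun.continuous.abs continuous_const

theorem contMDiffOn_inv (hc : IsCollar I I₂ f ε Φ Q) : ContMDiffOn I (I₂.prod 𝓘(ℝ, ℝ)) ∞ (fun x => (Q x, f x))
    {x | |f x| < ε} :=
  hc.smooth_inv.prodMk hc.smooth_fun.contMDiffOn

theorem modelDeriv_fun (hc : IsCollar I I₂ f ε Φ Q) {p : Z × ℝ} (hp : |p.2| < ε) (v : E₂ × ℝ) :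
    modelDeriv I 𝓘(ℝ, ℝ) f (Φ p) (modelDeriv (I₂.prod 𝓘(ℝ, ℝ)) I Φ p v) = v.2 := by
  rw [← modelDeriv_comp ((hc.smooth_fun _).mdifferentiableAt (by simp))
    ((hc.smooth p).mdifferentiableAt (by simp))]
  have h1 : (fun q => f (Φ q)) =ᶠ[𝓝 p] Prod.snd := by
    filter_upwards [(isOpen_lt continuous_snd.abs continuous_const).mem_nhds hp] with q hq
      using hc.fun_apply q hq
  rw [h1.modelDeriv_eq]
  exact congrArg (fun L : E₂ × ℝ →L[ℝ] ℝ => L v) mfderiv_snd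

theorem exists_modelDeriv_inverse (hc : IsCollar I I₂ f ε Φ Q) {p : Z × ℝ} (hp : |p.2| < ε) :
    ∃ D : E →L[ℝ] E₂ × ℝ, (∀ v, D (modelDeriv (I₂.prod 𝓘(ℝ, ℝ)) I Φ p v) = v) ∧
      ∀ w, modelDeriv (I₂.prod 𝓘(ℝ, ℝ)) I Φ p (D w) = w := by
  have hx : |f (Φ p)| < ε := by rwa [hc.fun_apply p hp]
  have h1 : MDifferentiableAt I (I₂.prod 𝓘(ℝ, ℝ)) (fun x => (Q x, f x)) (Φ p) :=
    (hc.contMDiffOn_inv.contMDiffAt (hc.isOpen.mem_nhds hx)).mdifferentiableAt (by simp)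
  have h2 : MDifferentiableAt (I₂.prod 𝓘(ℝ, ℝ)) I Φ p :=
    (hc.smooth p).mdifferentiableAt (by simp)
  have hpp : (Q (Φ p), f (Φ p)) = p := by rw [hc.left_inv p hp, hc.fun_apply p hp]
  refine ⟨modelDeriv I (I₂.prod 𝓘(ℝ, ℝ)) (fun x => (Q x, f x)) (Φ p), fun v => ?_, fun w => ?_⟩
  · rw [← modelDeriv_comp h1 h2]
    have h3 : (fun q => (Q (Φ q), f (Φ q))) =ᶠ[𝓝 p] id := by
      filter_upwards [(isOpen_lt continuous_snd.abs continuous_const).mem_nhds hp] with q hq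
      rw [hc.left_inv q hq, hc.fun_apply q hq]
      rfl
    rw [h3.modelDeriv_eq]
    exact congrArg (fun L : E₂ × ℝ →L[ℝ] E₂ × ℝ => L v) mfderiv_id
  · have h4 := modelDeriv_comp (x := Φ p) (G := Φ) (F := fun x => (Q x, f x))
      (by beta_reduce; rw [hpp]; exact h2) h1 w
    beta_reduce at h4
    rw [hpp] at h4
    rw [← h4]
    have h3 : (fun x => Φ (Q x, f x)) =ᶠ[𝓝 (Φ p)] id := by
      filter_upwards [hc.isOpen.mem_nhds hx] with x hx using hc.right_inv x hx
    rw [h3.modelDeriv_eq]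
    exact congrArg (fun L : E →L[ℝ] E => L w) mfderiv_id

end IsCollar

variable (I I₂) in
/-- The map `(u, k) ↦ (k, dΦ(u, f^m k))` to the fibre of the `b^m`-tangent bundle. -/
noncomputable def bmFrame (f : M → ℝ) (m : ℕ) (Φ : Z × ℝ → M) (p : Z × ℝ) :
    E₂ × ℝ →L[ℝ] BmTangent I f m (Φ p) :=
  let L : E₂ × ℝ →L[ℝ] ℝ × TangentSpace I (Φ p) := (ContinuousLinearMap.snd ℝ E₂ ℝ).prod
    ((modelDeriv (I₂.prod 𝓘(ℝ, ℝ)) I Φ p).comp ((ContinuousLinearMap.fst ℝ E₂ ℝ).prod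
      (f (Φ p) ^ m • ContinuousLinearMap.snd ℝ E₂ ℝ)))
  open Classical in
  if h : ∀ v, L v ∈ BmTangent I f m (Φ p) then L.codRestrict (BmTangent I f m (Φ p)) h else 0

variable {f : M → ℝ} {ε : ℝ} {Φ : Z × ℝ → M} {Q : M → Z} {m : ℕ}

theorem bmFrame_apply (hc : IsCollar I I₂ f ε Φ Q) {p : Z × ℝ} (hp : |p.2| < ε) (v : E₂ × ℝ) :
    (bmFrame I I₂ f m Φ p v).1 =
      (v.2, modelDeriv (I₂.prod 𝓘(ℝ, ℝ)) I Φ p (v.1, f (Φ p) ^ m * v.2)) := by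
  rw [bmFrame, dif_pos]
  · rfl
  · intro v
    exact hc.modelDeriv_fun hp (v.1, f (Φ p) ^ m * v.2)

theorem bmLift_apply {x : M} (hx : f x ≠ 0) (v : E) :
    (bmLift I f m x v).1 = ((f x ^ m)⁻¹ * modelDeriv I 𝓘(ℝ, ℝ) f x v, v) := by
  rw [bmLift, dif_pos hx]
  rfl

variable (I₂) in
/-- The pullback of a `b^m`-form under the frame over a collar. -/
noncomputable def bmPull (σ : BmForm I f m) (Φ : Z × ℝ → M) (p : Z × ℝ) :
    (E₂ × ℝ) [⋀^Fin 2]→L[ℝ] ℝ :=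
  (σ (Φ p)).compContinuousLinearMap (bmFrame I I₂ f m Φ p)

theorem bmPull_apply (σ : BmForm I f m) (Φ : Z × ℝ → M) (p : Z × ℝ) (v w : E₂ × ℝ) :
    bmPull I₂ σ Φ p ![v, w] = σ (Φ p) ![bmFrame I I₂ f m Φ p v, bmFrame I I₂ f m Φ p w] := by
  rw [bmPull, ContinuousAlternatingMap.compContinuousLinearMap_apply]
  congr 1
  funext i; fin_cases i <;> rfl

theorem BmForm.toForm_val_apply (σ : BmForm I f m) (x : M) (v w : E) :
    (BmForm.toForm I σ).val x ![v, w] = σ x ![bmLift I f m x v, bmLift I f m x w] := by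
  change (σ x).compContinuousLinearMap (bmLift I f m x) ![v, w] = _
  rw [ContinuousAlternatingMap.compContinuousLinearMap_apply]
  congr 1
  funext i; fin_cases i <;> rfl

/-- Off the hypersurface, the pullback of a `b^m`-form under a collar is
`t^{-m} dt ∧ A + B`. -/
theorem bmPull_eq_toForm (hc : IsCollar I I₂ f ε Φ Q) (σ : BmForm I f m) {p : Z × ℝ}
    (hp : |p.2| < ε) (hp0 : p.2 ≠ 0) (v w : E₂ × ℝ) :
    (BmForm.toForm I σ).val (Φ p) ![modelDeriv (I₂.prod 𝓘(ℝ, ℝ)) I Φ p v,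
      modelDeriv (I₂.prod 𝓘(ℝ, ℝ)) I Φ p w] =
    bmPull I₂ σ Φ p ![(v.1, (p.2 ^ m)⁻¹ * v.2), (w.1, (p.2 ^ m)⁻¹ * w.2)] := by
  rw [BmForm.toForm_val_apply, bmPull_apply]
  have hf := hc.fun_apply p hp
  have h1 : ∀ v : E₂ × ℝ, bmLift I f m (Φ p) (modelDeriv (I₂.prod 𝓘(ℝ, ℝ)) I Φ p v) =
      bmFrame I I₂ f m Φ p (v.1, (p.2 ^ m)⁻¹ * v.2) := by
    intro v
    refine Subtype.ext ?_
    rw [bmLift_apply (by rwa [hf]), bmFrame_apply hc hp, hc.modelDeriv_fun hp, hf,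
      mul_inv_cancel_left₀ (pow_ne_zero m hp0)]
  rw [h1, h1]

/-- The frame is an isomorphism onto the fibre even over t = 0. It is onto because df(v) = f^m k
fixes the t-component of the preimage of v under dΦ, leaving only its Z-component free. -/
theorem nondegTwo_bmPull (hc : IsCollar I I₂ f ε Φ Q) {σ : BmForm I f m}
    (hσ : ∀ (x : M) (p : BmTangent I f m x), (∀ q : BmTangent I f m x, σ x ![p, q] = 0) → p = 0)
    {p : Z × ℝ} (hp : |p.2| < ε) : NondegTwo (bmPull I₂ σ Φ p) := by
  obtain ⟨D, hD1, hD2⟩ := hc.exists_modelDeriv_inverse hp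
  intro v hv
  have h1 : bmFrame I I₂ f m Φ p v = 0 := by
    refine hσ _ _ fun q => ?_
    have hq : modelDeriv I 𝓘(ℝ, ℝ) f (Φ p) q.1.2 = f (Φ p) ^ m * q.1.1 := q.2
    have h2 : q = bmFrame I I₂ f m Φ p ((D q.1.2).1, q.1.1) := by
      refine Subtype.ext ?_
      rw [bmFrame_apply hc hp]
      have h3 : (D q.1.2).2 = f (Φ p) ^ m * q.1.1 := by
        rw [← hq, ← hc.modelDeriv_fun hp (D q.1.2)]
        exact congrArg (modelDeriv I 𝓘(ℝ, ℝ) f (Φ p)) (hD2 q.1.2)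
      refine Prod.ext rfl ?_
      rw [← h3]
      exact (hD2 q.1.2).symm
    rw [h2, ← bmPull_apply]
    exact hv _
  have h2 := congrArg Subtype.val h1
  rw [bmFrame_apply hc hp] at h2
  have h3 : v.2 = 0 := congrArg Prod.fst h2
  have h4 : modelDeriv (I₂.prod 𝓘(ℝ, ℝ)) I Φ p (v.1, f (Φ p) ^ m * v.2) = 0 :=
    congrArg Prod.snd h2
  have h5 := hD1 (v.1, f (Φ p) ^ m * v.2)
  rw [h4, map_zero] at h5
  exact Prod.ext (congrArg Prod.fst h5).symm h3

end Frame

/-! ### Smoothness of the pullback under the frame -/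

section FrameSmooth

variable {E : Type*} [NormedAddCommGroup E] [NormedSpace ℝ E] [FiniteDimensional ℝ E]
  {H : Type*} [TopologicalSpace H] {I : ModelWithCorners ℝ E H} [I.Boundaryless]
  {M : Type*} [TopologicalSpace M] [ChartedSpace H M] [IsManifold I ∞ M] [T2Space M]
  {E₂ : Type*} [NormedAddCommGroup E₂] [NormedSpace ℝ E₂]
  {H₂ : Type*} [TopologicalSpace H₂] {I₂ : ModelWithCorners ℝ E₂ H₂} [I₂.Boundaryless]
  {Z : Type*} [TopologicalSpace Z] [ChartedSpace H₂ Z] [IsManifold I₂ ∞ Z]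
  {f : M → ℝ} {ε : ℝ} {Φ : Z × ℝ → M} {Q : M → Z} {m : ℕ}

/-- The frame over a collar extends locally to global smooth `b^m`-fields. -/
theorem exists_bmField (hc : IsCollar I I₂ f ε Φ Q) (x₀ : Z × ℝ) {q₀ : E₂ × ℝ}
    (hq₀ : q₀ ∈ (extChartAt (I₂.prod 𝓘(ℝ, ℝ)) x₀).target)
    (hq₀ε : |((extChartAt (I₂.prod 𝓘(ℝ, ℝ)) x₀).symm q₀).2| < ε) (v : E₂ × ℝ) :
    ∃ P : ∀ x, BmTangent I f m x, IsSmoothBmField I f m P ∧ ∀ᶠ q in 𝓝 q₀,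
      P (Φ ((extChartAt (I₂.prod 𝓘(ℝ, ℝ)) x₀).symm q)) =
        bmFrame I I₂ f m Φ ((extChartAt (I₂.prod 𝓘(ℝ, ℝ)) x₀).symm q)
          (chartDeriv (I₂.prod 𝓘(ℝ, ℝ)) x₀ q v) := by
  obtain ⟨e, he⟩ : ∃ e, e = extChartAt (I₂.prod 𝓘(ℝ, ℝ)) x₀ := ⟨_, rfl⟩
  have heo : IsOpen e.target := he ▸ isOpen_extChartAt_target x₀
  have heso : IsOpen e.source := he ▸ isOpen_extChartAt_source x₀
  have hes : ContMDiffOn 𝓘(ℝ, E₂ × ℝ) (I₂.prod 𝓘(ℝ, ℝ)) ∞ e.symm e.target :=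
    he ▸ contMDiffOn_extChartAt_symm x₀
  have hee : ContMDiffOn (I₂.prod 𝓘(ℝ, ℝ)) 𝓘(ℝ, E₂ × ℝ) ∞ e e.source := by
    rw [he, extChartAt_source]; exact contMDiffOn_extChartAt
  have hcd : ∀ q, chartDeriv (I₂.prod 𝓘(ℝ, ℝ)) x₀ q =
      modelDeriv 𝓘(ℝ, E₂ × ℝ) (I₂.prod 𝓘(ℝ, ℝ)) e.symm q := fun q => he ▸ rfl
  have hcd2 : ∀ q ∈ e.target, ∀ v, chartDeriv (I₂.prod 𝓘(ℝ, ℝ)) x₀ q v =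
      (chartDeriv I₂ x₀.1 q.1 v.1, v.2) := by
    intro q hq v
    rw [he, extChartAt_prod_line] at hq
    rw [chartDeriv_prod_line x₀ hq.1]
    rfl
  rw [← he] at hq₀ hq₀ε ⊢
  set G : E₂ × ℝ → M := fun q => Φ (e.symm q) with hG
  set O : Set (E₂ × ℝ) := e.target ∩ e.symm ⁻¹' {p | |p.2| < ε} with hO
  have hOo : IsOpen O := hes.continuousOn.isOpen_inter_preimage heo
    (isOpen_lt continuous_snd.abs continuous_const)
  have hGs : ContMDiffOn 𝓘(ℝ, E₂ × ℝ) I ∞ G O :=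
    hc.smooth.comp_contMDiffOn (hes.mono inter_subset_left)
  have hfG : ∀ q ∈ O, f (G q) = (e.symm q).2 := fun q hq => hc.fun_apply _ hq.2
  set W : Set M := {x | |f x| < ε} ∩ (fun x => (Q x, f x)) ⁻¹' e.source with hW
  have hWo : IsOpen W := hc.contMDiffOn_inv.continuousOn.isOpen_inter_preimage hc.isOpen heso
  set k : M → E₂ × ℝ := fun x => e (Q x, f x) with hk
  have hks : ContMDiffOn I 𝓘(ℝ, E₂ × ℝ) ∞ k W :=
    hee.comp (hc.contMDiffOn_inv.mono inter_subset_left) fun x hx => hx.2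
  have hkO : ∀ x ∈ W, k x ∈ O := fun x hx => ⟨e.map_source hx.2, by
    rw [mem_preimage, e.left_inv hx.2]; exact hx.1⟩
  have hGk : ∀ x ∈ W, G (k x) = x := fun x hx => by
    rw [hG, hk]; beta_reduce; rw [e.left_inv hx.2]; exact hc.right_inv x hx.1
  have hkG : ∀ q ∈ O, k (G q) = q := fun q hq => by
    have h1 : (Q (G q), f (G q)) = e.symm q := by
      rw [hfG q hq]
      exact Prod.ext (hc.left_inv _ hq.2) rfl
    rw [hk]; beta_reduce; rw [h1, e.right_inv hq.1]
  have hGW : ∀ q ∈ O, G q ∈ W := fun q hq => by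
    have h1 : (Q (G q), f (G q)) = e.symm q := by
      rw [hfG q hq]
      exact Prod.ext (hc.left_inv _ hq.2) rfl
    refine ⟨?_, ?_⟩
    · rw [mem_ofPred_eq, hfG q hq]; exact hq.2
    · rw [mem_preimage, h1]; exact e.map_target hq.1
  have hfGs : ContDiffOn ℝ ∞ (fun q => f (G q)) O :=
    (hc.smooth_fun.comp_contMDiffOn hGs).contDiffOn
  set X : E₂ × ℝ → E₂ × ℝ := fun q => (v.1, f (G q) ^ m * v.2) with hX
  have hXs : ContDiffOn ℝ ∞ X O := contDiffOn_const.prodMk ((hfGs.pow m).mul contDiffOn_const)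
  set V : M → E := fun x => modelDeriv 𝓘(ℝ, E₂ × ℝ) I G (k x) (X (k x)) with hV
  have hVs : ContMDiffOn I I.tangent ∞ (fun x => (⟨x, V x⟩ : TangentBundle I M)) W := by
    refine ((contMDiffOn_mfderiv_apply hOo hGs hXs).comp hks hkO).congr fun x hx => ?_
    have h4 : ∀ (x' : M) (w : E), x = x' → (⟨x, w⟩ : TangentBundle I M) = ⟨x', w⟩ := by
      rintro _ _ rfl; rfl
    exact h4 _ _ (hGk x hx).symm
  have hGd : ∀ q ∈ O, MDifferentiableAt 𝓘(ℝ, E₂ × ℝ) I G q := fun q hq =>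
    (hGs.contMDiffAt (hOo.mem_nhds hq)).mdifferentiableAt (by simp)
  have hGD : ∀ q ∈ O, ∀ u, modelDeriv 𝓘(ℝ, E₂ × ℝ) I G q u =
      modelDeriv (I₂.prod 𝓘(ℝ, ℝ)) I Φ (e.symm q) (chartDeriv (I₂.prod 𝓘(ℝ, ℝ)) x₀ q u) := by
    intro q hq u
    rw [hcd]
    exact modelDeriv_comp ((hc.smooth _).mdifferentiableAt (by simp))
      ((hes.contMDiffAt (heo.mem_nhds hq.1)).mdifferentiableAt (by simp)) u
  have hfV : ∀ x ∈ W, modelDeriv I 𝓘(ℝ, ℝ) f x (V x) = f x ^ m * v.2 := by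
    intro x hx
    have h1 := hGD (k x) (hkO x hx) (X (k x))
    have h2 := hc.modelDeriv_fun (p := e.symm (k x)) (hkO x hx).2
      (chartDeriv (I₂.prod 𝓘(ℝ, ℝ)) x₀ (k x) (X (k x)))
    rw [← h1] at h2
    rw [hcd2 _ (hkO x hx).1] at h2
    have h3 : Φ (e.symm (k x)) = x := hGk x hx
    rw [h3] at h2
    refine h2.trans ?_
    rw [hX]; beta_reduce
    rw [hGk x hx]
  have hq₀O : q₀ ∈ O := ⟨hq₀, hq₀ε⟩
  -- Smoothness of a b^m-form is tested on global fields, so the coordinate field is cut off inside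
  -- the part of the collar covered by the chart.
  obtain ⟨ψ, hψW⟩ : ∃ ψ : SmoothBumpFunction I (G q₀), tsupport ψ ⊆ W := by
    obtain ⟨ψ, -, h⟩ := (SmoothBumpFunction.nhds_basis_tsupport (I := I) (G q₀)).mem_iff.1
      (hWo.mem_nhds (hGW q₀ hq₀O))
    exact ⟨ψ, h⟩
  have hmem : ∀ x, ((ψ x * v.2, ψ x • V x) : ℝ × E) ∈ BmTangent I f m x := by
    intro x
    change modelDeriv I 𝓘(ℝ, ℝ) f x (ψ x • V x) = f x ^ m * (ψ x * v.2)
    rw [map_smul, smul_eq_mul]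
    by_cases hx : x ∈ W
    · rw [hfV x hx]; ring
    · have h0 : ψ x = 0 := image_eq_zero_of_notMem_tsupport fun h => hx (hψW h)
      rw [h0]; ring
  refine ⟨fun x => ⟨(ψ x * v.2, ψ x • V x), hmem x⟩, ⟨?_, ?_⟩, ?_⟩
  · exact ψ.contMDiff.mul contMDiff_const
  · exact ContMDiffOn.smul_section_of_tsupport (V := (TangentSpace I : M → Type _))
      ψ.contMDiff.contMDiffOn hWo hψW hVs
  · have h1 : ∀ᶠ q in 𝓝 q₀, ψ (G q) = 1 :=
      (hGs.contMDiffAt (hOo.mem_nhds hq₀O)).continuousAt.eventually ψ.eventuallyEq_one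
    filter_upwards [h1, hOo.mem_nhds hq₀O] with q hq1 hqO
    refine Subtype.ext ?_
    rw [bmFrame_apply hc hqO.2, hcd2 q hqO.1]
    refine Prod.ext ?_ ?_
    · change ψ (G q) * v.2 = v.2
      rw [hq1, one_mul]
    · change ψ (G q) • V (G q) = _
      rw [hq1, one_smul, hV]
      beta_reduce
      rw [hkG q hqO, hGD q hqO, hcd2 q hqO.1]

/-- Near q₀ the frame vectors are values of global smooth b^m-fields, on which σ is smooth by
definition. -/
theorem contDiffAt_bmPull (hc : IsCollar I I₂ f ε Φ Q) {σ : BmForm I f m}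
    (hσ : BmForm.IsSmooth I σ) (x₀ : Z × ℝ) {q₀ : E₂ × ℝ}
    (hq₀ : q₀ ∈ (extChartAt (I₂.prod 𝓘(ℝ, ℝ)) x₀).target)
    (hq₀ε : |((extChartAt (I₂.prod 𝓘(ℝ, ℝ)) x₀).symm q₀).2| < ε) (v w : E₂ × ℝ) :
    ContDiffAt ℝ ∞ (fun q => bmPull I₂ σ Φ ((extChartAt (I₂.prod 𝓘(ℝ, ℝ)) x₀).symm q)
      ![chartDeriv (I₂.prod 𝓘(ℝ, ℝ)) x₀ q v, chartDeriv (I₂.prod 𝓘(ℝ, ℝ)) x₀ q w]) q₀ := by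
  obtain ⟨P, hP, hPe⟩ := exists_bmField (m := m) hc x₀ hq₀ hq₀ε v
  obtain ⟨P', hP', hPe'⟩ := exists_bmField (m := m) hc x₀ hq₀ hq₀ε w
  have h1 : ContMDiffAt 𝓘(ℝ, E₂ × ℝ) (I₂.prod 𝓘(ℝ, ℝ)) ∞
    (extChartAt (I₂.prod 𝓘(ℝ, ℝ)) x₀).symm q₀ := contMDiffAt_extChartAt_symm_of_mem hq₀
  have h2 := ((hσ P P' hP hP').comp hc.smooth _).comp q₀ h1
  refine ContDiffAt.congr_of_eventuallyEq h2.contDiffAt ?_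
  filter_upwards [hPe, hPe'] with q hq hq'
  rw [bmPull_apply, ← hq, ← hq']
  rfl

end FrameSmooth

/-! ### The coefficients of a `b^m`-symplectic form on a collar -/

section Coefficients

variable {E : Type*} [NormedAddCommGroup E] [NormedSpace ℝ E]
  {H : Type*} [TopologicalSpace H] {I : ModelWithCorners ℝ E H}
  {M : Type*} [TopologicalSpace M] [ChartedSpace H M]
  {E₂ : Type*} [NormedAddCommGroup E₂] [NormedSpace ℝ E₂] [FiniteDimensional ℝ E₂]
  {H₂ : Type*} [TopologicalSpace H₂] {I₂ : ModelWithCorners ℝ E₂ H₂}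
  {Z : Type*} [TopologicalSpace Z] [ChartedSpace H₂ Z]
  {f : M → ℝ} {ε : ℝ} {Φ : Z × ℝ → M} {Q : M → Z} {m : ℕ}

variable (I₂) in
/-- The one-form `A_t` in `Φ^* σ = t^{-m} dt ∧ A_t + B_t`. -/
noncomputable def bmCoeffOne (σ : BmForm I f m) (Φ : Z × ℝ → M) (t : ℝ) : RawForm I₂ Z 1 :=
  fun z => ContinuousAlternatingMap.ofSubsingleton ℝ E₂ ℝ (0 : Fin 1)
    ((flatTwo (bmPull I₂ σ Φ (z, t)) (0, 1)).comp (ContinuousLinearMap.inl ℝ E₂ ℝ))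

variable (I₂) in
/-- The two-form `B_t` in `Φ^* σ = t^{-m} dt ∧ A_t + B_t`. -/
noncomputable def bmCoeffTwo (σ : BmForm I f m) (Φ : Z × ℝ → M) (t : ℝ) : RawForm I₂ Z 2 :=
  fun z => (bmPull I₂ σ Φ (z, t)).compContinuousLinearMap (ContinuousLinearMap.inl ℝ E₂ ℝ)

theorem bmCoeffOne_apply (σ : BmForm I f m) (Φ : Z × ℝ → M) (t : ℝ) (z : Z) (u : E₂) :
    (bmCoeffOne I₂ σ Φ t).val z ![u] = bmPull I₂ σ Φ (z, t) ![(0, 1), (u, 0)] := rfl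

theorem bmCoeffTwo_apply (σ : BmForm I f m) (Φ : Z × ℝ → M) (t : ℝ) (z : Z) (u w : E₂) :
    (bmCoeffTwo I₂ σ Φ t).val z ![u, w] = bmPull I₂ σ Φ (z, t) ![(u, 0), (w, 0)] := by
  change (bmPull I₂ σ Φ (z, t)).compContinuousLinearMap (ContinuousLinearMap.inl ℝ E₂ ℝ) _ = _
  rw [ContinuousAlternatingMap.compContinuousLinearMap_apply]
  congr 1
  funext i; fin_cases i <;> rfl

theorem wedgeLine_bmCoeff (σ : BmForm I f m) (Φ : Z × ℝ → M) (p : Z × ℝ) :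
    wedgeLine ((bmCoeffOne I₂ σ Φ p.2).val p.1) ((bmCoeffTwo I₂ σ Φ p.2).val p.1) =
      bmPull I₂ σ Φ p := by
  refine alternating_two_ext fun v w => ?_
  rw [wedgeLine_apply, bmCoeffOne_apply, bmCoeffOne_apply, bmCoeffTwo_apply]
  have h : ∀ v : E₂ × ℝ, v = (v.1, 0) + v.2 • ((0, 1) : E₂ × ℝ) := fun v => by
    simp
  obtain ⟨S, hS⟩ : ∃ S, S = bmPull I₂ σ Φ p := ⟨_, rfl⟩
  have hp : ((p.1, p.2) : Z × ℝ) = p := rfl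
  rw [hp, ← hS]
  conv_rhs => rw [h v, h w]
  rw [alternating_two_add_left, alternating_two_add_right, alternating_two_add_right,
    alternating_two_smul_left, alternating_two_smul_left, alternating_two_smul_right,
    alternating_two_smul_right, alternating_two_self, alternating_two_swap S (v.1, 0) (0, 1)]
  ring

theorem familyForm_bmCoeff (hc : IsCollar I I₂ f ε Φ Q) (σ : BmForm I f m) {p : Z × ℝ}
    (hp : |p.2| < ε) (hp0 : p.2 ≠ 0) (v w : E₂ × ℝ) :
    (familyForm I₂ (fun t => (t ^ m)⁻¹ • bmCoeffOne I₂ σ Φ t) (bmCoeffTwo I₂ σ Φ)).val p ![v, w] =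
      (BmForm.toForm I σ).val (Φ p) ![modelDeriv (I₂.prod 𝓘(ℝ, ℝ)) I Φ p v,
        modelDeriv (I₂.prod 𝓘(ℝ, ℝ)) I Φ p w] := by
  rw [bmPull_eq_toForm hc σ hp hp0, ← wedgeLine_bmCoeff, wedgeLine_apply, familyForm_apply,
    RawForm.val_smul_one_apply, RawForm.val_smul_one_apply]
  ring

variable [FiniteDimensional ℝ E] [I.Boundaryless] [IsManifold I ∞ M] [T2Space M]
  [I₂.Boundaryless] [IsManifold I₂ ∞ Z]

theorem isSmoothFamily_bmCoeffOne (hc : IsCollar I I₂ f ε Φ Q) {σ : BmForm I f m}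
    (hσ : BmForm.IsSmooth I σ) : IsSmoothFamily I₂ (Ioo (-ε) ε) (bmCoeffOne I₂ σ Φ) := by
  rintro x₀ q ⟨hq, hqε⟩
  refine contDiffWithinAt_alternating fun v => ?_
  have hq' : q ∈ (extChartAt (I₂.prod 𝓘(ℝ, ℝ)) ((x₀, 0) : Z × ℝ)).target := by
    rw [extChartAt_prod_line]; exact ⟨hq, mem_univ _⟩
  have h1 := contDiffAt_bmPull hc hσ (x₀, 0) hq'
    (by rw [extChartAt_prod_line]; exact abs_lt.2 hqε) (0, 1) (v 0, 0)
  refine (h1.contDiffWithinAt (s := (extChartAt I₂ x₀).target ×ˢ Ioo (-ε) ε)).congr_of_mem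
    (fun q hq => ?_) ⟨hq, hqε⟩
  have hv : v = ![v 0] := by funext i; fin_cases i; rfl
  rw [hv, RawForm.inChart_one_apply, bmCoeffOne_apply, chartDeriv_prod_line _ hq.1,
    extChartAt_prod_line]
  refine congrArg _ ?_
  funext i
  fin_cases i
  · exact Prod.ext (map_zero (chartDeriv I₂ x₀ q.1)).symm rfl
  · rfl

theorem isSmoothFamily_bmCoeffTwo (hc : IsCollar I I₂ f ε Φ Q) {σ : BmForm I f m}
    (hσ : BmForm.IsSmooth I σ) : IsSmoothFamily I₂ (Ioo (-ε) ε) (bmCoeffTwo I₂ σ Φ) := by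
  rintro x₀ q ⟨hq, hqε⟩
  refine contDiffWithinAt_alternating fun v => ?_
  have hq' : q ∈ (extChartAt (I₂.prod 𝓘(ℝ, ℝ)) ((x₀, 0) : Z × ℝ)).target := by
    rw [extChartAt_prod_line]; exact ⟨hq, mem_univ _⟩
  have h1 := contDiffAt_bmPull hc hσ (x₀, 0) hq'
    (by rw [extChartAt_prod_line]; exact abs_lt.2 hqε) (v 0, 0) (v 1, 0)
  refine (h1.contDiffWithinAt (s := (extChartAt I₂ x₀).target ×ˢ Ioo (-ε) ε)).congr_of_mem
    (fun q hq => ?_) ⟨hq, hqε⟩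
  have hv : v = ![v 0, v 1] := by funext i; fin_cases i <;> rfl
  rw [hv, RawForm.inChart_two_apply, bmCoeffTwo_apply, chartDeriv_prod_line _ hq.1,
    extChartAt_prod_line]
  rfl

theorem nondegTwo_bmCoeff (hc : IsCollar I I₂ f ε Φ Q) (hε : 0 < ε) {σ : BmForm I f m}
    (hσ : ∀ (x : M) (p : BmTangent I f m x), (∀ q : BmTangent I f m x, σ x ![p, q] = 0) → p = 0)
    (z : Z) : NondegTwo (wedgeLine ((bmCoeffOne I₂ σ Φ 0).val z) ((bmCoeffTwo I₂ σ Φ 0).val z)) := by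
  have h := nondegTwo_bmPull hc hσ (p := (z, 0)) (by simpa using hε)
  rwa [← wedgeLine_bmCoeff] at h

theorem RawForm.ext_two_val {N : Type*} [TopologicalSpace N] [ChartedSpace H N]
    {η η' : RawForm I N 2} {x : N} (h : ∀ v w : E, η.val x ![v, w] = η'.val x ![v, w]) :
    η x = η' x :=
  alternating_two_ext (V := E) h

theorem RawForm.inChart_congr {N : Type*} [TopologicalSpace N] [ChartedSpace H N] {k : ℕ}
    {η η' : RawForm I N k} {x₀ : N} {y : E}
    (h : η ((extChartAt I x₀).symm y) = η' ((extChartAt I x₀).symm y)) :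
    RawForm.inChart I η x₀ y = RawForm.inChart I η' x₀ y := by
  rw [RawForm.inChart, RawForm.inChart, h]

theorem RawForm.IsSmoothOn.congr {N : Type*} [TopologicalSpace N] [ChartedSpace H N] {k : ℕ}
    {η η' : RawForm I N k} {S : Set N} (h : RawForm.IsSmoothOn I η S) (he : ∀ x ∈ S, η' x = η x) :
    RawForm.IsSmoothOn I η' S := fun x₀ =>
  (h x₀).congr fun _ hy => RawForm.inChart_congr (he _ hy.2)

theorem RawForm.IsClosedOn.congr {N : Type*} [TopologicalSpace N] [ChartedSpace H N]
    [IsManifold I ∞ N] {k : ℕ}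
    {η η' : RawForm I N k} {S : Set N} (hS : IsOpen S) (h : RawForm.IsClosedOn I η S)
    (he : ∀ x ∈ S, η' x = η x) : RawForm.IsClosedOn I η' S := by
  intro x₀ y hy hyS
  rw [← h x₀ y hy hyS]
  refine Filter.EventuallyEq.extDeriv_eq ?_
  filter_upwards [(RawForm.isOpen_chart_preimage hS x₀).mem_nhds ⟨hy, hyS⟩] with z hz
    using RawForm.inChart_congr (he _ hz.2)

/-- Off t = 0 the family form is the pullback of the ordinary form under the collar, and pullback
preserves closedness of smooth forms. -/
theorem isClosedOn_familyForm_bmCoeff (hc : IsCollar I I₂ f ε Φ Q) {σ : BmForm I f m}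
    (hσ : BmForm.IsSmooth I σ)
    (hcl : RawForm.IsClosedOn I (BmForm.toForm I σ) {x | f x ≠ 0}) :
    RawForm.IsClosedOn (I₂.prod 𝓘(ℝ, ℝ)) (familyForm I₂ (fun t => (t ^ m)⁻¹ • bmCoeffOne I₂ σ Φ t)
      (bmCoeffTwo I₂ σ Φ)) (univ ×ˢ {t ∈ Ioo (-ε) ε | t ≠ 0}) := by
  obtain ⟨η, hη⟩ : ∃ η, η = familyForm I₂ (fun t => (t ^ m)⁻¹ • bmCoeffOne I₂ σ Φ t)
      (bmCoeffTwo I₂ σ Φ) := ⟨_, rfl⟩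
  have hJ : IsOpen {t ∈ Ioo (-ε) ε | t ≠ 0} := isOpen_Ioo.inter isOpen_ne
  have hS₁ : IsOpen ((univ : Set Z) ×ˢ {t ∈ Ioo (-ε) ε | t ≠ 0}) := isOpen_univ.prod hJ
  have hS₂ : IsOpen {x | |f x| < ε ∧ f x ≠ 0} :=
    hc.isOpen.inter (isOpen_ne.preimage hc.smooth_fun.continuous)
  have hηs : RawForm.IsSmoothOn (I₂.prod 𝓘(ℝ, ℝ)) η (univ ×ˢ {t ∈ Ioo (-ε) ε | t ≠ 0}) := by
    rw [hη]
    refine IsSmoothFamily.familyForm (fun x₀ => ?_) fun x₀ =>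
      (isSmoothFamily_bmCoeffTwo hc hσ x₀).mono fun q hq => ⟨hq.1, hq.2.1⟩
    exact ((contDiff_snd.pow m).contDiffOn.inv fun p hp => pow_ne_zero m hp.2.2).smul
      ((isSmoothFamily_bmCoeffOne hc hσ x₀).mono fun p hp => ⟨hp.1, hp.2.1⟩)
  have hηv : ∀ p : Z × ℝ, |p.2| < ε → p.2 ≠ 0 → ∀ v w : E₂ × ℝ, η.val p ![v, w] =
      (BmForm.toForm I σ).val (Φ p) ![modelDeriv (I₂.prod 𝓘(ℝ, ℝ)) I Φ p v,
        modelDeriv (I₂.prod 𝓘(ℝ, ℝ)) I Φ p w] := fun p hp hp0 v w => by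
    rw [hη]; exact familyForm_bmCoeff hc σ hp hp0 v w
  rw [← hη]
  -- Smoothness of the ordinary form is not part of the hypotheses, which speak of b^m-fields. On
  -- the collar off Z the form is the pullback of the smooth family form by the inverse of the
  -- collar.
  have hσs : RawForm.IsSmoothOn I (BmForm.toForm I σ) {x | |f x| < ε ∧ f x ≠ 0} := by
    refine RawForm.IsSmoothOn.congr (hηs.pullback hS₂ hS₁
      (hc.contMDiffOn_inv.mono fun x hx => hx.1)
      fun x hx => ⟨mem_univ _, abs_lt.1 hx.1, hx.2⟩) fun x hx => ?_
    refine RawForm.ext_two_val fun v w => ?_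
    rw [RawForm.val_pullback_two, hηv _ hx.1 hx.2]
    have h1 : MDifferentiableAt I (I₂.prod 𝓘(ℝ, ℝ)) (fun x => (Q x, f x)) x :=
      (hc.contMDiffOn_inv.contMDiffAt (hc.isOpen.mem_nhds hx.1)).mdifferentiableAt (by simp)
    have h2 : ∀ v : E, modelDeriv (I₂.prod 𝓘(ℝ, ℝ)) I Φ (Q x, f x)
        (modelDeriv I (I₂.prod 𝓘(ℝ, ℝ)) (fun x => (Q x, f x)) x v) = v := by
      intro v
      rw [← modelDeriv_comp (G := Φ) (F := fun x => (Q x, f x))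
        ((hc.smooth _).mdifferentiableAt (by simp)) h1]
      have h3 : (fun x => Φ (Q x, f x)) =ᶠ[𝓝 x] id := by
        filter_upwards [hc.isOpen.mem_nhds hx.1] with x hx using hc.right_inv x hx
      rw [h3.modelDeriv_eq]
      exact congrArg (fun L : E →L[ℝ] E => L v) mfderiv_id
    rw [h2, h2, hc.right_inv x hx.1]
  refine RawForm.IsClosedOn.congr hS₁ (RawForm.IsClosedOn.pullback hσs
    (fun x₀ y hy hyS => hcl x₀ y hy hyS.2) hS₁ hS₂ hc.smooth.contMDiffOn fun p hp => ?_)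
    fun p hp => ?_
  · have h1 := hc.fun_apply p (abs_lt.2 hp.2.1)
    exact ⟨by rw [h1]; exact abs_lt.2 hp.2.1, by rw [h1]; exact hp.2.2⟩
  · refine RawForm.ext_two_val fun v w => ?_
    rw [RawForm.val_pullback_two, hηv p (abs_lt.2 hp.2.1) hp.2.2]

end Coefficients

/-! ### Invariance of the coefficients -/

section CoefficientInvariance

variable {E : Type*} [NormedAddCommGroup E] [NormedSpace ℝ E] [FiniteDimensional ℝ E]
  {H : Type*} [TopologicalSpace H] {I : ModelWithCorners ℝ E H} [I.Boundaryless]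
  {M : Type*} [TopologicalSpace M] [ChartedSpace H M] [IsManifold I ∞ M] [T2Space M]
  {E₂ : Type*} [NormedAddCommGroup E₂] [NormedSpace ℝ E₂] [FiniteDimensional ℝ E₂]
  {H₂ : Type*} [TopologicalSpace H₂] {I₂ : ModelWithCorners ℝ E₂ H₂} [I₂.Boundaryless]
  {Z : Type*} [TopologicalSpace Z] [ChartedSpace H₂ Z] [IsManifold I₂ ∞ Z]
  {f : M → ℝ} {ε : ℝ} {Φ : Z × ℝ → M} {Q : M → Z} {m : ℕ}

theorem RawForm.isInvariantOn_one_iff {G : Type*} [SMul G Z] {η : RawForm I₂ Z 1} {S : Set Z} :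
    RawForm.IsInvariantOn I₂ G η S ↔ ∀ g : G, ∀ z ∈ S, ∀ u : E₂,
      η.val (g • z) ![modelDeriv I₂ I₂ (fun y : Z => g • y) z u] = η.val z ![u] := by
  have h : ∀ (g : G) (z : Z) (u : E₂), (η.val (g • z)).compContinuousLinearMap
      (modelDeriv I₂ I₂ (fun y : Z => g • y) z) ![u] =
      η.val (g • z) ![modelDeriv I₂ I₂ (fun y : Z => g • y) z u] := by
    intro g z u
    rw [ContinuousAlternatingMap.compContinuousLinearMap_apply]
    congr 1
    funext i; fin_cases i; rfl
  refine forall_congr' fun g => forall₂_congr fun z _ => ⟨fun h' u => ?_, fun h' => ?_⟩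
  · rw [← h]
    exact congrArg (fun φ : E₂ [⋀^Fin 1]→L[ℝ] ℝ => φ ![u]) h'
  · exact alternating_one_ext (V := E₂) fun u => (h g z u).trans (h' u)

theorem RawForm.isInvariantOn_two_iff {G : Type*} [SMul G Z] {η : RawForm I₂ Z 2} {S : Set Z} :
    RawForm.IsInvariantOn I₂ G η S ↔ ∀ g : G, ∀ z ∈ S, ∀ u w : E₂,
      η.val (g • z) ![modelDeriv I₂ I₂ (fun y : Z => g • y) z u,
        modelDeriv I₂ I₂ (fun y : Z => g • y) z w] = η.val z ![u, w] := by
  have h : ∀ (g : G) (z : Z) (u w : E₂), (η.val (g • z)).compContinuousLinearMap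
      (modelDeriv I₂ I₂ (fun y : Z => g • y) z) ![u, w] =
      η.val (g • z) ![modelDeriv I₂ I₂ (fun y : Z => g • y) z u,
        modelDeriv I₂ I₂ (fun y : Z => g • y) z w] := by
    intro g z u w
    rw [ContinuousAlternatingMap.compContinuousLinearMap_apply]
    congr 1
    funext i; fin_cases i <;> rfl
  refine forall_congr' fun g => forall₂_congr fun z _ => ⟨fun h' u w => ?_, fun h' => ?_⟩
  · rw [← h]
    exact congrArg (fun φ : E₂ [⋀^Fin 2]→L[ℝ] ℝ => φ ![u, w]) h'
  · exact alternating_two_ext (V := E₂) fun u w => (h g z u w).trans (h' u w)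

variable {T : Type*} [Group T] [MulAction T M] [MulAction T Z]

theorem modelDeriv_smul_prod {g : T} (hg : ContMDiff I₂ I₂ ∞ (fun z : Z => g • z)) (p : Z × ℝ)
    (v : E₂ × ℝ) : modelDeriv (I₂.prod 𝓘(ℝ, ℝ)) (I₂.prod 𝓘(ℝ, ℝ))
      (fun q : Z × ℝ => (g • q.1, q.2)) p v =
      (modelDeriv I₂ I₂ (fun z : Z => g • z) p.1 v.1, v.2) := by
  have h2 := HasMFDerivAt.prodMap (p := p) ((hg p.1).mdifferentiableAt (by simp)).hasMFDerivAt
    (hasMFDerivAt_id (I := 𝓘(ℝ, ℝ)) p.2)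
  refine (congrArg (fun L : E₂ × ℝ →L[ℝ] E₂ × ℝ => L v) h2.mfderiv).trans ?_
  exact Prod.ext rfl (congrArg (fun L : ℝ →L[ℝ] ℝ => L v.2) mfderiv_id)

/-- Off t = 0 this is invariance of the ordinary form combined with equivariance of Φ. The factors
t^m that rescale the normal component agree on both sides, since T does not move t. -/
theorem bmPull_smul (hc : IsCollar I I₂ f ε Φ Q) (σ : BmForm I f m)
    (hσT : RawForm.IsInvariantOn I T (BmForm.toForm I σ) {x | f x ≠ 0})
    (hT : ∀ g : T, ContMDiff I I ∞ (fun x : M => g • x))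
    (hTZ : ∀ g : T, ContMDiff I₂ I₂ ∞ (fun z : Z => g • z))
    (hΦT : ∀ (g : T) (z : Z) (t : ℝ), Φ (g • z, t) = g • Φ (z, t)) (g : T) {p : Z × ℝ}
    (hp : |p.2| < ε) (hp0 : p.2 ≠ 0) (v w : E₂ × ℝ) :
    bmPull I₂ σ Φ (g • p.1, p.2) ![(modelDeriv I₂ I₂ (fun z : Z => g • z) p.1 v.1, v.2),
      (modelDeriv I₂ I₂ (fun z : Z => g • z) p.1 w.1, w.2)] = bmPull I₂ σ Φ p ![v, w] := by
  have hfp := hc.fun_apply p hp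
  have h1 := fun v w => bmPull_eq_toForm hc σ (p := (g • p.1, p.2)) hp hp0 v w
  have h2 := fun v w => bmPull_eq_toForm hc σ hp hp0 v w
  have h3 : ∀ v : E₂ × ℝ, modelDeriv (I₂.prod 𝓘(ℝ, ℝ)) I Φ (g • p.1, p.2)
      (modelDeriv I₂ I₂ (fun z : Z => g • z) p.1 v.1, v.2) =
      modelDeriv I I (fun x : M => g • x) (Φ p) (modelDeriv (I₂.prod 𝓘(ℝ, ℝ)) I Φ p v) := by
    intro v
    have hs : ContMDiff (I₂.prod 𝓘(ℝ, ℝ)) (I₂.prod 𝓘(ℝ, ℝ)) ∞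
        (fun q : Z × ℝ => (g • q.1, q.2)) :=
      ((hTZ g).comp contMDiff_fst).prodMk contMDiff_snd
    rw [← modelDeriv_smul_prod (hTZ g), ← modelDeriv_comp (G := Φ)
      (F := fun q : Z × ℝ => (g • q.1, q.2)) ((hc.smooth _).mdifferentiableAt (by simp))
      ((hs p).mdifferentiableAt (by simp)), ← modelDeriv_comp
      ((hT g _).mdifferentiableAt (by simp)) ((hc.smooth p).mdifferentiableAt (by simp))]
    have h4 : (fun q : Z × ℝ => Φ (g • q.1, q.2)) = fun q => g • Φ q := funext fun q => hΦT g q.1 q.2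
    rw [h4]
  have h5 := RawForm.isInvariantOn_two_iff.1 hσT g (Φ p) (by rw [mem_ofPred_eq, hfp]; exact hp0)
    (modelDeriv (I₂.prod 𝓘(ℝ, ℝ)) I Φ p (v.1, p.2 ^ m * v.2))
    (modelDeriv (I₂.prod 𝓘(ℝ, ℝ)) I Φ p (w.1, p.2 ^ m * w.2))
  rw [← h3, ← h3, ← hΦT] at h5
  rw [h2] at h5
  have h6 := h1 (modelDeriv I₂ I₂ (fun z : Z => g • z) p.1 v.1, p.2 ^ m * v.2)
    (modelDeriv I₂ I₂ (fun z : Z => g • z) p.1 w.1, p.2 ^ m * w.2)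
  have h7 := h6.symm.trans h5
  simpa only [inv_mul_cancel_left₀ (pow_ne_zero m hp0)] using h7

/-- Invariance is given only off Z; it reaches t = 0 because the coefficients are continuous there.
-/
theorem isInvariantOn_bmCoeff (hc : IsCollar I I₂ f ε Φ Q) {σ : BmForm I f m}
    (hσ : BmForm.IsSmooth I σ)
    (hσT : RawForm.IsInvariantOn I T (BmForm.toForm I σ) {x | f x ≠ 0})
    (hT : ∀ g : T, ContMDiff I I ∞ (fun x : M => g • x))
    (hTZ : ∀ g : T, ContMDiff I₂ I₂ ∞ (fun z : Z => g • z))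
    (hΦT : ∀ (g : T) (z : Z) (t : ℝ), Φ (g • z, t) = g • Φ (z, t)) {t : ℝ} (ht : t ∈ Ioo (-ε) ε) :
    RawForm.IsInvariantOn I₂ T (bmCoeffOne I₂ σ Φ t) univ ∧
      RawForm.IsInvariantOn I₂ T (bmCoeffTwo I₂ σ Φ t) univ := by
  have hε : 0 < ε := by linarith [ht.1, ht.2]
  have h1 : ∀ (g : T) (z : Z) (u : E₂), ∀ t ∈ Ioo (-ε) ε, t ≠ 0 → (bmCoeffOne I₂ σ Φ t).val (g • z)
      ![modelDeriv I₂ I₂ (fun y : Z => g • y) z u] = (bmCoeffOne I₂ σ Φ t).val z ![u] := by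
    intro g z u t ht ht0
    rw [bmCoeffOne_apply, bmCoeffOne_apply, ← bmPull_smul hc σ hσT hT hTZ hΦT g
      (p := (z, t)) (abs_lt.2 ht) ht0, map_zero]
  have h2 : ∀ (g : T) (z : Z) (u w : E₂), ∀ t ∈ Ioo (-ε) ε, t ≠ 0 →
      (bmCoeffTwo I₂ σ Φ t).val (g • z) ![modelDeriv I₂ I₂ (fun y : Z => g • y) z u,
        modelDeriv I₂ I₂ (fun y : Z => g • y) z w] = (bmCoeffTwo I₂ σ Φ t).val z ![u, w] := by
    intro g z u w t ht ht0
    rw [bmCoeffTwo_apply, bmCoeffTwo_apply, ← bmPull_smul hc σ hσT hT hTZ hΦT g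
      (p := (z, t)) (abs_lt.2 ht) ht0]
  rw [RawForm.isInvariantOn_one_iff, RawForm.isInvariantOn_two_iff]
  refine ⟨fun g z _ u => ?_, fun g z _ u w => ?_⟩
  · by_cases ht0 : t = 0
    · rw [ht0]
      exact eq_zero_of_tendsto_of_forall_ne hε
        (((isSmoothFamily_bmCoeffOne hc hσ).contDiffOn_val _).apply_one _).continuousOn
        (((isSmoothFamily_bmCoeffOne hc hσ).contDiffOn_val z).apply_one u).continuousOn (h1 g z u)
    · exact h1 g z u t ht ht0
  · by_cases ht0 : t = 0
    · rw [ht0]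
      exact eq_zero_of_tendsto_of_forall_ne hε
        (((isSmoothFamily_bmCoeffTwo hc hσ).contDiffOn_val _).apply_two _ _).continuousOn
        (((isSmoothFamily_bmCoeffTwo hc hσ).contDiffOn_val z).apply_two u w).continuousOn
        (h2 g z u w)
    · exact h2 g z u w t ht ht0

end CoefficientInvariance

/-! ### The normal form of a `b^m`-symplectic form -/

section BmNormalForm

variable {E : Type*} [NormedAddCommGroup E] [NormedSpace ℝ E] [FiniteDimensional ℝ E]
  {H : Type*} [TopologicalSpace H] {I : ModelWithCorners ℝ E H} [I.Boundaryless]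
  {M : Type*} [TopologicalSpace M] [ChartedSpace H M] [IsManifold I ∞ M] [T2Space M]
  {E₂ : Type} [NormedAddCommGroup E₂] [NormedSpace ℝ E₂] [FiniteDimensional ℝ E₂]
  {H₂ : Type*} [TopologicalSpace H₂] {I₂ : ModelWithCorners ℝ E₂ H₂} [I₂.Boundaryless]
  {Z : Type*} [TopologicalSpace Z] [ChartedSpace H₂ Z] [IsManifold I₂ ∞ Z] [T2Space Z]
  [CompactSpace Z]
  {f : M → ℝ} {ε₀ : ℝ} {Φ₀ : Z × ℝ → M} {Q : M → Z} {m : ℕ}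
  {T : Type*} [Group T] [MulAction T M] [MulAction T Z]

/-- Φ is the collar composed with the time-one map Ψ of Moser's isotopy. As f is the coordinate t on
the collar, f ∘ Φ is the second component of Ψ; and β is B_0. -/
theorem exists_bmNormalForm (hm : 1 ≤ m) (hε₀ : 0 < ε₀) (hc : IsCollar I I₂ f ε₀ Φ₀ Q)
    {σ : BmForm I f m} (hσ : IsBmSymplectic I σ)
    (hσT : RawForm.IsInvariantOn I T (BmForm.toForm I σ) {x | f x ≠ 0})
    (hT : ∀ g : T, ContMDiff I I ∞ (fun x : M => g • x))
    (hTZ : ∀ g : T, ContMDiff I₂ I₂ ∞ (fun z : Z => g • z))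
    (hΦT : ∀ (g : T) (z : Z) (t : ℝ), Φ₀ (g • z, t) = g • Φ₀ (z, t)) :
    ∃ (ε : ℝ) (Φ : Z × ℝ → M) (α : ℕ → RawForm I₂ Z 1) (β : RawForm I₂ Z 2) (h : Z × ℝ → ℝ),
      0 < ε ∧ ContMDiff (I₂.prod 𝓘(ℝ, ℝ)) I ∞ Φ ∧
      IsLocalDiffeomorphOn (I₂.prod 𝓘(ℝ, ℝ)) I ∞ Φ (univ ×ˢ Ioo (-ε) ε) ∧
      InjOn Φ (univ ×ˢ Ioo (-ε) ε) ∧ (∀ z, Φ (z, 0) = Φ₀ (z, 0)) ∧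
      (∀ (g : T) (z : Z) (t : ℝ), Φ (g • z, t) = g • Φ (z, t)) ∧
      ContMDiffOn (I₂.prod 𝓘(ℝ, ℝ)) 𝓘(ℝ, ℝ) ∞ h (univ ×ˢ Ioo (-ε) ε) ∧
      (∀ p ∈ (univ : Set Z) ×ˢ Ioo (-ε) ε, f (Φ p) = p.2 + p.2 ^ (m + 1) * h p) ∧
      (∀ p ∈ (univ : Set Z) ×ˢ Ioo (-ε) ε, p.2 ≠ 0 → f (Φ p) ≠ 0) ∧
      (∀ j ∈ Finset.Icc 1 m, RawForm.IsSmooth I₂ (α j) ∧ RawForm.IsClosedOn I₂ (α j) univ ∧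
        RawForm.IsInvariantOn I₂ T (α j) univ) ∧
      RawForm.IsSmooth I₂ β ∧ RawForm.IsClosedOn I₂ β univ ∧ RawForm.IsInvariantOn I₂ T β univ ∧
      (∀ p ∈ (univ : Set Z) ×ˢ Ioo (-ε) ε, p.2 ≠ 0 → ∀ v w : E₂ × ℝ,
        (BmForm.toForm I σ).val (Φ p) ![modelDeriv (I₂.prod 𝓘(ℝ, ℝ)) I Φ p v,
          modelDeriv (I₂.prod 𝓘(ℝ, ℝ)) I Φ p w] =
        ∑ j ∈ Finset.Icc 1 m, (p.2 ^ j)⁻¹ * (v.2 * (α j).val p.1 ![w.1] -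
          w.2 * (α j).val p.1 ![v.1]) + β.val p.1 ![v.1, w.1]) ∧
      ∀ z, NondegTwo (wedgeLine ((α m).val z) (β.val z)) := by
  have hA := isSmoothFamily_bmCoeffOne hc hσ.smooth
  have hB := isSmoothFamily_bmCoeffTwo hc hσ.smooth
  have hinv := fun t ht => isInvariantOn_bmCoeff hc hσ.smooth hσT hT hTZ hΦT (t := t) ht
  obtain ⟨α, R, hα, hR, hAR, hαm, hcl, hαT, hRT⟩ := exists_laurent_expansion hε₀ hA hB
    (isClosedOn_familyForm_bmCoeff hc hσ.smooth hσ.closed) (fun t ht => (hinv t ht).1)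
  have hnd : ∀ z, NondegTwo (wedgeLine ((α m).val z) ((bmCoeffTwo I₂ σ Φ₀ 0).val z)) := by
    rw [hαm]
    exact nondegTwo_bmCoeff hc hε₀ hσ.nondegenerate
  obtain ⟨ε, Ψ, Ψ', O, h, hε, hΨ, hΨ', hO, hOε, hΨ0, hm1, hm2, hi1, hi2, hh, hhe, hne, hform,
    hΨT⟩ := exists_normalForm hm hε₀ hα hR hB hcl hnd hTZ hαT hRT (fun t ht => (hinv t ht).2)
  have h00 : (0 : ℝ) ∈ Ioo (-ε₀) ε₀ := ⟨by linarith, hε₀⟩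
  have hΨε : ∀ p ∈ (univ : Set Z) ×ˢ Ioo (-ε) ε, |(Ψ p).2| < ε₀ := fun p hp => hOε _ (hm1 hp)
  have hf : ∀ p ∈ (univ : Set Z) ×ˢ Ioo (-ε) ε, f (Φ₀ (Ψ p)) = (Ψ p).2 := fun p hp =>
    hc.fun_apply _ (hΨε p hp)
  have hΦs : ContMDiff (I₂.prod 𝓘(ℝ, ℝ)) I ∞ (fun p => Φ₀ (Ψ p)) := hc.smooth.comp hΨ
  have hSo : IsOpen ((univ : Set Z) ×ˢ Ioo (-ε) ε) := isOpen_univ.prod isOpen_Ioo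
  have hOo : IsOpen ({x | |f x| < ε₀} ∩ (fun x => (Q x, f x)) ⁻¹' O) :=
    hc.contMDiffOn_inv.continuousOn.isOpen_inter_preimage hc.isOpen hO
  have hinvs : ContMDiffOn I (I₂.prod 𝓘(ℝ, ℝ)) ∞ (fun x => Ψ' (Q x, f x))
      ({x | |f x| < ε₀} ∩ (fun x => (Q x, f x)) ⁻¹' O) :=
    hΨ'.comp_contMDiffOn (hc.contMDiffOn_inv.mono inter_subset_left)
  have hQΦ : ∀ p ∈ (univ : Set Z) ×ˢ Ioo (-ε) ε, (Q (Φ₀ (Ψ p)), f (Φ₀ (Ψ p))) = Ψ p := by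
    intro p hp
    rw [hf p hp, hc.left_inv _ (hΨε p hp)]
  have hleft : ∀ p ∈ (univ : Set Z) ×ˢ Ioo (-ε) ε, Ψ' (Q (Φ₀ (Ψ p)), f (Φ₀ (Ψ p))) = p := by
    intro p hp
    rw [hQΦ p hp, hi1 p hp]
  let D : PartialDiffeomorph (I₂.prod 𝓘(ℝ, ℝ)) I (Z × ℝ) M ∞ :=
    { toFun := fun p => Φ₀ (Ψ p)
      invFun := fun x => Ψ' (Q x, f x)
      source := (univ : Set Z) ×ˢ Ioo (-ε) ε
      target := {x | |f x| < ε₀} ∩ (fun x => (Q x, f x)) ⁻¹' O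
      map_source' := fun p hp => by
        refine ⟨?_, ?_⟩
        · rw [mem_ofPred_eq, hf p hp]; exact hΨε p hp
        · rw [mem_preimage, hQΦ p hp]; exact hm1 hp
      map_target' := fun x hx => hm2 hx.2
      left_inv' := hleft
      right_inv' := fun x hx => by rw [hi2 _ hx.2, hc.right_inv x hx.1]
      open_source := hSo
      open_target := hOo
      contMDiffOn_toFun := hΦs.contMDiffOn
      contMDiffOn_invFun := hinvs }
  refine ⟨ε, fun p => Φ₀ (Ψ p), α, bmCoeffTwo I₂ σ Φ₀ 0, h, hε, hΦs,
    fun p => ⟨D, p.2, fun _ _ => rfl⟩, fun p hp q hq hpq => ?_, fun z => congrArg Φ₀ (hΨ0 z),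
    fun g z t => ?_, hh, fun p hp => by rw [hf p hp, hhe p hp],
    fun p hp hp0 => by rw [hf p hp]; exact hne p hp hp0,
    fun j hj => ⟨(hα j hj).1, (hα j hj).2, hαT j hj⟩, hB.isSmooth h00, fun x₀ y hy _ => ?_,
    (hinv 0 h00).2, fun p hp hp0 v w => ?_, hnd⟩
  · rw [← hleft p hp, ← hleft q hq]
    exact congrArg (fun x => Ψ' (Q x, f x)) hpq
  · beta_reduce
    rw [hΨT g z t, hΦT]
  · exact ((isClosedOn_familyForm_iff isOpen_Ioo hR hB).1 hcl x₀ y hy 0 h00).1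
  · have h1 : ∀ v, modelDeriv (I₂.prod 𝓘(ℝ, ℝ)) I (fun p => Φ₀ (Ψ p)) p v =
        modelDeriv (I₂.prod 𝓘(ℝ, ℝ)) I Φ₀ (Ψ p)
          (modelDeriv (I₂.prod 𝓘(ℝ, ℝ)) (I₂.prod 𝓘(ℝ, ℝ)) Ψ p v) := fun v =>
      modelDeriv_comp ((hc.smooth _).mdifferentiableAt (by simp))
        ((hΨ p).mdifferentiableAt (by simp)) v
    rw [h1, h1, ← familyForm_bmCoeff hc σ (hΨε p hp) (hne p hp hp0)]
    have h2 : ((Ψ p).2 ^ m)⁻¹ • bmCoeffOne I₂ σ Φ₀ (Ψ p).2 =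
        ∑ j ∈ Finset.Icc 1 m, ((Ψ p).2 ^ j)⁻¹ • α j + R (Ψ p).2 := by
      have ht0 := hne p hp hp0
      rw [hAR _ (abs_lt.1 (hΨε p hp)), smul_add, smul_smul, inv_mul_cancel₀ (pow_ne_zero m ht0),
        one_smul, Finset.smul_sum]
      congr 1
      refine Finset.sum_congr rfl fun j hj => ?_
      rw [Finset.mem_Icc] at hj
      rw [smul_smul, ← pow_sub_mul_pow (Ψ p).2 hj.2, mul_inv, mul_right_comm,
        inv_mul_cancel₀ (pow_ne_zero _ ht0), one_mul]
    have h3 := hform p hp hp0 v w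
    rw [familyForm_apply, familyForm_apply] at h3
    rw [familyForm_apply, h2, h3, RawForm.val_sum, ContinuousAlternatingMap.sum_apply,
      ContinuousAlternatingMap.sum_apply, Finset.mul_sum, Finset.mul_sum,
      ← Finset.sum_sub_distrib]
    congr 1
    refine Finset.sum_congr rfl fun j _ => ?_
    rw [RawForm.val_smul_one_apply, RawForm.val_smul_one_apply]
    ring

end BmNormalForm

/-! ### Primitives of Laurent polynomials -/

section LaurentPrimitive

/-- Multiplied by t^m, the sum is a polynomial with infinitely many roots. -/
theorem eq_zero_of_sum_inv_pow_eq_zero {m : ℕ} {d : ℕ → ℝ} {ε : ℝ} (hε : 0 < ε)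
    (h : ∀ t ∈ Ioo 0 ε, ∑ j ∈ Finset.Icc 1 m, (t ^ j)⁻¹ * d j = 0) {j : ℕ}
    (hj : j ∈ Finset.Icc 1 m) : d j = 0 := by
  classical
  obtain ⟨P, hP⟩ : ∃ P : Polynomial ℝ, P = ∑ j ∈ Finset.Icc 1 m, Polynomial.monomial (m - j) (d j) :=
    ⟨_, rfl⟩
  have hP0 : P = 0 := by
    refine Polynomial.eq_zero_of_infinite_isRoot P ((Ioo_infinite hε).mono fun t ht => ?_)
    have h1 := congrArg (fun r => t ^ m * r) (h t ht)
    simp only [mul_zero, Finset.mul_sum] at h1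
    change P.eval t = 0
    rw [hP, Polynomial.eval_finsetSum, ← h1]
    refine Finset.sum_congr rfl fun i hi => ?_
    have hi' := Finset.mem_Icc.mp hi
    have ht0 : t ≠ 0 := ht.1.ne'
    have : t ^ m = t ^ (m - i) * t ^ i := by rw [← pow_add, Nat.sub_add_cancel hi'.2]
    rw [Polynomial.eval_monomial, this]
    field_simp
  have h2 := congrArg (fun p => Polynomial.coeff p (m - j)) hP0
  simp only [hP, Polynomial.finsetSum_coeff, Polynomial.coeff_monomial, Polynomial.coeff_zero] at h2
  rw [Finset.sum_eq_single j] at h2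
  · simpa using h2
  · intro i hi hij
    rw [if_neg]
    have hi' := Finset.mem_Icc.mp hi
    have hj' := Finset.mem_Icc.mp hj
    omega
  · exact fun h => absurd hj h

/-- The primitive of `-∑ c_j t⁻ʲ`. -/
noncomputable def laurentPrimitive (m : ℕ) (c : ℕ → ℝ) (t : ℝ) : ℝ :=
  -(Real.log |t| * c 1) + ∑ i ∈ Finset.Icc 2 m, (t ^ (i - 1))⁻¹ / ((i : ℝ) - 1) * c i

theorem hasDerivAt_laurentPrimitive {m : ℕ} (hm : 1 ≤ m) (c : ℕ → ℝ) {t : ℝ} (ht : t ≠ 0) :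
    HasDerivAt (laurentPrimitive m c) (-∑ j ∈ Finset.Icc 1 m, (t ^ j)⁻¹ * c j) t := by
  have h1 : HasDerivAt (fun t : ℝ => Real.log |t|) t⁻¹ t := by
    simpa only [Real.log_abs] using Real.hasDerivAt_log ht
  have h2 : ∀ i ∈ Finset.Icc 2 m, HasDerivAt
      (fun t : ℝ => (t ^ (i - 1))⁻¹ / ((i : ℝ) - 1) * c i) (-((t ^ i)⁻¹ * c i)) t := by
    intro i hi
    obtain ⟨k, rfl⟩ : ∃ k, i = k + 2 := ⟨i - 2, by have := (Finset.mem_Icc.mp hi).1; omega⟩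
    have h3 := (((hasDerivAt_pow (k + 1) t).fun_inv (pow_ne_zero _ ht)).div_const
      (((k + 2 : ℕ) : ℝ) - 1)).mul_const (c (k + 2))
    have hk : (k : ℝ) + 1 ≠ 0 := by positivity
    refine h3.congr_deriv ?_
    have : ((k + 2 : ℕ) : ℝ) - 1 = k + 1 := by push_cast; ring
    rw [this]
    push_cast
    field_simp
    ring
  have h4 := (h1.mul_const (c 1)).fun_neg.add (HasDerivAt.fun_sum h2)
  refine h4.congr_deriv ?_
  have h5 : Finset.Icc 1 m = insert 1 (Finset.Icc 2 m) :=
    (Finset.insert_Icc_add_one_left_eq_Icc hm).symm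
  rw [h5, Finset.sum_insert (by simp), Finset.sum_neg_distrib, pow_one]
  ring

/-- The logarithm is even and cancels. After clearing the pole the difference is a polynomial in t,
hence smooth at 0. -/
theorem pow_mul_laurentPrimitive_sub {m : ℕ} (hm : 1 ≤ m) (c : ℕ → ℝ) {t : ℝ} (ht : t ≠ 0) :
    t ^ (m - 1) * (laurentPrimitive m c t - laurentPrimitive m c (-t)) =
      ∑ i ∈ Finset.Icc 2 m, (1 - (-1) ^ (i - 1)) / ((i : ℝ) - 1) * c i * t ^ (m - i) := by
  have h : laurentPrimitive m c t - laurentPrimitive m c (-t) =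
      ∑ i ∈ Finset.Icc 2 m, ((t ^ (i - 1))⁻¹ / ((i : ℝ) - 1) * c i -
        ((-t) ^ (i - 1))⁻¹ / ((i : ℝ) - 1) * c i) := by
    simp only [laurentPrimitive, abs_neg, Finset.sum_sub_distrib]
    ring
  rw [h, Finset.mul_sum]
  refine Finset.sum_congr rfl fun i hi => ?_
  have hi' := Finset.mem_Icc.mp hi
  have h1 : t ^ (m - 1) = t ^ (m - i) * t ^ (i - 1) := by
    rw [← pow_add]; congr 1; omega
  have h2 : (-t) ^ (i - 1) = (-1) ^ (i - 1) * t ^ (i - 1) := by rw [← mul_pow]; simp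
  have h3 : (((-1 : ℝ)) ^ (i - 1))⁻¹ = (-1) ^ (i - 1) := by
    rw [← inv_pow]; norm_num
  rw [h2, mul_inv, h3, h1]
  have h4 : t ^ (i - 1) ≠ 0 := pow_ne_zero _ ht
  field_simp

/-- A function with derivative `-∑ c_j t⁻ʲ` for `t ≠ 0` which is, up to a multiple of `log |t|`,
meromorphic at `0`, has the same constant of integration for `t < 0` and `t > 0`. -/
theorem exists_eq_laurentPrimitive_add {m : ℕ} (hm : 1 ≤ m) {u S : ℝ → ℝ} {c : ℕ → ℝ}
    {ε δ b : ℝ} (hε : 0 < ε) (hδ : 0 < δ)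
    (hu : ∀ t ∈ Ioo (-ε) ε, t ≠ 0 → HasDerivAt u (-∑ j ∈ Finset.Icc 1 m, (t ^ j)⁻¹ * c j) t)
    (hS : ContDiffOn ℝ ∞ S (Ioo (-δ) δ))
    (huS : ∀ t ∈ Ioo (-δ) δ, t ≠ 0 → u t = b * Real.log |t| + (t ^ (m - 1))⁻¹ * S t) :
    ∃ C : ℝ, ∀ t ∈ Ioo (-ε) ε, t ≠ 0 → u t = laurentPrimitive m c t + C := by
  have hV : ∀ t ∈ Ioo (-ε) ε, t ≠ 0 → HasDerivAt (fun t => u t - laurentPrimitive m c t) 0 t :=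
    fun t ht ht0 => ((hu t ht ht0).fun_sub (hasDerivAt_laurentPrimitive hm c ht0)).congr_deriv
      (sub_self _)
  have hconst : ∀ s : Set ℝ, IsOpen s → IsPreconnected s → s ⊆ Ioo (-ε) ε → (∀ t ∈ s, t ≠ 0) →
      ∀ x ∈ s, ∀ y ∈ s, u x - laurentPrimitive m c x = u y - laurentPrimitive m c y := by
    intro s hs hc hsub h0 x hx y hy
    refine hs.is_const_of_deriv_eq_zero hc (fun t ht => (hV t (hsub ht) (h0 t ht)
      ).differentiableAt.differentiableWithinAt) (fun t ht => (hV t (hsub ht) (h0 t ht)).deriv) hx hy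
  have hp := hconst (Ioo 0 ε) isOpen_Ioo isPreconnected_Ioo
    (Ioo_subset_Ioo_left (by linarith)) (fun t ht => ht.1.ne')
  have hn := hconst (Ioo (-ε) 0) isOpen_Ioo isPreconnected_Ioo
    (Ioo_subset_Ioo_right hε.le) (fun t ht => ht.2.ne)
  obtain ⟨Cp, hCp⟩ : ∃ Cp, Cp = u (ε / 2) - laurentPrimitive m c (ε / 2) := ⟨_, rfl⟩
  obtain ⟨Cn, hCn⟩ : ∃ Cn, Cn = u (-(ε / 2)) - laurentPrimitive m c (-(ε / 2)) := ⟨_, rfl⟩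
  have hp' : ∀ t ∈ Ioo 0 ε, u t = laurentPrimitive m c t + Cp := fun t ht => by
    rw [hCp, ← hp t ht (ε / 2) ⟨by linarith, by linarith⟩]; ring
  have hn' : ∀ t ∈ Ioo (-ε) 0, u t = laurentPrimitive m c t + Cn := fun t ht => by
    rw [hCn, ← hn t ht (-(ε / 2)) ⟨by linarith, by linarith⟩]; ring
  obtain ⟨ρ, hρ, hρε, hρδ⟩ : ∃ ρ : ℝ, 0 < ρ ∧ ρ ≤ ε ∧ ρ ≤ δ :=
    ⟨min ε δ, lt_min hε hδ, min_le_left _ _, min_le_right _ _⟩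
  -- By its formula g is smooth through 0. Since the logarithms cancel in u(t) - u(-t), off 0 it
  -- equals t^(m-1) times the difference of the integration constants at t and at -t.
  obtain ⟨g, hg⟩ : ∃ g : ℝ → ℝ, g = fun t => S t - (-1) ^ (m - 1) * S (-t) -
      ∑ i ∈ Finset.Icc 2 m, (1 - (-1) ^ (i - 1)) / ((i : ℝ) - 1) * c i * t ^ (m - i) := ⟨_, rfl⟩
  have hneg : ∀ t ∈ Ioo (-ρ) ρ, -t ∈ Ioo (-ρ) ρ := fun t ht => ⟨by linarith [ht.2], by linarith [ht.1]⟩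
  have hsub : Ioo (-ρ) ρ ⊆ Ioo (-δ) δ := Ioo_subset_Ioo (by linarith) hρδ
  have hgs : ContDiffOn ℝ ∞ g (Ioo (-ρ) ρ) := by
    rw [hg]
    refine ((hS.mono hsub).sub (contDiffOn_const.mul ((hS.mono hsub).comp contDiff_neg.contDiffOn hneg))).sub
      (ContDiffOn.sum fun i _ => contDiffOn_const.mul (contDiffOn_id.pow _))
  have hge : ∀ t ∈ Ioo (-ρ) ρ, t ≠ 0 → g t = t ^ (m - 1) *
      ((u t - laurentPrimitive m c t) - (u (-t) - laurentPrimitive m c (-t))) := by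
    intro t ht ht0
    have h1 := huS t (hsub ht) ht0
    have h2 := huS (-t) (hsub (hneg t ht)) (neg_ne_zero.mpr ht0)
    have h3 := pow_mul_laurentPrimitive_sub hm c ht0
    have h4 : t ^ (m - 1) ≠ 0 := pow_ne_zero _ ht0
    have h5 : t ^ (m - 1) * (((-t)) ^ (m - 1))⁻¹ = (-1) ^ (m - 1) := by
      have : (-t) ^ (m - 1) = (-1) ^ (m - 1) * t ^ (m - 1) := by rw [← mul_pow]; simp
      rw [this, mul_inv, ← inv_pow]
      have h6 : ((-1 : ℝ))⁻¹ = -1 := by norm_num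
      rw [h6]
      field_simp
    have h6 : t ^ (m - 1) * (u t - u (-t)) = S t - (-1) ^ (m - 1) * S (-t) := by
      rw [h1, h2, abs_neg, ← h5]
      field_simp
      ring
    rw [hg]
    beta_reduce
    rw [← h6, ← h3]
    ring
  -- That difference changes sign with t, so g is (Cp - Cn) t^(m-1) sgn t, which is smooth only if
  -- Cp = Cn.
  have hD : Cp - Cn = 0 := by
    refine eq_zero_of_contDiffOn_sign_pow (n := m - 1) hρ hgs (fun t ht => ?_) (fun t ht => ?_)
    · rw [hge t ⟨by linarith [ht.1], ht.2⟩ ht.1.ne', hp' t ⟨ht.1, by linarith [ht.2]⟩,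
        hn' (-t) ⟨by linarith [ht.2], by linarith [ht.1]⟩]
      ring
    · rw [hge t ⟨ht.1, by linarith [ht.2]⟩ ht.2.ne, hn' t ⟨by linarith [ht.1], ht.2⟩,
        hp' (-t) ⟨by linarith [ht.2], by linarith [ht.1]⟩]
      ring
  refine ⟨Cp, fun t ht ht0 => ?_⟩
  rcases lt_or_gt_of_ne ht0 with h | h
  · rw [hn' t ⟨ht.1, h⟩, sub_eq_zero.mp hD]
  · exact hp' t ⟨h, ht.2⟩

end LaurentPrimitive

/-! ### Functions with prescribed differential -/

section PrescribedDifferential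

variable {E : Type*} [NormedAddCommGroup E] [NormedSpace ℝ E]
  {H : Type*} [TopologicalSpace H] {I : ModelWithCorners ℝ E H}
  {N : Type*} [TopologicalSpace N] [ChartedSpace H N]

variable {u : N × ℝ → ℝ}

theorem modelDeriv_slice {p : N × ℝ} (hu : MDifferentiableAt (I.prod 𝓘(ℝ, ℝ)) 𝓘(ℝ, ℝ) u p) (v : E) :
    MDifferentiableAt I 𝓘(ℝ, ℝ) (fun z => u (z, p.2)) p.1 ∧
    modelDeriv I 𝓘(ℝ, ℝ) (fun z => u (z, p.2)) p.1 v =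
      modelDeriv (I.prod 𝓘(ℝ, ℝ)) 𝓘(ℝ, ℝ) u p (v, 0) := by
  have h1 : HasMFDerivAt I (I.prod 𝓘(ℝ, ℝ)) (fun z : N => (z, p.2)) p.1 _ :=
    (hasMFDerivAt_id p.1).prodMk (hasMFDerivAt_const p.2 p.1)
  have h2 := hu.hasMFDerivAt.comp p.1 h1
  exact ⟨h2.mdifferentiableAt, congrArg (fun L : E →L[ℝ] ℝ => L v) h2.mfderiv⟩

theorem hasDerivAt_slice {p : N × ℝ} (hu : MDifferentiableAt (I.prod 𝓘(ℝ, ℝ)) 𝓘(ℝ, ℝ) u p) :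
    HasDerivAt (fun t => u (p.1, t)) (modelDeriv (I.prod 𝓘(ℝ, ℝ)) 𝓘(ℝ, ℝ) u p (0, 1)) p.2 := by
  have h1 : HasMFDerivAt 𝓘(ℝ, ℝ) (I.prod 𝓘(ℝ, ℝ)) (fun r : ℝ => (p.1, r)) p.2 _ :=
    (hasMFDerivAt_const p.1 p.2).prodMk (hasMFDerivAt_id p.2)
  have h2 := hu.hasMFDerivAt.comp p.2 h1
  have h3 : HasFDerivAt (fun t : ℝ => u (p.1, t)) ((modelDeriv (I.prod 𝓘(ℝ, ℝ)) 𝓘(ℝ, ℝ) u p).comp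
      ((0 : ℝ →L[ℝ] E).prod (ContinuousLinearMap.id ℝ ℝ))) p.2 := h2.hasFDerivAt
  simpa using h3.hasDerivAt

variable [I.Boundaryless] [IsManifold I ∞ N]

/-- The neighbourhood, a ball in a chart, is chosen before F, so that one neighbourhood serves all
values of the parameter t. -/
theorem exists_nhds_eq_of_modelDeriv_eq_zero (z₀ : N) : ∃ U ∈ 𝓝 z₀, ∀ F : N → ℝ,
    (∀ z, MDifferentiableAt I 𝓘(ℝ, ℝ) F z) → (∀ z v, modelDeriv I 𝓘(ℝ, ℝ) F z v = 0) →
    ∀ z ∈ U, F z = F z₀ := by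
  obtain ⟨r, hr, hball⟩ := Metric.isOpen_iff.mp (isOpen_extChartAt_target (I := I) z₀)
    (extChartAt I z₀ z₀) (mem_extChartAt_target z₀)
  refine ⟨(extChartAt I z₀).source ∩ extChartAt I z₀ ⁻¹' Metric.ball (extChartAt I z₀ z₀) r,
    inter_mem (extChartAt_source_mem_nhds z₀)
      ((continuousAt_extChartAt z₀).preimage_mem_nhds (Metric.ball_mem_nhds _ hr)),
    fun F hF hF0 z hz => ?_⟩
  have hd : ∀ y ∈ Metric.ball (extChartAt I z₀ z₀) r,
      HasFDerivAt (fun y => F ((extChartAt I z₀).symm y)) (0 : E →L[ℝ] ℝ) y := by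
    intro y hy
    have h1 : MDifferentiableAt 𝓘(ℝ, E) I (extChartAt I z₀).symm y :=
      (contMDiffAt_extChartAt_symm_of_mem (hball hy)).mdifferentiableAt (by simp)
    have h2 : MDifferentiableAt 𝓘(ℝ, E) 𝓘(ℝ, ℝ) (fun y => F ((extChartAt I z₀).symm y)) y :=
      (hF _).comp y h1
    have h3 := (mdifferentiableAt_iff_differentiableAt.mp h2).hasFDerivAt
    have h4 : fderiv ℝ (fun y => F ((extChartAt I z₀).symm y)) y = (0 : E →L[ℝ] ℝ) := by
      ext v
      have h5 := modelDeriv_comp (hF ((extChartAt I z₀).symm y)) h1 v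
      rw [hF0] at h5
      exact (congrArg (fun L : E →L[ℝ] ℝ => L v) mfderiv_eq_fderiv).symm.trans h5
    rwa [h4] at h3
  have h := Metric.isOpen_ball.is_const_of_fderiv_eq_zero (𝕜 := ℝ)
    (convex_ball (extChartAt I z₀ z₀) r).isPreconnected
    (fun y hy => (hd y hy).differentiableAt.differentiableWithinAt) (fun y hy => (hd y hy).fderiv)
    hz.2 (Metric.mem_ball_self hr)
  simpa only [(extChartAt I z₀).left_inv hz.1,
    (extChartAt I z₀).left_inv (mem_extChartAt_source z₀)] using h

variable {ε : ℝ} {m : ℕ} {c : ℕ → N → ℝ} {b : N → E → ℝ}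

/-- If `du = -(∑ c_j t⁻ʲ) dt + b` for `t ≠ 0`, with `b` independent of `t`, then the `c_j` are
locally constant. -/
theorem eventually_eq_of_modelDeriv_eq (hε : 0 < ε)
    (hu : ∀ p ∈ (univ : Set N) ×ˢ Ioo (-ε) ε, p.2 ≠ 0 →
      MDifferentiableAt (I.prod 𝓘(ℝ, ℝ)) 𝓘(ℝ, ℝ) u p ∧ ∀ v : E × ℝ,
      modelDeriv (I.prod 𝓘(ℝ, ℝ)) 𝓘(ℝ, ℝ) u p v =
        -(v.2 * ∑ j ∈ Finset.Icc 1 m, (p.2 ^ j)⁻¹ * c j p.1) + b p.1 v.1)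
    (z₀ : N) : ∀ᶠ z in 𝓝 z₀, ∀ j ∈ Finset.Icc 1 m, c j z = c j z₀ := by
  obtain ⟨U, hU, hUc⟩ := exists_nhds_eq_of_modelDeriv_eq_zero (I := I) z₀
  have hmem : ∀ (z : N), ∀ t ∈ Ioo 0 ε, (z, t) ∈ (univ : Set N) ×ˢ Ioo (-ε) ε := fun z t ht =>
    ⟨mem_univ _, by linarith [ht.1], ht.2⟩
  filter_upwards [hU] with z hz j hj
  -- As b does not depend on t, the function u(·, t) - u(·, t') has zero differential on N and is
  -- constant near z₀.
  have hdiff : ∀ t ∈ Ioo 0 ε, ∀ t' ∈ Ioo 0 ε, u (z, t) - u (z₀, t) = u (z, t') - u (z₀, t') := by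
    intro t ht t' ht'
    have h := hUc (fun z => u (z, t) - u (z, t')) (fun z => ?_) (fun z v => ?_) z hz
    · beta_reduce at h
      linarith
    · exact (modelDeriv_slice (hu (z, t) (hmem z t ht) ht.1.ne').1 0).1.sub
        (modelDeriv_slice (hu (z, t') (hmem z t' ht') ht'.1.ne').1 0).1
    · have h1 := modelDeriv_slice (hu (z, t) (hmem z t ht) ht.1.ne').1 v
      have h2 := modelDeriv_slice (hu (z, t') (hmem z t' ht') ht'.1.ne').1 v
      refine (congrArg (fun L : E →L[ℝ] ℝ => L v)
        (h1.1.hasMFDerivAt.sub h2.1.hasMFDerivAt).mfderiv).trans ?_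
      change modelDeriv I 𝓘(ℝ, ℝ) (fun z => u (z, t)) z v -
        modelDeriv I 𝓘(ℝ, ℝ) (fun z => u (z, t')) z v = 0
      have h3 := h1.2
      have h4 := h2.2
      dsimp only at h3 h4
      rw [h3, h4, (hu (z, t) (hmem z t ht) ht.1.ne').2, (hu (z, t') (hmem z t' ht') ht'.1.ne').2]
      simp
  -- So u(z, t) - u(z₀, t) is constant in t, and its derivative in t compares the coefficients at z
  -- and z₀.
  have hd : ∀ t ∈ Ioo 0 ε, ∑ j ∈ Finset.Icc 1 m, (t ^ j)⁻¹ * (c j z - c j z₀) = 0 := by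
    intro t ht
    have h1 := hasDerivAt_slice (hu (z, t) (hmem z t ht) ht.1.ne').1
    have h2 := hasDerivAt_slice (hu (z₀, t) (hmem z₀ t ht) ht.1.ne').1
    have h3 : HasDerivAt (fun s => u (z, s) - u (z₀, s)) 0 t := by
      refine (hasDerivAt_const t (u (z, t) - u (z₀, t))).congr_of_eventuallyEq ?_
      filter_upwards [Ioo_mem_nhds ht.1 ht.2] with s hs using hdiff s hs t ht
    have h4 := (h1.sub h2).unique h3
    rw [(hu (z, t) (hmem z t ht) ht.1.ne').2, (hu (z₀, t) (hmem z₀ t ht) ht.1.ne').2] at h4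
    have hb : ∀ z, b z 0 = 0 := fun z => by
      have := (hu (z, t) (hmem z t ht) ht.1.ne').2 0
      rw [map_zero] at this
      simpa using this.symm
    simp only [hb, one_mul, add_zero] at h4
    simp only [mul_sub, Finset.sum_sub_distrib]
    linarith
  exact sub_eq_zero.mp (eq_zero_of_sum_inv_pow_eq_zero hε hd hj)

end PrescribedDifferential

/-! ### The moment map in the collar -/

section CollarFunction

variable {E : Type*} [NormedAddCommGroup E] [NormedSpace ℝ E]
  {H : Type*} [TopologicalSpace H] {I : ModelWithCorners ℝ E H}
  {M : Type*} [TopologicalSpace M] [ChartedSpace H M]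
  {E₂ : Type*} [NormedAddCommGroup E₂] [NormedSpace ℝ E₂]
  {H₂ : Type*} [TopologicalSpace H₂] {I₂ : ModelWithCorners ℝ E₂ H₂}
  {Z : Type*} [TopologicalSpace Z] [ChartedSpace H₂ Z]
  {f : M → ℝ} {ε : ℝ} {Φ : Z × ℝ → M} {m : ℕ} {h : Z × ℝ → ℝ}

/-- The factor is 1 at t = 0. If it were not positive somewhere, the intermediate value theorem
would give it a zero with t ≠ 0, hence a zero of f ∘ Φ off t = 0. -/
theorem one_add_pow_mul_pos (hm : 1 ≤ m)
    (hh : ContMDiffOn (I₂.prod 𝓘(ℝ, ℝ)) 𝓘(ℝ, ℝ) ∞ h (univ ×ˢ Ioo (-ε) ε))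
    (hfΦ : ∀ p ∈ (univ : Set Z) ×ˢ Ioo (-ε) ε, f (Φ p) = p.2 + p.2 ^ (m + 1) * h p)
    (hf0 : ∀ p ∈ (univ : Set Z) ×ˢ Ioo (-ε) ε, p.2 ≠ 0 → f (Φ p) ≠ 0) {p : Z × ℝ}
    (hp : p ∈ (univ : Set Z) ×ˢ Ioo (-ε) ε) : 0 < 1 + p.2 ^ m * h p := by
  by_contra hneg
  have hε : 0 < ε := by linarith [hp.2.1, hp.2.2]
  have hc : ContinuousOn (fun t => 1 + t ^ m * h (p.1, t)) (Ioo (-ε) ε) :=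
    continuousOn_const.add ((continuous_pow m).continuousOn.mul
      (hh.continuousOn.comp (by fun_prop) fun t ht => ⟨mem_univ _, ht⟩))
  have h0 : (0 : ℝ) ∈ Icc (1 + p.2 ^ m * h p) (1 + 0 ^ m * h (p.1, 0)) := by
    rw [zero_pow (by omega)]
    constructor <;> linarith
  obtain ⟨t, ht, ht0⟩ := isPreconnected_Ioo.intermediate_value hp.2
    (⟨by linarith, hε⟩ : (0 : ℝ) ∈ Ioo (-ε) ε) hc h0
  rcases eq_or_ne t 0 with rfl | htn
  · beta_reduce at ht0
    rw [zero_pow (by omega)] at ht0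
    norm_num at ht0
  · refine hf0 (p.1, t) ⟨mem_univ _, ht⟩ htn ?_
    rw [hfΦ (p.1, t) ⟨mem_univ _, ht⟩]
    linear_combination t * ht0

theorem contMDiffAt_of_isBmFunction {u : M → ℝ} (hf : ContMDiff I 𝓘(ℝ, ℝ) ∞ f)
    (hu : IsBmFunction I f m u) {x : M} (hx : f x ≠ 0) : ContMDiffAt I 𝓘(ℝ, ℝ) ∞ u x := by
  obtain ⟨a, g, c, ha, hg, hc, -, hac⟩ := hu
  have h1 : ContMDiffAt I 𝓘(ℝ, ℝ) ∞ (fun x => a x * Real.log |f x| + g x +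
      ∑ j ∈ Finset.Icc 1 (m - 1), (f x ^ j)⁻¹ * c j x) x := by
    have hl : ContMDiffAt I 𝓘(ℝ, ℝ) ∞ (fun x => Real.log |f x|) x := by
      simp only [Real.log_abs]
      exact (Real.contDiffAt_log.mpr hx).contMDiffAt.comp x (hf x)
    refine ((ha.contMDiffAt.mul hl).add hg.contMDiffAt).add (ContMDiffAt.sum fun j _ => ?_)
    have h2 : ContDiffAt ℝ ∞ (fun t : ℝ => (t ^ j)⁻¹) (f x) :=
      (contDiffAt_id.pow j).inv (pow_ne_zero _ hx)
    exact (h2.contMDiffAt.comp x (hf x)).mul (hc j).contMDiffAt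
  refine h1.congr_of_eventuallyEq ?_
  filter_upwards [hf.continuous.continuousAt.eventually_ne hx] with y hy using hac y hy

/-- On the line over z, f = t w with w = 1 + t^m h smooth and positive. So log |f| = log |t| + log
w, negative powers of f are those of t times smooth functions, and t^(m-1) clears every pole. The
logarithm has constant coefficient near z. -/
theorem exists_meromorphic_of_isBmFunction {u : M → ℝ} (hm : 1 ≤ m) (hε : 0 < ε)
    (hΦ : ContMDiff (I₂.prod 𝓘(ℝ, ℝ)) I ∞ Φ)
    (hh : ContMDiffOn (I₂.prod 𝓘(ℝ, ℝ)) 𝓘(ℝ, ℝ) ∞ h (univ ×ˢ Ioo (-ε) ε))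
    (hfΦ : ∀ p ∈ (univ : Set Z) ×ˢ Ioo (-ε) ε, f (Φ p) = p.2 + p.2 ^ (m + 1) * h p)
    (hf0 : ∀ p ∈ (univ : Set Z) ×ˢ Ioo (-ε) ε, p.2 ≠ 0 → f (Φ p) ≠ 0)
    (hu : IsBmFunction I f m u) (z : Z) : ∃ (δ b : ℝ) (S : ℝ → ℝ), 0 < δ ∧
      ContDiffOn ℝ ∞ S (Ioo (-δ) δ) ∧ ∀ t ∈ Ioo (-δ) δ, t ≠ 0 →
      u (Φ (z, t)) = b * Real.log |t| + (t ^ (m - 1))⁻¹ * S t := by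
  obtain ⟨a, g, c, ha, hg, hc, hac, huc⟩ := hu
  have hline : ContMDiff 𝓘(ℝ, ℝ) (I₂.prod 𝓘(ℝ, ℝ)) ∞ (fun t : ℝ => (z, t)) :=
    contMDiff_const.prodMk contMDiff_id
  have hz0 : f (Φ (z, 0)) = 0 := by
    rw [hfΦ (z, 0) ⟨mem_univ _, by linarith, hε⟩]
    simp
  have hev : ∀ᶠ t in 𝓝 (0 : ℝ), a (Φ (z, t)) = a (Φ (z, 0)) :=
    ((hΦ.comp hline).continuous.tendsto 0).eventually (hac _ hz0)
  obtain ⟨δ', hδ', hδa⟩ := Metric.eventually_nhds_iff.mp hev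
  obtain ⟨δ, hδ, hδ1, hδε⟩ : ∃ δ : ℝ, 0 < δ ∧ δ ≤ δ' ∧ δ ≤ ε :=
    ⟨min δ' ε, lt_min hδ' hε, min_le_left _ _, min_le_right _ _⟩
  have hsub : Ioo (-δ) δ ⊆ Ioo (-ε) ε := Ioo_subset_Ioo (by linarith) hδε
  have hcomp : ∀ {k : M → ℝ}, ContMDiff I 𝓘(ℝ, ℝ) ∞ k →
      ContDiffOn ℝ ∞ (fun t => k (Φ (z, t))) (Ioo (-δ) δ) := fun hk =>
    (contMDiff_iff_contDiff.mp (hk.comp (hΦ.comp hline))).contDiffOn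
  have hw : ContDiffOn ℝ ∞ (fun t => 1 + t ^ m * h (z, t)) (Ioo (-δ) δ) := by
    refine contDiffOn_const.add ((contDiffOn_id.pow m).mul ?_)
    exact contMDiffOn_iff_contDiffOn.mp
      (hh.comp hline.contMDiffOn fun t ht => ⟨mem_univ _, hsub ht⟩)
  have hwp : ∀ t ∈ Ioo (-δ) δ, 0 < 1 + t ^ m * h (z, t) := fun t ht =>
    one_add_pow_mul_pos hm hh hfΦ hf0 (p := (z, t)) ⟨mem_univ _, hsub ht⟩
  refine ⟨δ, a (Φ (z, 0)), fun t => t ^ (m - 1) *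
    (a (Φ (z, 0)) * Real.log (1 + t ^ m * h (z, t)) + g (Φ (z, t))) +
    ∑ j ∈ Finset.Icc 1 (m - 1), t ^ (m - 1 - j) * (((1 + t ^ m * h (z, t)) ^ j)⁻¹ *
      c j (Φ (z, t))), hδ, ?_, fun t ht ht0 => ?_⟩
  · refine ((contDiffOn_id.pow _).mul ((contDiffOn_const.mul (hw.log fun t ht => (hwp t ht).ne')).add
      (hcomp hg))).add (ContDiffOn.sum fun j _ => (contDiffOn_id.pow _).mul (((hw.pow j).inv
      fun t ht => pow_ne_zero _ (hwp t ht).ne').mul (hcomp (hc j))))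
  · have hft : f (Φ (z, t)) = t * (1 + t ^ m * h (z, t)) := by
      rw [hfΦ (z, t) ⟨mem_univ _, hsub ht⟩]; ring
    have hat : a (Φ (z, t)) = a (Φ (z, 0)) := hδa (by
      rw [Real.dist_eq, sub_zero, abs_lt]; exact ⟨by linarith [ht.1], by linarith [ht.2]⟩)
    have hpos := hwp t ht
    rw [huc _ (hf0 _ ⟨mem_univ _, hsub ht⟩ ht0), hat, hft, abs_mul, abs_of_pos hpos,
      Real.log_mul (abs_ne_zero.mpr ht0) hpos.ne']
    obtain ⟨w, hw'⟩ : ∃ w, w = 1 + t ^ m * h (z, t) := ⟨_, rfl⟩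
    beta_reduce
    rw [← hw', mul_add (t ^ (m - 1))⁻¹, Finset.mul_sum, inv_mul_cancel_left₀ (pow_ne_zero _ ht0)]
    have hsum : ∀ j ∈ Finset.Icc 1 (m - 1), ((t * w) ^ j)⁻¹ * c j (Φ (z, t)) =
        (t ^ (m - 1))⁻¹ * (t ^ (m - 1 - j) * ((w ^ j)⁻¹ * c j (Φ (z, t)))) := by
      intro j hj
      have hj' := (Finset.mem_Icc.mp hj).2
      have h1 : t ^ (m - 1) = t ^ (m - 1 - j) * t ^ j := by rw [← pow_add, Nat.sub_add_cancel hj']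
      have h2 : t ^ (m - 1 - j) ≠ 0 := pow_ne_zero _ ht0
      rw [h1, mul_pow, mul_inv, mul_inv]
      field_simp
    rw [Finset.sum_congr rfl hsum]
    ring

/-- The coefficients of the difference between the Laurent primitives in `t` and in
`t * (1 + t ^ m * h)`. -/
noncomputable def laurentShift (m i : ℕ) (h t : ℝ) : ℝ :=
  t ^ (m - (i - 1)) * h * (1 + t ^ m * h)⁻¹ *
    (∑ l ∈ Finset.range (i - 1), ((1 + t ^ m * h)⁻¹) ^ l) / ((i : ℝ) - 1)

/-- With w = 1 + t^m h, a geometric sum exhibits 1 - w^{-(i-1)} as a multiple of 1 - w⁻¹ = t^m h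
w⁻¹. Since i ≤ m, the factor t^m absorbs the pole of order i - 1. -/
theorem laurentPrimitive_sub_shift {h t : ℝ} (ht : t ≠ 0) (hw : 0 < 1 + t ^ m * h) (c : ℕ → ℝ) :
    laurentPrimitive m c t - laurentPrimitive m c (t + t ^ (m + 1) * h) =
      Real.log (1 + t ^ m * h) * c 1 + ∑ i ∈ Finset.Icc 2 m, laurentShift m i h t * c i := by
  obtain ⟨w, hw'⟩ : ∃ w, w = 1 + t ^ m * h := ⟨_, rfl⟩
  have ht' : t + t ^ (m + 1) * h = t * w := by rw [hw']; ring
  rw [← hw'] at hw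
  rw [ht', ← hw']
  simp only [laurentPrimitive, laurentShift, ← hw']
  rw [abs_mul, abs_of_pos hw, Real.log_mul (abs_ne_zero.mpr ht) hw.ne']
  have hsum : ∀ i ∈ Finset.Icc 2 m, t ^ (m - (i - 1)) * h * w⁻¹ *
      (∑ l ∈ Finset.range (i - 1), w⁻¹ ^ l) / ((i : ℝ) - 1) * c i =
      (t ^ (i - 1))⁻¹ / ((i : ℝ) - 1) * c i - ((t * w) ^ (i - 1))⁻¹ / ((i : ℝ) - 1) * c i := by
    intro i hi
    have hi' := Finset.mem_Icc.mp hi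
    have h1 : t ^ m = t ^ (m - (i - 1)) * t ^ (i - 1) := by rw [← pow_add]; congr 1; omega
    have h2 := mul_neg_geom_sum w⁻¹ (i - 1)
    have h3 : 1 - w⁻¹ = t ^ m * h * w⁻¹ := by
      have h4 : t ^ m * h = w - 1 := by rw [hw']; ring
      rw [h4, sub_mul, mul_inv_cancel₀ hw.ne', one_mul]
    have h4 : t ^ (m - (i - 1)) * h * w⁻¹ * (∑ l ∈ Finset.range (i - 1), w⁻¹ ^ l) =
        (t ^ (i - 1))⁻¹ - ((t * w) ^ (i - 1))⁻¹ := by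
      have h5 : t ^ (i - 1) ≠ 0 := pow_ne_zero _ ht
      rw [h3, h1] at h2
      rw [mul_pow, mul_inv, ← inv_pow w]
      obtain ⟨B, hB⟩ : ∃ B, B = t ^ (i - 1) := ⟨_, rfl⟩
      rw [← hB] at h2 h5 ⊢
      linear_combination B⁻¹ * h2 - t ^ (m - (i - 1)) * h * w⁻¹ *
        (∑ l ∈ Finset.range (i - 1), w⁻¹ ^ l) * inv_mul_cancel₀ h5
    rw [h4]
    ring
  rw [Finset.sum_congr rfl hsum, Finset.sum_sub_distrib]
  ring

theorem contMDiffOn_laurentShift (i : ℕ)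
    (hh : ContMDiffOn (I₂.prod 𝓘(ℝ, ℝ)) 𝓘(ℝ, ℝ) ∞ h (univ ×ˢ Ioo (-ε) ε))
    (hpos : ∀ p ∈ (univ : Set Z) ×ˢ Ioo (-ε) ε, 0 < 1 + p.2 ^ m * h p) :
    ContMDiffOn (I₂.prod 𝓘(ℝ, ℝ)) 𝓘(ℝ, ℝ) ∞ (fun p => Real.log (1 + p.2 ^ m * h p))
      (univ ×ˢ Ioo (-ε) ε) ∧
    ContMDiffOn (I₂.prod 𝓘(ℝ, ℝ)) 𝓘(ℝ, ℝ) ∞ (fun p => laurentShift m i (h p) p.2)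
      (univ ×ˢ Ioo (-ε) ε) := by
  have hA : ContMDiffOn (I₂.prod 𝓘(ℝ, ℝ)) 𝓘(ℝ, ℝ × ℝ) ∞ (fun p : Z × ℝ => (h p, p.2))
      (univ ×ˢ Ioo (-ε) ε) := hh.prodMk_space contMDiffOn_snd
  have hw : ContDiff ℝ ∞ (fun q : ℝ × ℝ => 1 + q.2 ^ m * q.1) := by fun_prop
  have hS : IsOpen {q : ℝ × ℝ | 0 < 1 + q.2 ^ m * q.1} := isOpen_lt continuous_const hw.continuous
  have h0 : ∀ q ∈ {q : ℝ × ℝ | 0 < 1 + q.2 ^ m * q.1}, 1 + q.2 ^ m * q.1 ≠ 0 := fun q hq => hq.ne'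
  have hi := hw.contDiffOn.inv h0
  constructor
  · exact (hw.contDiffOn.log h0).contMDiffOn.comp hA fun p hp => hpos p hp
  · have h1 : ContDiffOn ℝ ∞ (fun q : ℝ × ℝ => laurentShift m i q.1 q.2)
        {q : ℝ × ℝ | 0 < 1 + q.2 ^ m * q.1} :=
      ((((contDiff_snd.pow _).contDiffOn.mul contDiff_fst.contDiffOn).mul hi).mul
        (ContDiffOn.sum fun l _ => hi.pow l)).div_const _
    exact h1.contMDiffOn.comp hA fun p hp => hpos p hp

end CollarFunction

/-! ### Expansion of the moment map -/

section MomentMap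

variable {E : Type*} [NormedAddCommGroup E] [NormedSpace ℝ E]
  {H : Type*} [TopologicalSpace H] {I : ModelWithCorners ℝ E H}
  {M : Type*} [TopologicalSpace M] [ChartedSpace H M]
  {E₂ : Type*} [NormedAddCommGroup E₂] [NormedSpace ℝ E₂]
  {H₂ : Type*} [TopologicalSpace H₂] {I₂ : ModelWithCorners ℝ E₂ H₂}
  {Z : Type*} [TopologicalSpace Z] [ChartedSpace H₂ Z]
  {F : Type*} [NormedAddCommGroup F] [NormedSpace ℝ F]
  {K : Type*} [TopologicalSpace K] {J : ModelWithCorners ℝ F K}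
  {T : Type*} [TopologicalSpace T] [ChartedSpace K T] [CommGroup T]
  [MulAction T M] [ContMDiffSMul J I ∞ T M] [MulAction T Z] [ContMDiffSMul J I₂ ∞ T Z]
  {f : M → ℝ} {ε : ℝ} {Φ : Z × ℝ → M} {m : ℕ} {h : Z × ℝ → ℝ}

variable (J I) in
/-- The fundamental vector field `X^M`, as a function with values in the model space. -/
noncomputable def orbitDeriv (X : GroupLieAlgebra J T) (x : M) : E := modelDeriv J I (fun g : T => g • x) (1 : T) X

theorem contMDiff_orbit (x : M) : ContMDiff J I ∞ (fun g : T => g • x) :=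
  (contMDiff_smul (I := J) (I' := I) (n := ∞)).comp (contMDiff_id.prodMk contMDiff_const)

/-- By equivariance the orbit through Φ (z, t) is the image of the orbit through z at constant t. -/
theorem orbitDeriv_collar (hΦ : ContMDiff (I₂.prod 𝓘(ℝ, ℝ)) I ∞ Φ)
    (hΦT : ∀ (g : T) (z : Z) (t : ℝ), Φ (g • z, t) = g • Φ (z, t)) (X : GroupLieAlgebra J T) (p : Z × ℝ) :
    orbitDeriv I J X (Φ p) =
      modelDeriv (I₂.prod 𝓘(ℝ, ℝ)) I Φ p (orbitDeriv I₂ J X p.1, 0) := by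
  have h1 : (fun g : T => g • Φ p) = fun g : T => Φ (g • p.1, p.2) := by
    funext g; exact (hΦT g p.1 p.2).symm
  have h2 : HasMFDerivAt J (I₂.prod 𝓘(ℝ, ℝ)) (fun g : T => (g • p.1, p.2)) 1 _ :=
    ((contMDiff_orbit (J := J) (I := I₂) p.1).mdifferentiableAt (by simp)).hasMFDerivAt.prodMk
      (hasMFDerivAt_const p.2 (1 : T))
  have h3 := modelDeriv_comp (F := fun g : T => (g • p.1, p.2)) (x := (1 : T))
    ((hΦ _).mdifferentiableAt (by simp)) h2.mdifferentiableAt X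
  rw [one_smul] at h3
  rw [orbitDeriv, h1, h3]
  exact congrArg (modelDeriv (I₂.prod 𝓘(ℝ, ℝ)) I Φ p)
    (congrArg (fun L : F →L[ℝ] E₂ × ℝ => L X) h2.mfderiv)

theorem laurentPrimitive_congr {m : ℕ} (hm : 1 ≤ m) {c c' : ℕ → ℝ}
    (h : ∀ j ∈ Finset.Icc 1 m, c j = c' j) (t : ℝ) :
    laurentPrimitive m c t = laurentPrimitive m c' t := by
  rw [laurentPrimitive, laurentPrimitive, h 1 (Finset.mem_Icc.mpr ⟨le_rfl, hm⟩)]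
  congr 1
  refine Finset.sum_congr rfl fun i hi => ?_
  rw [h i (Finset.mem_Icc.mpr ⟨by have := (Finset.mem_Icc.mp hi).1; omega, (Finset.mem_Icc.mp hi).2⟩)]

theorem modelDeriv_eq_zero_of_isLocalMax [I₂.Boundaryless] {u : Z → ℝ} {z : Z}
    (hu : MDifferentiableAt I₂ 𝓘(ℝ, ℝ) u z) (hmax : IsLocalMax u z) :
    modelDeriv I₂ 𝓘(ℝ, ℝ) u z = 0 := by
  have h1 : modelDeriv I₂ 𝓘(ℝ, ℝ) u z =
      fderiv ℝ (fun y => u ((extChartAt I₂ z).symm y)) (extChartAt I₂ z z) := by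
    rw [modelDeriv, hu.mfderiv, I₂.range_eq_univ, fderivWithin_univ]
    rfl
  rw [h1]
  refine IsLocalMax.fderiv_eq_zero ?_
  have h2 := (continuousAt_extChartAt_symm (I := I₂) z).tendsto
  rw [(extChartAt I₂ z).left_inv (mem_extChartAt_source z)] at h2
  filter_upwards [h2.eventually hmax] with y hy
  rwa [(extChartAt I₂ z).left_inv (mem_extChartAt_source z)]

variable [IsManifold I ∞ M]
  {σ : BmForm I f m} {μ : M → Module.Dual ℝ (GroupLieAlgebra J T)} {α : ℕ → RawForm I₂ Z 1}
  {β : RawForm I₂ Z 2}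

/-- The field X^M is dΦ(X^Z, 0). Having no ∂_t component, it contracts t^{-j} dt ∧ α_j to -t^{-j}
α_j(X^Z) dt. -/
theorem modelDeriv_moment_collar (hf : ContMDiff I 𝓘(ℝ, ℝ) ∞ f)
    (hμ : IsBmMomentMap I J σ μ) (hΦ : ContMDiff (I₂.prod 𝓘(ℝ, ℝ)) I ∞ Φ)
    (hΦT : ∀ (g : T) (z : Z) (t : ℝ), Φ (g • z, t) = g • Φ (z, t)) {p : Z × ℝ}
    (hp : f (Φ p) ≠ 0)
    (hform : ∀ v w : E₂ × ℝ,
      (BmForm.toForm I σ).val (Φ p) ![modelDeriv (I₂.prod 𝓘(ℝ, ℝ)) I Φ p v,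
          modelDeriv (I₂.prod 𝓘(ℝ, ℝ)) I Φ p w] =
        ∑ j ∈ Finset.Icc 1 m, (p.2 ^ j)⁻¹ * (v.2 * (α j).val p.1 ![w.1] -
          w.2 * (α j).val p.1 ![v.1]) + β.val p.1 ![v.1, w.1]) (X : GroupLieAlgebra J T) :
    ContMDiffAt (I₂.prod 𝓘(ℝ, ℝ)) 𝓘(ℝ, ℝ) ∞ (fun p => μ (Φ p) X) p ∧ ∀ v : E₂ × ℝ,
      modelDeriv (I₂.prod 𝓘(ℝ, ℝ)) 𝓘(ℝ, ℝ) (fun p => μ (Φ p) X) p v =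
        -(v.2 * ∑ j ∈ Finset.Icc 1 m, (p.2 ^ j)⁻¹ *
          (α j).val p.1 ![orbitDeriv I₂ J X p.1]) +
        β.val p.1 ![orbitDeriv I₂ J X p.1, v.1] := by
  have hu := contMDiffAt_of_isBmFunction hf (hμ.bmFunction X) hp
  refine ⟨hu.comp p (hΦ p), fun v => ?_⟩
  have h1 := modelDeriv_comp (hu.mdifferentiableAt (by simp))
    ((hΦ p).mdifferentiableAt (by simp)) v
  rw [h1]
  have h2 : modelDeriv I 𝓘(ℝ, ℝ) (fun x => μ x X) (Φ p) (modelDeriv (I₂.prod 𝓘(ℝ, ℝ)) I Φ p v) =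
      (BmForm.toForm I σ).val (Φ p) ![orbitDeriv I J X (Φ p),
        modelDeriv (I₂.prod 𝓘(ℝ, ℝ)) I Φ p v] := hμ.hamiltonian X (Φ p) hp _
  rw [h2, orbitDeriv_collar hΦ hΦT X p, hform]
  congr 1
  rw [Finset.mul_sum, ← Finset.sum_neg_distrib]
  refine Finset.sum_congr rfl fun j _ => ?_
  dsimp only
  ring

/-- The differential of ⟨μ, X⟩ in the normal form makes the c_j locally constant, and the
b^m-function property gives a single constant C z for both signs of t. The slice t = ε / 2 shows
that C is smooth with dC = β(X^Z, ·). That c_m = 0 kills all c_j is seen at a critical point of C.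
-/
theorem exists_moment_expansion [I₂.Boundaryless] [IsManifold I₂ ∞ Z] [CompactSpace Z] (hm : 1 ≤ m)
    (hε : 0 < ε) (hf : ContMDiff I 𝓘(ℝ, ℝ) ∞ f)
    (hμ : IsBmMomentMap I J σ μ) (hΦ : ContMDiff (I₂.prod 𝓘(ℝ, ℝ)) I ∞ Φ)
    (hΦT : ∀ (g : T) (z : Z) (t : ℝ), Φ (g • z, t) = g • Φ (z, t))
    (hh : ContMDiffOn (I₂.prod 𝓘(ℝ, ℝ)) 𝓘(ℝ, ℝ) ∞ h (univ ×ˢ Ioo (-ε) ε))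
    (hfΦ : ∀ p ∈ (univ : Set Z) ×ˢ Ioo (-ε) ε, f (Φ p) = p.2 + p.2 ^ (m + 1) * h p)
    (hf0 : ∀ p ∈ (univ : Set Z) ×ˢ Ioo (-ε) ε, p.2 ≠ 0 → f (Φ p) ≠ 0)
    (hform : ∀ p ∈ (univ : Set Z) ×ˢ Ioo (-ε) ε, p.2 ≠ 0 → ∀ v w : E₂ × ℝ,
      (BmForm.toForm I σ).val (Φ p) ![modelDeriv (I₂.prod 𝓘(ℝ, ℝ)) I Φ p v,
          modelDeriv (I₂.prod 𝓘(ℝ, ℝ)) I Φ p w] =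
        ∑ j ∈ Finset.Icc 1 m, (p.2 ^ j)⁻¹ * (v.2 * (α j).val p.1 ![w.1] -
          w.2 * (α j).val p.1 ![v.1]) + β.val p.1 ![v.1, w.1])
    (hnd : ∀ z, NondegTwo (wedgeLine ((α m).val z) (β.val z))) (X : GroupLieAlgebra J T)
    {c : ℕ → Z → ℝ} (hc : ∀ j z, c j z = (α j).val z ![orbitDeriv I₂ J X z]) :
    ∃ C : Z → ℝ, ContMDiff I₂ 𝓘(ℝ, ℝ) ∞ C ∧
      (∀ z w, modelDeriv I₂ 𝓘(ℝ, ℝ) C z w = β.val z ![orbitDeriv I₂ J X z, w]) ∧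
      (∀ z₀, ∀ᶠ z in 𝓝 z₀, ∀ j ∈ Finset.Icc 1 m, c j z = c j z₀) ∧
      (∀ z, c m z = 0 → ∀ j ∈ Finset.Icc 1 m, c j z = 0) ∧
      ∀ p ∈ (univ : Set Z) ×ˢ Ioo (-ε) ε, p.2 ≠ 0 →
        μ (Φ p) X = laurentPrimitive m (fun j => c j p.1) p.2 + C p.1 := by
  have hdu : ∀ p ∈ (univ : Set Z) ×ˢ Ioo (-ε) ε, p.2 ≠ 0 →
      ContMDiffAt (I₂.prod 𝓘(ℝ, ℝ)) 𝓘(ℝ, ℝ) ∞ (fun p => μ (Φ p) X) p ∧ ∀ v : E₂ × ℝ,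
      modelDeriv (I₂.prod 𝓘(ℝ, ℝ)) 𝓘(ℝ, ℝ) (fun p => μ (Φ p) X) p v =
        -(v.2 * ∑ j ∈ Finset.Icc 1 m, (p.2 ^ j)⁻¹ * c j p.1) +
        β.val p.1 ![orbitDeriv I₂ J X p.1, v.1] := fun p hp hp0 => by
    simp only [hc]
    exact modelDeriv_moment_collar hf hμ hΦ hΦT (hf0 p hp hp0) (hform p hp hp0) X
  have hdu' := fun p hp hp0 => And.intro ((hdu p hp hp0).1.mdifferentiableAt (by simp)) (hdu p hp hp0).2
  have hloc := eventually_eq_of_modelDeriv_eq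
    (b := fun z w => β.val z ![orbitDeriv I₂ J X z, w]) hε hdu'
  have hex : ∀ z, ∃ C : ℝ, ∀ t ∈ Ioo (-ε) ε, t ≠ 0 →
      μ (Φ (z, t)) X = laurentPrimitive m (fun j => c j z) t + C := by
    intro z
    obtain ⟨δ, b, S, hδ, hS, huS⟩ := exists_meromorphic_of_isBmFunction hm hε hΦ hh hfΦ hf0
      (hμ.bmFunction X) z
    refine exists_eq_laurentPrimitive_add hm hε hδ (fun t ht ht0 => ?_) hS huS
    have h1 := hasDerivAt_slice (hdu' (z, t) ⟨mem_univ _, ht⟩ ht0).1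
    rw [(hdu' (z, t) ⟨mem_univ _, ht⟩ ht0).2] at h1
    refine h1.congr_deriv ?_
    have h2 : β.val z ![orbitDeriv I₂ J X z, (0 : E₂)] = 0 :=
      (β.val z).map_coord_zero 1 rfl
    dsimp only
    rw [h2, one_mul, add_zero]
  choose C hC using hex
  have hmid : ε / 2 ∈ Ioo (-ε) ε := ⟨by linarith, by linarith⟩
  have hmid0 : ε / 2 ≠ 0 := by linarith
  -- The c_j are constant near z₀, so there C is ⟨μ, X⟩ on the slice t = ε / 2 minus a constant.
  have hCz : ∀ z₀, C =ᶠ[𝓝 z₀] fun z => μ (Φ (z, ε / 2)) X -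
      laurentPrimitive m (fun j => c j z₀) (ε / 2) := by
    intro z₀
    filter_upwards [hloc z₀] with z hz
    rw [hC z (ε / 2) hmid hmid0, laurentPrimitive_congr hm hz]
    ring
  have hline : ContMDiff I₂ (I₂.prod 𝓘(ℝ, ℝ)) ∞ (fun z : Z => (z, ε / 2)) :=
    contMDiff_id.prodMk contMDiff_const
  have hdC : ∀ z w, modelDeriv I₂ 𝓘(ℝ, ℝ) C z w =
      β.val z ![orbitDeriv I₂ J X z, w] := by
    intro z w
    have h1 := modelDeriv_slice (hdu' (z, ε / 2) ⟨mem_univ _, hmid⟩ hmid0).1 w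
    rw [(hdu' (z, ε / 2) ⟨mem_univ _, hmid⟩ hmid0).2] at h1
    have h2 := (hCz z).modelDeriv_eq (I₁ := I₂) (I₂ := 𝓘(ℝ, ℝ))
    have h3 := (h1.1.hasMFDerivAt.sub
      (hasMFDerivAt_const (laurentPrimitive m (fun j => c j z) (ε / 2)) z)).mfderiv
    rw [h2]
    refine (congrArg (fun L : E₂ →L[ℝ] ℝ => L w) h3).trans ?_
    refine (sub_zero _).trans (h1.2.trans ?_)
    dsimp only
    rw [zero_mul, neg_zero, zero_add]
  have hCs : ContMDiff I₂ 𝓘(ℝ, ℝ) ∞ C := fun z => by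
    refine ContMDiffAt.congr_of_eventuallyEq ?_ (hCz z)
    exact ((hdu (z, ε / 2) ⟨mem_univ _, hmid⟩ hmid0).1.comp z (hline z)).sub contMDiffAt_const
  refine ⟨C, hCs, hdC, hloc, fun z₀ hz₀ => ?_, fun p hp hp0 => hC p.1 p.2 hp.2 hp0⟩
  -- A is open and closed, hence compact, so C has a maximum on A that is a critical point. There
  -- β(X^Z, ·) = dC = 0 and α_m(X^Z) = 0, so X^Z = 0 by nondegeneracy of dt ∧ α_m + β. All c_j
  -- vanish at that point, and they are constant on A.
  obtain ⟨A, hA⟩ : ∃ A : Set Z, A = {z | ∀ j ∈ Finset.Icc 1 m, c j z = c j z₀} := ⟨_, rfl⟩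
  have hAo : IsOpen A := by
    rw [hA, isOpen_iff_mem_nhds]
    intro z hz
    filter_upwards [hloc z] with z' hz' j hj
    rw [hz' j hj, hz j hj]
  have hAc : IsClosed A := by
    rw [← isOpen_compl_iff, hA, isOpen_iff_mem_nhds]
    intro z hz
    filter_upwards [hloc z] with z' hz' hz''
    exact hz fun j hj => (hz' j hj).symm.trans (hz'' j hj)
  have hz₀A : z₀ ∈ A := by rw [hA]; exact fun j _ => rfl
  obtain ⟨z₁, hz₁, hmax⟩ := hAc.isCompact.exists_isMaxOn ⟨z₀, hz₀A⟩ hCs.continuous.continuousOn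
  have hz₁' : ∀ j ∈ Finset.Icc 1 m, c j z₁ = c j z₀ := by rwa [hA] at hz₁
  have hcrit : ∀ w, modelDeriv I₂ 𝓘(ℝ, ℝ) C z₁ w = 0 := fun w =>
    congrArg (fun L : E₂ →L[ℝ] ℝ => L w)
      (modelDeriv_eq_zero_of_isLocalMax (hCs.mdifferentiableAt (by simp))
        (hmax.isLocalMax (hAo.mem_nhds hz₁)))
  have hξ : orbitDeriv I₂ J X z₁ = 0 := by
    have h1 := hnd z₁ (orbitDeriv I₂ J X z₁, 0) fun v => by
      rw [wedgeLine_apply]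
      dsimp only
      rw [← hc, hz₁' m (Finset.mem_Icc.mpr ⟨hm, le_rfl⟩), hz₀, ← hdC, hcrit]
      ring
    exact congrArg Prod.fst h1
  intro j hj
  rw [← hz₁' j hj, hc, hξ]
  exact ((α j).val z₁).map_coord_zero 0 rfl

end MomentMap

/-! ### The main theorem -/

/-! ### Linear algebra of dt ∧ a + b -/

section WedgeLineKernel

variable {V : Type*} [NormedAddCommGroup V] [NormedSpace ℝ V] {a : V [⋀^Fin 1]→L[ℝ] ℝ}
  {b : V [⋀^Fin 2]→L[ℝ] ℝ}

/-- Otherwise ∂_t would lie in the kernel. -/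
theorem NondegTwo.wedgeLine_ne_zero (h : NondegTwo (wedgeLine a b)) : a ≠ 0 := by
  rintro rfl
  have h1 := h (0, 1) fun w => by
    rw [wedgeLine_apply]
    have : b ![(0 : V), w.1] = 0 := b.map_coord_zero 0 rfl
    simp [this]
  exact one_ne_zero (congrArg Prod.snd h1)

/-- If `dt ∧ a + b` is nondegenerate, then so is `b` on `ker a`. -/
theorem NondegTwo.wedgeLine_ker (h : NondegTwo (wedgeLine a b)) {u : V} (hu : a ![u] = 0)
    (hw : ∀ w, a ![w] = 0 → b ![u, w] = 0) : u = 0 := by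
  obtain ⟨e, he⟩ : ∃ e, a ![e] ≠ 0 := by
    by_contra! h0
    exact h.wedgeLine_ne_zero (alternating_one_ext fun e => h0 e)
  have key : ∀ w, b ![u, w] = a ![w] / a ![e] * b ![u, e] := by
    intro w
    have h1 : a ![w + (-(a ![w] / a ![e])) • e] = 0 := by
      rw [← oneFormCLM_apply, map_add, map_smul, oneFormCLM_apply, oneFormCLM_apply, smul_eq_mul]
      field_simp
      ring
    have h2 := hw _ h1
    rw [alternating_two_add_right, alternating_two_smul_right] at h2
    linear_combination h2
  -- As b(u, ·) vanishes on ker a, it is a multiple of a; the ∂_t component of the test vector is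
  -- chosen to cancel it.
  have h1 := h (u, -(b ![u, e] / a ![e])) fun w => by
    rw [wedgeLine_apply]
    dsimp only
    rw [hu, key w.1]
    ring
  exact congrArg Prod.fst h1

end WedgeLineKernel

/-! ### Laurent primitives with values in a dual space -/

section DualValued

variable {V : Type*} [AddCommGroup V] [Module ℝ V]

/-- Evaluation of a Laurent primitive with coefficients in a dual space. -/
theorem dual_laurentPrimitive_apply (m : ℕ) (a : ℕ → Module.Dual ℝ V) (t : ℝ) (X : V) :
    (-(Real.log |t| • a 1) +
      ∑ i ∈ Finset.Icc 2 m, ((t ^ (i - 1))⁻¹ / ((i : ℝ) - 1)) • a i : Module.Dual ℝ V) X =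
      laurentPrimitive m (fun i => a i X) t := by
  simp [laurentPrimitive]

theorem dual_laurentShift_apply (m : ℕ) (a : ℕ → Module.Dual ℝ V) (h t : ℝ) (X : V) :
    (Real.log (1 + t ^ m * h) • a 1 +
      ∑ i ∈ Finset.Icc 2 m, laurentShift m i h t • a i : Module.Dual ℝ V) X =
      Real.log (1 + t ^ m * h) * a 1 X + ∑ i ∈ Finset.Icc 2 m, laurentShift m i h t * a i X := by
  simp

theorem laurentShift_zero {m i : ℕ} (hi : i ∈ Finset.Icc 2 m) (h : ℝ) : laurentShift m i h 0 = 0 := by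
  have hi' := Finset.mem_Icc.mp hi
  rw [laurentShift, zero_pow (by omega)]
  simp

/-- A finite basis turns local constancy of each ⟨a, X⟩ into local constancy of a. -/
theorem eventually_eq_dual [FiniteDimensional ℝ V] {N : Type*} [TopologicalSpace N]
    {a : N → Module.Dual ℝ V} {z₀ : N} (h : ∀ X, ∀ᶠ z in 𝓝 z₀, a z X = a z₀ X) :
    ∀ᶠ z in 𝓝 z₀, a z = a z₀ := by
  have h1 := eventually_all.mpr fun i => h (Module.finBasis ℝ V i)
  filter_upwards [h1] with z hz using (Module.finBasis ℝ V).ext hz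

end DualValued

theorem mainTheorem4 {d r m : ℕ} (hm : 1 ≤ m)
    -- the compact manifold `M`
    {M : Type*} [TopologicalSpace M] [T2Space M] [CompactSpace M]
    [ChartedSpace (EuclideanSpace ℝ (Fin (d + 1))) M] [IsManifold (𝓡 (d + 1)) ∞ M]
    -- the hypersurface `Z`, embedded by `ι`, along which `f` has a transverse zero
    {Z : Type*} [TopologicalSpace Z]
    [ChartedSpace (EuclideanSpace ℝ (Fin d)) Z] [IsManifold (𝓡 d) ∞ Z]
    (ι : Z → M) (hι : Manifold.IsSmoothEmbedding (𝓡 d) (𝓡 (d + 1)) ∞ ι)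
    (f : M → ℝ) (hf : ContMDiff (𝓡 (d + 1)) 𝓘(ℝ, ℝ) ∞ f)
    (hZ : Set.range ι = {x | f x = 0})
    (hdf : ∀ x, f x = 0 → diffAt (𝓡 (d + 1)) f x ≠ 0)
    -- the `b^m`-symplectic form
    (σ : BmForm (𝓡 (d + 1)) f m) (hσ : IsBmSymplectic (𝓡 (d + 1)) σ)
    -- the torus `T` and its smooth action on `(M, Z, f)`, preserving `σ`
    {T : Type*} [TopologicalSpace T] [CompactSpace T] [ConnectedSpace T]
    [ChartedSpace (EuclideanSpace ℝ (Fin r)) T] [CommGroup T] [LieGroup (𝓡 r) ∞ T]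
    [MulAction T M] [ContMDiffSMul (𝓡 r) (𝓡 (d + 1)) ∞ T M]
    [MulAction T Z] [ContMDiffSMul (𝓡 r) (𝓡 d) ∞ T Z]
    (hιT : ∀ (g : T) (z : Z), ι (g • z) = g • ι z)
    (hfT : ∀ (g : T) (x : M), f (g • x) = f x)
    (hσT : RawForm.IsInvariantOn (𝓡 (d + 1)) T (BmForm.toForm (𝓡 (d + 1)) σ) {x | f x ≠ 0})
    -- the moment map
    (μ : M → Module.Dual ℝ (GroupLieAlgebra (𝓡 r) T))
    (hμ : IsBmMomentMap (𝓡 (d + 1)) (𝓡 r) σ μ) :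
    -- a neighbourhood `Φ (Z × (-ε, ε))` of `Z`
    ∃ (ε : ℝ) (Φ : Z × ℝ → M)
      -- the forms of the Laurent expansion, which live on `Z`
      (α : ℕ → RawForm (𝓡 d) Z 1) (β : RawForm (𝓡 d) Z 2)
      -- the modular weights, and the moment map on `Z`
      (a : ℕ → Z → Module.Dual ℝ (GroupLieAlgebra (𝓡 r) T))
      (μ₀ : Z → Module.Dual ℝ (GroupLieAlgebra (𝓡 r) T))
      (h : Z × ℝ → ℝ) (ν : Z × ℝ → Module.Dual ℝ (GroupLieAlgebra (𝓡 r) T)),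
      0 < ε ∧
      -- `Φ` is a `T`-equivariant diffeomorphism from `Z × (-ε, ε)` onto an open neighbourhood of
      -- `Z`, is the identity on `Z`, and takes `f` to a function with the same germ to order `m`
      -- as the coordinate `t`
      IsLocalDiffeomorphOn ((𝓡 d).prod 𝓘(ℝ, ℝ)) (𝓡 (d + 1)) ∞ Φ
        (Set.univ ×ˢ Set.Ioo (-ε) ε) ∧
      Set.InjOn Φ (Set.univ ×ˢ Set.Ioo (-ε) ε) ∧
      (∀ z, Φ (z, 0) = ι z) ∧
      (∀ (g : T) (z : Z), ∀ t ∈ Set.Ioo (-ε) ε, Φ (g • z, t) = g • Φ (z, t)) ∧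
      ContMDiffOn ((𝓡 d).prod 𝓘(ℝ, ℝ)) 𝓘(ℝ, ℝ) ∞ h (Set.univ ×ˢ Set.Ioo (-ε) ε) ∧
      (∀ z, ∀ t ∈ Set.Ioo (-ε) ε, f (Φ (z, t)) = t + t ^ (m + 1) * h (z, t)) ∧
      -- the forms on `Z` are smooth, closed and invariant
      (∀ j ∈ Finset.Icc 1 m, RawForm.IsSmooth (𝓡 d) (α j) ∧
        RawForm.IsClosedOn (𝓡 d) (α j) Set.univ ∧
        RawForm.IsInvariantOn (𝓡 d) T (α j) Set.univ) ∧
      RawForm.IsSmooth (𝓡 d) β ∧ RawForm.IsClosedOn (𝓡 d) β Set.univ ∧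
      RawForm.IsInvariantOn (𝓡 d) T β Set.univ ∧
      -- `Φ^* σ = ∑_{j=1}^m t^{-j} dt ∧ α_j + β`
      (∀ z, ∀ t ∈ Set.Ioo (-ε) ε, t ≠ 0 → ∀ (u w : TangentSpace (𝓡 d) z) (s s' : ℝ),
        BmForm.toForm (𝓡 (d + 1)) σ (Φ (z, t))
            ![mfderiv ((𝓡 d).prod 𝓘(ℝ, ℝ)) (𝓡 (d + 1)) Φ (z, t) (u, s),
              mfderiv ((𝓡 d).prod 𝓘(ℝ, ℝ)) (𝓡 (d + 1)) Φ (z, t) (w, s')] =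
          ∑ j ∈ Finset.Icc 1 m, (t ^ j)⁻¹ * (s * α j z ![w] - s' * α j z ![u]) + β z ![u, w]) ∧
      -- symplectic foliation of `Z`: the leaves are tangent to `ker α_m`, and `β` is symplectic
      -- on them
      (∀ z, α m z ≠ 0) ∧
      (∀ (z : Z) (u : TangentSpace (𝓡 d) z), α m z ![u] = 0 →
        (∀ w : TangentSpace (𝓡 d) z, α m z ![w] = 0 → β z ![u, w] = 0) → u = 0) ∧
      -- the modular weights: locally constant, `⟨a_i, X⟩ = α_i(X^Z)`, and `a_i` annihilates
      -- `𝔱_L`, the `X` whose fundamental vector field is tangent to the leaf through `z`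
      (∀ i ∈ Finset.Icc 1 m, IsLocallyConstant (a i) ∧
        (∀ (z : Z) (X : GroupLieAlgebra (𝓡 r) T),
          a i z X = α i z ![fundamentalField (𝓡 d) (𝓡 r) X z]) ∧
        ∀ (z : Z) (X : GroupLieAlgebra (𝓡 r) T),
          α m z ![fundamentalField (𝓡 d) (𝓡 r) X z] = 0 → a i z X = 0) ∧
      -- `μ₀` is the moment map for the action on `Z` and its leaves:
      -- `d⟨μ₀, X⟩ = β(X^Z, ·)`
      (∀ X : GroupLieAlgebra (𝓡 r) T,
        ContMDiff (𝓡 d) 𝓘(ℝ, ℝ) ∞ (fun z => μ₀ z X) ∧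
        ∀ (z : Z) (w : TangentSpace (𝓡 d) z),
          diffAt (𝓡 d) (fun z => μ₀ z X) z w =
            β z ![fundamentalField (𝓡 d) (𝓡 r) X z, w]) ∧
      -- the moment map in the coordinate `t`
      (∀ z, ∀ t ∈ Set.Ioo (-ε) ε, t ≠ 0 →
        μ (Φ (z, t)) = -(Real.log |t| • a 1 z) +
          ∑ i ∈ Finset.Icc 2 m, ((t ^ (i - 1))⁻¹ / ((i : ℝ) - 1)) • a i z + μ₀ z) ∧
      -- the moment map in terms of the given function `f`
      (∀ X : GroupLieAlgebra (𝓡 r) T, ContMDiffOn ((𝓡 d).prod 𝓘(ℝ, ℝ)) 𝓘(ℝ, ℝ) ∞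
        (fun p => ν p X) (Set.univ ×ˢ Set.Ioo (-ε) ε)) ∧
      (∀ z, ν (z, 0) = μ₀ z) ∧
      (∀ z, ∀ t ∈ Set.Ioo (-ε) ε, t ≠ 0 →
        μ (Φ (z, t)) = -(Real.log |f (Φ (z, t))| • a 1 z) +
          ∑ i ∈ Finset.Icc 2 m, ((f (Φ (z, t)) ^ (i - 1))⁻¹ / ((i : ℝ) - 1)) • a i z +
            ν (z, t)) := by
  -- If Z is empty every assertion about Z is vacuous; the collar construction needs a point of Z.
  rcases isEmpty_or_nonempty Z with hZe | hZn
  · exact ⟨1, fun p => isEmptyElim p.1, fun _ _ => 0, fun _ => 0, fun _ _ => 0, fun _ => 0,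
      fun _ => 0, fun _ => 0, one_pos, fun p => isEmptyElim p.1.1, fun p => isEmptyElim p.1,
      fun z => isEmptyElim z, fun _ z => isEmptyElim z, fun p => isEmptyElim p.1,
      fun z => isEmptyElim z, fun _ _ => ⟨fun z => isEmptyElim z, fun z => isEmptyElim z,
        fun _ z => isEmptyElim z⟩, fun z => isEmptyElim z, fun z => isEmptyElim z,
      fun _ z => isEmptyElim z, fun z => isEmptyElim z, fun z => isEmptyElim z,
      fun z => isEmptyElim z, fun _ _ => ⟨IsLocallyConstant.of_constant _ fun z => isEmptyElim z,
        fun z => isEmptyElim z, fun z => isEmptyElim z⟩,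
      fun _ => ⟨fun z => isEmptyElim z, fun z => isEmptyElim z⟩, fun z => isEmptyElim z,
      fun _ p => isEmptyElim p.1, fun z => isEmptyElim z, fun z => isEmptyElim z⟩
  have hιc : IsClosed (range ι) := by
    rw [hZ]; exact isClosed_eq hf.continuous continuous_const
  have : CompactSpace Z := (⟨hι.isEmbedding, hιc⟩ : IsClosedEmbedding ι).compactSpace
  have : T2Space Z := hι.isEmbedding.t2Space
  have : IsTopologicalGroup T := topologicalGroup_of_lieGroup (𝓡 r) ∞
  -- The charts give T1, which for a topological group implies Hausdorff, and compactness gives a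
  -- countable base. Both are used in averaging over T.
  have : T1Space T := (𝓡 r).t1Space T
  have : SecondCountableTopology T :=
    ChartedSpace.secondCountable_of_sigmaCompact (EuclideanSpace ℝ (Fin r)) T
  have : FiniteDimensional ℝ (GroupLieAlgebra (𝓡 r) T) :=
    inferInstanceAs (FiniteDimensional ℝ (EuclideanSpace ℝ (Fin r)))
  obtain ⟨ε₀, Φ₀, Q, hε₀, hΦ₀, hQ, hΦ₀0, hfΦ₀, hQΦ₀, hΦ₀Q, hΦ₀T⟩ :=
    exists_equivariant_collar (J := 𝓡 r) hι hf hZ hdf hιT hfT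
  have hcollar : IsCollar (𝓡 (d + 1)) (𝓡 d) f ε₀ Φ₀ Q :=
    ⟨hΦ₀, hf, hQ, fun p => hfΦ₀ p.1 p.2, fun p => hQΦ₀ p.1 p.2, hΦ₀Q⟩
  obtain ⟨ε, Φ, α, β, h, hε, hΦ, hloc, hinj, hΦ0, hΦT, hh, hfΦ, hf0, hα, hβ, hβc, hβT, hform, hnd⟩ :=
    exists_bmNormalForm hm hε₀ hcollar hσ hσT
      (fun g => contMDiff_const_smul_of_action (𝓡 (d + 1)) (𝓡 r) g)
      (fun g => contMDiff_const_smul_of_action (𝓡 d) (𝓡 r) g) hΦ₀T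
  obtain ⟨a, ha⟩ : ∃ a : ℕ → Z → Module.Dual ℝ (GroupLieAlgebra (𝓡 r) T),
      ∀ i z X, a i z X = (α i).val z ![orbitDeriv (𝓡 d) (𝓡 r) X z] :=
    ⟨fun i z => ((oneFormCLM ((α i).val z)).comp
      (modelDeriv (𝓡 r) (𝓡 d) (fun g : T => g • z) 1)).toLinearMap,
      fun i z X => oneFormCLM_apply _ _⟩
  have key := fun X => exists_moment_expansion hm hε hf hμ hΦ hΦT hh hfΦ hf0 hform hnd X
    (c := fun i z => a i z X) (fun i z => ha i z X)
  choose C hCs hdC hac ha0 hμC using key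
  have hmem : ∀ (z : Z), ∀ t ∈ Ioo (-ε) ε, (z, t) ∈ (univ : Set Z) ×ˢ Ioo (-ε) ε := fun z t ht =>
    ⟨mem_univ _, ht⟩
  have hmid : ε / 2 ∈ Ioo (-ε) ε := ⟨by linarith, by linarith⟩
  -- C X comes from a separate choice for each X. Linearity in X is recovered by defining μ₀ as μ on
  -- the slice t = ε / 2 minus its singular part there.
  obtain ⟨μ₀, hμ₀⟩ : ∃ μ₀ : Z → Module.Dual ℝ (GroupLieAlgebra (𝓡 r) T), ∀ z X, μ₀ z X = C X z := by
    refine ⟨fun z => μ (Φ (z, ε / 2)) - (-(Real.log |ε / 2| • a 1 z) +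
      ∑ i ∈ Finset.Icc 2 m, (((ε / 2) ^ (i - 1))⁻¹ / ((i : ℝ) - 1)) • a i z), fun z X => ?_⟩
    rw [LinearMap.sub_apply, dual_laurentPrimitive_apply m (fun i => a i z),
      hμC X (z, ε / 2) (hmem z _ hmid) (by dsimp only; linarith)]
    ring
  have hpos : ∀ p ∈ (univ : Set Z) ×ˢ Ioo (-ε) ε, 0 < 1 + p.2 ^ m * h p := fun p hp =>
    one_add_pow_mul_pos hm hh hfΦ hf0 hp
  have has : ∀ i ∈ Finset.Icc 1 m, ∀ X, ContMDiff ((𝓡 d).prod 𝓘(ℝ, ℝ)) 𝓘(ℝ, ℝ) ∞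
      (fun p : Z × ℝ => a i p.1 X) := fun i hi X => by
    have h1 : ContMDiff (𝓡 d) 𝓘(ℝ, ℝ) ∞ (fun z : Z => a i z X) := fun z₀ =>
      contMDiffAt_const.congr_of_eventuallyEq ((hac X z₀).mono fun z hz => hz i hi)
    exact h1.comp contMDiff_fst
  -- ν is μ₀ plus the difference of the singular parts in t and in f, which is smooth and vanishes
  -- at t = 0.
  refine ⟨ε, Φ, α, β, a, μ₀, h, fun p => μ₀ p.1 + (Real.log (1 + p.2 ^ m * h p) • a 1 p.1 +
    ∑ i ∈ Finset.Icc 2 m, laurentShift m i (h p) p.2 • a i p.1), hε, hloc, hinj,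
    fun z => (hΦ0 z).trans (hΦ₀0 z), fun g z t _ => hΦT g z t, hh,
    fun z t ht => hfΦ (z, t) (hmem z t ht), hα, hβ, hβc, hβT,
    fun z t ht ht0 u w s s' => hform (z, t) (hmem z t ht) ht0 (u, s) (w, s'), fun z hz => ?_,
    fun z u hu hw => ?_, fun i hi => ⟨?_, fun z X => ha i z X, fun z X hX => ?_⟩,
    fun X => ⟨?_, fun z w => ?_⟩, fun z t ht ht0 => ?_, fun X => ?_, fun z => ?_,
    fun z t ht ht0 => ?_⟩
  · exact (hnd z).wedgeLine_ne_zero hz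
  · exact (hnd z).wedgeLine_ker hu hw
  · exact (IsLocallyConstant.iff_eventually_eq _).mpr fun z₀ =>
      eventually_eq_dual fun X => (hac X z₀).mono fun z hz => hz i hi
  · exact ha0 X z ((ha m z X).trans hX) i hi
  · simp only [hμ₀]
    exact hCs X
  · simp only [hμ₀]
    exact hdC X z w
  · refine LinearMap.ext fun X => ?_
    rw [LinearMap.add_apply, dual_laurentPrimitive_apply m (fun i => a i z), hμ₀]
    exact hμC X (z, t) (hmem z t ht) ht0
  · have h1 : ∀ p : Z × ℝ, (μ₀ p.1 + (Real.log (1 + p.2 ^ m * h p) • a 1 p.1 +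
        ∑ i ∈ Finset.Icc 2 m, laurentShift m i (h p) p.2 • a i p.1)) X =
        C X p.1 + (Real.log (1 + p.2 ^ m * h p) * a 1 p.1 X +
          ∑ i ∈ Finset.Icc 2 m, laurentShift m i (h p) p.2 * a i p.1 X) := fun p => by
      rw [LinearMap.add_apply, dual_laurentShift_apply m (fun i => a i p.1), hμ₀]
    simp only [h1]
    refine ((hCs X).comp contMDiff_fst).contMDiffOn.add
      (((contMDiffOn_laurentShift 0 hh hpos).1.mul
        (has 1 (Finset.mem_Icc.mpr ⟨le_rfl, hm⟩) X).contMDiffOn).add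
        (contMDiffOn_finsetSum fun i hi => (contMDiffOn_laurentShift i hh hpos).2.mul
          (has i (Finset.Icc_subset_Icc_left one_le_two hi) X).contMDiffOn))
  · dsimp only
    rw [zero_pow (by omega), Finset.sum_eq_zero fun i hi => by rw [laurentShift_zero hi, zero_smul]]
    simp
  · refine LinearMap.ext fun X => ?_
    have h1 := laurentPrimitive_sub_shift ht0 (hpos (z, t) (hmem z t ht)) (fun i => a i z X)
    have h2 := hμC X (z, t) (hmem z t ht) ht0
    rw [LinearMap.add_apply, LinearMap.add_apply (μ₀ z),
      dual_laurentPrimitive_apply m (fun i => a i z),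
      dual_laurentShift_apply m (fun i => a i z), hμ₀, hfΦ (z, t) (hmem z t ht), h2]
    dsimp only at h1 ⊢
    linear_combination h1
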